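/- **Theorem 4.3.** The parameterized homomorphism problem $p\text{-}\mathrm{HOM}(\mathcal P^*)$ is complete for the class $\mathrm{PATH}$ under pl-reductions; that is, $p\text{-}\mathrm{HOM}(\mathcal P^*)\in\mathrm{PATH}$, and every problem in $\mathrm{PATH}$ is pl-reducible to $p\text{-}\mathrm{HOM}(\mathcal P^*)$. Here the notions are as follows. *Machines.* Turing machines have a read-only input tape and several worktapes. A nondeterministic machine has a guess state; a configuration with the guess state has two successors, obtained by changing the state to one of two further states $s_0,s_1$. It accepts $Q\subseteq\{0,1\}^*$ if exactly the inputs in $Q$ have an accepting run, and it uses $b(x)$ nondeterministic bits if on every input $x$ every run contains at most $b(x)$ configurations with the guess state. A machine is pl-space bounded with respect to $\kappa:\{0,1\}^*\to\mathbb N$ if there is a computable $f:\mathbb N\to\mathbb N$ such that on every input $x$ it runs in space $O(f(\kappa(x))+\log|x|)$. *Problems.* A parameterized problem is a pair $(Q,\kappa)$ of a set $Q\subseteq\{0,1\}^*$ and a logarithmic space computable function $\kappa:\{0,1\}^*\to\mathbb N$. It is in para-L if $Q$ is decided by a deterministic machine that is pl-space bounded with respect to $\kappa$. It is in $\mathrm{PATH}$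 if there are a computable $f:\mathbb N\to\mathbb N$ and a nondeterministic machine that accepts $Q$, is pl-space bounded with respect to $\kappa$, and uses $f(\kappa(x))\cdot\log|x|$ nondeterministic bits. *Reductions.* A pl-reduction from $(Q,\kappa)$ to $(Q',\kappa')$ is a function $R:\{0,1\}^*\to\{0,1\}^*$ such that $x\in Q\Leftrightarrow R(x)\in Q'$ for all $x$, such that $\kappa'(R(x))\le f(\kappa(x))$ for all $x$ and some computable $f$, and such that $R$ is implicitly pl-computable with respect to $\kappa$. The latter means that $|R(x)|\le g(\kappa(x))\cdot(|x|+1)^{O(1)}$ for some computable $g$, and that the following problem is in para-L: given $(x,i,b)$ with $x\in\{0,1\}^*$, $i\ge1$, $b\in\{0,1\}$, and with parameter $\kappa(x)$, decide whether $|R(x)|\ge i$ and the $i$th bit of $R(x)$ is $b$. *The homomorphism problem.* Structures are finite, nonempty and relational, with finite vocabularies. For $k\ge2$ let $\mathbf P_k$ be the graph on $\{1,\dots,k\}$ whose edge relation is the symmetric closure of $\{(i,i+1)\mid 1\le i<k\}$; for a structure $\mathbf A$ let $\mathbf A^*$ be its expansion by a fresh unary relation symbol $C_a$ for every $a\in A$,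 interpreted by $\{a\}$; and let $\mathcal P^*$ be the class of all structures $\mathbf A^*$ with $\mathbf A$ isomorphic to some $\mathbf P_k$, $k\ge2$. An instance of $p\text{-}\mathrm{HOM}(\mathcal P^*)$ is a pair $(\mathbf A,\mathbf B)$ of structures of the same vocabulary $\tau$, encoded in binary by listing the universes and, for each relation symbol, its argument places and the tuples in its two interpretations. It is a yes-instance if $\mathbf A\in\mathcal P^*$ (up to the names of the symbols) and there is a homomorphism from $\mathbf A$ to $\mathbf B$. The parameter is $|\mathbf A|:=|\tau|+|A|+\sum_{R\in\tau}|R^{\mathbf A}|\cdot\mathrm{ar}(R)$, and $0$ on strings that encode no pair of structures. -/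

import Mathlib

namespace ParamLog

/-! ## Turing machines with a read-only input tape and several worktapes -/

/-- What the input head can scan: the left end marker, an input bit, the right end marker. -/
inductive InSym where
  | left
  | bit (b : Bool)
  | right

/-- Head movements. -/
inductive Dir where
  | left
  | stay
  | right

/-- The input tape carries the left end marker on cell `0`, the bits of `x` on the cells
`1, …, |x|` and the right end marker on cell `|x| + 1`. -/
def readInput (x : List Bool) : ℕ → InSym
  | 0 => .left
  | p + 1 => match x[p]? with
    | some b => .bit b
    | none => .right

/-- The input head never leaves the cells `0, …, |x| + 1`. -/
def moveInput (x : List Bool) (p : ℕ) : Dir → ℕ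
  | .left => p - 1
  | .stay => p
  | .right => min (p + 1) (x.length + 1)

/-- Worktapes are one-way infinite, with cells `0, 1, 2, …`; on cell `0` a left move has no
effect. -/
def moveWork (p : ℕ) : Dir → ℕ
  | .left => p - 1
  | .stay => p
  | .right => p + 1

/-- A deterministic Turing machine. In a state other than `accept` and `reject` the transition
function `δ` takes the state, the scanned input symbol and the symbols scanned on the worktapes,
and gives the new state, the movement of the input head, and for every worktape the symbol to be
written and the movement of its head. -/
structure TM where
  State : Type
  Sym : Type
  [decState : DecidableEq State]
  [finState : Finite State]
  [finSym : Finite Sym]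
  tapes : ℕ
  blank : Sym
  start : State
  accept : State
  reject : State
  accept_ne_reject : accept ≠ reject
  δ : State → InSym → (Fin tapes → Sym) → State × Dir × (Fin tapes → Sym × Dir)

attribute [instance] TM.decState TM.finState TM.finSym

/-- A configuration of a machine (on an input that is kept apart). -/
structure TM.Cfg (M : TM) where
  state : M.State
  inHead : ℕ
  head : Fin M.tapes → ℕ
  tape : Fin M.tapes → ℕ → M.Sym

namespace TM

variable (M : TM)

/-- The starting configuration: all worktapes are blank, all heads are on cell `0`. -/
def startCfg : M.Cfg where
  state := M.start
  inHead := 0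
  head := fun _ => 0
  tape := fun _ _ => M.blank

/-- The symbols scanned on the worktapes. -/
def scanned (c : M.Cfg) : Fin M.tapes → M.Sym := fun j => c.tape j (c.head j)

/-- The configuration obtained from `c` by applying the transition function. -/
def next (x : List Bool) (c : M.Cfg) : M.Cfg :=
  let a := M.δ c.state (readInput x c.inHead) (M.scanned c)
  { state := a.1
    inHead := moveInput x c.inHead a.2.1
    head := fun j => moveWork (c.head j) (a.2.2 j).2
    tape := fun j => Function.update (c.tape j) (c.head j) (a.2.2 j).1 }

/-- A configuration is halting if its state is `accept` or `reject`. -/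
def Halting (c : M.Cfg) : Prop := c.state = M.accept ∨ c.state = M.reject

instance (c : M.Cfg) : Decidable (M.Halting c) :=
  inferInstanceAs (Decidable (_ ∨ _))

/-- One step on input `x`; halting configurations have no successor. -/
def step (x : List Bool) (c : M.Cfg) : Option M.Cfg :=
  if M.Halting c then none else some (M.next x c)

/-- `c` occurs in the computation of `M` on `x`. -/
def ReachesCfg (x : List Bool) (c : M.Cfg) : Prop :=
  Relation.ReflTransGen (fun c₁ c₂ => M.step x c₁ = some c₂) M.startCfg c

/-- `M` decides `Q`: it halts on every input, accepting the elements of `Q` and rejecting all other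
strings. -/
def Decides (Q : Set (List Bool)) : Prop :=
  ∀ x, (x ∈ Q → ∃ c, M.ReachesCfg x c ∧ c.state = M.accept) ∧
    (x ∉ Q → ∃ c, M.ReachesCfg x c ∧ c.state = M.reject)

/-- On input `x` the machine scans, on every worktape, only the first `s` cells. -/
def RunsInSpace (x : List Bool) (s : ℕ) : Prop :=
  ∀ c, M.ReachesCfg x c → ∀ j, c.head j < s

end TM

/-- A deterministic machine with an additional write-only output tape: a step from a configuration
with state `q` in which the scanned symbols are `a`, `w` appends `out q a w` to the output. -/
structure Transducer extends TM where
  out : State → InSym → (Fin tapes → Sym) → Option Bool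

namespace Transducer

variable (T : Transducer)

/-- One step on input `x`, acting on a configuration together with the output so far. -/
def stepOut (x : List Bool) (c : T.toTM.Cfg × List Bool) : Option (T.toTM.Cfg × List Bool) :=
  (T.toTM.step x c.1).map fun c' =>
    (c', c.2 ++ (T.out c.1.state (readInput x c.1.inHead) (T.toTM.scanned c.1)).toList)

/-- On every input `x` the machine halts with output `F x`. -/
def Computes (F : List Bool → List Bool) : Prop :=
  ∀ x, ∃ c, Relation.ReflTransGen (fun c₁ c₂ => T.stepOut x c₁ = some c₂)
    (T.toTM.startCfg, []) (c, F x) ∧ T.toTM.Halting c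

end Transducer

/-- A nondeterministic Turing machine: it has a guess state, and a configuration with the guess
state has two successors, obtained by changing the state to `s₀` or to `s₁` (the value of `δ` in
the guess state is not used). -/
structure NTM extends TM where
  guess : State
  s₀ : State
  s₁ : State
  distinct : [accept, reject, guess, s₀, s₁].Nodup

namespace NTM

variable (N : NTM)

/-- The successor relation on configurations, on input `x`. -/
def Step (x : List Bool) (c c' : N.toTM.Cfg) : Prop :=
  if c.state = N.guess then c' = { c with state := N.s₀ } ∨ c' = { c with state := N.s₁ }
  else N.toTM.step x c = some c'

/-- `c` occurs in some run of `N` on `x`. -/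
def ReachesCfg (x : List Bool) (c : N.toTM.Cfg) : Prop :=
  Relation.ReflTransGen (N.Step x) N.toTM.startCfg c

/-- `N` accepts `Q`: exactly the inputs in `Q` have an accepting run. -/
def Accepts (Q : Set (List Bool)) : Prop :=
  ∀ x, x ∈ Q ↔ ∃ c, N.ReachesCfg x c ∧ c.state = N.accept

/-- In every run on `x`, on every worktape, only the first `s` cells are scanned. -/
def RunsInSpace (x : List Bool) (s : ℕ) : Prop :=
  ∀ c, N.ReachesCfg x c → ∀ j, c.head j < s

/-- Every run `r 0, r 1, …, r n` on `x` contains at most `g` configurations with the guess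
state. -/
def UsesBits (x : List Bool) (g : ℕ) : Prop :=
  ∀ (n : ℕ) (r : ℕ → N.toTM.Cfg), r 0 = N.toTM.startCfg →
    (∀ i < n, N.Step x (r i) (r (i + 1))) →
    ((Finset.range (n + 1)).filter fun i => (r i).state = N.guess).card ≤ g

end NTM

/-! ## Parameterized problems, para-L, PATH, pl-reductions -/

/-- `κ` is computable in logarithmic space (values are written in binary, least significant bit
first). -/
def LogspaceComputable (κ : List Bool → ℕ) : Prop :=
  ∃ T : Transducer, T.Computes (fun x => (κ x).bits) ∧
    ∃ d : ℕ, ∀ x, T.toTM.RunsInSpace x (d * Nat.log 2 x.length + d)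

/-- A classical problem together with a function on its instances. It is a parameterized problem in
the strict sense if this function is a parameterization, i.e. `LogspaceComputable`. -/
structure ParamProblem where
  lang : Set (List Bool)
  param : List Bool → ℕ

/-- The bound `O(f(κ(x)) + log |x|)` for some computable `f`, for a machine that runs on input `x`
in space `s` whenever `run x s`. -/
def PLSpaceBounded (run : List Bool → ℕ → Prop) (κ : List Bool → ℕ) : Prop :=
  ∃ f : ℕ → ℕ, Computable f ∧
    ∃ d : ℕ, ∀ x, run x (d * (f (κ x) + Nat.log 2 x.length))

/-- The problem is decided by a pl-space bounded deterministic machine. -/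
def ParamProblem.InParaL (P : ParamProblem) : Prop :=
  ∃ M : TM, M.Decides P.lang ∧ PLSpaceBounded M.RunsInSpace P.param

/-- The class PATH: the parameterized problems accepted by a pl-space bounded nondeterministic
machine that uses `f(κ(x)) · log |x|` nondeterministic bits for some computable `f`. -/
def PATH : Set ParamProblem :=
  {P | LogspaceComputable P.param ∧
    ∃ N : NTM, N.Accepts P.lang ∧ PLSpaceBounded N.RunsInSpace P.param ∧
      ∃ f : ℕ → ℕ, Computable f ∧
        ∀ x, N.UsesBits x (f (P.param x) * Nat.log 2 x.length)}

/-! ### Self-delimiting binary encodings -/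

/-- A list is encoded by the encodings of its entries, each preceded by a `1`, and a final `0`. -/
def encList {α : Type} (enc : α → List Bool) : List α → List Bool
  | [] => [false]
  | a :: l => true :: (enc a ++ encList enc l)

/-- Bit strings. -/
def encStr : List Bool → List Bool := encList fun b => [b]

/-- Natural numbers, in binary. -/
def encNat (n : ℕ) : List Bool := encStr n.bits

/-- Natural numbers, in unary. -/
def encUnary (n : ℕ) : List Bool := List.replicate n true ++ [false]

/-- The encoding of a triple `(x, i, b)` with `i ≥ 1`. -/
def encTriple (t : List Bool × ℕ+ × Bool) : List Bool :=
  encStr t.1 ++ encNat t.2.1 ++ [t.2.2]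

open Classical in
/-- The problem Bitgraph(F), with parameter `κ(x)` on the triple `(x, i, b)`, and `0` on strings
that do not encode a triple. -/
noncomputable def bitgraph (κ : List Bool → ℕ) (F : List Bool → List Bool) : ParamProblem where
  lang := {w | ∃ (x : List Bool) (i : ℕ+) (b : Bool),
    w = encTriple (x, i, b) ∧ (F x)[(i : ℕ) - 1]? = some b}
  param := fun w => if h : ∃ t, encTriple t = w then κ h.choose.1 else 0

/-- `F` is implicitly pl-computable with respect to `κ`: Bitgraph(F) is in para-L. As usual for
implicit computability in logarithmic space, values of `F` have to have a length that a pl-space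
bounded machine with an output tape can produce, `g(κ(x)) · |x|^O(1)` with `g` computable. -/
def ImplicitlyPLComputable (κ : List Bool → ℕ) (F : List Bool → List Bool) : Prop :=
  (bitgraph κ F).InParaL ∧
    ∃ g : ℕ → ℕ, Computable g ∧
      ∃ d : ℕ, ∀ x, (F x).length ≤ g (κ x) * (x.length + 1) ^ d

/-- pl-reducibility. -/
def PLReducible (P P' : ParamProblem) : Prop :=
  ∃ R : List Bool → List Bool, (∀ x, x ∈ P.lang ↔ R x ∈ P'.lang) ∧
    ImplicitlyPLComputable P.param R ∧
    ∃ f : ℕ → ℕ, Computable f ∧ ∀ x, P'.param (R x) ≤ f (P.param x)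

/-- `P` is complete for the class `C` under pl-reductions. -/
def PLComplete (P : ParamProblem) (C : Set ParamProblem) : Prop :=
  P ∈ C ∧ ∀ P' ∈ C, PLReducible P' P

/-! ## Finite relational structures and homomorphisms -/

/-- A vocabulary. -/
structure Vocabulary where
  Symb : Type
  [fintypeSymb : Fintype Symb]
  ar : Symb → ℕ

attribute [instance] Vocabulary.fintypeSymb

/-- A structure with nonempty finite universe `U`. -/
structure RelStr (τ : Vocabulary) where
  U : Type
  [finU : Finite U]
  [nonemptyU : Nonempty U]
  rel : (R : τ.Symb) → Set (Fin (τ.ar R) → U)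

attribute [instance] RelStr.finU RelStr.nonemptyU

namespace RelStr

/-- `h` is a homomorphism from `A` to `B`. -/
def IsHom {τ : Vocabulary} (A B : RelStr τ) (h : A.U → B.U) : Prop :=
  ∀ R, ∀ v ∈ A.rel R, h ∘ v ∈ B.rel R

/-- The size `|τ| + |A| + ∑_R |R^A| · ar(R)`. -/
noncomputable def size {τ : Vocabulary} (A : RelStr τ) : ℕ :=
  Fintype.card τ.Symb + Nat.card A.U + ∑ R, (A.rel R).ncard * τ.ar R

/-- `A` and `B` are isomorphic up to a renaming of the relation symbols. -/
def Iso {τ σ : Vocabulary} (A : RelStr τ) (B : RelStr σ) : Prop :=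
  ∃ (e : τ.Symb ≃ σ.Symb) (har : ∀ R, σ.ar (e R) = τ.ar R) (u : A.U ≃ B.U),
    ∀ (R : τ.Symb) (v : Fin (τ.ar R) → A.U),
      v ∈ A.rel R ↔ (fun j => u (v (Fin.cast (har R) j))) ∈ B.rel (e R)

/-- The vocabulary of the expansion of `A` by a fresh unary relation symbol for every element. -/
noncomputable def starVocabulary {τ : Vocabulary} (A : RelStr τ) : Vocabulary :=
  letI := Fintype.ofFinite A.U
  { Symb := τ.Symb ⊕ A.U
    ar := Sum.elim τ.ar fun _ => 1 }

/-- The expansion `A*`, in which the symbol of `a` is interpreted by `{a}`. -/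
noncomputable def star {τ : Vocabulary} (A : RelStr τ) : RelStr A.starVocabulary where
  U := A.U
  rel := fun R => match R with
    | .inl R => A.rel R
    | .inr a => {fun _ : Fin 1 => a}

end RelStr

/-- A class of structures. -/
def StrClass : Type 1 := ∀ τ : Vocabulary, RelStr τ → Prop

/-- The class of all structures `A*` with `A` in the given class. The names of the fresh symbols do
not matter. -/
def StrClass.star (C : StrClass) : StrClass := fun _ A =>
  ∃ (σ : Vocabulary) (B : RelStr σ), C σ B ∧ A.Iso B.star

/-- The vocabulary of graphs: one binary symbol. -/
def graphVocabulary : Vocabulary where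
  Symb := Unit
  ar := fun _ => 2

/-- The path `P_k` on `k ≥ 2` vertices `0, …, k - 1`, the edge relation being the symmetric closure
of `{(i, i + 1)}`. -/
def pathStr (k : ℕ) (hk : 2 ≤ k) : RelStr graphVocabulary where
  U := Fin k
  nonemptyU := ⟨⟨0, by omega⟩⟩
  rel := fun _ => {v : Fin 2 → Fin k |
    (v 0 : ℕ) + 1 = (v 1 : ℕ) ∨ (v 1 : ℕ) + 1 = (v 0 : ℕ)}

/-- The class of paths. -/
def paths : StrClass := fun _ A => ∃ (k : ℕ) (hk : 2 ≤ k), A.Iso (pathStr k hk)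

/-! ### Encoding pairs of structures -/

/-- A relation symbol `R` of arity `ar`, with the list of the tuples of `R^A` and the list of the
tuples of `R^B`. -/
structure RelCode where
  ar : ℕ
  left : List (List ℕ)
  right : List (List ℕ)

/-- A listing of a pair `(A, B)` of structures over the same vocabulary, with universes
`{0, …, a - 1}` and `{0, …, b - 1}`. -/
structure PairCode where
  a : ℕ
  b : ℕ
  rels : List RelCode
  a_pos : 0 < a
  b_pos : 0 < b
  left_nodup : ∀ r ∈ rels, r.left.Nodup
  right_nodup : ∀ r ∈ rels, r.right.Nodup
  left_tuple : ∀ r ∈ rels, ∀ v ∈ r.left, v.length = r.ar ∧ ∀ m ∈ v, m < a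
  right_tuple : ∀ r ∈ rels, ∀ v ∈ r.right, v.length = r.ar ∧ ∀ m ∈ v, m < b

/-- A list of tuples; the entries of the tuples are written in binary. -/
def encTuples : List (List ℕ) → List Bool := encList (encList encNat)

/-- The binary encoding of a symbol with its two interpretations. -/
def RelCode.encode (r : RelCode) : List Bool :=
  encUnary r.ar ++ encTuples r.left ++ encTuples r.right

namespace PairCode

/-- The binary encoding of a pair of structures. -/
def encode (D : PairCode) : List Bool :=
  encUnary D.a ++ encUnary D.b ++ encList RelCode.encode D.rels

/-- The vocabulary of the two structures. -/
def vocabulary (D : PairCode) : Vocabulary where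
  Symb := Fin D.rels.length
  ar := fun i => (D.rels.get i).ar

/-- The left structure `A`. -/
def A (D : PairCode) : RelStr D.vocabulary where
  U := Fin D.a
  nonemptyU := ⟨⟨0, D.a_pos⟩⟩
  rel := fun i => {v | List.ofFn (fun j => ((v j : Fin D.a) : ℕ)) ∈ (D.rels.get i).left}

/-- The right structure `B`. -/
def B (D : PairCode) : RelStr D.vocabulary where
  U := Fin D.b
  nonemptyU := ⟨⟨0, D.b_pos⟩⟩
  rel := fun i => {v | List.ofFn (fun j => ((v j : Fin D.b) : ℕ)) ∈ (D.rels.get i).right}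

end PairCode

open Classical in
/-- The problem `p`-HOM(C): given a pair `(A, B)` of structures with `A` in `C`, is there a
homomorphism from `A` to `B`? The parameter is `|A|` on encodings of pairs of structures, and `0` on
all other strings. -/
noncomputable def pHOM (C : StrClass) : ParamProblem where
  lang := {w | ∃ D : PairCode, D.encode = w ∧ C D.vocabulary D.A ∧ ∃ h, D.A.IsHom D.B h}
  param := fun w => if h : ∃ D : PairCode, D.encode = w then h.choose.A.size else 0

/-! ### The encodings are uniquely readable, so the parameters above are well defined -/

/-- An encoding that can be read off from the front of a string. -/
def Readable {α : Type} (enc : α → List Bool) : Prop :=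
  ∀ a a' u u', enc a ++ u = enc a' ++ u' → a = a' ∧ u = u'

theorem readable_encList {α : Type} {enc : α → List Bool} (h : Readable enc) :
    Readable (encList enc) := by
  intro l
  induction l with
  | nil =>
    intro l' u u' he
    cases l' with
    | nil => simpa [encList] using he
    | cons a l' => simp [encList] at he
  | cons a l ih =>
    intro l' u u' he
    cases l' with
    | nil => simp [encList] at he
    | cons a' l' =>
      simp only [encList, List.cons_append, List.append_assoc, List.cons.injEq, true_and] at he
      replace he := h _ _ _ _ he
      obtain ⟨rfl, he⟩ := he
      obtain ⟨rfl, rfl⟩ := ih _ _ _ he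
      exact ⟨rfl, rfl⟩

theorem readable_encStr : Readable encStr :=
  readable_encList fun a a' u u' he => by simpa using he

theorem readable_encNat : Readable encNat := by
  intro a a' u u' he
  obtain ⟨h, rfl⟩ := readable_encStr _ _ _ _ he
  refine ⟨?_, rfl⟩
  exact Nat.eq_of_testBit_eq fun i => by rw [Nat.testBit_eq_inth, Nat.testBit_eq_inth, h]

theorem readable_encUnary : Readable encUnary := by
  intro a
  induction a with
  | zero =>
    intro a' u u' he
    cases a' with
    | zero => simpa [encUnary] using he
    | succ n => simp [encUnary, List.replicate_succ] at he
  | succ a ih =>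
    intro a' u u' he
    cases a' with
    | zero => simp [encUnary, List.replicate_succ] at he
    | succ n =>
      have := ih n u u' (by simpa [encUnary, List.replicate_succ] using he)
      exact ⟨by rw [this.1], this.2⟩

theorem readable_relCode : Readable RelCode.encode := by
  have ht : Readable encTuples := readable_encList (readable_encList readable_encNat)
  rintro ⟨a, l, r⟩ ⟨a', l', r'⟩ u u' he
  simp only [RelCode.encode, List.append_assoc] at he
  replace he := readable_encUnary _ _ _ _ he
  obtain ⟨rfl, he⟩ := he
  replace he := ht _ _ _ _ he
  obtain ⟨rfl, he⟩ := he
  replace he := ht _ _ _ _ he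
  obtain ⟨rfl, he⟩ := he
  exact ⟨rfl, he⟩

theorem encTriple_injective : Function.Injective encTriple := by
  rintro ⟨x, i, b⟩ ⟨x', i', b'⟩ he
  simp only [encTriple, List.append_assoc] at he
  replace he := readable_encStr _ _ _ _ he
  obtain ⟨rfl, he⟩ := he
  replace he := readable_encNat _ _ _ _ he
  obtain ⟨hi, he⟩ := he
  obtain rfl := PNat.coe_injective hi
  simpa using he

theorem PairCode.encode_injective : Function.Injective PairCode.encode := by
  intro D D' he
  suffices D.a = D'.a ∧ D.b = D'.b ∧ D.rels = D'.rels by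
    cases D; cases D'; simp_all
  simp only [PairCode.encode, List.append_assoc] at he
  obtain ⟨ha, h₁⟩ := readable_encUnary _ _ _ _ he
  obtain ⟨hb, h₂⟩ := readable_encUnary _ _ _ _ h₁
  exact ⟨ha, hb, (readable_encList readable_relCode D.rels D'.rels [] [] (by simpa using h₂)).1⟩

end ParamLog

/-! Membership. A homomorphism from a coloured path to `B` can be guessed vertex by vertex along the
path. Only the image of the previous vertex has to be remembered; the next image is checked against
it by means of the edge relation, and against the colour of its own vertex. An image has at most
`log |x| + 1` bits and there are at most `|A|` of them, so the guesses stay within the allowed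
number. The order of the vertices along the path is not part of the input, but it can be found
deterministically: written in base `a = |A|` (the size of the universe) it is a number below `a ^
a`, whose length depends on the parameter only. The criterion that is checked is
`PairCode.IsStar.exists_isHom_iff`.

Hardness. Let `N` be a machine with at most `g · log |x|` guesses, where `g` depends on the
parameter. Its configurations have codes below some `V` that is polynomial in `|x|` and a computable
function of the parameter. As soon as the next `log |x|` guesses are fixed by a number `w`, the
machine runs deterministically until it asks for a further bit; call this a block. A shortest
accepting run is a sequence of at most `g + 1` blocks. So `N` accepts if and only if a layered
graph, with pairs (layer, code) as vertices and blocks as edges, has a walk from the start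
configuration to an accepting one that passes through all layers (`NTM.exists_walk`,
`NTM.accepting_of_walk`). Such a walk is a homomorphism from a coloured path: the colour of the
`i`th vertex confines its image to the `i`th layer and imposes the conditions at both ends
(`NTM.instanceCode_exists_isHom_iff`). There are at most `|x| + 1` candidates for `w`, so an edge
can be decided by deterministic simulation, and the instance can be produced bit by bit.

Machines. All machines are obtained from counter programs; a register with values up to `B` costs
about `log B` worktape cells (`chain_of_exec`). Typed functions with polynomially bounded registers
form the class `LS`, which is closed under composition, bounded recursion, sums and bounded search;
parsing and simulation take place inside this class. A computable function of the parameter is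
computed with a computable register bound (`calc_of_computable`), which is where the term `f(κ(x))`
in the space bound comes from. For the bit problem of the reduction the string `x` is only given as
a part of a longer input, and the value `κ(x)` is found by search, each candidate being compared
with the output of a simulated transducer (`exists_lsp_eq`). -/

namespace ParamLog

/-! ## Counter programs -/

/-- Programs over registers holding natural numbers, with a read-only input head. -/
inductive Prog
  | skip
  | inc (r : ℕ)
  | clear (r : ℕ)
  | home
  | fwd
  | emit (b : Bool)
  | seq (P Q : Prog)
  | whileNe (r s : ℕ) (P : Prog)
  | ifEq (r s : ℕ) (P Q : Prog)
  | ifIn (p : InSym → Bool) (P Q : Prog)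

/-- A state of a counter program: registers, input head, output so far. -/
structure St where
  reg : ℕ → ℕ
  hd : ℕ
  out : List Bool

/-- Assign `v` to register `r`. -/
def St.set (s : St) (r v : ℕ) : St := { s with reg := Function.update s.reg r v }

/-- Big-step semantics, on input `x`, with all register values kept at most `B`. -/
inductive Exec (x : List Bool) (B : ℕ) : Prog → St → St → Prop
  | skip (s) : Exec x B .skip s s
  | inc (r) (s : St) : s.reg r < B → Exec x B (.inc r) s (s.set r (s.reg r + 1))
  | clear (r) (s : St) : Exec x B (.clear r) s (s.set r 0)
  | home (s : St) : Exec x B .home s { s with hd := 0 }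
  | fwd (s : St) : Exec x B .fwd s { s with hd := min (s.hd + 1) (x.length + 1) }
  | emit (b) (s : St) : Exec x B (.emit b) s { s with out := s.out ++ [b] }
  | seq {P Q s s' s''} : Exec x B P s s' → Exec x B Q s' s'' → Exec x B (.seq P Q) s s''
  | while_done {r t P} {s : St} : s.reg r = s.reg t → Exec x B (.whileNe r t P) s s
  | while_step {r t P} {s s' s'' : St} : s.reg r ≠ s.reg t → Exec x B P s s' →
      Exec x B (.whileNe r t P) s' s'' → Exec x B (.whileNe r t P) s s''
  | ifEq_pos {r t P Q} {s s' : St} : s.reg r = s.reg t → Exec x B P s s' →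
      Exec x B (.ifEq r t P Q) s s'
  | ifEq_neg {r t P Q} {s s' : St} : s.reg r ≠ s.reg t → Exec x B Q s s' →
      Exec x B (.ifEq r t P Q) s s'
  | ifIn_pos {p P Q} {s s' : St} : p (readInput x s.hd) = true → Exec x B P s s' →
      Exec x B (.ifIn p P Q) s s'
  | ifIn_neg {p P Q} {s s' : St} : p (readInput x s.hd) = false → Exec x B Q s s' →
      Exec x B (.ifIn p P Q) s s'

theorem Exec.le {x B P s s'} (h : Exec x B P s s') (hs : ∀ r, s.reg r ≤ B) :
    ∀ r, s'.reg r ≤ B := by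
  induction h with
  | inc r s h =>
    intro r'
    simp only [St.set, Function.update_apply]
    split
    · omega
    · exact hs r'
  | clear r s =>
    intro r'
    simp only [St.set, Function.update_apply]
    split
    · omega
    · exact hs r'
  | seq _ _ ih₁ ih₂ => exact ih₂ (ih₁ hs)
  | while_step _ _ _ ih₁ ih₂ => exact ih₂ (ih₁ hs)
  | ifEq_pos _ _ ih => exact ih hs
  | ifEq_neg _ _ ih => exact ih hs
  | ifIn_pos _ _ ih => exact ih hs
  | ifIn_neg _ _ ih => exact ih hs
  | _ => exact hs

/-! ### Bijective binary notation -/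

/-- Increment in bijective base 2, least significant digit first; `false` is the digit 1 and `true`
the digit 2. -/
def incL : List Bool → List Bool
  | [] => [false]
  | false :: l => true :: l
  | true :: l => false :: incL l

/-- Bijective base 2 notation. -/
def digits : ℕ → List Bool
  | 0 => []
  | n + 1 => incL (digits n)

/-- The value of a string in bijective base 2. -/
def digVal : List Bool → ℕ
  | [] => 0
  | b :: l => (if b then 2 else 1) + 2 * digVal l

theorem digVal_incL (l : List Bool) : digVal (incL l) = digVal l + 1 := by
  induction l with
  | nil => rfl
  | cons b l ih => cases b <;> simp [incL, digVal, ih] <;> omega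

theorem digVal_digits (n : ℕ) : digVal (digits n) = n := by
  induction n with
  | zero => rfl
  | succ n ih => rw [digits, digVal_incL, ih]

/-- Bijective base 2 has no leading zeros. Equal numbers therefore have equal tapes, and two
registers can be compared cell by cell. -/
theorem digits_injective : Function.Injective digits := fun a b h => by
  rw [← digVal_digits a, h, digVal_digits]

/-- All digits are at least 1, so a string of length `n` has value at least `2 ^ n - 1`. This makes
tapes logarithmically short. -/
theorem two_pow_length_le (l : List Bool) : 2 ^ l.length ≤ digVal l + 1 := by
  induction l with
  | nil => simp [digVal]
  | cons b l ih => cases b <;> simp [digVal, pow_succ] <;> omega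

/-- The space that suffices for registers with values at most `B`. -/
def spaceFor (B : ℕ) : ℕ := Nat.log 2 (B + 1) + 3

/-- Besides the digits a sweep visits the marker on cell `0` and the first blank cell behind the
digits; the third cell is slack. -/
theorem length_digits_le {n B : ℕ} (h : n ≤ B) : (digits n).length + 3 ≤ spaceFor B := by
  have h₁ := two_pow_length_le (digits n)
  rw [digVal_digits] at h₁
  have := Nat.le_log_of_pow_le (b := 2) (by norm_num) (h₁.trans (Nat.add_le_add_right h 1))
  unfold spaceFor
  omega

theorem spaceFor_pos (B : ℕ) : 0 < spaceFor B := by unfold spaceFor; omega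

/-- Tape symbols: `none` marks cell `0`, `some none` is blank. -/
abbrev Sy := Option (Option Bool)

/-- The tape on which a list of digits is written. -/
def tp (l : List Bool) : ℕ → Sy
  | 0 => none
  | i + 1 => some l[i]?

/-! ### Machine instructions -/

/-- The three operations on registers. -/
inductive Kind
  | inc
  | clear
  | eq

/-- The symbol written in a sweep. -/
def Kind.wr : Kind → Sy → Sy
  | .inc, some (some true) => some (some false)
  | .inc, some (some false) => some (some true)
  | .inc, some none => some (some false)
  | .inc, none => none
  | .clear, _ => some none
  | .eq, a => a

/-- Whether a sweep goes on (`none`), or turns with the given outcome. -/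
def Kind.test : Kind → Sy → Sy → Option Bool
  | .inc, a, _ => if a = some (some true) then none else some false
  | .clear, a, _ => if a = some none then some false else none
  | .eq, a, b => if a = b then (if a = some none then some true else none) else some false

/-- Instructions of the assembly language that programs are compiled to. -/
inductive Instr
  | sweep (k : Kind) (r s t : ℕ)
  | home
  | fwd
  | emit (b : Bool)
  | jin (p : InSym → Bool) (t : ℕ)
  | halt (b : Bool)
  | guess

/-- The output of an instruction. -/
def Instr.emits : Instr → List Bool
  | .emit b => [b]
  | _ => []

/-- A bound on the registers used by an instruction. -/
def Instr.top : Instr → ℕ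
  | .sweep _ r s _ => max r s + 1
  | _ => 0

/-- The number of worktapes. -/
def tapesOf (C : List Instr) : ℕ := (C.map Instr.top).foldr max 0

theorem top_le_tapesOf {C : List Instr} {i : Instr} (h : i ∈ C) : i.top ≤ tapesOf C := by
  induction C with
  | nil => simp at h
  | cons a C ih =>
    simp only [tapesOf, List.map_cons, List.foldr_cons] at ih ⊢
    rcases List.mem_cons.1 h with rfl | h
    · exact le_max_left _ _
    · exact (ih h).trans (le_max_right _ _)

/-- Machine states: `0, …, 5` are accept, reject, guess, the two successors of the guess state, and
the initial state. -/
abbrev MSt (C : List Instr) := Fin 6 ⊕ (Fin C.length × Fin 4)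

/-- The state that starts the instruction at address `t`. -/
def goto (C : List Instr) (t : ℕ) : MSt C :=
  -- Addresses behind the code lead to the rejecting state, merely to make the map total.
  if h : t < C.length then .inr (⟨t, h⟩, 0) else .inl 1

/-- The symbol scanned on tape `r`. -/
def rd {K : ℕ} (w : Fin K → Sy) (r : ℕ) : Sy := if h : r < K then w ⟨r, h⟩ else none

/-- Write with `f` and move in direction `d` on tapes `r` and `s`. -/
def act {K : ℕ} (r s : ℕ) (f : Sy → Sy) (d : Dir) (w : Fin K → Sy) : Fin K → Sy × Dir :=
  fun j => if (j : ℕ) = r ∨ (j : ℕ) = s then (f (w j), d) else (w j, .stay)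

/-- Leave the tapes as they are. -/
def keep {K : ℕ} (w : Fin K → Sy) : Fin K → Sy × Dir := fun j => (w j, .stay)

/-- The transition function on the states that execute instruction `i` at address `pc`. -/
def instrDelta (C : List Instr) {K : ℕ} (pc : Fin C.length) (ph : Fin 4) (a : InSym)
    (w : Fin K → Sy) : Instr → MSt C × Dir × (Fin K → Sy × Dir)
  | .sweep k r s t =>
    -- Phase `0` leaves the marker, phase `1` sweeps to the right, and the phases `2` and `3` return
    -- to the marker, remembering the outcome `false` or `true`.
    if ph = 0 then (.inr (pc, 1), .stay, act r s id .right w)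
    else if ph = 1 then
      match k.test (rd w r) (rd w s) with
      | none => (.inr (pc, 1), .stay, act r s k.wr .right w)
      | some b => (.inr (pc, if b then 3 else 2), .stay, act r s k.wr .left w)
    else if rd w r = none then (goto C (if ph = 3 then t else pc + 1), .stay, keep w)
    else (.inr (pc, ph), .stay, act r s id .left w)
  | .home =>
    match a with
    | .left => (goto C (pc + 1), .stay, keep w)
    | _ => (.inr (pc, 0), .left, keep w)
  | .fwd => (goto C (pc + 1), .right, keep w)
  | .emit _ => (goto C (pc + 1), .stay, keep w)
  | .jin p t => (goto C (if p a then t else pc + 1), .stay, keep w)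
  | .halt b => (.inl (if b then 0 else 1), .stay, keep w)
  | .guess => (.inl 2, .stay, keep w)

/-- The transition function; `g₀` and `g₁` are the addresses to which the successors of the guess
state lead. -/
def delta (C : List Instr) (g₀ g₁ : ℕ) {K : ℕ} (q : MSt C) (a : InSym) (w : Fin K → Sy) :
    MSt C × Dir × (Fin K → Sy × Dir) :=
  match q with
  | .inl i =>
    -- The initial state puts the marker on cell `0` of every worktape.
    if i = 5 then (goto C 0, .stay, fun _ => (none, .stay))
    else (goto C (if i = 3 then g₀ else g₁), .stay, keep w)
  | .inr p => instrDelta C p.1 p.2 a w (C.get p.1)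

/-- The machine executing a list of instructions. -/
def mach (C : List Instr) (g₀ g₁ : ℕ) : Transducer where
  State := MSt C
  Sym := Sy
  tapes := tapesOf C
  blank := some none
  start := .inl 5
  accept := .inl 0
  reject := .inl 1
  accept_ne_reject := by simp
  δ := delta C g₀ g₁
  out := fun q _ _ => match q with
    | .inl _ => none
    | .inr p => match C.get p.1 with
      | .emit b => some b
      | _ => none

/-- The nondeterministic machine executing a list of instructions. -/
def nmach (C : List Instr) (g₀ g₁ : ℕ) : NTM where
  toTM := (mach C g₀ g₁).toTM
  guess := .inl 2
  s₀ := .inl 3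
  s₁ := .inl 4
  distinct := by
    show List.Nodup ([.inl 0, .inl 1, .inl 2, .inl 3, .inl 4] : List (MSt C))
    simp

section Machine

variable {C : List Instr} {g₀ g₁ : ℕ} {x : List Bool} {S : ℕ}

/-- A configuration given by total families of head positions and tapes. -/
def cfg (C : List Instr) (g₀ g₁ : ℕ) (q : MSt C) (h : ℕ) (H : ℕ → ℕ) (T : ℕ → ℕ → Sy) :
    (mach C g₀ g₁).Cfg where
  state := q
  inHead := h
  head := fun j => H j
  tape := fun j => T j

/-- A deterministic step in space `S` of a machine with its output, from a configuration that is
neither halting nor guessing. -/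
def DStep (C : List Instr) (g₀ g₁ : ℕ) (x : List Bool) (S : ℕ)
    (p p' : (mach C g₀ g₁).Cfg × List Bool) : Prop :=
  (p.1.state ≠ Sum.inl 0 ∧ p.1.state ≠ Sum.inl 1 ∧ p.1.state ≠ Sum.inl 2) ∧
    (∀ j, p.1.head j < S) ∧
    p' = ((mach C g₀ g₁).next x p.1, p.2 ++ ((mach C g₀ g₁).out p.1.state
      (readInput x p.1.inHead) ((mach C g₀ g₁).scanned p.1)).toList)

/-- Finitely many deterministic steps. -/
abbrev Chain (C : List Instr) (g₀ g₁ : ℕ) (x : List Bool) (S : ℕ) :=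
  Relation.ReflTransGen (DStep C g₀ g₁ x S)

/-- Head positions of the worktapes in a sweep over the tapes `r` and `s`. -/
def swH (r s p : ℕ) : ℕ → ℕ := fun i => if i = r ∨ i = s then p else 0

/-- The tapes after a sweep up to cell `p`. -/
def swT (k : Kind) (r s : ℕ) (T : ℕ → ℕ → Sy) (p : ℕ) : ℕ → ℕ → Sy :=
  fun j i => if (j = r ∨ j = s) ∧ 1 ≤ i ∧ i ≤ p then k.wr (T j i) else T j i

/-- Head positions and tapes are given by families indexed by all numbers, so that registers need no
proof of being below the number of tapes; only the indices of actual tapes are compared. -/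
theorem dstep_instr {pc : Fin C.length} {ph : Fin 4} {h : ℕ} {H : ℕ → ℕ} {T : ℕ → ℕ → Sy}
    {o : List Bool} {i : Instr} (hi : C.get pc = i) (hS : ∀ j, H j < S)
    {q : MSt C} {d : Dir} {f : Fin (tapesOf C) → Sy × Dir}
    (hd : instrDelta C pc ph (readInput x h) (fun j => T j (H j)) i = (q, d, f))
    {H' : ℕ → ℕ} {T' : ℕ → ℕ → Sy}
    (hH : ∀ j : Fin (tapesOf C), moveWork (H j) (f j).2 = H' j)
    (hT : ∀ j : Fin (tapesOf C), Function.update (T j) (H j) (f j).1 = T' j)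
    {o' : List Bool} (ho : o ++ i.emits = o') :
    DStep C g₀ g₁ x S (cfg C g₀ g₁ (.inr (pc, ph)) h H T, o)
      (cfg C g₀ g₁ q (moveInput x h d) H' T', o') := by
  refine ⟨⟨Sum.inr_ne_inl, Sum.inr_ne_inl, Sum.inr_ne_inl⟩, fun j => hS j, ?_⟩
  have hδ : (mach C g₀ g₁).δ (.inr (pc, ph)) (readInput x h) (fun j => T j (H j)) = (q, d, f) := by
    simp only [mach, delta, hi, hd]
  have hn : (mach C g₀ g₁).next x (cfg C g₀ g₁ (.inr (pc, ph)) h H T) =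
      (let a := (mach C g₀ g₁).δ (.inr (pc, ph)) (readInput x h) (fun j => T j (H j))
      ⟨a.1, moveInput x h a.2.1, fun j => moveWork (H j) (a.2.2 j).2,
        fun j => Function.update (T j) (H j) (a.2.2 j).1⟩) := rfl
  rw [hδ] at hn
  refine Prod.ext ?_ ?_
  · refine Eq.trans ?_ hn.symm
    simp only [cfg]
    congr 1
    · funext j; exact (hH j).symm
    · funext j; exact (hT j).symm
  · simp only [cfg, mach, hi, ← ho]
    cases i <;> rfl

theorem rd_eq {f : ℕ → Sy} {r : ℕ} (hr : r < tapesOf C) :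
    rd (fun j : Fin (tapesOf C) => f j) r = f r := by simp [rd, hr]

theorem goto_eq {pc : ℕ} (h : pc < C.length) : goto C pc = .inr (⟨pc, h⟩, 0) := by
  simp [goto, h]

/-- No cell of tape `r` behind cell `0` receives the marker, so on the way back the marker is met
exactly at cell `0`. All heads rest there between two instructions, which makes sweeps composable.
-/
theorem chain_sweep {pc : ℕ} {k : Kind} {r s t : ℕ} (hpc : C[pc]? = some (.sweep k r s t))
    {h : ℕ} {T : ℕ → ℕ → Sy} {o : List Bool} {l : ℕ} {b : Bool}
    (hcont : ∀ i < l, k.test (T r (i + 1)) (T s (i + 1)) = none)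
    (hhalt : k.test (T r (l + 1)) (T s (l + 1)) = some b)
    (h0 : T r 0 = none) (hw : ∀ i, k.wr (T r (i + 1)) ≠ none) (hS : l + 2 ≤ S) :
    Chain C g₀ g₁ x S (cfg C g₀ g₁ (goto C pc) h (fun _ => 0) T, o)
      (cfg C g₀ g₁ (goto C (if b then t else pc + 1)) h (fun _ => 0) (swT k r s T (l + 1)), o) := by
  obtain ⟨hlt, hget⟩ := List.getElem?_eq_some_iff.1 hpc
  have htop : max r s + 1 ≤ tapesOf C := top_le_tapesOf (List.mem_of_getElem? hpc)
  have hr : r < tapesOf C := by omega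
  have hs : s < tapesOf C := by omega
  rw [goto_eq hlt]
  have hi : C.get ⟨pc, hlt⟩ = .sweep k r s t := hget
  -- the first step
  refine .head (b := (cfg C g₀ g₁ (.inr (⟨pc, hlt⟩, 1)) h (swH r s 1) (swT k r s T 0), o)) ?_ ?_
  · refine dstep_instr (d := .stay) (f := act r s id .right (fun j => T j 0)) hi
      (fun _ => by omega) (by simp [instrDelta]) ?_ ?_ (by simp [Instr.emits])
    · intro j
      by_cases hj : (j : ℕ) = r ∨ (j : ℕ) = s <;> simp [act, hj, moveWork, swH]
    · intro j
      have : swT k r s T 0 j = T j := by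
        funext i; simp only [swT]; rw [if_neg]; omega
      by_cases hj : (j : ℕ) = r ∨ (j : ℕ) = s <;> simp [act, hj, this]
  -- the way to the right
  have fw : ∀ p ≤ l, Chain C g₀ g₁ x S
      (cfg C g₀ g₁ (.inr (⟨pc, hlt⟩, 1)) h (swH r s 1) (swT k r s T 0), o)
      (cfg C g₀ g₁ (.inr (⟨pc, hlt⟩, 1)) h (swH r s (p + 1)) (swT k r s T p), o) := by
    intro p hp
    induction p with
    | zero => exact .refl
    | succ p ih =>
      refine (ih (by omega)).tail ?_
      refine dstep_instr (d := .stay)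
        (f := act r s k.wr .right (fun j => swT k r s T p j (swH r s (p + 1) j))) hi
        (fun j => by unfold swH; split <;> omega) ?_ ?_ ?_ (by simp [Instr.emits])
      · have e₁ : swT k r s T p r (swH r s (p + 1) r) = T r (p + 1) := by simp [swT, swH]
        have e₂ : swT k r s T p s (swH r s (p + 1) s) = T s (p + 1) := by simp [swT, swH]
        have := hcont p (by omega)
        simp only [instrDelta]
        rw [rd_eq (f := fun j => swT k r s T p j (swH r s (p + 1) j)) hr,
          rd_eq (f := fun j => swT k r s T p j (swH r s (p + 1) j)) hs, e₁, e₂, this]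
        simp
      · intro j
        by_cases hj : (j : ℕ) = r ∨ (j : ℕ) = s <;> simp [act, hj, moveWork, swH]
      · intro j
        funext i
        by_cases hj : (j : ℕ) = r ∨ (j : ℕ) = s
        · simp only [act, hj, if_true, swH, swT, Function.update_apply, true_and]
          by_cases hi' : i = p + 1
          · subst hi'; simp
          · simp only [hi', if_false]
            by_cases h1 : 1 ≤ i ∧ i ≤ p
            · rw [if_pos h1, if_pos (by omega)]
            · rw [if_neg h1, if_neg (by omega)]
        · simpa [act, hj, swH, swT, Function.update_apply] using fun hi' : i = 0 => by rw [hi']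
  refine (fw l le_rfl).trans ?_
  -- the turn
  refine .head (b := (cfg C g₀ g₁ (.inr (⟨pc, hlt⟩, if b then 3 else 2)) h (swH r s l)
    (swT k r s T (l + 1)), o)) ?_ ?_
  · refine dstep_instr (d := .stay)
        (f := act r s k.wr .left (fun j => swT k r s T l j (swH r s (l + 1) j))) hi
        (fun j => by unfold swH; split <;> omega) ?_ ?_ ?_ (by simp [Instr.emits])
    · have e₁ : swT k r s T l r (swH r s (l + 1) r) = T r (l + 1) := by simp [swT, swH]
      have e₂ : swT k r s T l s (swH r s (l + 1) s) = T s (l + 1) := by simp [swT, swH]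
      simp only [instrDelta]
      rw [rd_eq (f := fun j => swT k r s T l j (swH r s (l + 1) j)) hr,
        rd_eq (f := fun j => swT k r s T l j (swH r s (l + 1) j)) hs, e₁, e₂, hhalt]
      simp
    · intro j
      by_cases hj : (j : ℕ) = r ∨ (j : ℕ) = s <;> simp [act, hj, moveWork, swH]
    · intro j
      funext i
      by_cases hj : (j : ℕ) = r ∨ (j : ℕ) = s
      · simp only [act, hj, if_true, swH, swT, Function.update_apply, true_and]
        by_cases hi' : i = l + 1
        · subst hi'; simp
        · simp only [hi', if_false]
          by_cases h1 : 1 ≤ i ∧ i ≤ l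
          · rw [if_pos h1, if_pos (by omega)]
          · rw [if_neg h1, if_neg (by omega)]
      · simpa [act, hj, swH, swT, Function.update_apply] using fun hi' : i = 0 => by rw [hi']
  -- the way back
  have bw : ∀ p ≤ l, Chain C g₀ g₁ x S
      (cfg C g₀ g₁ (.inr (⟨pc, hlt⟩, if b then 3 else 2)) h (swH r s p) (swT k r s T (l + 1)), o)
      (cfg C g₀ g₁ (.inr (⟨pc, hlt⟩, if b then 3 else 2)) h (swH r s 0) (swT k r s T (l + 1)), o) := by
    intro p hp
    induction p with
    | zero => exact .refl
    | succ p ih =>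
      refine .head ?_ (ih (by omega))
      refine dstep_instr (d := .stay)
        (f := act r s id .left (fun j => swT k r s T (l + 1) j (swH r s (p + 1) j))) hi
        (fun j => by unfold swH; split <;> omega) ?_ ?_ ?_ (by simp [Instr.emits])
      · have e₁ : swT k r s T (l + 1) r (swH r s (p + 1) r) ≠ none := by
          simp only [swT, swH, true_or, if_true, true_and]
          rw [if_pos (by omega)]
          exact hw p
        simp only [instrDelta]
        rw [rd_eq (f := fun j => swT k r s T (l + 1) j (swH r s (p + 1) j)) hr, if_neg e₁]
        cases b <;> simp
      · intro j
        by_cases hj : (j : ℕ) = r ∨ (j : ℕ) = s <;> simp [act, hj, moveWork, swH]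
      · intro j
        by_cases hj : (j : ℕ) = r ∨ (j : ℕ) = s <;> simp [act, hj]
  refine (bw l le_rfl).tail ?_
  refine dstep_instr (d := .stay)
        (f := keep (fun j => swT k r s T (l + 1) j (swH r s 0 j))) hi
        (fun j => by unfold swH; split <;> omega) ?_ ?_ ?_ (by simp [Instr.emits])
  · have e₁ : swT k r s T (l + 1) r (swH r s 0 r) = none := by
      simp only [swT, swH, true_or, if_true, true_and]
      rw [if_neg (by omega)]
      exact h0
    simp only [instrDelta]
    rw [rd_eq (f := fun j => swT k r s T (l + 1) j (swH r s 0 j)) hr, if_pos e₁]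
    cases b <;> simp
  · intro j
    simp [keep, moveWork, swH]
  · intro j
    simp [keep]

/-- The configuration in which the instruction at `pc` starts, in program state `s`. -/
def conf (C : List Instr) (g₀ g₁ : ℕ) (pc : ℕ) (s : St) : (mach C g₀ g₁).Cfg × List Bool :=
  (cfg C g₀ g₁ (goto C pc) s.hd (fun _ => 0) (fun r => tp (digits (s.reg r))), s.out)

theorem dstep_single {pc : ℕ} {i : Instr} (hpc : C[pc]? = some i) (s s' : St) (hS : 0 < S)
    {t : ℕ} {d : Dir}
    (hd : ∀ (hlt : pc < C.length) (w : Fin (tapesOf C) → Sy),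
      instrDelta C ⟨pc, hlt⟩ 0 (readInput x s.hd) w i = (goto C t, d, keep w))
    (hr : s'.reg = s.reg) (hh : moveInput x s.hd d = s'.hd) (ho : s.out ++ i.emits = s'.out) :
    DStep C g₀ g₁ x S (conf C g₀ g₁ pc s) (conf C g₀ g₁ t s') := by
  obtain ⟨hlt, hget⟩ := List.getElem?_eq_some_iff.1 hpc
  unfold conf
  rw [goto_eq hlt, ← hh, hr]
  exact dstep_instr hget (fun _ => hS) (hd hlt _) (fun j => rfl)
    (fun j => by simp [keep]) ho

theorem chain_home {pc : ℕ} (hpc : C[pc]? = some .home) (s : St) (hS : 0 < S) :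
    Chain C g₀ g₁ x S (conf C g₀ g₁ pc s) (conf C g₀ g₁ (pc + 1) { s with hd := 0 }) := by
  obtain ⟨r, h, o⟩ := s
  induction h with
  | zero =>
    exact .single (dstep_single hpc _ _ hS (d := .stay) (fun _ _ => rfl) rfl rfl
      (by simp [Instr.emits]))
  | succ h ih =>
    refine .head (b := conf C g₀ g₁ pc ⟨r, h, o⟩) ?_ ih
    refine dstep_single hpc _ _ hS (d := .left) (fun hlt w => ?_) rfl rfl (by simp [Instr.emits])
    have : readInput x (h + 1) ≠ .left := by
      simp only [readInput]; split <;> simp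
    simp only [instrDelta, goto_eq hlt]

theorem chain_sweep_conf {pc : ℕ} {k : Kind} {r s t : ℕ}
    (hpc : C[pc]? = some (.sweep k r s t)) (σ τ : St) {l : ℕ} {b : Bool}
    (hcont : ∀ i < l, k.test (some (digits (σ.reg r))[i]?) (some (digits (σ.reg s))[i]?) = none)
    (hhalt : k.test (some (digits (σ.reg r))[l]?) (some (digits (σ.reg s))[l]?) = some b)
    (hS : l + 2 ≤ S) (hh : τ.hd = σ.hd) (ho : τ.out = σ.out)
    (hT : ∀ j, tp (digits (τ.reg j)) = swT k r s (fun r => tp (digits (σ.reg r))) (l + 1) j) :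
    Chain C g₀ g₁ x S (conf C g₀ g₁ pc σ) (conf C g₀ g₁ (if b then t else pc + 1) τ) := by
  have := chain_sweep (C := C) (g₀ := g₀) (g₁ := g₁) (x := x) (S := S) hpc (h := σ.hd)
    (T := fun r => tp (digits (σ.reg r))) (o := σ.out) (l := l) (b := b) hcont hhalt rfl
    (fun i => by
      have : ∀ a : Option Bool, k.wr (some a) ≠ none := by
        intro a; rcases k <;> rcases a with _ | _ | _ <;> simp [Kind.wr]
      exact this _) hS
  unfold conf
  rw [hh, ho]
  have e : (fun r => tp (digits (τ.reg r))) =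
    swT k r s (fun r => tp (digits (σ.reg r))) (l + 1) := funext hT
  rw [e]
  exact this

/-- The carry runs through the initial digits 2, turning each into 1, and is absorbed at the first
other place `n`, possibly the blank behind the digits. -/
theorem exists_carry (l : List Bool) : ∃ n ≤ l.length, (∀ i < n, l[i]? = some true) ∧
    l[n]? ≠ some true ∧
    ∀ i, some (incL l)[i]? = if i ≤ n then Kind.inc.wr (some l[i]?) else some l[i]? := by
  induction l with
  | nil =>
    refine ⟨0, le_rfl, by simp, by simp, ?_⟩
    rintro (_ | i) <;> simp [incL, Kind.wr]
  | cons b l ih =>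
    cases b
    · refine ⟨0, by simp, by simp, by simp, ?_⟩
      rintro (_ | i) <;> simp [incL, Kind.wr]
    · obtain ⟨n, h₁, h₂, h₃, h₄⟩ := ih
      refine ⟨n + 1, by simpa using h₁, ?_, by simpa using h₃, ?_⟩
      · rintro (_ | i) hi
        · rfl
        · simpa using h₂ i (by omega)
      · rintro (_ | i)
        · simp [incL, Kind.wr]
        · simpa [incL] using h₄ i

theorem chain_inc {pc r : ℕ} (hpc : C[pc]? = some (.sweep .inc r r 0)) (s : St)
    (hS : (digits (s.reg r)).length + 2 ≤ S) :
    Chain C g₀ g₁ x S (conf C g₀ g₁ pc s) (conf C g₀ g₁ (pc + 1) (s.set r (s.reg r + 1))) := by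
  obtain ⟨n, h₁, h₂, h₃, h₄⟩ := exists_carry (digits (s.reg r))
  refine chain_sweep_conf (b := false) hpc s _ (l := n) (fun i hi => ?_) ?_ (by omega) rfl rfl ?_
  · simp [Kind.test, h₂ i hi]
  · simp [Kind.test, h₃]
  · intro j
    funext i
    by_cases hj : j = r
    · subst hj
      simp only [St.set, Function.update_self, digits, swT, or_self, true_and]
      rcases i with _ | i
      · simp [tp]
      · simp only [tp, h₄]
        congr 1
        simp
    · simp [St.set, swT, hj]

theorem chain_clear {pc r : ℕ} (hpc : C[pc]? = some (.sweep .clear r r 0)) (s : St)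
    (hS : (digits (s.reg r)).length + 2 ≤ S) :
    Chain C g₀ g₁ x S (conf C g₀ g₁ pc s) (conf C g₀ g₁ (pc + 1) (s.set r 0)) := by
  refine chain_sweep_conf (b := false) hpc s _ (l := (digits (s.reg r)).length)
    (fun i hi => ?_) ?_ hS rfl rfl ?_
  · simp [Kind.test, hi]
  · simp [Kind.test]
  · intro j
    funext i
    by_cases hj : j = r
    · subst hj
      simp only [St.set, Function.update_self, digits, swT, or_self, true_and]
      rcases i with _ | i
      · simp [tp]
      · simp only [tp]
        split
        · simp [Kind.wr]
        · simp at *; omega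
    · simp [St.set, swT, hj]

/-- The comparison turns at the first difference. For equal strings this place does not exist, and
the turn happens at the blank behind both. -/
theorem exists_first_diff (l l' : List Bool) : ∃ n ≤ l.length,
    (∀ i < n, l[i]? = l'[i]? ∧ l[i]? ≠ none) ∧
    if l = l' then l[n]? = none ∧ l'[n]? = none else l[n]? ≠ l'[n]? := by
  induction l generalizing l' with
  | nil =>
    refine ⟨0, le_rfl, by simp, ?_⟩
    cases l' <;> simp
  | cons a l ih =>
    rcases l' with _ | ⟨a', l'⟩
    · exact ⟨0, by simp, by simp, by simp⟩
    · by_cases ha : a = a'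
      · subst ha
        obtain ⟨n, h₁, h₂, h₃⟩ := ih l'
        refine ⟨n + 1, by simpa using h₁, ?_, by simpa using h₃⟩
        rintro (_ | i) hi
        · simp
        · simpa using h₂ i (by omega)
      · exact ⟨0, by simp, by simp, by simp [ha]⟩

theorem chain_eq {pc r s t : ℕ} (hpc : C[pc]? = some (.sweep .eq r s t)) (σ : St)
    (hS : (digits (σ.reg r)).length + 2 ≤ S) :
    Chain C g₀ g₁ x S (conf C g₀ g₁ pc σ)
      (conf C g₀ g₁ (if σ.reg r = σ.reg s then t else pc + 1) σ) := by
  obtain ⟨n, h₁, h₂, h₃⟩ := exists_first_diff (digits (σ.reg r)) (digits (σ.reg s))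
  have := chain_sweep_conf (C := C) (g₀ := g₀) (g₁ := g₁) (x := x) (S := S)
    (b := decide (σ.reg r = σ.reg s)) hpc σ σ (l := n)
    (fun i hi => ?_) ?_ (by omega) rfl rfl ?_
  · simpa using this
  · obtain ⟨h, h'⟩ := h₂ i hi
    rw [← h]
    simp only [Kind.test, if_true]
    rw [if_neg (by simpa using h')]
  · by_cases h : σ.reg r = σ.reg s
    · rw [if_pos (by rw [h])] at h₃
      simp only [Kind.test, h₃, h, decide_true, if_true]
    · rw [if_neg (fun h' => h (digits_injective h'))] at h₃
      simp [Kind.test, h₃, h]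
  · intro j
    funext i
    simp [swT, Kind.wr]

/-! ### Compilation -/

/-- The instructions for a program, placed at address `n`. -/
def compile : Prog → ℕ → List Instr
  | .skip, _ => []
  | .inc r, _ => [.sweep .inc r r 0]
  | .clear r, _ => [.sweep .clear r r 0]
  | .home, _ => [.home]
  | .fwd, _ => [.fwd]
  | .emit b, _ => [.emit b]
  | .seq P Q, n => compile P n ++ compile Q (n + (compile P n).length)
  | .whileNe r s P, n =>
    .sweep .eq r s (n + 1 + (compile P (n + 1)).length + 1) ::
      (compile P (n + 1) ++ [.jin (fun _ => true) n])
  | .ifEq r s P Q, n =>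
    -- The negative branch comes first, since a failed test falls through to the next address; `m`
    -- is the address of the positive branch.
    let m := n + 1 + (compile Q (n + 1)).length + 1
    .sweep .eq r s m :: (compile Q (n + 1) ++
      .jin (fun _ => true) (m + (compile P m).length) :: compile P m)
  | .ifIn p P Q, n =>
    let m := n + 1 + (compile Q (n + 1)).length + 1
    .jin p m :: (compile Q (n + 1) ++
      .jin (fun _ => true) (m + (compile P m).length) :: compile P m)

theorem getElem?_mid {α : Type*} (pre : List α) (a : α) (post : List α) :
    (pre ++ a :: post)[pre.length]? = some a := by simp

theorem getElem?_mid' {α : Type*} (pre : List α) (a : α) (post : List α) {n : ℕ}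
    (h : n = pre.length) : (pre ++ a :: post)[n]? = some a := by simp [h]

theorem chain_jin {pc t : ℕ} {p : InSym → Bool} (hpc : C[pc]? = some (.jin p t)) (s : St)
    (hS : 0 < S) : Chain C g₀ g₁ x S (conf C g₀ g₁ pc s)
      (conf C g₀ g₁ (if p (readInput x s.hd) then t else pc + 1) s) :=
  .single (dstep_single hpc _ _ hS (d := .stay) (fun _ _ => rfl) rfl rfl (by simp [Instr.emits]))

/-- The induction is on the execution, not on the program. Hence a loop needs no termination
measure: after one round the induction hypothesis applies to the same code at the same address. -/
theorem chain_of_exec {B : ℕ} {P : Prog} {s s' : St} (he : Exec x B P s s')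
    (hs : ∀ r, s.reg r ≤ B) (hS : spaceFor B ≤ S) :
    ∀ (pre post : List Instr) (n : ℕ), n = pre.length → C = pre ++ (compile P n ++ post) →
      Chain C g₀ g₁ x S (conf C g₀ g₁ n s) (conf C g₀ g₁ (n + (compile P n).length) s') := by
  have hS0 : 0 < S := (spaceFor_pos B).trans_le hS
  have hlen : ∀ {v}, v ≤ B → (digits v).length + 2 ≤ S := fun h => by
    have := length_digits_le h; omega
  induction he with
  | skip s => intros; exact .refl
  | inc r s h =>
    rintro pre post n rfl hC
    exact chain_inc (by rw [hC]; exact getElem?_mid ..) s (hlen (hs r))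
  | clear r s =>
    rintro pre post n rfl hC
    exact chain_clear (by rw [hC]; exact getElem?_mid ..) s (hlen (hs r))
  | home s =>
    rintro pre post n rfl hC
    exact chain_home (by rw [hC]; exact getElem?_mid ..) s hS0
  | fwd s =>
    rintro pre post n rfl hC
    exact .single (dstep_single (by rw [hC]; exact getElem?_mid ..) _ _ hS0 (d := .right)
      (fun _ _ => rfl) rfl rfl (by simp [Instr.emits]))
  | emit b s =>
    rintro pre post n rfl hC
    exact .single (dstep_single (by rw [hC]; exact getElem?_mid ..) _ _ hS0 (d := .stay)
      (fun _ _ => rfl) rfl rfl (by simp [Instr.emits]))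
  | @seq P Q s s₁ s₂ h₁ h₂ ih₁ ih₂ =>
    intro pre post n hn hC
    simp only [compile, List.append_assoc, List.length_append] at hC ⊢
    refine (ih₁ hs pre _ n hn hC).trans ?_
    have := ih₂ (h₁.le hs) (pre ++ compile P n) post (n + (compile P n).length) (by simp [hn])
      (by simpa using hC)
    rwa [add_assoc] at this
  | @while_done r t P s h =>
    intro pre post n hn hC
    have := chain_eq (C := C) (g₀ := g₀) (g₁ := g₁) (x := x) (pc := n) (r := r) (s := t)
      (by rw [hC]; exact getElem?_mid' _ _ _ hn) s (hlen (hs r))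
    rw [if_pos h] at this
    convert this using 2
    simp only [compile, List.length_cons, List.length_append, List.length_nil, if_true]; omega
  | @while_step r t P s s₁ s₂ h h₁ h₂ ih₁ ih₂ =>
    intro pre post n hn hC
    have := chain_eq (C := C) (g₀ := g₀) (g₁ := g₁) (x := x) (pc := n) (r := r) (s := t)
      (by rw [hC]; exact getElem?_mid' _ _ _ hn) s (hlen (hs r))
    rw [if_neg h] at this
    refine this.trans (.trans ?_ (ih₂ (h₁.le hs) pre post n hn hC))
    simp only [compile] at hC
    refine (ih₁ hs (pre ++ [_]) _ (n + 1) (by simp [hn]) (by simpa using hC)).trans ?_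
    have := chain_jin (C := C) (g₀ := g₀) (g₁ := g₁) (x := x)
      (pc := n + 1 + (compile P (n + 1)).length)
      (p := fun _ => true) (t := n) (by
        rw [hC, show ∀ (a : Instr) (l m r : List Instr),
          pre ++ (a :: (l ++ m) ++ r) = (pre ++ a :: l) ++ (m ++ r) by simp]
        exact getElem?_mid' _ _ _ (by simp [hn]; omega)) s₁ hS0
    simpa using this
  | @ifEq_pos r t P Q s s₁ h h₁ ih =>
    intro pre post n hn hC
    have := chain_eq (C := C) (g₀ := g₀) (g₁ := g₁) (x := x) (pc := n) (r := r) (s := t)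
      (by rw [hC]; exact getElem?_mid' _ _ _ hn) s (hlen (hs r))
    rw [if_pos h] at this
    refine this.trans ?_
    simp only [compile] at hC
    have := ih hs (pre ++ _ :: (compile Q (n + 1) ++ [_])) post
      (n + 1 + (compile Q (n + 1)).length + 1) (by simp [hn]; omega) (by simpa using hC)
    convert this using 2
    simp only [compile, List.length_cons, List.length_append, List.length_nil, if_true]; omega
  | @ifEq_neg r t P Q s s₁ h h₁ ih =>
    intro pre post n hn hC
    have := chain_eq (C := C) (g₀ := g₀) (g₁ := g₁) (x := x) (pc := n) (r := r) (s := t)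
      (by rw [hC]; exact getElem?_mid' _ _ _ hn) s (hlen (hs r))
    rw [if_neg h] at this
    refine this.trans ?_
    simp only [compile] at hC
    refine (ih hs (pre ++ [_]) _ (n + 1) (by simp [hn]) (by simpa using hC)).trans ?_
    have := chain_jin (C := C) (g₀ := g₀) (g₁ := g₁) (x := x)
      (pc := n + 1 + (compile Q (n + 1)).length)
      (p := fun _ => true) (by
        rw [hC, show ∀ (a b : Instr) (l m r : List Instr),
          pre ++ (a :: (l ++ b :: m) ++ r) = (pre ++ a :: l) ++ b :: (m ++ r) by simp]
        exact getElem?_mid' _ _ _ (by simp [hn]; omega)) s₁ hS0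
    convert this using 2
    simp only [compile, List.length_cons, List.length_append, List.length_nil, if_true]; omega
  | @ifIn_pos p P Q s s₁ h h₁ ih =>
    intro pre post n hn hC
    have := chain_jin (C := C) (g₀ := g₀) (g₁ := g₁) (x := x) (pc := n) (p := p)
      (by rw [hC]; exact getElem?_mid' _ _ _ hn) s hS0
    rw [if_pos h] at this
    refine this.trans ?_
    simp only [compile] at hC
    have := ih hs (pre ++ _ :: (compile Q (n + 1) ++ [_])) post
      (n + 1 + (compile Q (n + 1)).length + 1) (by simp [hn]; omega) (by simpa using hC)
    convert this using 2
    simp only [compile, List.length_cons, List.length_append, List.length_nil, if_true]; omega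
  | @ifIn_neg p P Q s s₁ h h₁ ih =>
    intro pre post n hn hC
    have := chain_jin (C := C) (g₀ := g₀) (g₁ := g₁) (x := x) (pc := n) (p := p)
      (by rw [hC]; exact getElem?_mid' _ _ _ hn) s hS0
    rw [if_neg (by simp [h])] at this
    refine this.trans ?_
    simp only [compile] at hC
    refine (ih hs (pre ++ [_]) _ (n + 1) (by simp [hn]) (by simpa using hC)).trans ?_
    have := chain_jin (C := C) (g₀ := g₀) (g₁ := g₁) (x := x)
      (pc := n + 1 + (compile Q (n + 1)).length)
      (p := fun _ => true) (by
        rw [hC, show ∀ (a b : Instr) (l m r : List Instr),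
          pre ++ (a :: (l ++ b :: m) ++ r) = (pre ++ a :: l) ++ b :: (m ++ r) by simp]
        exact getElem?_mid' _ _ _ (by simp [hn]; omega)) s₁ hS0
    convert this using 2
    simp only [compile, List.length_cons, List.length_append, List.length_nil, if_true]; omega

end Machine
end ParamLog

namespace ParamLog

/-! ## Runs of the machines -/

/-- All runs from `c` stay in space `S` and contain at most `m` guesses, and one of them accepts if
and only if `A`. -/
structure Good (N : NTM) (x : List Bool) (S m : ℕ) (A : Prop) (c : N.toTM.Cfg) : Prop where
  space : ∀ c', Relation.ReflTransGen (N.Step x) c c' → ∀ j, c'.head j < S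
  acc : A ↔ ∃ c', Relation.ReflTransGen (N.Step x) c c' ∧ c'.state = N.accept
  bits : ∀ (n : ℕ) (r : ℕ → N.toTM.Cfg), r 0 = c → (∀ i < n, N.Step x (r i) (r (i + 1))) →
    ((Finset.range (n + 1)).filter fun i => (r i).state = N.guess).card ≤ m

section Good

variable {N : NTM} {x : List Bool} {S m : ℕ} {A A' : Prop} {c : N.toTM.Cfg}

theorem NTM.accept_ne_guess (N : NTM) : N.accept ≠ N.guess := by
  have := N.distinct
  simp only [List.nodup_cons, List.mem_cons, not_or] at this
  exact this.1.2.1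

theorem NTM.reject_ne_guess (N : NTM) : N.reject ≠ N.guess := by
  have := N.distinct
  simp only [List.nodup_cons, List.mem_cons, not_or] at this
  exact this.2.1.1

theorem NTM.step_of_halting {c c' : N.toTM.Cfg} (h : N.toTM.Halting c) : ¬ N.Step x c c' := by
  have hg : c.state ≠ N.guess := by
    rcases h with h | h <;> rw [h]
    exacts [N.accept_ne_guess, N.reject_ne_guess]
  simp [NTM.Step, hg, TM.step, h]

theorem card_guess_succ (n : ℕ) (r : ℕ → N.toTM.Cfg) :
    ((Finset.range (n + 1 + 1)).filter fun i => (r i).state = N.guess).card =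
      ((Finset.range (n + 1)).filter fun i => (r (i + 1)).state = N.guess).card +
        if (r 0).state = N.guess then 1 else 0 := by
  rw [Finset.card_filter, Finset.card_filter, Finset.sum_range_succ']

/-- Together with `Good.det` and `Good.guess` this gives backward rules: a machine is analysed from
its halting configurations towards the start. A guess costs one unit of `m` and turns acceptance
into a disjunction. -/
theorem Good.halt (h : N.toTM.Halting c) (hS : ∀ j, c.head j < S) :
    Good N x S m (c.state = N.accept) c := by
  have hr : ∀ c', Relation.ReflTransGen (N.Step x) c c' → c' = c := by
    intro c' hc
    rcases Relation.ReflTransGen.cases_head hc with rfl | ⟨d, hd, -⟩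
    · rfl
    · exact (NTM.step_of_halting h hd).elim
  refine ⟨fun c' hc => by rw [hr c' hc]; exact hS,
    ⟨fun h => ⟨c, .refl, h⟩, fun ⟨c', hc, h⟩ => by rw [hr c' hc] at h; exact h⟩, ?_⟩
  intro n r h0 hr
  rcases n with _ | n
  · have : (r 0).state ≠ N.guess := by
      rw [h0]
      rcases h with h | h <;> rw [h]
      exacts [N.accept_ne_guess, N.reject_ne_guess]
    simp [Finset.filter_singleton, this]
  · exact (NTM.step_of_halting h (h0 ▸ hr 0 (by omega))).elim

theorem Good.det (h : ¬ N.toTM.Halting c) (hg : c.state ≠ N.guess) (hS : ∀ j, c.head j < S)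
    (H : Good N x S m A (N.toTM.next x c)) : Good N x S m A c := by
  have hst : ∀ c', N.Step x c c' ↔ c' = N.toTM.next x c := by
    intro c'
    simp [NTM.Step, hg, TM.step, h, eq_comm]
  refine ⟨fun c' hc => ?_, ?_, ?_⟩
  · rcases Relation.ReflTransGen.cases_head hc with rfl | ⟨d, hd, hc⟩
    · exact hS
    · rw [hst] at hd
      exact H.space c' (hd ▸ hc)
  · rw [H.acc]
    refine ⟨fun ⟨c', hc, ha⟩ => ⟨c', .head ((hst _).2 rfl) hc, ha⟩, fun ⟨c', hc, ha⟩ => ?_⟩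
    rcases Relation.ReflTransGen.cases_head hc with rfl | ⟨d, hd, hc⟩
    · exact (h (.inl ha)).elim
    · rw [hst] at hd
      exact ⟨c', hd ▸ hc, ha⟩
  · intro n r h0 hr
    rcases n with _ | n
    · simp [Finset.filter_singleton, h0, hg]
    · rw [card_guess_succ, h0, if_neg hg]
      exact H.bits n (fun i => r (i + 1)) ((hst _).1 (h0 ▸ hr 0 (by omega)))
        fun i hi => hr (i + 1) (by omega)

theorem Good.guess (hg : c.state = N.guess) (hS : ∀ j, c.head j < S)
    (H : Good N x S m A { c with state := N.s₀ }) (H' : Good N x S m A' { c with state := N.s₁ }) :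
    Good N x S (m + 1) (A ∨ A') c := by
  have hst : ∀ c', N.Step x c c' ↔ c' = { c with state := N.s₀ } ∨ c' = { c with state := N.s₁ } := by
    intro c'
    simp [NTM.Step, hg]
  refine ⟨fun c' hc => ?_, ?_, ?_⟩
  · rcases Relation.ReflTransGen.cases_head hc with rfl | ⟨d, hd, hc⟩
    · exact hS
    · rcases (hst _).1 hd with rfl | rfl
      exacts [H.space c' hc, H'.space c' hc]
  · rw [H.acc, H'.acc]
    constructor
    · rintro (⟨c', hc, ha⟩ | ⟨c', hc, ha⟩)
      · exact ⟨c', .head ((hst _).2 (.inl rfl)) hc, ha⟩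
      · exact ⟨c', .head ((hst _).2 (.inr rfl)) hc, ha⟩
    · rintro ⟨c', hc, ha⟩
      rcases Relation.ReflTransGen.cases_head hc with rfl | ⟨d, hd, hc⟩
      · exact (N.accept_ne_guess (ha.symm.trans hg)).elim
      · rcases (hst _).1 hd with rfl | rfl
        exacts [.inl ⟨c', hc, ha⟩, .inr ⟨c', hc, ha⟩]
  · intro n r h0 hr
    rcases n with _ | n
    · simp [Finset.filter_singleton, h0, hg]
    · rw [card_guess_succ, h0, if_pos hg]
      refine Nat.add_le_add_right ?_ 1
      rcases (hst _).1 (h0 ▸ hr 0 (by omega)) with h | h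
      · exact H.bits n (fun i => r (i + 1)) h fun i hi => hr (i + 1) (by omega)
      · exact H'.bits n (fun i => r (i + 1)) h fun i hi => hr (i + 1) (by omega)

theorem Good.iff (H : Good N x S m A c) (h : A ↔ A') : Good N x S m A' c := by
  rwa [propext h] at H

end Good

section Machine

variable {C : List Instr} {g₀ g₁ : ℕ} {x : List Bool} {S m : ℕ} {A A' : Prop}

theorem chain_start (hS : 0 < S) : Chain C g₀ g₁ x S ((mach C g₀ g₁).startCfg, [])
    (conf C g₀ g₁ 0 ⟨fun _ => 0, 0, []⟩) := by
  refine .single ⟨⟨?_, ?_, ?_⟩, fun j => hS, ?_⟩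
  · exact Sum.inl_injective.ne (by decide)
  · exact Sum.inl_injective.ne (by decide)
  · exact Sum.inl_injective.ne (by decide)
  · refine Prod.ext ?_ rfl
    refine Eq.trans ?_ (show cfg C g₀ g₁ (goto C 0) 0 (fun _ => 0)
      (fun r => Function.update (fun _ => some none) 0 none) = _ from rfl)
    simp only [conf]
    congr 1
    funext r i
    rcases i with _ | i <;> simp [tp, digits]

theorem dstep_succ {i : Fin 6} (hi : i = 3 ∨ i = 4) (hS : 0 < S) {h : ℕ} {T : ℕ → ℕ → Sy}
    {o : List Bool} : DStep C g₀ g₁ x S (cfg C g₀ g₁ (.inl i) h (fun _ => 0) T, o)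
      (cfg C g₀ g₁ (goto C (if i = 3 then g₀ else g₁)) h (fun _ => 0) T, o) := by
  refine ⟨⟨?_, ?_, ?_⟩, fun j => hS, ?_⟩
  · exact Sum.inl_injective.ne (by rcases hi with rfl | rfl <;> decide)
  · exact Sum.inl_injective.ne (by rcases hi with rfl | rfl <;> decide)
  · exact Sum.inl_injective.ne (by rcases hi with rfl | rfl <;> decide)
  · refine Prod.ext ?_ (by simp [mach, cfg])
    have : (mach C g₀ g₁).δ (.inl i) (readInput x h) (fun j => T j 0) =
        (goto C (if i = 3 then g₀ else g₁), .stay, keep fun j => T j 0) := by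
      simp only [mach, delta]
      rw [if_neg (by rcases hi with rfl | rfl <;> decide)]
    refine Eq.trans ?_ (show
      (let a := (mach C g₀ g₁).δ (.inl i) (readInput x h) (fun j => T j 0)
      (⟨a.1, moveInput x h a.2.1, fun j => moveWork 0 (a.2.2 j).2,
        fun j => Function.update (T j) 0 (a.2.2 j).1⟩ : (mach C g₀ g₁).Cfg)) = _ from rfl)
    rw [this]
    simp only [keep, cfg, moveInput, moveWork]
    congr 1
    funext j
    exact (Function.update_eq_self 0 (T j)).symm

theorem dstep_special {pc : ℕ} {i : Instr} {q : Fin 6} (hpc : C[pc]? = some i)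
    (hi : i = .guess ∧ q = 2 ∨ i = .halt true ∧ q = 0 ∨ i = .halt false ∧ q = 1) (s : St)
    (hS : 0 < S) : DStep C g₀ g₁ x S (conf C g₀ g₁ pc s)
      (cfg C g₀ g₁ (.inl q) s.hd (fun _ => 0) (fun r => tp (digits (s.reg r))), s.out) := by
  obtain ⟨hlt, hget⟩ := List.getElem?_eq_some_iff.1 hpc
  unfold conf
  rw [goto_eq hlt]
  refine dstep_instr (d := .stay) (f := keep fun j => tp (digits (s.reg j)) 0) hget (fun _ => hS) ?_
    (fun j => rfl) (fun j => by simp [keep]) ?_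
  · rcases hi with ⟨rfl, rfl⟩ | ⟨rfl, rfl⟩ | ⟨rfl, rfl⟩ <;> rfl
  · rcases hi with ⟨rfl, rfl⟩ | ⟨rfl, rfl⟩ | ⟨rfl, rfl⟩ <;> simp [Instr.emits]

theorem stepOut_of_dstep {p p' : (mach C g₀ g₁).Cfg × List Bool} (h : DStep C g₀ g₁ x S p p') :
    (mach C g₀ g₁).stepOut x p = some p' := by
  obtain ⟨⟨h₀, h₁, -⟩, -, rfl⟩ := h
  have : ¬ (mach C g₀ g₁).toTM.Halting p.1 := by rintro (h | h); exacts [h₀ h, h₁ h]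
  simp [Transducer.stepOut, TM.step, this]

theorem step_of_dstep {p p' : (mach C g₀ g₁).Cfg × List Bool} (h : DStep C g₀ g₁ x S p p') :
    (mach C g₀ g₁).toTM.step x p.1 = some p'.1 := by
  obtain ⟨⟨h₀, h₁, -⟩, -, rfl⟩ := h
  have : ¬ (mach C g₀ g₁).toTM.Halting p.1 := by rintro (h | h); exacts [h₀ h, h₁ h]
  simp [TM.step, this]

theorem reachesCfg_of_chain {p p' : (mach C g₀ g₁).Cfg × List Bool} (h : Chain C g₀ g₁ x S p p') :
    Relation.ReflTransGen (fun c₁ c₂ => (mach C g₀ g₁).toTM.step x c₁ = some c₂) p.1 p'.1 := by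
  induction h with
  | refl => exact .refl
  | tail _ h ih => exact ih.tail (step_of_dstep h)

theorem stepOut_of_chain {p p' : (mach C g₀ g₁).Cfg × List Bool} (h : Chain C g₀ g₁ x S p p') :
    Relation.ReflTransGen (fun c₁ c₂ => (mach C g₀ g₁).stepOut x c₁ = some c₂) p p' := by
  induction h with
  | refl => exact .refl
  | tail _ h ih => exact ih.tail (stepOut_of_dstep h)

/-- By determinism, and because the chain ends in a halting configuration, every configuration
reachable from its beginning lies on it. -/
theorem space_of_chain {p p' : (mach C g₀ g₁).Cfg × List Bool} (h : Chain C g₀ g₁ x S p p')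
    (hh : (mach C g₀ g₁).toTM.Halting p'.1) (hS : ∀ j, p'.1.head j < S) {c : (mach C g₀ g₁).Cfg}
    (hc : Relation.ReflTransGen (fun c₁ c₂ => (mach C g₀ g₁).toTM.step x c₁ = some c₂) p.1 c) :
    ∀ j, c.head j < S := by
  induction h using Relation.ReflTransGen.head_induction_on with
  | refl =>
    rcases Relation.ReflTransGen.cases_head hc with rfl | ⟨d, hd, -⟩
    · exact hS
    · simp [TM.step, hh] at hd
  | head hd _ ih =>
    rcases Relation.ReflTransGen.cases_head hc with rfl | ⟨d, hd', hc⟩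
    · exact hd.2.1
    · rw [step_of_dstep hd] at hd'
      obtain rfl := Option.some_injective _ hd'
      exact ih hc

theorem good_of_chain {p p' : (mach C g₀ g₁).Cfg × List Bool} (h : Chain C g₀ g₁ x S p p')
    (H : Good (nmach C g₀ g₁) x S m A p'.1) : Good (nmach C g₀ g₁) x S m A p.1 := by
  induction h using Relation.ReflTransGen.head_induction_on with
  | refl => exact H
  | head hd _ ih =>
    obtain ⟨⟨h₀, h₁, h₂⟩, hS, rfl⟩ := hd
    refine Good.det ?_ h₂ hS ih
    rintro (h | h)
    exacts [h₀ h, h₁ h]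

theorem good_guess {pc : ℕ} (hpc : C[pc]? = some .guess) (s : St) (hS : 0 < S)
    (H : Good (nmach C g₀ g₁) x S m A (conf C g₀ g₁ g₀ s).1)
    (H' : Good (nmach C g₀ g₁) x S m A' (conf C g₀ g₁ g₁ s).1) :
    Good (nmach C g₀ g₁) x S (m + 1) (A ∨ A') (conf C g₀ g₁ pc s).1 := by
  refine good_of_chain (.single (dstep_special hpc (.inl ⟨rfl, rfl⟩) s hS)) ?_
  refine Good.guess rfl (fun _ => hS) ?_ ?_
  · exact good_of_chain (.single (dstep_succ (C := C) (g₀ := g₀) (g₁ := g₁) (x := x)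
      (i := 3) (.inl rfl) hS (o := s.out))) H
  · exact good_of_chain (.single (dstep_succ (C := C) (g₀ := g₀) (g₁ := g₁) (x := x)
      (i := 4) (.inr rfl) hS (o := s.out))) H'

theorem good_halt {pc : ℕ} {b : Bool} (hpc : C[pc]? = some (.halt b)) (s : St) (hS : 0 < S) :
    Good (nmach C g₀ g₁) x S m (b = true) (conf C g₀ g₁ pc s).1 := by
  refine good_of_chain (.single (dstep_special hpc (q := if b then 0 else 1)
    (by cases b <;> simp) s hS)) ?_
  refine (Good.halt ?_ fun _ => hS).iff ?_
  · cases b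
    exacts [.inr rfl, .inl rfl]
  · cases b
    · exact iff_of_false (Sum.inl_injective.ne (by decide)) (by simp)
    · exact iff_of_true rfl rfl

end Machine
end ParamLog

namespace ParamLog

/-! ## Functions computed by counter programs -/

@[simp] theorem St.set_reg (s : St) (r v t : ℕ) :
    (s.set r v).reg t = if t = r then v else s.reg t := by
  simp [St.set, Function.update_apply]

@[simp] theorem St.set_out (s : St) (r v : ℕ) : (s.set r v).out = s.out := rfl

@[simp] theorem St.set_hd (s : St) (r v : ℕ) : (s.set r v).hd = s.hd := rfl

/-- The program can run from `s`, with registers bounded by `B`, to a state satisfying `Q`. -/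
def Run (x : List Bool) (B : ℕ) (P : Prog) (s : St) (Q : St → Prop) : Prop :=
  ∃ s', Exec x B P s s' ∧ Q s'

section Run

variable {x : List Bool} {B : ℕ} {P P' : Prog} {s : St} {Q Q' : St → Prop}

theorem Run.mono (h : Run x B P s Q) (hs : ∀ r, s.reg r ≤ B)
    (hQ : ∀ s', (∀ r, s'.reg r ≤ B) → Q s' → Q' s') : Run x B P s Q' := by
  obtain ⟨s', he, hq⟩ := h
  exact ⟨s', he, hQ s' (he.le hs) hq⟩

theorem Run.seq (h : Run x B P s fun s' => Run x B P' s' Q) : Run x B (.seq P P') s Q := by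
  obtain ⟨s', he, s'', he', hq⟩ := h
  exact ⟨s'', .seq he he', hq⟩

theorem Run.inc {r : ℕ} (hr : s.reg r < B) (h : Q (s.set r (s.reg r + 1))) :
    Run x B (.inc r) s Q := ⟨_, .inc r s hr, h⟩

theorem Run.clear {r : ℕ} (h : Q (s.set r 0)) : Run x B (.clear r) s Q := ⟨_, .clear r s, h⟩

theorem Run.skip (h : Q s) : Run x B .skip s Q := ⟨_, .skip s, h⟩

theorem Run.ifEq {r t : ℕ} (h : s.reg r = s.reg t → Run x B P s Q)
    (h' : s.reg r ≠ s.reg t → Run x B P' s Q) : Run x B (.ifEq r t P P') s Q := by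
  by_cases e : s.reg r = s.reg t
  · obtain ⟨s', he, hq⟩ := h e
    exact ⟨s', .ifEq_pos e he, hq⟩
  · obtain ⟨s', he, hq⟩ := h' e
    exact ⟨s', .ifEq_neg e he, hq⟩

theorem Run.ifIn {p : InSym → Bool} (h : p (readInput x s.hd) = true → Run x B P s Q)
    (h' : p (readInput x s.hd) = false → Run x B P' s Q) : Run x B (.ifIn p P P') s Q := by
  cases e : p (readInput x s.hd)
  · obtain ⟨s', he, hq⟩ := h' e
    exact ⟨s', .ifIn_neg e he, hq⟩
  · obtain ⟨s', he, hq⟩ := h e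
    exact ⟨s', .ifIn_pos e he, hq⟩

/-- The loop in which register `i` runs from `0` to the content of register `n`. -/
def Prog.loop (i n : ℕ) (P : Prog) : Prog := .seq (.clear i) (.whileNe i n (.seq P (.inc i)))

/-- Hoare rule for counting loops. The body may change every register except the counter and the
limit; what survives is expressed by the invariant `I`. -/
theorem Run.loop {i n N : ℕ} (I : ℕ → St → Prop) (hN : s.reg n = N) (hin : i ≠ n)
    (hs : ∀ r, s.reg r ≤ B) (h0 : I 0 (s.set i 0))
    (hstep : ∀ k t, k < N → (∀ r, t.reg r ≤ B) → t.reg i = k → t.reg n = N → I k t →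
      Run x B P t fun t' => t'.reg i = k ∧ t'.reg n = N ∧ I (k + 1) (t'.set i (k + 1)))
    (hQ : ∀ t, t.reg i = N → t.reg n = N → I N t → Q t) :
    Run x B (.loop i n P) s Q := by
  have key : ∀ d k t, k + d = N → (∀ r, t.reg r ≤ B) → t.reg i = k → t.reg n = N → I k t →
      Run x B (.whileNe i n (.seq P (.inc i))) t Q := by
    intro d
    induction d with
    | zero =>
      intro k t hk ht hi hn hI
      obtain rfl : k = N := by omega
      exact ⟨t, .while_done (hi.trans hn.symm), hQ t hi hn hI⟩
    | succ d ih =>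
      intro k t hk ht hi hn hI
      obtain ⟨t', he, hi', hn', hI'⟩ := hstep k t (by omega) ht hi hn hI
      have hB := he.le ht
      -- The counter is still below the content of register `n`, which is at most `B` as is every
      -- register.
      have hlt : t'.reg i < B := by
        have := hB n
        omega
      have he₂ : Exec x B (.seq P (.inc i)) t (t'.set i (k + 1)) := by
        have := Exec.inc (x := x) i t' hlt
        rw [hi'] at this
        exact .seq he this
      obtain ⟨t'', he₃, hq⟩ := ih (k + 1) (t'.set i (k + 1)) (by omega) (he₂.le ht) (by simp)
        (by simp [hin.symm, hn']) hI'
      exact ⟨t'', .while_step (by omega) he₂ he₃, hq⟩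
  refine Run.seq (Run.clear ?_)
  have hs' := (Exec.clear (x := x) (B := B) i s).le hs
  exact key N 0 _ (by omega) hs' (by simp) (by simp [hin.symm, hN]) h0

/-- Add register `n` to register `r`, using register `i` as a counter. -/
theorem Run.addLoop {i n r : ℕ} (hin : i ≠ n) (hr : r ≠ i) (hrn : r ≠ n)
    (hs : ∀ r, s.reg r ≤ B) (hB : s.reg r + s.reg n ≤ B)
    (hQ : ∀ t, t.reg r = s.reg r + s.reg n → (∀ j, j ≠ r → j ≠ i → t.reg j = s.reg j) →
      t.out = s.out → Q t) : Run x B (.loop i n (.inc r)) s Q := by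
  refine Run.loop (fun k t => t.reg r = s.reg r + k ∧
    (∀ j, j ≠ r → j ≠ i → t.reg j = s.reg j) ∧ t.out = s.out) rfl hin hs ?_ ?_ ?_
  · refine ⟨by simp [hr], ?_, rfl⟩
    intro j _ h
    simp [h]
  · rintro k t hk ht hi hn ⟨h₁, h₂, h₃⟩
    refine Run.inc (by omega) ⟨by simp [hr.symm, hi], by simp [hrn.symm, hn], ?_, ?_, h₃⟩
    · simp [hr, h₁]; omega
    · intro j h h'
      simp [h, h', h₂ j h h']
  · rintro t - - ⟨h₁, h₂, h₃⟩
    exact hQ t h₁ h₂ h₃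

/-- Add the square of register `n` to register `r`. -/
theorem Run.sqLoop {i j n r : ℕ} (hin : i ≠ n) (hjn : j ≠ n) (hij : i ≠ j) (hr : r ≠ i)
    (hrj : r ≠ j) (hrn : r ≠ n) (hs : ∀ r, s.reg r ≤ B)
    (hB : s.reg r + s.reg n * s.reg n ≤ B)
    (hQ : ∀ t, t.reg r = s.reg r + s.reg n * s.reg n →
      (∀ l, l ≠ r → l ≠ i → l ≠ j → t.reg l = s.reg l) → t.out = s.out → Q t) :
    Run x B (.loop i n (.loop j n (.inc r))) s Q := by
  refine Run.loop (fun k t => t.reg r = s.reg r + k * s.reg n ∧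
    (∀ l, l ≠ r → l ≠ i → l ≠ j → t.reg l = s.reg l) ∧ t.out = s.out) rfl hin hs ?_ ?_ ?_
  · refine ⟨by simp [hr], ?_, rfl⟩
    intro l _ h _
    simp [h]
  · rintro k t hk ht hi hn ⟨h₁, h₂, h₃⟩
    have hle : (k + 1) * s.reg n ≤ s.reg n * s.reg n := Nat.mul_le_mul_right _ hk
    rw [add_mul, one_mul] at hle
    refine Run.addLoop hjn hrj hrn ht (by rw [h₁, hn]; omega) fun t' h₁' h₂' h₃' => ?_
    refine ⟨by rw [h₂' i hr.symm hij, hi], by rw [h₂' n hrn.symm hjn.symm, hn], ?_, ?_, ?_⟩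
    · simp only [St.set_reg, hr, if_false, h₁', h₁, hn]; ring
    · intro l h h' h''
      simp [h', h₂' l h h'', h₂ l h h' h'']
    · simp [h₃', h₃]
  · rintro t - - ⟨h₁, h₂, h₃⟩
    exact hQ t h₁ h₂ h₃

/-- Copy register `r` to register `t`. -/
def Prog.copy (r t : ℕ) : Prog := .loop t r .skip

theorem Run.copy {r t : ℕ} (h : t ≠ r) (hs : ∀ r, s.reg r ≤ B)
    (hQ : ∀ s' : St, s'.reg t = s.reg r → (∀ j, j ≠ t → s'.reg j = s.reg j) → s'.out = s.out →
      Q s') : Run x B (.copy r t) s Q := by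
  refine Run.loop (fun k s' => (∀ j, j ≠ t → s'.reg j = s.reg j) ∧ s'.out = s.out) rfl h hs ?_ ?_ ?_
  · refine ⟨fun j hj => by simp [hj], rfl⟩
  · rintro k u hk hu hi hn ⟨h₁, h₂⟩
    exact Run.skip ⟨hi, hn, fun j hj => by simp [hj, h₁ j hj], h₂⟩
  · rintro u hu - ⟨h₁, h₂⟩
    exact hQ u hu h₁ h₂

end Run

/-- The programs `P n` compute `g` in register `n`, leave the registers below `n` alone, and have no
register exceed `b` (or a value that was there at the start). -/
def Realizes (P : ℕ → Prog) (g b : List Bool → ℕ → ℕ) : Prop :=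
  ∀ (x : List Bool) (n B : ℕ) (s : St), (∀ r, s.reg r ≤ B) → b x (s.reg n) ≤ B →
    Run x B (P n) s fun s' =>
      s'.reg n = g x (s.reg n) ∧ (∀ r < n, s'.reg r = s.reg r) ∧ s'.out = s.out

/-- `g` is computed by programs with register bound `b`. -/
def Calc (g b : List Bool → ℕ → ℕ) : Prop := ∃ P, Realizes P g b

/-! ### Basic functions and closure properties of counter programs -/

namespace Calc

variable {f g h k b b₁ b₂ b₃ b₄ : List Bool → ℕ → ℕ}

/-- The result stands in a register, and no register exceeds the bound of the execution. So values
of intermediate results need no separate estimate. -/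
theorem le (H : Calc g b) (x : List Bool) (v : ℕ) : g x v ≤ max v (b x v) := by
  obtain ⟨P, hP⟩ := H
  have hs : ∀ r, (⟨fun r => if r = 0 then v else 0, 0, []⟩ : St).reg r ≤ max v (b x v) := by
    intro r
    dsimp only
    split <;> simp
  obtain ⟨s', he, h, -⟩ := hP x 0 (max v (b x v)) _ hs (by simp)
  have := he.le hs 0
  rw [h] at this
  simpa using this

protected theorem id : Calc (fun _ v => v) (fun _ _ => 0) :=
  ⟨fun _ => .skip, fun _ _ _ _ _ _ => Run.skip ⟨rfl, fun _ _ => rfl, rfl⟩⟩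

theorem zero : Calc (fun _ _ => 0) (fun _ _ => 0) :=
  ⟨fun n => .clear n, fun _ _ _ _ _ _ =>
    Run.clear ⟨by simp, fun r hr => by simp [hr.ne], rfl⟩⟩

theorem succ : Calc (fun _ v => v + 1) (fun _ v => v + 1) :=
  ⟨fun n => .inc n, fun _ _ _ _ _ hb =>
    Run.inc hb ⟨by simp, fun r hr => by simp [hr.ne], rfl⟩⟩

theorem comp (hg : Calc g b₁) (hf : Calc f b₂) :
    Calc (fun x v => g x (f x v)) (fun x v => max (b₂ x v) (b₁ x (f x v))) := by
  obtain ⟨P, hP⟩ := hg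
  obtain ⟨P', hP'⟩ := hf
  refine ⟨fun n => .seq (P' n) (P n), fun x n B s hs hb => Run.seq ?_⟩
  refine (hP' x n B s hs (le_of_max_le_left hb)).mono hs fun s₁ hs₁ ⟨h₁, h₂, h₃⟩ => ?_
  refine (hP x n B s₁ hs₁ (by rw [h₁]; exact le_of_max_le_right hb)).mono hs₁
    fun s₂ _ ⟨h₁', h₂', h₃'⟩ => ?_
  exact ⟨by rw [h₁', h₁], fun r hr => by rw [h₂' r hr, h₂ r hr], h₃'.trans h₃⟩

/-- Compute the pair of registers `n + 1`, `n + 2` in register `n`. -/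
def pairProg (n : ℕ) : Prog :=
  .seq (.clear (n + 5)) (.seq (.clear (n + 6)) (.seq (.clear n)
    -- The counter takes the values below the second component, so it meets the first component
    -- exactly when this is the smaller one; register `n + 5` records that.
    (.seq (.loop (n + 3) (n + 2) (.ifEq (n + 3) (n + 1) (.inc (n + 5)) .skip))
      (.ifEq (n + 5) (n + 6)
        (.seq (.loop (n + 3) (n + 1) (.loop (n + 4) (n + 1) (.inc n)))
          (.seq (.loop (n + 3) (n + 1) (.inc n)) (.loop (n + 3) (n + 2) (.inc n))))
        (.seq (.loop (n + 3) (n + 2) (.loop (n + 4) (n + 2) (.inc n)))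
          (.loop (n + 3) (n + 1) (.inc n)))))))

theorem run_pairProg {x : List Bool} {B n a b : ℕ} {s : St} (hs : ∀ r, s.reg r ≤ B)
    (ha : s.reg (n + 1) = a) (hb : s.reg (n + 2) = b) (hB : Nat.pair a b ≤ B) (hB1 : 1 ≤ B) :
    Run x B (pairProg n) s fun s' =>
      s'.reg n = Nat.pair a b ∧ (∀ r < n, s'.reg r = s.reg r) ∧ s'.out = s.out := by
  refine Run.seq ((Run.clear (Q := fun t => t = _) rfl).mono hs ?_)
  rintro s₁ hs₁ rfl
  refine Run.seq ((Run.clear (Q := fun t => t = _) rfl).mono hs₁ ?_)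
  rintro s₂ hs₂ rfl
  refine Run.seq ((Run.clear (Q := fun t => t = _) rfl).mono hs₂ ?_)
  rintro s₃ hs₃ rfl
  set s₃ := ((s.set (n + 5) 0).set (n + 6) 0).set n 0 with e₃
  have e5 : s₃.reg (n + 5) = 0 := by simp [e₃]
  have e6 : s₃.reg (n + 6) = 0 := by simp [e₃]
  have e0 : s₃.reg n = 0 := by simp [e₃]
  have e1 : s₃.reg (n + 1) = a := by simp [e₃, ha]
  have e2 : s₃.reg (n + 2) = b := by simp [e₃, hb]
  have ef : ∀ r < n, s₃.reg r = s.reg r := fun r hr => by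
    simp [e₃, hr.ne, show r ≠ n + 5 by omega, show r ≠ n + 6 by omega]
  have eo : s₃.out = s.out := rfl
  clear_value s₃
  -- compare
  refine Run.seq ((Run.loop (Q := fun t => t.reg (n + 5) = (if a < b then 1 else 0) ∧
      (∀ r, r ≠ n + 3 → r ≠ n + 5 → t.reg r = s₃.reg r) ∧ t.out = s₃.out)
    (fun k t => t.reg (n + 5) = (if a < k then 1 else 0) ∧
      (∀ r, r ≠ n + 3 → r ≠ n + 5 → t.reg r = s₃.reg r) ∧ t.out = s₃.out)
    rfl (by omega) hs₃ ?_ ?_ ?_).mono hs₃ ?_)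
  · refine ⟨by simp [e5], fun r h h' => by simp [h], rfl⟩
  · rintro k t hk ht hi hn ⟨h₁, h₂, h₃⟩
    have h1 : t.reg (n + 1) = a := by rw [h₂ _ (by omega) (by omega), e1]
    refine Run.ifEq (fun h => ?_) (fun h => ?_)
    · have : ¬ a < k := by omega
      refine Run.inc (by rw [h₁, if_neg this]; omega) ⟨by simpa using hi, by simpa using hn, ?_, ?_, ?_⟩
      · simp only [St.set_reg, h₁, if_neg this]
        rw [if_pos (show a < k + 1 by omega)]
        simp
      · intro r h h'
        simp [h, h', h₂ r h h']
      · simp [h₃]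
    · refine Run.skip ⟨hi, hn, ?_, ?_, by simp [h₃]⟩
      · have : a < k ↔ a < k + 1 := by omega
        simp [h₁, this]
      · intro r h h'
        simp [h, h₂ r h h']
  · rintro t - - h
    rwa [e2] at h
  rintro s₄ hs₄ ⟨f5, ff, fo⟩
  have f6 : s₄.reg (n + 6) = 0 := by rw [ff _ (by omega) (by omega), e6]
  have f0 : s₄.reg n = 0 := by rw [ff _ (by omega) (by omega), e0]
  have f1 : s₄.reg (n + 1) = a := by rw [ff _ (by omega) (by omega), e1]
  have f2 : s₄.reg (n + 2) = b := by rw [ff _ (by omega) (by omega), e2]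
  have fr : ∀ r < n, s₄.reg r = s.reg r := fun r hr => by
    rw [ff _ (by omega) (by omega), ef r hr]
  have fo' : s₄.out = s.out := fo.trans eo
  refine Run.ifEq (fun h => ?_) (fun h => ?_)
  · have hab : ¬ a < b := by
      intro hab
      rw [f5, f6, if_pos hab] at h
      omega
    have hp : Nat.pair a b = a * a + a + b := by simp [Nat.pair, hab]
    refine Run.seq ((Run.sqLoop (by omega) (by omega) (by omega) (by omega) (by omega) (by omega)
      hs₄ (by rw [f0, f1]; omega) (Q := fun t => t.reg n = a * a ∧
        (∀ r, r ≠ n → r ≠ n + 3 → r ≠ n + 4 → t.reg r = s₄.reg r) ∧ t.out = s₄.out) ?_).mono hs₄ ?_)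
    · intro t h₁ h₂ h₃
      exact ⟨by rw [h₁, f0, f1, zero_add], h₂, h₃⟩
    rintro s₅ hs₅ ⟨g0, gf, go⟩
    have g1 : s₅.reg (n + 1) = a := by rw [gf _ (by omega) (by omega) (by omega), f1]
    refine Run.seq ((Run.addLoop (by omega) (by omega) (by omega) hs₅ (by rw [g0, g1]; omega)
      (Q := fun t => t.reg n = a * a + a ∧
        (∀ r, r ≠ n → r ≠ n + 3 → r ≠ n + 4 → t.reg r = s₄.reg r) ∧ t.out = s₄.out) ?_).mono hs₅ ?_)
    · intro t h₁ h₂ h₃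
      exact ⟨by rw [h₁, g0, g1], fun r h h' h'' => by rw [h₂ r h h', gf r h h' h''], h₃.trans go⟩
    rintro s₆ hs₆ ⟨i0, hf, ho⟩
    have i2 : s₆.reg (n + 2) = b := by rw [hf _ (by omega) (by omega) (by omega), f2]
    refine Run.addLoop (by omega) (by omega) (by omega) hs₆ (by rw [i0, i2]; omega) ?_
    intro t h₁ h₂ h₃
    refine ⟨by rw [h₁, i0, i2, hp], fun r hr => ?_, by rw [h₃, ho, fo']⟩
    rw [h₂ _ (by omega) (by omega), hf _ (by omega) (by omega) (by omega), fr r hr]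
  · have hab : a < b := by
      by_contra hab
      rw [f5, f6, if_neg hab] at h
      omega
    have hp : Nat.pair a b = b * b + a := by simp [Nat.pair, hab]
    refine Run.seq ((Run.sqLoop (by omega) (by omega) (by omega) (by omega) (by omega) (by omega)
      hs₄ (by rw [f0, f2]; omega) (Q := fun t => t.reg n = b * b ∧
        (∀ r, r ≠ n → r ≠ n + 3 → r ≠ n + 4 → t.reg r = s₄.reg r) ∧ t.out = s₄.out) ?_).mono hs₄ ?_)
    · intro t h₁ h₂ h₃
      exact ⟨by rw [h₁, f0, f2, zero_add], h₂, h₃⟩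
    rintro s₅ hs₅ ⟨g0, gf, go⟩
    have g1 : s₅.reg (n + 1) = a := by rw [gf _ (by omega) (by omega) (by omega), f1]
    refine Run.addLoop (by omega) (by omega) (by omega) hs₅ (by rw [g0, g1]; omega) ?_
    intro t h₁ h₂ h₃
    refine ⟨by rw [h₁, g0, g1, hp], fun r hr => ?_, by rw [h₃, go, fo']⟩
    rw [h₂ _ (by omega) (by omega), gf _ (by omega) (by omega) (by omega), fr r hr]

theorem pair (hf : Calc f b₁) (hg : Calc g b₂) : Calc (fun x v => Nat.pair (f x v) (g x v))
    (fun x v => max (max (b₁ x v) (b₂ x v)) (Nat.pair (f x v) (g x v) + 1)) := by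
  obtain ⟨P, hP⟩ := hf
  obtain ⟨P', hP'⟩ := hg
  refine ⟨fun n => .seq (.copy n (n + 1)) (.seq (P (n + 1)) (.seq (.copy n (n + 2))
    (.seq (P' (n + 2)) (pairProg n)))), fun x n B s hs hb => ?_⟩
  simp only [max_le_iff] at hb
  refine Run.seq ((Run.copy (by omega) hs (Q := fun t => t.reg (n + 1) = s.reg n ∧
    (∀ j ≠ n + 1, t.reg j = s.reg j) ∧ t.out = s.out) fun _ h₁ h₂ h₃ => ⟨h₁, h₂, h₃⟩).mono hs ?_)
  rintro s₁ hs₁ ⟨a₁, a₂, a₃⟩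
  refine Run.seq ((hP x (n + 1) B s₁ hs₁ (by rw [a₁]; omega)).mono hs₁ ?_)
  rintro s₂ hs₂ ⟨c₁, c₂, c₃⟩
  rw [a₁] at c₁
  have c₄ : s₂.reg n = s.reg n := by rw [c₂ n (by omega), a₂ n (by omega)]
  refine Run.seq ((Run.copy (by omega) hs₂ (Q := fun t => t.reg (n + 2) = s₂.reg n ∧
    (∀ j ≠ n + 2, t.reg j = s₂.reg j) ∧ t.out = s₂.out) fun _ h₁ h₂ h₃ => ⟨h₁, h₂, h₃⟩).mono hs₂ ?_)
  rintro s₃ hs₃ ⟨d₁, d₂, d₃⟩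
  rw [c₄] at d₁
  refine Run.seq ((hP' x (n + 2) B s₃ hs₃ (by rw [d₁]; omega)).mono hs₃ ?_)
  rintro s₄ hs₄ ⟨e₁, e₂, e₃⟩
  rw [d₁] at e₁
  refine (run_pairProg hs₄ (by rw [e₂ (n + 1) (by omega), d₂ (n + 1) (by omega), c₁]) e₁ (by omega)
    (by omega)).mono hs₄ ?_
  rintro s₅ - ⟨k₁, k₂, k₃⟩
  refine ⟨k₁, fun r hr => ?_, by rw [k₃, e₃, d₃, c₃, a₃]⟩
  rw [k₂ r hr, e₂ r (by omega), d₂ r (by omega), c₂ r (by omega), a₂ r (by omega)]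

/-- `Nat.unpair` lists the pairs with maximum `w` as `(0, w), …, (w - 1, w), (w, 0), …, (w, w)`.
Unpairing `k` thus means to take `k` steps in this list, which a counter program can do. -/
theorem unpair_succ {k u w : ℕ} (h : Nat.unpair k = (u, w)) : Nat.unpair (k + 1) =
    if u = w then (0, w + 1) else if u < w then (if u + 1 = w then (w, 0) else (u + 1, w))
    else (u, w + 1) := by
  have hk : k = Nat.pair u w := by rw [← Nat.pair_unpair k, h]
  have : ∀ p : ℕ × ℕ, Nat.pair p.1 p.2 = k + 1 → Nat.unpair (k + 1) = p := by
    intro p hp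
    rw [← hp, Nat.unpair_pair]
  apply this
  rw [hk]
  split_ifs with h₁ h₂ h₃
  · subst h₁
    simp [Nat.pair]; ring
  · subst h₃
    simp [Nat.pair]; ring
  · have : u + 1 < w := by omega
    simp [Nat.pair, this, h₂]; ring
  · have : ¬ u < w + 1 := by omega
    simp [Nat.pair, this, h₂]; ring

/-- Compute the components of register `n` in registers `n + 1` and `n + 2`. -/
def unpairProg (n : ℕ) : Prog :=
  .seq (.clear (n + 1)) (.seq (.clear (n + 2)) (.seq (.clear (n + 3)) (.seq (.clear (n + 4))
    (.seq (.inc (n + 3)) (.loop (n + 5) n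
      (.ifEq (n + 1) (n + 2)
        (.seq (.clear (n + 1)) (.seq (.inc (n + 2)) (.clear (n + 3))))
        (.ifEq (n + 3) (n + 4)
          (.seq (.inc (n + 1)) (.ifEq (n + 1) (n + 2)
            (.seq (.clear (n + 2)) (.inc (n + 3))) .skip))
          (.inc (n + 2)))))))))

theorem run_unpairProg {x : List Bool} {B n : ℕ} {s : St} (hs : ∀ r, s.reg r ≤ B) (hB1 : 1 ≤ B) :
    Run x B (unpairProg n) s fun s' =>
      (s'.reg (n + 1), s'.reg (n + 2)) = Nat.unpair (s.reg n) ∧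
      (∀ r < n, s'.reg r = s.reg r) ∧ s'.out = s.out := by
  refine Run.seq ((Run.clear (Q := fun t => t = _) rfl).mono hs ?_)
  rintro s₁ hs₁ rfl
  refine Run.seq ((Run.clear (Q := fun t => t = _) rfl).mono hs₁ ?_)
  rintro s₂ hs₂ rfl
  refine Run.seq ((Run.clear (Q := fun t => t = _) rfl).mono hs₂ ?_)
  rintro s₃ hs₃ rfl
  refine Run.seq ((Run.clear (Q := fun t => t = _) rfl).mono hs₃ ?_)
  rintro s₄ hs₄ rfl
  refine Run.seq ((Run.inc (Q := fun t => t = _) (by simp; omega) rfl).mono hs₄ ?_)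
  rintro s₅ hs₅ rfl
  -- Programs can test registers for equality only. Register `n + 3` is kept as a flag for the order
  -- of the two components, and register `n + 4` is the zero it is compared with.
  refine Run.loop (N := s.reg n) (fun k t => (t.reg (n + 1), t.reg (n + 2)) = Nat.unpair k ∧
    t.reg (n + 3) = (if t.reg (n + 2) ≤ t.reg (n + 1) then 1 else 0) ∧ t.reg (n + 4) = 0 ∧
      (∀ r < n, t.reg r = s.reg r) ∧ t.out = s.out) (by simp) (by omega) hs₅ ?_ ?_ ?_
  · refine ⟨by simp, by simp, by simp, fun r hr => ?_, rfl⟩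
    simp [show r ≠ n + 1 by omega, show r ≠ n + 2 by omega, show r ≠ n + 3 by omega,
      show r ≠ n + 4 by omega, show r ≠ n + 5 by omega]
  · rintro k t hk ht hi hn ⟨h₁, h₂, h₃, h₄, h₅⟩
    have hu := unpair_succ h₁.symm
    have hle₁ := Nat.unpair_left_le k
    have hle₂ := Nat.unpair_right_le k
    rw [← h₁] at hle₁ hle₂
    simp only at hle₁ hle₂
    have hB := ht n
    have hr : ∀ r < n, r ≠ n + 1 ∧ r ≠ n + 2 ∧ r ≠ n + 3 ∧ r ≠ n + 4 ∧ r ≠ n + 5 := by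
      intro r hr; omega
    refine Run.ifEq (fun h => ?_) fun h => Run.ifEq (fun h' => ?_) fun h' => ?_
    · refine Run.seq (Run.clear (Run.seq (Run.inc (by simp; omega) (Run.clear ?_))))
      refine ⟨by simpa using hi, by simpa using hn, ?_, ?_, ?_, ?_, by simpa using h₅⟩
      · rw [hu, if_pos h]; simp
      · simp
      · simpa using h₃
      · intro r hlt
        obtain ⟨i₁, i₂, i₃, i₄, i₅⟩ := hr r hlt
        simp [i₁, i₂, i₃, i₅, h₄ r hlt]
    · have hlt : t.reg (n + 1) < t.reg (n + 2) := by
        rw [h₂, h₃] at h'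
        split at h' <;> omega
      refine Run.seq (Run.inc (by omega) (Run.ifEq (fun h'' => ?_) fun h'' => ?_))
      · simp only [St.set_reg] at h''
        simp at h''
        refine Run.seq (Run.clear (Run.inc (by simp [h', h₃]; omega) ?_))
        refine ⟨by simpa using hi, by simpa using hn, ?_, ?_, ?_, ?_, by simpa using h₅⟩
        · rw [hu, if_neg h, if_pos hlt, if_pos h'']; simp [h'']
        · simp [h', h₃]
        · simpa using h₃
        · intro r hlt
          obtain ⟨i₁, i₂, i₃, i₄, i₅⟩ := hr r hlt
          simp [i₁, i₂, i₃, i₅, h₄ r hlt]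
      · simp only [St.set_reg] at h''
        simp at h''
        refine Run.skip ?_
        refine ⟨by simpa using hi, by simpa using hn, ?_, ?_, ?_, ?_, by simpa using h₅⟩
        · rw [hu, if_neg h, if_pos hlt, if_neg h'']; simp
        · have : ¬ t.reg (n + 2) ≤ t.reg (n + 1) + 1 := by omega
          simp [h', h₃, this]
        · simpa using h₃
        · intro r hlt
          obtain ⟨i₁, i₂, i₃, i₄, i₅⟩ := hr r hlt
          simp [i₁, i₅, h₄ r hlt]
    · have hlt : t.reg (n + 2) < t.reg (n + 1) := by
        rw [h₂, h₃] at h'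
        split at h' <;> omega
      refine Run.inc (by omega) ?_
      refine ⟨by simpa using hi, by simpa using hn, ?_, ?_, ?_, ?_, by simpa using h₅⟩
      · rw [hu, if_neg h, if_neg (by omega)]; simp
      · simp [h₂, hlt.le, Nat.succ_le_iff.2 hlt]
      · simpa using h₃
      · intro r hlt
        obtain ⟨i₁, i₂, i₃, i₄, i₅⟩ := hr r hlt
        simp [i₂, i₅, h₄ r hlt]
  · rintro t - - ⟨h₁, -, -, h₄, h₅⟩
    exact ⟨h₁, h₄, h₅⟩

theorem left : Calc (fun _ v => (Nat.unpair v).1) (fun _ v => v + 1) := by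
  refine ⟨fun n => .seq (unpairProg n) (.copy (n + 1) n), fun x n B s hs hb => Run.seq ?_⟩
  replace hb : s.reg n + 1 ≤ B := hb
  refine (run_unpairProg hs (by omega)).mono hs fun s₁ hs₁ ⟨h₁, h₂, h₃⟩ => ?_
  refine Run.copy (by omega) hs₁ fun s₂ k₁ k₂ k₃ => ⟨?_, fun r hr => ?_, by rw [k₃, h₃]⟩
  · simp only [k₁, ← h₁]
  · rw [k₂ r (by omega), h₂ r hr]

theorem right : Calc (fun _ v => (Nat.unpair v).2) (fun _ v => v + 1) := by
  refine ⟨fun n => .seq (unpairProg n) (.copy (n + 2) n), fun x n B s hs hb => Run.seq ?_⟩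
  replace hb : s.reg n + 1 ≤ B := hb
  refine (run_unpairProg hs (by omega)).mono hs fun s₁ hs₁ ⟨h₁, h₂, h₃⟩ => ?_
  refine Run.copy (by omega) hs₁ fun s₂ k₁ k₂ k₃ => ⟨?_, fun r hr => ?_, by rw [k₃, h₃]⟩
  · simp only [k₁, ← h₁]
  · rw [k₂ r (by omega), h₂ r hr]

theorem ite (hf : Calc f b₁) (hg : Calc g b₂) (hh : Calc h b₃) (hk : Calc k b₄) :
    Calc (fun x v => if f x v = g x v then h x v else k x v)
      (fun x v => max (max (b₁ x v) (b₂ x v)) (max (b₃ x v) (b₄ x v))) := by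
  obtain ⟨P₁, hP₁⟩ := hf
  obtain ⟨P₂, hP₂⟩ := hg
  obtain ⟨P₃, hP₃⟩ := hh
  obtain ⟨P₄, hP₄⟩ := hk
  refine ⟨fun n => .seq (.copy n (n + 1)) (.seq (P₁ (n + 1)) (.seq (.copy n (n + 2))
    (.seq (P₂ (n + 2)) (.ifEq (n + 1) (n + 2) (P₃ n) (P₄ n))))), fun x n B s hs hb => ?_⟩
  simp only [max_le_iff] at hb
  refine Run.seq ((Run.copy (by omega) hs (Q := fun t => t.reg (n + 1) = s.reg n ∧
    (∀ j ≠ n + 1, t.reg j = s.reg j) ∧ t.out = s.out) fun _ h₁ h₂ h₃ => ⟨h₁, h₂, h₃⟩).mono hs ?_)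
  rintro s₁ hs₁ ⟨a₁, a₂, a₃⟩
  refine Run.seq ((hP₁ x (n + 1) B s₁ hs₁ (by rw [a₁]; omega)).mono hs₁ ?_)
  rintro s₂ hs₂ ⟨c₁, c₂, c₃⟩
  rw [a₁] at c₁
  have c₄ : s₂.reg n = s.reg n := by rw [c₂ n (by omega), a₂ n (by omega)]
  refine Run.seq ((Run.copy (by omega) hs₂ (Q := fun t => t.reg (n + 2) = s₂.reg n ∧
    (∀ j ≠ n + 2, t.reg j = s₂.reg j) ∧ t.out = s₂.out) fun _ h₁ h₂ h₃ => ⟨h₁, h₂, h₃⟩).mono hs₂ ?_)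
  rintro s₃ hs₃ ⟨d₁, d₂, d₃⟩
  rw [c₄] at d₁
  refine Run.seq ((hP₂ x (n + 2) B s₃ hs₃ (by rw [d₁]; omega)).mono hs₃ ?_)
  rintro s₄ hs₄ ⟨e₁, e₂, e₃⟩
  rw [d₁] at e₁
  have e₄ : s₄.reg (n + 1) = f x (s.reg n) := by
    rw [e₂ (n + 1) (by omega), d₂ (n + 1) (by omega), c₁]
  have e₅ : ∀ r ≤ n, s₄.reg r = s.reg r := fun r hr => by
    rw [e₂ r (by omega), d₂ r (by omega), c₂ r (by omega), a₂ r (by omega)]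
  have e₆ : s₄.out = s.out := by rw [e₃, d₃, c₃, a₃]
  refine Run.ifEq (fun h => ?_) (fun h => ?_)
  · rw [e₁, e₄] at h
    refine (hP₃ x n B s₄ hs₄ (by rw [e₅ n le_rfl]; omega)).mono hs₄ ?_
    rintro s₅ - ⟨k₁, k₂, k₃⟩
    rw [e₅ n le_rfl] at k₁
    exact ⟨k₁.trans (if_pos h).symm, fun r hr => by rw [k₂ r hr, e₅ r hr.le], k₃.trans e₆⟩
  · rw [e₁, e₄] at h
    refine (hP₄ x n B s₄ hs₄ (by rw [e₅ n le_rfl]; omega)).mono hs₄ ?_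
    rintro s₅ - ⟨k₁, k₂, k₃⟩
    rw [e₅ n le_rfl] at k₁
    exact ⟨k₁.trans (if_neg h).symm, fun r hr => by rw [k₂ r hr, e₅ r hr.le], k₃.trans e₆⟩

/-- Iteration: `f` is iterated `g x v` times, starting from `h x v`. -/
theorem iterate (hf : Calc f b₁) (hg : Calc g b₂) (hh : Calc h b₃)
    (hb₁ : ∀ x v, b₂ x v ≤ b x v) (hb₂ : ∀ x v, b₃ x v ≤ b x v)
    (hb₃ : ∀ x v i, i < g x v → b₁ x ((f x)^[i] (h x v)) ≤ b x v) :
    Calc (fun x v => (f x)^[g x v] (h x v)) b := by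
  obtain ⟨P, hP⟩ := hf
  obtain ⟨P', hP'⟩ := hg
  obtain ⟨P'', hP''⟩ := hh
  -- The iterated value is held in register `n + 3`, above the limit `n + 1` and the counter `n +
  -- 2`, because `P (n + 3)` preserves only the registers below its own.
  refine ⟨fun n => .seq (.copy n (n + 1)) (.seq (P' (n + 1)) (.seq (.copy n (n + 3)) (.seq (P'' (n + 3))
    (.seq (.loop (n + 2) (n + 1) (P (n + 3))) (.copy (n + 3) n))))), fun x n B s hs hb => ?_⟩
  refine Run.seq ((Run.copy (by omega) hs (Q := fun t => t.reg (n + 1) = s.reg n ∧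
    (∀ j ≠ n + 1, t.reg j = s.reg j) ∧ t.out = s.out) fun _ h₁ h₂ h₃ => ⟨h₁, h₂, h₃⟩).mono hs ?_)
  rintro s₁ hs₁ ⟨a₁, a₂, a₃⟩
  refine Run.seq ((hP' x (n + 1) B s₁ hs₁ (by rw [a₁]; exact (hb₁ _ _).trans hb)).mono hs₁ ?_)
  rintro s₂ hs₂ ⟨c₁, c₂, c₃⟩
  rw [a₁] at c₁
  have c₄ : s₂.reg n = s.reg n := by rw [c₂ n (by omega), a₂ n (by omega)]
  refine Run.seq ((Run.copy (by omega) hs₂ (Q := fun t => t.reg (n + 3) = s₂.reg n ∧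
    (∀ j ≠ n + 3, t.reg j = s₂.reg j) ∧ t.out = s₂.out) fun _ h₁ h₂ h₃ => ⟨h₁, h₂, h₃⟩).mono hs₂ ?_)
  rintro s₃ hs₃ ⟨d₁, d₂, d₃⟩
  rw [c₄] at d₁
  refine Run.seq ((hP'' x (n + 3) B s₃ hs₃ (by rw [d₁]; exact (hb₂ _ _).trans hb)).mono hs₃ ?_)
  rintro s₃' hs₃' ⟨d₁', d₂', d₃'⟩
  rw [d₁] at d₁'
  have hcnt : s₃'.reg (n + 1) = g x (s.reg n) := by
    rw [d₂' (n + 1) (by omega), d₂ (n + 1) (by omega), c₁]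
  refine Run.seq ((Run.loop (Q := fun t => t.reg (n + 3) = (f x)^[g x (s.reg n)] (h x (s.reg n)) ∧
      (∀ r < n, t.reg r = s.reg r) ∧ t.out = s.out)
    (fun i t => t.reg (n + 3) = (f x)^[i] (h x (s.reg n)) ∧
      (∀ r < n, t.reg r = s.reg r) ∧ t.out = s.out) hcnt (by omega) hs₃' ?_ ?_ ?_).mono hs₃' ?_)
  · refine ⟨by simp [d₁'], fun r hr => ?_, ?_⟩
    · simp only [St.set_reg]
      rw [if_neg (by omega), d₂' r (by omega), d₂ r (by omega), c₂ r (by omega), a₂ r (by omega)]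
    · rw [St.set_out, d₃', d₃, c₃, a₃]
  · rintro i t hi ht ht₁ ht₂ ⟨h₁, h₂, h₃⟩
    refine (hP x (n + 3) B t ht (by rw [h₁]; exact (hb₃ _ _ _ hi).trans hb)).mono ht ?_
    rintro t' - ⟨k₁, k₂, k₃⟩
    refine ⟨by rw [k₂ _ (by omega), ht₁], by rw [k₂ _ (by omega), ht₂], ?_, fun r hr => ?_, ?_⟩
    · simp only [St.set_reg]
      rw [if_neg (by omega), k₁, h₁, Function.iterate_succ_apply']
    · simp only [St.set_reg]
      rw [if_neg (by omega), k₂ r (by omega), h₂ r hr]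
    · rw [St.set_out, k₃, h₃]
  · rintro t - - h
    exact h
  rintro s₄ hs₄ ⟨e₁, e₂, e₃⟩
  refine Run.copy (by omega) hs₄ fun s₅ k₁ k₂ k₃ => ⟨by rw [k₁, e₁], fun r hr => ?_, by rw [k₃, e₃]⟩
  rw [k₂ r (by omega), e₂ r hr]

/-- Iteration of `f` until `g` vanishes, starting from `h x v`. -/
theorem iterateUntil (hf : Calc f b₁) (hg : Calc g b₂) (hh : Calc h b₃)
    {m : List Bool → ℕ → ℕ}
    (hm : ∀ x v, g x ((f x)^[m x v] (h x v)) = 0)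
    (hlt : ∀ x v, ∀ i < m x v, g x ((f x)^[i] (h x v)) ≠ 0)
    (hb₀ : ∀ x v, b₃ x v ≤ b x v)
    (hb₁ : ∀ x v i, i < m x v → b₁ x ((f x)^[i] (h x v)) ≤ b x v)
    (hb₂ : ∀ x v i, i ≤ m x v → b₂ x ((f x)^[i] (h x v)) ≤ b x v) :
    Calc (fun x v => (f x)^[m x v] (h x v)) b := by
  obtain ⟨P, hP⟩ := hf
  obtain ⟨P', hP'⟩ := hg
  obtain ⟨P'', hP''⟩ := hh
  refine ⟨fun n => .seq (P'' n) (.seq (.seq (.copy n (n + 1)) (.seq (P' (n + 1)) (.clear (n + 2))))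
    (.whileNe (n + 1) (n + 2) (.seq (P n)
      (.seq (.copy n (n + 1)) (.seq (P' (n + 1)) (.clear (n + 2))))))), fun x n B s hs hb => ?_⟩
  set v := s.reg n with hv
  have test : ∀ t : St, (∀ r, t.reg r ≤ B) → b₂ x (t.reg n) ≤ B →
      Run x B (.seq (.copy n (n + 1)) (.seq (P' (n + 1)) (.clear (n + 2)))) t fun t' =>
        t'.reg (n + 1) = g x (t.reg n) ∧ t'.reg (n + 2) = 0 ∧ (∀ r ≤ n, t'.reg r = t.reg r) ∧
          t'.out = t.out := by
    intro t ht hbt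
    refine Run.seq ((Run.copy (by omega) ht (Q := fun t' => t'.reg (n + 1) = t.reg n ∧
      (∀ j ≠ n + 1, t'.reg j = t.reg j) ∧ t'.out = t.out) fun _ h₁ h₂ h₃ => ⟨h₁, h₂, h₃⟩).mono ht ?_)
    rintro s₁ hs₁ ⟨a₁, a₂, a₃⟩
    refine Run.seq ((hP' x (n + 1) B s₁ hs₁ (by rw [a₁]; exact hbt)).mono hs₁ ?_)
    rintro s₂ hs₂ ⟨c₁, c₂, c₃⟩
    refine Run.clear ⟨by simp [c₁, a₁], by simp, fun r hr => ?_, by simp [c₃, a₃]⟩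
    simp only [St.set_reg]
    rw [if_neg (by omega), c₂ r (by omega), a₂ r (by omega)]
  have key : ∀ d i t, i + d = m x v → (∀ r, t.reg r ≤ B) → t.reg n = (f x)^[i] (h x v) →
      t.reg (n + 1) = g x (t.reg n) → t.reg (n + 2) = 0 → (∀ r < n, t.reg r = s.reg r) →
      t.out = s.out → Run x B (.whileNe (n + 1) (n + 2) (.seq (P n)
      (.seq (.copy n (n + 1)) (.seq (P' (n + 1)) (.clear (n + 2)))))) t fun s' =>
        s'.reg n = (f x)^[m x v] (h x v) ∧ (∀ r < n, s'.reg r = s.reg r) ∧ s'.out = s.out := by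
    intro d
    induction d with
    | zero =>
      intro i t hi ht h₁ h₂ h₃ h₄ h₅
      obtain rfl : i = m x v := by omega
      exact ⟨t, .while_done (by rw [h₂, h₁, hm, h₃]), h₁, h₄, h₅⟩
    | succ d ih =>
      intro i t hi ht h₁ h₂ h₃ h₄ h₅
      obtain ⟨t₁, he₁, k₁, k₂, k₃⟩ := hP x n B t ht
        (by rw [h₁]; exact (hb₁ x v i (by omega)).trans hb)
      rw [h₁, ← Function.iterate_succ_apply' (f x)] at k₁
      obtain ⟨t₂, he₂, l₁, l₂, l₃, l₄⟩ := test t₁ (he₁.le ht)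
        (by rw [k₁]; exact (hb₂ x v (i + 1) (by omega)).trans hb)
      have he := Exec.seq he₁ he₂
      obtain ⟨t₃, he₃, hq⟩ := ih (i + 1) t₂ (by omega) (he.le ht) (by rw [l₃ n le_rfl, k₁])
        (by rw [l₁, l₃ n le_rfl]) l₂ (fun r hr => by rw [l₃ r hr.le, k₂ r hr, h₄ r hr])
        (by rw [l₄, k₃, h₅])
      exact ⟨t₃, .while_step (by rw [h₂, h₃, h₁]; exact hlt x v i (by omega)) he he₃, hq⟩
  refine Run.seq ((hP'' x n B s hs ((hb₀ _ _).trans hb)).mono hs ?_)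
  rintro s₀ hs₀ ⟨k₁, k₂, k₃⟩
  refine Run.seq ((test s₀ hs₀ (by rw [k₁]; exact (hb₂ x v 0 (Nat.zero_le _)).trans hb)).mono hs₀ ?_)
  rintro s₁ hs₁ ⟨h₁, h₂, h₃, h₄⟩
  exact key (m x v) 0 s₁ (by omega) hs₁ ((h₃ n le_rfl).trans k₁) (by rw [h₁, h₃ n le_rfl]) h₂
    (fun r hr => (h₃ r hr.le).trans (k₂ r hr)) (h₄.trans k₃)

/-- A numbering of the input symbols. -/
def _root_.ParamLog.InSym.code : InSym → ℕ
  | .left => 0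
  | .bit false => 1
  | .bit true => 2
  | .right => 3

theorem readInput_min (x : List Bool) (i : ℕ) :
    readInput x (min i (x.length + 1)) = readInput x i := by
  by_cases h : i ≤ x.length + 1
  · rw [min_eq_left h]
  · rw [min_eq_right (by omega)]
    obtain ⟨j, rfl⟩ : ∃ j, i = j + 1 := ⟨i - 1, by omega⟩
    have : x[j]? = none := List.getElem?_eq_none (by omega)
    simp [readInput, this]

/-- The head walks from the left end as often as the argument says and stays at the right end marker
when it gets there, which agrees with `readInput` by `readInput_min`. -/
theorem input : Calc (fun x i => (readInput x i).code) (fun _ _ => 3) := by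
  refine ⟨fun n => .seq .home (.seq (.loop (n + 1) n .fwd) (.seq (.clear n)
    (.ifIn (fun a => a.code = 0) .skip (.seq (.inc n) (.ifIn (fun a => a.code = 1) .skip
      (.seq (.inc n) (.ifIn (fun a => a.code = 2) .skip (.inc n)))))))), fun x n B s hs hb => ?_⟩
  refine Run.seq ⟨_, .home s, ?_⟩
  have hs' : ∀ r, ({ s with hd := 0 } : St).reg r ≤ B := hs
  refine Run.seq ((Run.loop (i := n + 1) (n := n) (Q := fun t => t.hd = min (s.reg n) (x.length + 1) ∧
      (∀ r ≤ n, t.reg r = s.reg r) ∧ t.out = s.out)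
    (fun i t => t.hd = min i (x.length + 1) ∧ (∀ r ≤ n, t.reg r = s.reg r) ∧ t.out = s.out)
      rfl (by omega) hs' ?_ ?_ ?_).mono hs' ?_)
  · refine ⟨by simp, fun r hr => ?_, rfl⟩
    simp [show r ≠ n + 1 by omega]
  · rintro i t hi ht ht₁ ht₂ ⟨h₁, h₂, h₃⟩
    refine ⟨_, .fwd t, ht₁, ht₂, ?_, fun r hr => ?_, h₃⟩
    · simp only [St.set_hd, h₁]; omega
    · simp [show r ≠ n + 1 by omega, h₂ r hr]
  · rintro t - - h
    exact h
  rintro s₁ hs₁ ⟨h₁, h₂, h₃⟩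
  have hd : readInput x s₁.hd = readInput x (s.reg n) := by rw [h₁, readInput_min]
  refine Run.seq (Run.clear ?_)
  have fin : ∀ (t : St) (c : ℕ), t.reg n = c → (∀ r < n, t.reg r = s₁.reg r) → t.out = s₁.out →
      c = (readInput x (s.reg n)).code → t.reg n = (readInput x (s.reg n)).code ∧
        (∀ r < n, t.reg r = s.reg r) ∧ t.out = s.out := by
    intro t c hc hr ho he
    exact ⟨hc.trans he, fun r h => by rw [hr r h, h₂ r h.le], ho.trans h₃⟩
  have hB : 3 ≤ B := hb
  refine Run.ifIn (fun h => Run.skip (fin _ 0 (by simp) (fun r h => by simp [h.ne]) rfl ?_))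
    fun h => Run.seq ?_
  · simp only [St.set_hd, hd] at h
    exact (of_decide_eq_true h).symm
  simp only [St.set_hd, hd] at h
  refine Run.inc (by simp; omega) (Run.ifIn
    (fun h' => Run.skip (fin _ 1 (by simp) (fun r h => by simp [h.ne]) rfl ?_))
    fun h' => Run.seq ?_)
  · simp only [St.set_hd, hd] at h'
    exact (of_decide_eq_true h').symm
  simp only [St.set_hd, hd] at h'
  refine Run.inc (by simp; omega) (Run.ifIn
    (fun h'' => Run.skip (fin _ 2 (by simp) (fun r h => by simp [h.ne]) rfl ?_)) fun h'' => ?_)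
  · simp only [St.set_hd, hd] at h''
    exact (of_decide_eq_true h'').symm
  simp only [St.set_hd, hd] at h''
  refine Run.inc (by simp; omega) (fin _ 3 (by simp) (fun r h => by simp [h.ne]) rfl ?_)
  revert h h' h''
  generalize readInput x (s.reg n) = a
  rcases a with _ | _ | _ <;> (try rename_i b; cases b) <;> simp [InSym.code]

/-- The loop stops when the flag in register `n + 1` equals the constant 1 in register `n + 2`; the
additional 1 in the bound makes room for these two on the empty input. -/
theorem length : Calc (fun x _ => x.length) (fun x _ => x.length + 1) := by
  refine ⟨fun n => .seq (.clear n) (.seq .home (.seq .fwd (.seq (.clear (n + 1))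
    (.seq (.clear (n + 2)) (.seq (.inc (n + 2)) (.whileNe (n + 1) (n + 2)
      (.ifIn (fun a => a.code = 3) (.inc (n + 1)) (.seq (.inc n) .fwd)))))))),
    fun x n B s hs hb => ?_⟩
  replace hb : x.length + 1 ≤ B := hb
  have key : ∀ d i t, i + d = x.length → t.reg n = i → t.hd = i + 1 → t.reg (n + 1) = 0 →
      t.reg (n + 2) = 1 → (∀ r < n, t.reg r = s.reg r) → t.out = s.out →
      Run x B (.whileNe (n + 1) (n + 2)
        (.ifIn (fun a => a.code = 3) (.inc (n + 1)) (.seq (.inc n) .fwd))) t fun s' =>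
        s'.reg n = x.length ∧ (∀ r < n, s'.reg r = s.reg r) ∧ s'.out = s.out := by
    intro d
    induction d with
    | zero =>
      intro i t hi h₁ h₂ h₃ h₄ h₅ h₆
      have : readInput x t.hd = .right := by
        rw [h₂]
        simp [readInput, List.getElem?_eq_none (show x.length ≤ i by omega)]
      refine ⟨t.set (n + 1) 1, .while_step (by omega)
        (.ifIn_pos (by rw [this]; rfl) (s' := t.set (n + 1) 1) ?_)
        (.while_done (by simp [h₄])), ?_, fun r hr => ?_, h₆⟩
      · have := Exec.inc (x := x) (B := B) (n + 1) t (by omega)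
        rwa [h₃] at this
      · simp [h₁]; omega
      · simp [show r ≠ n + 1 by omega, h₅ r hr]
    | succ d ih =>
      intro i t hi h₁ h₂ h₃ h₄ h₅ h₆
      have : (readInput x t.hd).code ≠ 3 := by
        rw [h₂]
        simp only [readInput, List.getElem?_eq_getElem (show i < x.length by omega)]
        cases x[i] <;> simp [InSym.code]
      obtain ⟨t', he, hq⟩ := ih (i + 1)
        { t.set n (i + 1) with hd := min ((t.set n (i + 1)).hd + 1) (x.length + 1) }
        (by omega) (by simp) (by simp [h₂]; omega) (by simp [h₃]) (by simp [h₄])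
        (fun r hr => by simp [hr.ne, h₅ r hr]) (by simp [h₆])
      refine ⟨t', .while_step (by omega) (.ifIn_neg (by simpa using this) (.seq ?_ (.fwd _))) he, hq⟩
      have := Exec.inc (x := x) (B := B) n t (by omega)
      rwa [h₁] at this
  refine Run.seq (Run.clear (Run.seq ⟨_, .home _, Run.seq ⟨_, .fwd _, Run.seq (Run.clear
    (Run.seq (Run.clear (Run.seq (Run.inc ?_ ?_)))))⟩⟩))
  · simp; omega
  · refine key x.length 0 _ (by omega) (by simp) (by simp) (by simp) (by simp) (fun r hr => ?_) rfl
    simp [show r ≠ n by omega, show r ≠ n + 1 by omega, show r ≠ n + 2 by omega]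

end Calc
end ParamLog

namespace ParamLog

/-! ## Polynomially bounded functions computed by counter programs -/

/-- Polynomially bounded in the length of the input and the argument. -/
def PolyBdd (b : List Bool → ℕ → ℕ) : Prop := ∃ d, ∀ x v, b x v ≤ (x.length + v + 2) ^ d

namespace PolyBdd

variable {b b' : List Bool → ℕ → ℕ}

theorem mono (h : PolyBdd b) (hb : ∀ x v, b' x v ≤ b x v) : PolyBdd b' :=
  let ⟨d, hd⟩ := h
  ⟨d, fun x v => (hb x v).trans (hd x v)⟩

theorem mul (h : PolyBdd b) (h' : PolyBdd b') : PolyBdd fun x v => b x v * b' x v := by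
  obtain ⟨d, hd⟩ := h
  obtain ⟨d', hd'⟩ := h'
  exact ⟨d + d', fun x v => by rw [pow_add]; exact Nat.mul_le_mul (hd x v) (hd' x v)⟩

theorem base : PolyBdd fun x v => x.length + v + 2 := ⟨1, fun x v => by simp⟩

theorem arg : PolyBdd fun _ v => v := base.mono fun x v => by omega

theorem length : PolyBdd fun x _ => x.length := base.mono fun x v => by omega

theorem const (c : ℕ) : PolyBdd fun _ _ => c :=
  ⟨c, fun x v => c.lt_two_pow_self.le.trans (Nat.pow_le_pow_left (by omega) c)⟩

/-- The base is at least 2, so the factor 2 is paid for by one more exponent. -/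
theorem add (h : PolyBdd b) (h' : PolyBdd b') : PolyBdd fun x v => b x v + b' x v := by
  obtain ⟨d, hd⟩ := h
  obtain ⟨d', hd'⟩ := h'
  refine ⟨d + d' + 1, fun x v => ?_⟩
  have hN : 2 ≤ x.length + v + 2 := by omega
  have h₁ := (hd x v).trans (Nat.pow_le_pow_right (by omega) (show d ≤ d + d' by omega))
  have h₂ := (hd' x v).trans (Nat.pow_le_pow_right (by omega) (show d' ≤ d + d' by omega))
  calc b x v + b' x v ≤ (x.length + v + 2) ^ (d + d') * 2 := by omega
    _ ≤ _ := by rw [pow_succ]; exact Nat.mul_le_mul_left _ hN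

theorem max (h : PolyBdd b) (h' : PolyBdd b') : PolyBdd fun x v => Max.max (b x v) (b' x v) :=
  (h.add h').mono fun x v => by omega

theorem pow (h : PolyBdd b) (n : ℕ) : PolyBdd fun x v => b x v ^ n := by
  obtain ⟨d, hd⟩ := h
  exact ⟨d * n, fun x v => by rw [pow_mul]; exact Nat.pow_le_pow_left (hd x v) n⟩

theorem pair (h : PolyBdd b) (h' : PolyBdd b') : PolyBdd fun x v => Nat.pair (b x v) (b' x v) :=
  (((h.max h').add (const 1)).pow 2).mono fun x v => (Nat.pair_lt_max_add_one_sq _ _).le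

theorem comp (h : PolyBdd b) {f : List Bool → ℕ → ℕ} (hf : PolyBdd f) :
    PolyBdd fun x v => b x (f x v) := by
  obtain ⟨d, hd⟩ := h
  exact (((length.add hf).add (const 2)).pow d).mono fun x v => hd x _

end PolyBdd

/-- Functions computed by counter programs with polynomially bounded registers. -/
def PolyCalc (g : List Bool → ℕ → ℕ) : Prop := ∃ b, PolyBdd b ∧ Calc g b

namespace PolyCalc

variable {f g h k : List Bool → ℕ → ℕ}

theorem bdd (hg : PolyCalc g) : PolyBdd g :=
  let ⟨_, hb, hc⟩ := hg
  (PolyBdd.arg.max hb).mono hc.le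

protected theorem id : PolyCalc fun _ v => v := ⟨_, .const 0, .id⟩

theorem comp (hg : PolyCalc g) (hf : PolyCalc f) : PolyCalc fun x v => g x (f x v) := by
  obtain ⟨b, hb, hc⟩ := hg
  obtain ⟨b', hb', hc'⟩ := hf
  exact ⟨_, hb'.max (hb.comp (bdd ⟨b', hb', hc'⟩)), hc.comp hc'⟩

theorem succ (hf : PolyCalc f) : PolyCalc fun x v => f x v + 1 :=
  comp ⟨_, PolyBdd.arg.add (.const 1), .succ⟩ hf

theorem const (c : ℕ) : PolyCalc fun _ _ => c := by
  induction c with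
  | zero => exact ⟨_, .const 0, .zero⟩
  | succ c ih => exact ih.succ

theorem pair (hf : PolyCalc f) (hg : PolyCalc g) : PolyCalc fun x v => Nat.pair (f x v) (g x v) := by
  have h := hf.bdd.pair hg.bdd
  obtain ⟨b, hb, hc⟩ := hf
  obtain ⟨b', hb', hc'⟩ := hg
  exact ⟨_, (hb.max hb').max (h.add (.const 1)), hc.pair hc'⟩

theorem left (hf : PolyCalc f) : PolyCalc fun x v => (Nat.unpair (f x v)).1 :=
  comp ⟨_, PolyBdd.arg.add (.const 1), .left⟩ hf

theorem right (hf : PolyCalc f) : PolyCalc fun x v => (Nat.unpair (f x v)).2 :=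
  comp ⟨_, PolyBdd.arg.add (.const 1), .right⟩ hf

theorem ite (hf : PolyCalc f) (hg : PolyCalc g) (hh : PolyCalc h) (hk : PolyCalc k) :
    PolyCalc fun x v => if f x v = g x v then h x v else k x v := by
  obtain ⟨b, hb, hc⟩ := hf
  obtain ⟨b', hb', hc'⟩ := hg
  obtain ⟨b₁, hb₁, hc₁⟩ := hh
  obtain ⟨b₂, hb₂, hc₂⟩ := hk
  exact ⟨_, (hb.max hb').max (hb₁.max hb₂), hc.ite hc' hc₁ hc₂⟩

theorem input (hf : PolyCalc f) : PolyCalc fun x v => (readInput x (f x v)).code :=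
  comp ⟨_, .const 3, .input⟩ hf

theorem length : PolyCalc fun x _ => x.length := ⟨_, PolyBdd.length.add (.const 1), .length⟩

/-- The registers used in one step are polynomial in the current value. So it is enough to bound the
iterates themselves by one polynomial. -/
theorem iterate (hf : PolyCalc f) (hg : PolyCalc g) (hh : PolyCalc h) {b : List Bool → ℕ → ℕ}
    (hb : PolyBdd b) (H : ∀ x v i, i < g x v → (f x)^[i] (h x v) ≤ b x v) :
    PolyCalc fun x v => (f x)^[g x v] (h x v) := by
  obtain ⟨b₁, ⟨d, hd⟩, hc₁⟩ := hf
  obtain ⟨b₂, hb₂, hc₂⟩ := hg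
  obtain ⟨b₃, hb₃, hc₃⟩ := hh
  refine ⟨fun x v => max (max (b₂ x v) (b₃ x v)) ((x.length + b x v + 2) ^ d), ?_, ?_⟩
  · exact (hb₂.max hb₃).max (((PolyBdd.length.add hb).add (.const 2)).pow d)
  · refine hc₁.iterate hc₂ hc₃ (fun x v => by simp) (fun x v => by simp) fun x v i hi => ?_
    refine le_max_of_le_right ((hd x _).trans (Nat.pow_le_pow_left ?_ d))
    have := H x v i hi
    omega

/-- Primitive recursion with a bound. -/
theorem prec (hg : PolyCalc g) (hh : PolyCalc h) (hk : PolyCalc k) {b : List Bool → ℕ → ℕ}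
    (hb : PolyBdd b)
    (H : ∀ x v i, i < k x v →
      (Nat.rec (g x v) (fun i s => h x (Nat.pair v (Nat.pair i s))) i : ℕ) ≤ b x v) :
    PolyCalc fun x v => Nat.rec (g x v) (fun i s => h x (Nat.pair v (Nat.pair i s))) (k x v) := by
  have hF : PolyCalc fun x w => Nat.pair (Nat.unpair w).1 (Nat.pair ((Nat.unpair (Nat.unpair w).2).1 + 1)
      (h x w)) := (PolyCalc.id.left).pair ((PolyCalc.id.right.left.succ).pair hh)
  have key : ∀ x v i, (fun w => Nat.pair (Nat.unpair w).1
      (Nat.pair ((Nat.unpair (Nat.unpair w).2).1 + 1) (h x w)))^[i]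
      (Nat.pair v (Nat.pair 0 (g x v))) = Nat.pair v (Nat.pair i
        (Nat.rec (g x v) (fun i s => h x (Nat.pair v (Nat.pair i s))) i)) := by
    intro x v i
    induction i with
    | zero => rfl
    | succ i ih => rw [Function.iterate_succ_apply', ih]; simp
  have := (hF.iterate hk (PolyCalc.id.pair ((const 0).pair hg))
    (b := fun x v => Nat.pair v (Nat.pair (k x v) (b x v)))
    (PolyBdd.arg.pair (hk.bdd.pair hb)) fun x v i hi => ?_).right.right
  · simpa only [key, Nat.unpair_pair] using this
  · rw [key]
    have hm : ∀ {a b c d}, a ≤ b → c ≤ d → Nat.pair a c ≤ Nat.pair b d := by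
      intro a b c d h h'
      rcases h.lt_or_eq with h | rfl
      · rcases h'.lt_or_eq with h' | rfl
        · exact ((Nat.pair_lt_pair_left _ h).trans (Nat.pair_lt_pair_right _ h')).le
        · exact (Nat.pair_lt_pair_left _ h).le
      · rcases h'.lt_or_eq with h' | rfl
        · exact (Nat.pair_lt_pair_right _ h').le
        · rfl
    exact hm le_rfl (hm hi.le (H x v i hi))

theorem add (hf : PolyCalc f) (hg : PolyCalc g) : PolyCalc fun x v => f x v + g x v := by
  have := prec hf (h := fun _ w => (Nat.unpair (Nat.unpair w).2).2 + 1) PolyCalc.id.right.right.succ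
    hg (hf.bdd.add hg.bdd)
  have e : ∀ a n : ℕ, (Nat.rec a (fun _ s => s + 1) n : ℕ) = a + n := by
    intro a n
    induction n with
    | zero => rfl
    | succ n ih => simp only [ih]; omega
  simp only [Nat.unpair_pair, e] at this
  exact this fun x v i hi => by omega

theorem mul (hf : PolyCalc f) (hg : PolyCalc g) : PolyCalc fun x v => f x v * g x v := by
  have := prec (const 0) (h := fun x w => (Nat.unpair (Nat.unpair w).2).2 + f x (Nat.unpair w).1)
    (PolyCalc.id.right.right.add (hf.comp PolyCalc.id.left)) hg (hf.bdd.mul hg.bdd)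
  have e : ∀ a n : ℕ, (Nat.rec 0 (fun _ s => s + a) n : ℕ) = a * n := by
    intro a n
    induction n with
    | zero => rfl
    | succ n ih => simp only [ih, Nat.mul_succ]
  simp only [Nat.unpair_pair, e] at this
  exact this fun x v i hi => Nat.mul_le_mul_left _ hi.le

theorem pred (hf : PolyCalc f) : PolyCalc fun x v => f x v - 1 := by
  have := prec (const 0) (h := fun _ w => (Nat.unpair (Nat.unpair w).2).1)
    PolyCalc.id.right.left hf hf.bdd
  have e : ∀ n : ℕ, (Nat.rec 0 (fun i _ => i) n : ℕ) = n - 1 := by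
    intro n
    cases n <;> rfl
  simp only [Nat.unpair_pair, e] at this
  exact this fun x v i hi => by omega

theorem sub (hf : PolyCalc f) (hg : PolyCalc g) : PolyCalc fun x v => f x v - g x v := by
  have := prec hf (h := fun _ w => (Nat.unpair (Nat.unpair w).2).2 - 1)
    PolyCalc.id.right.right.pred hg hf.bdd
  have e : ∀ a n : ℕ, (Nat.rec a (fun _ s => s - 1) n : ℕ) = a - n := by
    intro a n
    induction n with
    | zero => rfl
    | succ n ih => simp only [ih]; omega
  simp only [Nat.unpair_pair, e] at this
  exact this fun x v i hi => by omega

theorem min (hf : PolyCalc f) (hg : PolyCalc g) : PolyCalc fun x v => Min.min (f x v) (g x v) := by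
  have : (fun x v => Min.min (f x v) (g x v)) = fun x v => f x v - (f x v - g x v) := by
    funext x v; omega
  rw [this]
  exact hf.sub (hf.sub hg)

end PolyCalc

/-! ### Typed functions -/

/-- Types whose elements are coded by natural numbers. -/
class NCode (α : Type) where
  enc : α → ℕ
  inj : Function.Injective enc

open NCode (enc)

instance : NCode ℕ := ⟨id, Function.injective_id⟩

instance : NCode Bool := ⟨fun b => if b then 1 else 0, by decide⟩

instance : NCode InSym := ⟨InSym.code, by
  rintro (_ | (_ | _) | _) (_ | (_ | _) | _) h <;> first | rfl | simp [InSym.code] at h⟩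

instance {α β : Type} [NCode α] [NCode β] : NCode (α × β) :=
  ⟨fun p => Nat.pair (enc p.1) (enc p.2), fun p q h => by
    have := Nat.pair_eq_pair.1 h
    exact Prod.ext (NCode.inj this.1) (NCode.inj this.2)⟩

/-- The code of a tuple. -/
def tupEnc : (k : ℕ) → (Fin k → ℕ) → ℕ
  | 0, _ => 0
  | k + 1, f => Nat.pair (f 0) (tupEnc k (Fin.tail f))

theorem tupEnc_injective : ∀ k, Function.Injective (tupEnc k)
  | 0 => fun f g _ => Subsingleton.elim f g
  | k + 1 => fun f g h => by
    have := Nat.pair_eq_pair.1 h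
    rw [← Fin.cons_self_tail f, ← Fin.cons_self_tail g, this.1, tupEnc_injective k this.2]

instance {α : Type} [NCode α] {k : ℕ} : NCode (Fin k → α) :=
  ⟨fun f => tupEnc k fun i => enc (f i), fun f g h => by
    have := tupEnc_injective k h
    funext i
    exact NCode.inj (congrFun this i)⟩

@[simp] theorem enc_nat (n : ℕ) : enc n = n := rfl

@[simp] theorem enc_prod {α β : Type} [NCode α] [NCode β] (p : α × β) :
    enc p = Nat.pair (enc p.1) (enc p.2) := rfl

/-- Typed functions that are computed by counter programs with polynomially bounded registers, i.e.
in logarithmic space. -/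
def LS {α β : Type} [NCode α] [NCode β] (f : List Bool → α → β) : Prop :=
  ∃ g, PolyCalc g ∧ ∀ x a, g x (enc a) = enc (f x a)

/-- Logspace decidable relations. -/
def LSP {α : Type} [NCode α] (p : List Bool → α → Prop) : Prop :=
  ∃ g, PolyCalc g ∧ ∀ x a, g x (enc a) = 1 ↔ p x a

variable {α β γ σ : Type} [NCode α] [NCode β] [NCode γ] [NCode σ]

namespace LS

theorem polyCalc {f : List Bool → ℕ → ℕ} (hf : LS f) : PolyCalc f := by
  obtain ⟨g, hg, h⟩ := hf
  have : g = f := by funext x v; exact h x v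
  rwa [this] at hg

theorem congr {f f' : List Bool → α → β} (hf : LS f) (h : ∀ x a, f x a = f' x a) : LS f' := by
  have : f = f' := by funext x a; exact h x a
  rwa [this] at hf

theorem toNat {f : List Bool → α → β} (hf : LS f) : LS fun x a => enc (f x a) := hf

theorem comp {g : List Bool → β → γ} {f : List Bool → α → β} (hg : LS g) (hf : LS f) :
    LS fun x a => g x (f x a) := by
  obtain ⟨g', hg', h⟩ := hg
  obtain ⟨f', hf', h'⟩ := hf
  exact ⟨_, hg'.comp hf', fun x a => by rw [h', h]⟩

protected theorem id : LS fun _ (a : α) => a := ⟨_, .id, fun _ _ => rfl⟩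

theorem const (b : β) : LS fun _ (_ : α) => b := ⟨_, .const (enc b), fun _ _ => rfl⟩

theorem pair {f : List Bool → α → β} {g : List Bool → α → γ} (hf : LS f) (hg : LS g) :
    LS fun x a => (f x a, g x a) := by
  obtain ⟨f', hf', h⟩ := hf
  obtain ⟨g', hg', h'⟩ := hg
  exact ⟨_, hf'.pair hg', fun x a => by rw [h, h']; rfl⟩

theorem fst {f : List Bool → α → β × γ} (hf : LS f) : LS fun x a => (f x a).1 := by
  obtain ⟨f', hf', h⟩ := hf
  exact ⟨_, hf'.left, fun x a => by simp [h]⟩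

theorem snd {f : List Bool → α → β × γ} (hf : LS f) : LS fun x a => (f x a).2 := by
  obtain ⟨f', hf', h⟩ := hf
  exact ⟨_, hf'.right, fun x a => by simp [h]⟩

theorem add {f g : List Bool → α → ℕ} (hf : LS f) (hg : LS g) : LS fun x a => f x a + g x a := by
  obtain ⟨f', hf', h⟩ := hf
  obtain ⟨g', hg', h'⟩ := hg
  exact ⟨_, hf'.add hg', fun x a => by rw [h, h']; rfl⟩

theorem mul {f g : List Bool → α → ℕ} (hf : LS f) (hg : LS g) : LS fun x a => f x a * g x a := by
  obtain ⟨f', hf', h⟩ := hf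
  obtain ⟨g', hg', h'⟩ := hg
  exact ⟨_, hf'.mul hg', fun x a => by rw [h, h']; rfl⟩

theorem sub {f g : List Bool → α → ℕ} (hf : LS f) (hg : LS g) : LS fun x a => f x a - g x a := by
  obtain ⟨f', hf', h⟩ := hf
  obtain ⟨g', hg', h'⟩ := hg
  exact ⟨_, hf'.sub hg', fun x a => by rw [h, h']; rfl⟩

theorem pow {f : List Bool → α → ℕ} (hf : LS f) (n : ℕ) : LS fun x a => f x a ^ n := by
  induction n with
  | zero => exact const 1
  | succ n ih => simpa only [pow_succ] using ih.mul hf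

theorem length : LS fun x (_ : α) => x.length := ⟨_, .length, fun _ _ => rfl⟩

theorem readInput {f : List Bool → α → ℕ} (hf : LS f) : LS fun x a => readInput x (f x a) := by
  obtain ⟨f', hf', h⟩ := hf
  exact ⟨_, hf'.input, fun x a => by rw [h]; rfl⟩

theorem ite {p : List Bool → α → Prop} [∀ x a, Decidable (p x a)] {f g : List Bool → α → β}
    (hp : LSP p) (hf : LS f) (hg : LS g) : LS fun x a => if p x a then f x a else g x a := by
  obtain ⟨p', hp', h⟩ := hp
  obtain ⟨f', hf', h'⟩ := hf
  obtain ⟨g', hg', h''⟩ := hg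
  refine ⟨_, hp'.ite (.const 1) hf' hg', fun x a => ?_⟩
  rw [h', h'']
  by_cases hpa : p x a
  · simp only [if_pos ((h x a).2 hpa), if_pos hpa]
  · simp only [if_neg (fun hh => hpa ((h x a).1 hh)), if_neg hpa]

/-- Bounded recursion. -/
theorem natRec {g : List Bool → α → σ} {h : List Bool → α → ℕ → σ → σ} {n b : List Bool → α → ℕ}
    (hg : LS g) (hh : LS fun x (p : α × ℕ × σ) => h x p.1 p.2.1 p.2.2) (hn : LS n) (hb : LS b)
    (H : ∀ x a i, i ≤ n x a → enc (Nat.rec (g x a) (fun i s => h x a i s) i : σ) ≤ b x a) :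
    LS fun x a => (Nat.rec (g x a) (fun i s => h x a i s) (n x a) : σ) := by
  obtain ⟨g', hg', eg⟩ := hg
  obtain ⟨h', hh', eh⟩ := hh
  obtain ⟨n', hn', en⟩ := hn
  obtain ⟨b', hb', eb⟩ := hb
  -- The hypothesis `H` says nothing about numbers that are not codes of elements of `α`. Cutting
  -- all values at `b'` makes the recursion bounded everywhere, and on codes the cut has no effect.
  have hle : ∀ x v i, (Nat.rec (min (g' x v) (b' x v)) (fun i s => (fun x w =>
      min (h' x w) (b' x (Nat.unpair w).1)) x (Nat.pair v (Nat.pair i s))) i : ℕ) ≤ b' x v := by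
    intro x v i
    cases i <;> simp
  refine ⟨_, (hg'.min hb').prec (hh'.min (hb'.comp PolyCalc.id.left)) hn' hb'.bdd
    fun x v i _ => hle x v i, fun x a => ?_⟩
  rw [en]
  suffices ∀ i ≤ n x a, (Nat.rec (min (g' x (enc a)) (b' x (enc a))) (fun i s => (fun x w =>
      min (h' x w) (b' x (Nat.unpair w).1)) x (Nat.pair (enc a) (Nat.pair i s))) i : ℕ) =
      enc (Nat.rec (g x a) (fun i s => h x a i s) i : σ) from this _ le_rfl
  intro i hi
  induction i with
  | zero =>
    simp only [eg, eb]
    exact min_eq_left (H x a 0 hi)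
  | succ i ih =>
    have := H x a (i + 1) hi
    simp only [Nat.unpair_pair, eb] at ih ⊢
    have e := eh x (a, i, (Nat.rec (g x a) (fun i s => h x a i s) i : σ))
    simp only [enc_prod, enc_nat] at e
    rw [ih (by omega), e]
    exact min_eq_left this

theorem iterate {g : List Bool → α → σ} {h : List Bool → α → σ → σ} {n b : List Bool → α → ℕ}
    (hg : LS g) (hh : LS fun x (p : α × σ) => h x p.1 p.2) (hn : LS n) (hb : LS b)
    (H : ∀ x a i, i ≤ n x a → enc ((h x a)^[i] (g x a)) ≤ b x a) :
    LS fun x a => (h x a)^[n x a] (g x a) := by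
  have e : ∀ x a i, (Nat.rec (g x a) (fun _ s => h x a s) i : σ) = (h x a)^[i] (g x a) := by
    intro x a i
    induction i with
    | zero => rfl
    | succ i ih => rw [Function.iterate_succ_apply', ← ih]
  have := natRec (h := fun x a _ s => h x a s) hg
    (hh.comp (LS.id.fst.pair LS.id.snd.snd)) hn hb (by simpa only [e] using H)
  simpa only [e] using this

/-- The terms are polynomially bounded, being logspace computable; the number of terms times a
common bound dominates every partial sum. -/
theorem sum {n : List Bool → α → ℕ} {f : List Bool → α → ℕ → ℕ} (hn : LS n)
    (hf : LS fun x (p : α × ℕ) => f x p.1 p.2) :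
    LS fun x a => ∑ i ∈ Finset.range (n x a), f x a i := by
  obtain ⟨f', hf', ef⟩ := id hf
  obtain ⟨d, hd⟩ := hf'.bdd
  have e : ∀ x a i, (Nat.rec 0 (fun i s => s + f x a i) i : ℕ) =
      ∑ j ∈ Finset.range i, f x a j := by
    intro x a i
    induction i with
    | zero => rfl
    | succ i ih => rw [Finset.sum_range_succ, ← ih]
  have hp : LS fun x (a : α) => n x a * (x.length + Nat.pair (enc a) (n x a) + 2) ^ d :=
    hn.mul (((length.add (LS.toNat (LS.id.pair hn))).add (const 2)).pow d)
  have := natRec (σ := ℕ) (h := fun x a i s => s + f x a i) (const 0)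
    (LS.id.snd.snd.add (hf.comp (LS.id.fst.pair LS.id.snd.fst))) hn hp ?_
  · simpa only [e] using this
  · intro x a i hi
    rw [enc_nat, e]
    refine (Finset.sum_le_card_nsmul _ _ ((x.length + Nat.pair (enc a) (n x a) + 2) ^ d)
      fun j hj => ?_).trans ?_
    · have := ef x (a, j)
      simp only [enc_nat] at this
      rw [← this]
      refine (hd x _).trans (Nat.pow_le_pow_left ?_ d)
      have := Nat.pair_lt_pair_right (enc a) ((Finset.mem_range.1 hj).trans_le hi)
      simp only [enc_prod, enc_nat]
      omega
    · simp only [Finset.card_range, smul_eq_mul]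
      exact Nat.mul_le_mul_right _ hi

theorem apply {k : ℕ} {f : List Bool → α → Fin k → β} (hf : LS f) (j : Fin k) :
    LS fun x a => f x a j := by
  obtain ⟨f', hf', h⟩ := hf
  suffices ∀ (k : ℕ) (j : Fin k), ∃ g, PolyCalc g ∧
      ∀ (x : List Bool) (t : Fin k → ℕ), g x (tupEnc k t) = t j by
    obtain ⟨g, hg, e⟩ := this k j
    exact ⟨_, hg.comp hf', fun x a => by rw [h]; exact e x _⟩
  intro k
  induction k with
  | zero => exact fun j => j.elim0
  | succ k ih =>
    intro j
    refine j.cases ?_ fun j => ?_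
    · exact ⟨_, PolyCalc.id.left, fun x t => by simp [tupEnc]⟩
    · obtain ⟨g, hg, e⟩ := ih j
      exact ⟨_, hg.comp PolyCalc.id.right, fun x t => by simp [tupEnc, e, Fin.tail]⟩

theorem tuple {k : ℕ} {f : List Bool → α → Fin k → β} (hf : ∀ j, LS fun x a => f x a j) :
    LS f := by
  suffices ∀ (k : ℕ) (g : Fin k → List Bool → ℕ → ℕ), (∀ j, PolyCalc (g j)) →
      ∃ G, PolyCalc G ∧ ∀ x v, G x v = tupEnc k fun j => g j x v by
    choose g hg e using hf
    obtain ⟨G, hG, eG⟩ := this k g hg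
    refine ⟨G, hG, fun x a => ?_⟩
    rw [eG]
    exact congrArg (tupEnc k) (funext fun j => e j x a)
  intro k
  induction k with
  | zero => exact fun g _ => ⟨_, .const 0, fun _ _ => rfl⟩
  | succ k ih =>
    intro g hg
    obtain ⟨G, hG, eG⟩ := ih (fun j => g j.succ) fun j => hg _
    exact ⟨_, (hg 0).pair hG, fun x v => by rw [eG]; rfl⟩

/-- A function on a finite type is a table, that is, a nested case distinction on the code of the
argument. -/
theorem ofFinite [Finite α] (f : α → β) : LS fun _ a => f a := by
  classical
  have := Fintype.ofFinite α
  suffices ∀ s : Finset α, ∃ g, PolyCalc g ∧ ∀ x, ∀ a ∈ s, g x (enc a) = enc (f a) by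
    obtain ⟨g, hg, h⟩ := this Finset.univ
    exact ⟨g, hg, fun x a => h x a (Finset.mem_univ a)⟩
  intro s
  induction s using Finset.induction_on with
  | empty => exact ⟨_, .const 0, by simp⟩
  | insert a s _ ih =>
    obtain ⟨g, hg, h⟩ := ih
    refine ⟨_, PolyCalc.id.ite (.const (enc a)) (.const (enc (f a))) hg, fun x b hb => ?_⟩
    by_cases hab : b = a
    · simp [hab]
    · rw [if_neg fun h => hab (NCode.inj h)]
      exact h x b (Finset.mem_of_mem_insert_of_ne hb hab)

end LS

namespace LSP

variable {p q : List Bool → α → Prop}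

theorem congr (hp : LSP p) (h : ∀ x a, p x a ↔ q x a) : LSP q := by
  have : p = q := by funext x a; exact propext (h x a)
  rwa [this] at hp

theorem comp {p : List Bool → β → Prop} {f : List Bool → α → β} (hp : LSP p) (hf : LS f) :
    LSP fun x a => p x (f x a) := by
  obtain ⟨p', hp', h⟩ := hp
  obtain ⟨f', hf', h'⟩ := hf
  exact ⟨_, hp'.comp hf', fun x a => by rw [h', h]⟩

theorem _root_.ParamLog.LS.eq {f g : List Bool → α → β} (hf : LS f) (hg : LS g) : LSP fun x a => f x a = g x a := by
  obtain ⟨f', hf', h⟩ := hf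
  obtain ⟨g', hg', h'⟩ := hg
  refine ⟨_, hf'.ite hg' (.const 1) (.const 0), fun x a => ?_⟩
  rw [h, h']
  by_cases e : f x a = g x a
  · simp [e]
  · simp [e, NCode.inj.ne e]

theorem not (hp : LSP p) : LSP fun x a => ¬ p x a := by
  obtain ⟨p', hp', h⟩ := hp
  refine ⟨_, hp'.ite (.const 1) (.const 0) (.const 1), fun x a => ?_⟩
  simp only [← h]
  by_cases e : p' x (enc a) = 1 <;> simp [e]

theorem and (hp : LSP p) (hq : LSP q) : LSP fun x a => p x a ∧ q x a := by
  obtain ⟨p', hp', h⟩ := hp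
  obtain ⟨q', hq', h'⟩ := hq
  refine ⟨_, hp'.ite (.const 1) hq' (.const 0), fun x a => ?_⟩
  simp only [← h, ← h']
  by_cases e : p' x (enc a) = 1 <;> simp [e]

theorem or (hp : LSP p) (hq : LSP q) : LSP fun x a => p x a ∨ q x a :=
  (hp.not.and hq.not).not.congr fun x a => by tauto

theorem imp (hp : LSP p) (hq : LSP q) : LSP fun x a => p x a → q x a :=
  (hp.not.or hq).congr fun x a => by tauto

theorem iff (hp : LSP p) (hq : LSP q) : LSP fun x a => p x a ↔ q x a :=
  ((hp.imp hq).and (hq.imp hp)).congr fun x a => by tauto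

theorem const (P : Prop) : LSP fun _ (_ : α) => P := by
  by_cases h : P
  · exact ⟨_, .const 1, fun x a => by simp [h]⟩
  · exact ⟨_, .const 0, fun x a => by simp [h]⟩

theorem _root_.ParamLog.LS.le {f g : List Bool → α → ℕ} (hf : LS f) (hg : LS g) : LSP fun x a => f x a ≤ g x a :=
  ((hf.sub hg).eq (LS.const 0)).congr fun x a => by omega

theorem _root_.ParamLog.LS.lt {f g : List Bool → α → ℕ} (hf : LS f) (hg : LS g) : LSP fun x a => f x a < g x a :=
  (hg.le hf).not.congr fun x a => by omega

/-- The number of witnesses is a bounded sum, and it has to be nonzero. All bounded quantifiers come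
from this. -/
theorem _root_.ParamLog.LS.exLt {n : List Bool → α → ℕ} {p : List Bool → α → ℕ → Prop} (hn : LS n)
    (hp : LSP fun x (q : α × ℕ) => p x q.1 q.2) : LSP fun x a => ∃ i < n x a, p x a i := by
  classical
  have h : LS fun x (q : α × ℕ) => if p x q.1 q.2 then 1 else 0 :=
    LS.ite hp (LS.const 1) (LS.const 0)
  refine ((hn.sum (f := fun x a i => if p x a i then 1 else 0) h).eq (LS.const 0)).not.congr
    fun x a => ?_
  simp [Finset.sum_eq_zero_iff]

theorem _root_.ParamLog.LS.allLt {n : List Bool → α → ℕ} {p : List Bool → α → ℕ → Prop} (hn : LS n)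
    (hp : LSP fun x (q : α × ℕ) => p x q.1 q.2) : LSP fun x a => ∀ i < n x a, p x a i :=
  (hn.exLt (p := fun x a i => ¬ p x a i) hp.not).not.congr fun x a => by push Not; rfl

theorem ofBool {f : List Bool → α → Bool} (hf : LS f) : LSP fun x a => f x a = true :=
  hf.eq (LS.const true)

end LSP

/-- The least `i < n` satisfying `p`, or `n` if there is none. -/
noncomputable def leastLt (n : ℕ) (p : ℕ → Prop) : ℕ :=
  -- The sum counts the `i` such that no `j ≤ i` satisfies `p`, which are the numbers before the
  -- first witness. In this form bounded search is an instance of bounded summation.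
  open Classical in ∑ i ∈ Finset.range n, if ∀ j < i + 1, ¬ p j then 1 else 0

theorem leastLt_of_forall {n : ℕ} {p : ℕ → Prop} (h : ∀ i < n, ¬ p i) : leastLt n p = n := by
  classical
  unfold leastLt
  rw [Finset.sum_congr rfl fun i hi => if_pos fun j hj => h j (by
    have := Finset.mem_range.1 hi; omega)]
  simp

theorem leastLt_eq {n i : ℕ} {p : ℕ → Prop} (hi : i < n) (h : p i) (h' : ∀ j < i, ¬ p j) :
    leastLt n p = i := by
  classical
  unfold leastLt
  rw [← Finset.sum_subset (Finset.range_mono hi.le)]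
  · rw [Finset.sum_congr rfl fun k hk => if_pos fun j hj => h' j (by
      have := Finset.mem_range.1 hk; omega)]
    simp
  · intro k _ hk
    rw [if_neg]
    intro hh
    exact hh i (by simpa [Nat.lt_succ_iff] using hk) h

theorem leastLt_le (n : ℕ) (p : ℕ → Prop) : leastLt n p ≤ n := by
  classical
  unfold leastLt
  refine (Finset.sum_le_card_nsmul _ _ 1 fun i _ => by split <;> simp).trans (by simp)

theorem leastLt_spec {n : ℕ} {p : ℕ → Prop} (h : ∃ i < n, p i) :
    leastLt n p < n ∧ p (leastLt n p) ∧ ∀ j < leastLt n p, ¬ p j := by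
  classical
  have hex : ∃ i, p i := h.imp fun _ h => h.2
  obtain ⟨i, hi, hp⟩ := h
  have := leastLt_eq ((Nat.find_min' hex hp).trans_lt hi) (Nat.find_spec hex)
    fun j hj => Nat.find_min hex hj
  rw [this]
  exact ⟨(Nat.find_min' hex hp).trans_lt hi, Nat.find_spec hex, fun j hj => Nat.find_min hex hj⟩

/-! ### Bounded search, division, logarithms and binary digits in logarithmic space -/

namespace LS

theorem least {n : List Bool → α → ℕ} {p : List Bool → α → ℕ → Prop} (hn : LS n)
    (hp : LSP fun x (q : α × ℕ) => p x q.1 q.2) : LS fun x a => leastLt (n x a) (p x a) := by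
  classical
  unfold leastLt
  refine sum hn (ite ?_ (const 1) (const 0))
  exact LS.allLt (p := fun x (q : α × ℕ) j => ¬ p x q.1 j) (LS.id.snd.add (const 1))
    (hp.comp (LS.id.fst.fst.pair LS.id.snd)).not

theorem div {f g : List Bool → α → ℕ} (hf : LS f) (hg : LS g) : LS fun x a => f x a / g x a := by
  -- The quotient is the least `i` with `f < (i + 1) * g`. The first alternative accounts for the
  -- convention that division by `0` gives `0`.
  have h : LS fun x a => leastLt (f x a + 1) fun i => g x a = 0 ∨ f x a < (i + 1) * g x a := by
    refine least (hf.add (const 1)) ?_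
    exact ((hg.comp LS.id.fst).eq (const 0)).or ((hf.comp LS.id.fst).lt
      ((LS.id.snd.add (const 1)).mul (hg.comp LS.id.fst)))
  refine h.congr fun x a => ?_
  by_cases h0 : g x a = 0
  · rw [h0, Nat.div_zero]
    exact leastLt_eq (by omega) (.inl rfl) (by simp)
  · have hpos : 0 < g x a := Nat.pos_of_ne_zero h0
    refine leastLt_eq ?_ (.inr ?_) fun j hj => ?_
    · exact Nat.lt_succ_of_le (Nat.div_le_self _ _)
    · rw [mul_comm]; exact Nat.lt_mul_div_succ _ hpos
    · rintro (h | h)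
      · exact h0 h
      · exact absurd ((Nat.le_div_iff_mul_le hpos).1 hj) (by simpa using h)

theorem mod {f g : List Bool → α → ℕ} (hf : LS f) (hg : LS g) : LS fun x a => f x a % g x a :=
  (hf.sub (hg.mul (hf.div hg))).congr fun x a => by
    have := Nat.div_add_mod (f x a) (g x a)
    omega

/-- The power may be exponentially large and must not be stored. Dividing `n` times by `g` instead
keeps all values below `f`. -/
theorem divPow {f g n : List Bool → α → ℕ} (hf : LS f) (hg : LS g) (hn : LS n) :
    LS fun x a => f x a / g x a ^ n x a := by
  have e : ∀ a b n : ℕ, (fun s => s / b)^[n] a = a / b ^ n := by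
    intro a b n
    induction n with
    | zero => simp
    | succ n ih => rw [Function.iterate_succ_apply', ih, Nat.div_div_eq_div_mul, pow_succ]
  have := iterate (σ := ℕ) (h := fun x a s => s / g x a) hf
    (LS.id.snd.div (hg.comp LS.id.fst)) hn hf fun x a i _ => by
      rw [e]; exact Nat.div_le_self _ _
  simpa only [e] using this

theorem log2 {f : List Bool → α → ℕ} (hf : LS f) : LS fun x a => Nat.log 2 (f x a) := by
  have h : LS fun x a => leastLt (f x a) fun i => f x a / 2 ^ (i + 1) = 0 := by
    refine least hf (LS.eq (divPow (hf.comp LS.id.fst) (const 2) (LS.id.snd.add (const 1)))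
      (const 0))
  refine h.congr fun x a => ?_
  rcases Nat.eq_zero_or_pos (f x a) with h | h
  · simp [h, leastLt]
  · refine leastLt_eq (Nat.log_lt_self 2 h.ne') ?_ fun j hj => ?_
    · exact Nat.div_eq_of_lt (Nat.lt_pow_succ_log_self (by norm_num) _)
    · intro h'
      have h₂ : 2 ^ (j + 1) ≤ f x a := Nat.pow_le_of_le_log h.ne' hj
      have := Nat.div_pos h₂ (by positivity)
      omega

theorem testBit {f n : List Bool → α → ℕ} (hf : LS f) (hn : LS n) :
    LS fun x a => (f x a).testBit (n x a) := by
  classical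
  have : LS fun x a => if f x a / 2 ^ n x a % 2 = 1 then true else false :=
    ite (((hf.divPow (const 2) hn).mod (const 2)).eq (const 1)) (const true) (const false)
  refine this.congr fun x a => ?_
  rw [Nat.testBit_eq_decide_div_mod_eq]
  split <;> simp_all

theorem dec {p : List Bool → α → Prop} [∀ x a, Decidable (p x a)] (hp : LSP p) :
    LS fun x a => decide (p x a) :=
  (ite hp (const true) (const false)).congr fun x a => by split <;> simp_all

end LS
end ParamLog

namespace ParamLog
open NCode (enc)

/-! ## Computable functions are computed by counter programs in computable space -/

/-- Functions computed with a primitive recursive bound on the registers. -/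
def PrimCalc (f : ℕ → ℕ) : Prop := ∃ b : ℕ → ℕ, Primrec b ∧ Calc (fun _ => f) fun _ => b

namespace PrimCalc

variable {f g : ℕ → ℕ}

theorem comp (hg : PrimCalc g) (hf : PrimCalc f) (hp : Primrec f) : PrimCalc fun v => g (f v) := by
  obtain ⟨b, hb, hc⟩ := hg
  obtain ⟨b', hb', hc'⟩ := hf
  exact ⟨_, Primrec.nat_max.comp hb' (hb.comp hp), hc.comp hc'⟩

theorem pair (hf : PrimCalc f) (hg : PrimCalc g) (pf : Primrec f) (pg : Primrec g) :
    PrimCalc fun v => Nat.pair (f v) (g v) := by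
  obtain ⟨b, hb, hc⟩ := hf
  obtain ⟨b', hb', hc'⟩ := hg
  exact ⟨_, Primrec.nat_max.comp (Primrec.nat_max.comp hb hb')
    (Primrec.succ.comp (Primrec₂.natPair.comp pf pg)), hc.pair hc'⟩

/-- The sum of the bounds along the iterates bounds all registers. It is primitive recursive,
because it can be accumulated in the course of the same iteration. -/
theorem iterate {h : ℕ → ℕ} (hf : PrimCalc f) (hg : PrimCalc g) (hh : PrimCalc h) (pf : Primrec f)
    (pg : Primrec g) (ph : Primrec h) : PrimCalc fun v => f^[g v] (h v) := by
  obtain ⟨b, hb, hc⟩ := hf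
  obtain ⟨b', hb', hc'⟩ := hg
  obtain ⟨b'', hb'', hc''⟩ := hh
  have key : ∀ a c n, (fun p : ℕ × ℕ => (f p.1, p.2 + b p.1))^[n] (a, c) =
      (f^[n] a, c + ∑ i ∈ Finset.range n, b (f^[i] a)) := by
    intro a c n
    induction n with
    | zero => simp
    | succ n ih =>
      rw [Function.iterate_succ_apply', ih, Finset.sum_range_succ, Function.iterate_succ_apply']
      simp [add_assoc]
  have hS : Primrec fun v => ((fun p : ℕ × ℕ => (f p.1, p.2 + b p.1))^[g v] (h v, 0)).2 := by
    refine Primrec.snd.comp (Primrec.nat_iterate pg (Primrec.pair ph (Primrec.const 0)) ?_)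
    exact (Primrec.pair (pf.comp (Primrec.fst.comp Primrec.snd))
      (Primrec.nat_add.comp (Primrec.snd.comp Primrec.snd)
        (hb.comp (Primrec.fst.comp Primrec.snd)))).to₂
  refine ⟨_, Primrec.nat_add.comp (Primrec.nat_add.comp hb' hb'') hS, ?_⟩
  have e : ∀ v, ((fun p : ℕ × ℕ => (f p.1, p.2 + b p.1))^[g v] (h v, 0)).2 =
      ∑ i ∈ Finset.range (g v), b (f^[i] (h v)) := fun v => by rw [key]; simp
  refine hc.iterate hc' hc'' (fun _ v => by omega) (fun _ v => by omega) fun _ v i hi => ?_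
  have := Finset.single_le_sum (f := fun i => b (f^[i] (h v))) (fun _ _ => Nat.zero_le _)
    (Finset.mem_range.2 hi)
  simp only [e] at this ⊢
  omega

/-- Induction on the definition of `f`. Primitive recursion becomes the iteration of a map on
triples of parameter, index and current value. -/
theorem of_primrec (hf : Nat.Primrec f) : PrimCalc f := by
  induction hf with
  | zero => exact ⟨_, Primrec.const 0, Calc.zero⟩
  | succ => exact ⟨_, Primrec.succ, Calc.succ⟩
  | left => exact ⟨_, Primrec.succ, Calc.left⟩
  | right => exact ⟨_, Primrec.succ, Calc.right⟩
  | pair hf hg ihf ihg => exact ihf.pair ihg (Primrec.nat_iff.2 hf) (Primrec.nat_iff.2 hg)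
  | comp hf hg ihf ihg => exact ihf.comp ihg (Primrec.nat_iff.2 hg)
  | @prec f g hf hg ihf ihg =>
    have pf := Primrec.nat_iff.2 hf
    have pg := Primrec.nat_iff.2 hg
    have cl : PrimCalc fun v => (Nat.unpair v).1 := ⟨_, Primrec.succ, Calc.left⟩
    have cr : PrimCalc fun v => (Nat.unpair v).2 := ⟨_, Primrec.succ, Calc.right⟩
    have cs : PrimCalc fun v => v + 1 := ⟨_, Primrec.succ, Calc.succ⟩
    have cz : PrimCalc fun _ => 0 := ⟨_, Primrec.const 0, Calc.zero⟩
    have pl : Primrec fun v => (Nat.unpair v).1 := Primrec.fst.comp Primrec.unpair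
    have pr : Primrec fun v => (Nat.unpair v).2 := Primrec.snd.comp Primrec.unpair
    have clr := cl.comp cr pr
    have plr := pl.comp pr
    have cstep : PrimCalc fun w => Nat.pair (Nat.unpair w).1
        (Nat.pair ((Nat.unpair (Nat.unpair w).2).1 + 1) (g w)) :=
      cl.pair ((cs.comp clr plr).pair ihg (Primrec.succ.comp plr) pg) pl
        (Primrec₂.natPair.comp (Primrec.succ.comp plr) pg)
    have pstep : Primrec fun w => Nat.pair (Nat.unpair w).1
        (Nat.pair ((Nat.unpair (Nat.unpair w).2).1 + 1) (g w)) :=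
      Primrec₂.natPair.comp pl (Primrec₂.natPair.comp (Primrec.succ.comp plr) pg)
    have cinit : PrimCalc fun v => Nat.pair (Nat.unpair v).1 (Nat.pair 0 (f (Nat.unpair v).1)) :=
      cl.pair (cz.pair (ihf.comp cl pl) (Primrec.const 0) (pf.comp pl)) pl
        (Primrec₂.natPair.comp (Primrec.const 0) (pf.comp pl))
    have pinit : Primrec fun v => Nat.pair (Nat.unpair v).1 (Nat.pair 0 (f (Nat.unpair v).1)) :=
      Primrec₂.natPair.comp pl (Primrec₂.natPair.comp (Primrec.const 0) (pf.comp pl))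
    have key : ∀ z i, (fun w => Nat.pair (Nat.unpair w).1
        (Nat.pair ((Nat.unpair (Nat.unpair w).2).1 + 1) (g w)))^[i] (Nat.pair z (Nat.pair 0 (f z))) =
        Nat.pair z (Nat.pair i (Nat.rec (f z) (fun y IH => g (Nat.pair z (Nat.pair y IH))) i)) := by
      intro z i
      induction i with
      | zero => rfl
      | succ i ih => rw [Function.iterate_succ_apply', ih]; simp
    have c := cstep.iterate cr cinit pstep pr pinit
    have p : Primrec fun v => (fun w => Nat.pair (Nat.unpair w).1
        (Nat.pair ((Nat.unpair (Nat.unpair w).2).1 + 1) (g w)))^[(Nat.unpair v).2]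
        (Nat.pair (Nat.unpair v).1 (Nat.pair 0 (f (Nat.unpair v).1))) :=
      Primrec.nat_iterate pr pinit (pstep.comp Primrec.snd).to₂
    have := cr.comp (cr.comp c p) (pr.comp p)
    simpa only [key, Nat.unpair_pair, Nat.unpaired] using this

end PrimCalc

/-- Kleene's normal form: `F n` is read off from a primitive recursive function at the least number
`m n` of steps for which the evaluation succeeds. The search inspects the numbers up to `m n`, so
its registers are bounded by a finite sum of primitive recursive bounds. As `m` is computable, so is
this bound, and a space bound in a parameterized sense may contain it. -/
theorem calc_of_computable {F : ℕ → ℕ} (hF : Computable F) :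
    ∃ G : ℕ → ℕ, Computable G ∧ Calc (fun _ => F) fun _ => G := by
  classical
  obtain ⟨c, hc⟩ := Nat.Partrec.Code.exists_code.1 (Partrec.nat_iff.1 hF)
  -- the search predicate
  set e : ℕ → ℕ := fun w =>
    Encodable.encode (Nat.Partrec.Code.evaln (Nat.unpair w).1 c (Nat.unpair w).2) with he
  have pe : Primrec e := by
    refine Primrec.encode.comp (Nat.Partrec.Code.primrec_evaln.comp (Primrec.pair (Primrec.pair
      (Primrec.fst.comp Primrec.unpair) (Primrec.const c)) (Primrec.snd.comp Primrec.unpair)))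
  have hex : ∀ n, ∃ k, e (Nat.pair k n) ≠ 0 := by
    intro n
    have : F n ∈ c.eval n := by rw [hc]; simp
    obtain ⟨k, hk⟩ := Nat.Partrec.Code.evaln_complete.1 this
    refine ⟨k, ?_⟩
    rw [Option.mem_def] at hk
    simp [he, hk]
  -- `Encodable.encode` sends `none` to `0` and `some v` to `v + 1`. So success means being nonzero,
  -- and subtracting `1` gives the value.
  have hval : ∀ k n, e (Nat.pair k n) ≠ 0 → e (Nat.pair k n) - 1 = F n := by
    intro k n hk
    simp only [he, Nat.unpair_pair] at hk ⊢
    cases h : Nat.Partrec.Code.evaln k c n with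
    | none => rw [h] at hk; simp at hk
    | some m =>
      have := Nat.Partrec.Code.evaln_sound (Option.mem_def.2 h)
      rw [hc] at this
      simpa using this
  set m : ℕ → ℕ := fun n => Nat.find (hex n) with hm
  have cm : Computable m := by
    have hp : Computable₂ fun n k => !decide (e (Nat.pair k n) = 0) := by
      refine (Primrec.not.comp ?_).to_comp
      exact (Primrec.eq.decide.comp (pe.comp (Primrec₂.natPair.comp Primrec.snd Primrec.fst))
        (Primrec.const 0))
    refine (Partrec.rfind hp.partrec₂).of_eq fun n => ?_
    rw [PFun.coe_val, Part.eq_some_iff, Nat.mem_rfind]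
    refine ⟨by simpa using Nat.find_spec (hex n), fun {k} hk => ?_⟩
    simpa using Nat.find_min (hex n) hk
  -- the programs
  have pf : Primrec fun w => Nat.pair ((Nat.unpair w).1 + 1) (Nat.unpair w).2 :=
    Primrec₂.natPair.comp (Primrec.succ.comp (Primrec.fst.comp Primrec.unpair))
      (Primrec.snd.comp Primrec.unpair)
  have pg : Primrec fun w => 1 - e w := Primrec.nat_sub.comp (Primrec.const 1) pe
  have ph : Primrec fun n => Nat.pair 0 n := Primrec₂.natPair.comp (Primrec.const 0) Primrec.id
  have pd : Primrec fun w => e w - 1 := Primrec.nat_sub.comp pe (Primrec.const 1)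
  obtain ⟨b₁, pb₁, cf⟩ := PrimCalc.of_primrec (Primrec.nat_iff.1 pf)
  obtain ⟨b₂, pb₂, cg⟩ := PrimCalc.of_primrec (Primrec.nat_iff.1 pg)
  obtain ⟨b₃, pb₃, ch⟩ := PrimCalc.of_primrec (Primrec.nat_iff.1 ph)
  obtain ⟨b₄, pb₄, cd⟩ := PrimCalc.of_primrec (Primrec.nat_iff.1 pd)
  have key : ∀ n i, (fun w => Nat.pair ((Nat.unpair w).1 + 1) (Nat.unpair w).2)^[i]
      (Nat.pair 0 n) = Nat.pair i n := by
    intro n i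
    induction i with
    | zero => rfl
    | succ i ih => rw [Function.iterate_succ_apply', ih]; simp
  have hsum : ∀ k n, (fun p : ℕ × ℕ => (p.1 + 1, p.2 +
      (b₁ (Nat.pair p.1 n) + b₂ (Nat.pair p.1 n))))^[k] (0, 0) =
      (k, ∑ i ∈ Finset.range k, (b₁ (Nat.pair i n) + b₂ (Nat.pair i n))) := by
    intro k n
    induction k with
    | zero => rfl
    | succ k ih => rw [Function.iterate_succ_apply', ih, Finset.sum_range_succ]
  have psum : Primrec₂ fun k n => ∑ i ∈ Finset.range k, (b₁ (Nat.pair i n) + b₂ (Nat.pair i n)) := by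
    have : Primrec fun q : ℕ × ℕ => ((fun p : ℕ × ℕ => (p.1 + 1, p.2 +
        (b₁ (Nat.pair p.1 q.2) + b₂ (Nat.pair p.1 q.2))))^[q.1] (0, 0)).2 := by
      refine Primrec.snd.comp (Primrec.nat_iterate Primrec.fst (Primrec.const (0, 0)) ?_)
      have hpr : Primrec fun r : (ℕ × ℕ) × (ℕ × ℕ) => Nat.pair r.2.1 r.1.2 :=
        Primrec₂.natPair.comp (Primrec.fst.comp Primrec.snd) (Primrec.snd.comp Primrec.fst)
      exact (Primrec.pair (Primrec.succ.comp (Primrec.fst.comp Primrec.snd))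
        (Primrec.nat_add.comp (Primrec.snd.comp Primrec.snd)
          (Primrec.nat_add.comp (pb₁.comp hpr) (pb₂.comp hpr)))).to₂
    have h : Primrec fun q : ℕ × ℕ => ∑ i ∈ Finset.range q.1, (b₁ (Nat.pair i q.2) + b₂ (Nat.pair i q.2)) := by
      simpa only [hsum] using this
    exact h.to₂
  have cs : Computable fun n => (∑ i ∈ Finset.range (m n + 1),
      (b₁ (Nat.pair i n) + b₂ (Nat.pair i n))) + b₃ n :=
    (Primrec.nat_add.to_comp).comp (psum.to_comp.comp (Computable.succ.comp cm) Computable.id)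
      pb₃.to_comp
  have hle : ∀ n, ∀ i ≤ m n, b₁ (Nat.pair i n) + b₂ (Nat.pair i n) ≤
      ∑ i ∈ Finset.range (m n + 1), (b₁ (Nat.pair i n) + b₂ (Nat.pair i n)) := fun n i hi =>
    Finset.single_le_sum (f := fun i => b₁ (Nat.pair i n) + b₂ (Nat.pair i n))
      (fun _ _ => Nat.zero_le _) (Finset.mem_range.2 (Nat.lt_succ_of_le hi))
  have cw := cf.iterateUntil cg ch (m := fun _ n => m n)
    (b := fun _ n => (∑ i ∈ Finset.range (m n + 1),
      (b₁ (Nat.pair i n) + b₂ (Nat.pair i n))) + b₃ n)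
    (fun _ n => by
      rw [key]
      have : e (Nat.pair (m n) n) ≠ 0 := Nat.find_spec (hex n)
      omega)
    (fun _ n i hi => by
      rw [key]
      have : ¬ e (Nat.pair i n) ≠ 0 := Nat.find_min (hex n) hi
      omega)
    (fun _ n => by omega)
    (fun _ n i hi => by
      have := hle n i hi.le
      rw [key]; omega)
    (fun _ n i hi => by
      have := hle n i hi
      rw [key]; omega)
  have := cd.comp cw
  simp only [key] at this
  refine ⟨_, (Primrec.nat_max.to_comp).comp cs (pb₄.to_comp.comp
    ((Primrec₂.natPair.to_comp).comp cm Computable.id)), ?_⟩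
  convert this using 3 with _ n
  · exact (hval _ _ (Nat.find_spec (hex n))).symm
  · rfl

end ParamLog

namespace ParamLog
open NCode (enc)

/-! ## Machines for functions and relations computed by counter programs -/

/-- The initial state of a counter program. -/
def St.zero : St := ⟨fun _ => 0, 0, []⟩

theorem Calc.run {g b : List Bool → ℕ → ℕ} {P : ℕ → Prog} (hP : Realizes P g b) {x : List Bool}
    {B n : ℕ} {s : St} (hs : ∀ r, s.reg r ≤ B) (hb : b x (s.reg n) ≤ B) :
    ∃ s', Exec x B (P n) s s' ∧ (∀ r, s'.reg r ≤ B) ∧ s'.reg n = g x (s.reg n) ∧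
      (∀ r < n, s'.reg r = s.reg r) ∧ s'.out = s.out := by
  obtain ⟨s', he, h⟩ := hP x n B s hs hb
  exact ⟨s', he, he.le hs, h⟩

theorem getElem?_pre {α : Type*} (pre post : List α) (i : α) (n : ℕ) (h : n = pre.length) :
    (pre ++ i :: post)[n]? = some i := by
  subst h; simp

/-- The value is computed in register `1`. Register `0` is left alone and still contains `0`, so it
serves for the final test. -/
theorem exists_decider {h b : List Bool → ℕ → ℕ} (H : Calc h b) :
    ∃ M : TM, M.Decides {x | h x 0 = 0} ∧ ∀ x, M.RunsInSpace x (spaceFor (b x 0)) := by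
  obtain ⟨P, hP⟩ := H
  set L := (compile (P 1) 0).length with hL
  set C := compile (P 1) 0 ++ [.sweep .eq 0 1 (L + 2), .halt false, .halt true] with hC
  have key : ∀ x, ∃ c, Chain C 0 0 x (spaceFor (b x 0)) ((mach C 0 0).startCfg, []) c ∧
      c.1.state = (if h x 0 = 0 then (mach C 0 0).accept else (mach C 0 0).reject) ∧
      ∀ j, c.1.head j < spaceFor (b x 0) := by
    intro x
    have hS := spaceFor_pos (b x 0)
    obtain ⟨s', he, hle, h1, h0, -⟩ := Calc.run hP (x := x) (B := b x 0) (n := 1) (s := St.zero)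
      (fun _ => Nat.zero_le _) le_rfl
    replace h0 : s'.reg 0 = 0 := h0 0 one_pos
    replace h1 : s'.reg 1 = h x 0 := h1
    have c₁ := chain_of_exec (C := C) (g₀ := 0) (g₁ := 0) he (fun _ => Nat.zero_le _) le_rfl []
      _ 0 rfl hC
    have c₂ := chain_eq (C := C) (g₀ := 0) (g₁ := 0) (x := x) (S := spaceFor (b x 0)) (pc := L)
      (r := 0) (s := 1) (t := L + 2) (getElem?_pre _ _ _ _ hL) s'
      (by have := length_digits_le (hle 0); omega)
    rw [zero_add, ← hL] at c₁
    rw [h0, h1] at c₂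
    have c₃ := ((chain_start (C := C) (g₀ := 0) (g₁ := 0) hS).trans c₁).trans c₂
    by_cases e : h x 0 = 0
    · rw [if_pos e.symm] at c₃
      refine ⟨_, c₃.tail (dstep_special (i := .halt true) (q := 0) ?_ (by simp) s' hS), ?_,
        fun _ => hS⟩
      · rw [hC, List.getElem?_append_right (by omega)]; simp [← hL]
      · rw [if_pos e]; rfl
    · rw [if_neg (Ne.symm e)] at c₃
      refine ⟨_, c₃.tail (dstep_special (i := .halt false) (q := 1) ?_ (by simp) s' hS), ?_,
        fun _ => hS⟩
      · rw [hC, List.getElem?_append_right (by omega)]; simp [← hL]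
      · rw [if_neg e]; rfl
  refine ⟨(mach C 0 0).toTM, fun x => ?_, fun x c hc => ?_⟩
  · obtain ⟨c, hc, hs, -⟩ := key x
    exact ⟨fun hx => ⟨c.1, reachesCfg_of_chain hc, hs.trans (if_pos hx)⟩,
      fun hx => ⟨c.1, reachesCfg_of_chain hc, hs.trans (if_neg hx)⟩⟩
  · obtain ⟨c', hc', hs, hS⟩ := key x
    refine space_of_chain hc' ?_ hS hc
    by_cases e : h x 0 = 0
    · exact .inl (by rw [hs, if_pos e])
    · exact .inr (by rw [hs, if_neg e])

/-- The value is computed in register `1` and halved repeatedly, the parity being written out each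
time; this gives the bits with the least significant one first. The bound `b'` takes care of the
registers used for halving. It is monotone, so its value at the bound for `κ x` covers all rounds.
-/
theorem exists_transducer {κ : List Bool → ℕ} {b : List Bool → ℕ → ℕ}
    (H : Calc (fun x _ => κ x) b) : ∃ T : Transducer, T.Computes (fun x => (κ x).bits) ∧
      ∃ b', PolyBdd b' ∧ ∀ x, T.toTM.RunsInSpace x (spaceFor (max (b x 0) (b' x (b x 0)))) := by
  obtain ⟨P, hP⟩ := H
  obtain ⟨bm, pm, Pm, hm⟩ := ((LS.id.mod (LS.const 2)) : LS fun _ (v : ℕ) => v % 2).polyCalc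
  obtain ⟨bd, pd, Pd, hd⟩ := ((LS.id.div (LS.const 2)) : LS fun _ (v : ℕ) => v / 2).polyCalc
  obtain ⟨dm, hdm⟩ := pm
  obtain ⟨dd, hdd⟩ := pd
  set body : Prog := .seq (.copy 1 2) (.seq (Pm 2) (.seq (.ifEq 2 0 (.emit false) (.emit true)) (Pd 1)))
  set Q : Prog := .seq (P 1) (.whileNe 1 0 body) with hQ
  set b' : List Bool → ℕ → ℕ := fun x v => (x.length + v + 2) ^ dm + (x.length + v + 2) ^ dd with hb'
  have loop : ∀ (x : List Bool) (B n : ℕ) (s : St), (∀ r, s.reg r ≤ B) → s.reg 0 = 0 →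
      s.reg 1 = n → b' x n ≤ B →
      ∃ s', Exec x B (.whileNe 1 0 body) s s' ∧ s'.out = s.out ++ n.bits := by
    intro x B n
    induction n using Nat.strong_induction_on with
    | _ n ih =>
      intro s hs h0 h1 hB
      by_cases hn : n = 0
      · exact ⟨s, .while_done (by rw [h0, h1, hn]), by simp [hn]⟩
      have hbd : Run x B body s fun t => t.reg 0 = 0 ∧ t.reg 1 = n / 2 ∧
          t.out = s.out ++ [decide (n % 2 = 1)] := by
        refine Run.seq (Run.copy (by omega) hs fun s₁ k₁ k₂ k₃ => ?_)
        have hs₁ : ∀ r, s₁.reg r ≤ B := by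
          intro r
          by_cases e : r = 2
          · rw [e, k₁]; exact hs 1
          · rw [k₂ r e]; exact hs r
        rw [h1] at k₁
        have hbm : bm x n ≤ B := (hdm x n).trans (by simp only [hb'] at hB; omega)
        have hbd : bd x n ≤ B := (hdd x n).trans (by simp only [hb'] at hB; omega)
        refine Run.seq ((hm x 2 B s₁ hs₁ (by rw [k₁]; exact hbm)).mono hs₁
          fun s₂ hs₂ ⟨j₁, j₂, j₃⟩ => ?_)
        replace j₁ : s₂.reg 2 = n % 2 := by rw [j₁, k₁]
        have hz : s₂.reg 0 = 0 := by rw [j₂ 0 (by omega), k₂ 0 (by omega), h0]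
        have hone : s₂.reg 1 = n := by rw [j₂ 1 (by omega), k₂ 1 (by omega), h1]
        have last : ∀ (a : Bool) (s₃ : St), a = decide (n % 2 = 1) →
            s₃ = { s₂ with out := s₂.out ++ [a] } →
            Run x B (Pd 1) s₃ fun t => t.reg 0 = 0 ∧ t.reg 1 = n / 2 ∧
              t.out = s.out ++ [decide (n % 2 = 1)] := by
          rintro a s₃ ha rfl
          refine (hd x 1 B ⟨s₂.reg, s₂.hd, s₂.out ++ [a]⟩ hs₂ (by simp only [hone]; exact hbd)).mono hs₂
            fun s₄ hs₄ ⟨l₁, l₂, l₃⟩ => ?_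
          refine ⟨by rw [l₂ 0 one_pos]; exact hz, by rw [l₁]; simp only [hone], ?_⟩
          rw [l₃, ← ha]; simp only [j₃, k₃]
        refine Run.seq (Run.ifEq (fun e => ?_) fun e => ?_)
        · exact ⟨_, .emit _ _, last _ _ (by rw [hz, j₁] at e; rw [e]; rfl) rfl⟩
        · exact ⟨_, .emit _ _, last _ _ (by
            rw [hz, j₁] at e
            have : n % 2 = 1 := by omega
            simp [this]) rfl⟩
      obtain ⟨u, he, t0, t1, tO⟩ := hbd
      have hmono : b' x (n / 2) ≤ b' x n := by
        have : n / 2 ≤ n := Nat.div_le_self _ _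
        simp only [hb']
        gcongr
      obtain ⟨s', he', hs'⟩ := ih (n / 2) (by omega) u (he.le hs) t0 t1 (hmono.trans hB)
      refine ⟨s', .while_step (by rw [h1, h0]; exact hn) he he', ?_⟩
      rw [hs', tO, List.append_assoc]
      congr 1
      have := Nat.bits_append_bit (n / 2) (decide (n % 2 = 1)) (fun e => by
        simp only [decide_eq_true_eq]; omega)
      rw [List.singleton_append, ← this]
      congr 1
      have := Nat.bit_decide_mod_two_eq_one_shiftRight_one n
      simpa [Nat.shiftRight_one] using this
  set C := compile Q 0 ++ [.halt true] with hC
  have pb' : PolyBdd b' :=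
    ((((PolyBdd.length.add .arg).add (.const 2)).pow dm).add
      (((PolyBdd.length.add .arg).add (.const 2)).pow dd))
  have key : ∀ x, ∃ c, Chain C 0 0 x (spaceFor (max (b x 0) (b' x (b x 0))))
      ((mach C 0 0).startCfg, []) (c, (κ x).bits) ∧ (mach C 0 0).Halting c ∧
      ∀ j, c.head j < spaceFor (max (b x 0) (b' x (b x 0))) := by
    intro x
    set B := max (b x 0) (b' x (b x 0)) with hB
    have hS := spaceFor_pos B
    obtain ⟨s', he, hle, h1, h0, ho⟩ := Calc.run hP (x := x) (B := B) (n := 1) (s := St.zero)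
      (fun _ => Nat.zero_le _) (le_max_left _ _)
    have hκ : κ x ≤ b x 0 := by
      have H : Calc (fun x _ => κ x) b := ⟨P, hP⟩
      have := H.le x 0
      simpa using this
    obtain ⟨s'', he', ho'⟩ := loop x B (κ x) s' hle (h0 0 one_pos) h1 (by
      refine le_trans ?_ (le_max_right _ _)
      simp only [hb']
      gcongr)
    have c₁ := chain_of_exec (C := C) (g₀ := 0) (g₁ := 0) (he.seq he') (fun _ => Nat.zero_le _)
      le_rfl [] _ 0 rfl hC
    have c₃ := ((chain_start (C := C) (g₀ := 0) (g₁ := 0) hS).trans c₁).tail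
      (dstep_special (i := .halt true) (q := 0) (by
        rw [zero_add]; exact getElem?_pre _ _ _ _ rfl) (by simp) s'' hS)
    rw [ho', ho] at c₃
    exact ⟨_, c₃, .inl rfl, fun _ => hS⟩
  refine ⟨mach C 0 0, fun x => ?_, b', pb', fun x c hc => ?_⟩
  · obtain ⟨c, hc, hh, -⟩ := key x
    exact ⟨c, stepOut_of_chain hc, hh⟩
  · obtain ⟨c', hc', hh, hS⟩ := key x
    exact space_of_chain hc' hh hS hc

/-- Register `0` holds the number of guesses, register `1` counts them and register `2` holds the
state. The two successors of the guess state lead to the code for `s₀` and for `s₁`, and both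
branches return to the test at address `L`. The invariant `I` confines the states, on all branches,
to values for which the registers stay below `B`. -/
theorem exists_guesser {m i s₀ s₁ t bm bi b₀ b₁ bt : List Bool → ℕ → ℕ} (hm : Calc m bm)
    (hi : Calc i bi) (h₀ : Calc s₀ b₀) (h₁ : Calc s₁ b₁) (ht : Calc t bt) (B : List Bool → ℕ)
    (I : List Bool → ℕ → Prop) (hBm : ∀ x, bm x 0 ≤ B x) (hBi : ∀ x, bi x 0 ≤ B x)
    (hI : ∀ x, I x (i x 0)) (hI₀ : ∀ x v, I x v → I x (s₀ x v)) (hI₁ : ∀ x v, I x v → I x (s₁ x v))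
    (hB : ∀ x v, I x v → b₀ x v ≤ B x ∧ b₁ x v ≤ B x ∧ bt x v ≤ B x) :
    ∃ N : NTM, ∀ x, Good N x (spaceFor (B x)) (m x 0)
      (∃ l : List Bool, l.length = m x 0 ∧
        t x (l.foldl (fun v a => if a then s₁ x v else s₀ x v) (i x 0)) = 0) N.toTM.startCfg := by
  obtain ⟨Pm, hm'⟩ := id hm
  obtain ⟨Pi, hi⟩ := hi
  obtain ⟨P₀, h₀⟩ := h₀
  obtain ⟨P₁, h₁⟩ := h₁
  obtain ⟨Pt, ht⟩ := ht
  set QA : Prog := .seq (Pm 0) (.seq (.clear 1) (.seq (.clear 2) (Pi 2))) with hQA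
  set Q₀ : Prog := .seq (P₀ 2) (.inc 1) with hQ₀
  set Q₁ : Prog := .seq (P₁ 2) (.inc 1) with hQ₁
  set QE : Prog := .seq (Pt 2) (.clear 1) with hQE
  set L := (compile QA 0).length with hL
  set l₀ := (compile Q₀ (L + 2)).length with hl₀
  set G := L + 2 + l₀ + 1 with hG
  set l₁ := (compile Q₁ G).length with hl₁
  set E := G + l₁ + 1 with hE
  set lE := (compile QE E).length with hlE
  set C : List Instr := compile QA 0 ++ (.sweep .eq 1 0 E :: .guess :: (compile Q₀ (L + 2) ++
    (.jin (fun _ => true) L :: (compile Q₁ G ++ (.jin (fun _ => true) L :: (compile QE E ++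
      [.sweep .eq 1 2 (E + lE + 2), .halt false, .halt true])))))) with hC
  have eL : C[L]? = some (.sweep .eq 1 0 E) := getElem?_pre _ _ _ _ hL
  have eL1 : C[L + 1]? = some .guess := by
    rw [hC, List.getElem?_append_right (by omega)]; simp [← hL]
  have eC₀ : C = (compile QA 0 ++ [.sweep .eq 1 0 E, .guess]) ++ (compile Q₀ (L + 2) ++
    (.jin (fun _ => true) L :: (compile Q₁ G ++ (.jin (fun _ => true) L :: (compile QE E ++
      [.sweep .eq 1 2 (E + lE + 2), .halt false, .halt true]))))) := by simp [hC]
  have eG0 : C[L + 2 + l₀]? = some (.jin (fun _ => true) L) := by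
    rw [eC₀, ← List.append_assoc]
    exact getElem?_pre _ _ _ _ (by simp [← hL, ← hl₀]; omega)
  have eC₁ : C = (compile QA 0 ++ [.sweep .eq 1 0 E, .guess] ++ compile Q₀ (L + 2) ++
    [.jin (fun _ => true) L]) ++ (compile Q₁ G ++ (.jin (fun _ => true) L :: (compile QE E ++
      [.sweep .eq 1 2 (E + lE + 2), .halt false, .halt true]))) := by simp [hC]
  have eG1 : C[G + l₁]? = some (.jin (fun _ => true) L) := by
    rw [eC₁, ← List.append_assoc]
    exact getElem?_pre _ _ _ _ (by simp [← hL, ← hl₀, ← hl₁]; omega)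
  have eCE : C = (compile QA 0 ++ [.sweep .eq 1 0 E, .guess] ++ compile Q₀ (L + 2) ++
    [.jin (fun _ => true) L] ++ compile Q₁ G ++ [.jin (fun _ => true) L]) ++ (compile QE E ++
      [.sweep .eq 1 2 (E + lE + 2), .halt false, .halt true]) := by simp [hC]
  have lenE : (compile QA 0 ++ [Instr.sweep .eq 1 0 E, Instr.guess] ++ compile Q₀ (L + 2) ++
    [Instr.jin (fun _ => true) L] ++ compile Q₁ G ++ [Instr.jin (fun _ => true) L]).length = E := by
    simp [← hL, ← hl₀, ← hl₁]; omega
  have eE0 : C[E + lE]? = some (.sweep .eq 1 2 (E + lE + 2)) := by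
    rw [eCE, ← List.append_assoc]
    exact getElem?_pre _ _ _ _ (by rw [List.length_append, lenE, ← hlE])
  have eE1 : C[E + lE + 1]? = some (.halt false) := by
    rw [eCE, ← List.append_assoc, List.getElem?_append_right (by
      rw [List.length_append, lenE, ← hlE]; omega), List.length_append, lenE, ← hlE]
    simp
  have eE2 : C[E + lE + 2]? = some (.halt true) := by
    rw [eCE, ← List.append_assoc, List.getElem?_append_right (by
      rw [List.length_append, lenE, ← hlE]; omega), List.length_append, lenE, ← hlE]
    simp
  refine ⟨nmach C (L + 2) G, fun x => ?_⟩
  have hmB : m x 0 ≤ B x := by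
    have := hm.le x 0
    have := hBm x
    omega
  have hS := spaceFor_pos (B x)
  have hlen : ∀ {v}, v ≤ B x → (digits v).length + 2 ≤ spaceFor (B x) := fun h => by
    have := length_digits_le h; omega
  -- the accepting phase
  have fin : ∀ s : St, (∀ r, s.reg r ≤ B x) → I x (s.reg 2) →
      Good (nmach C (L + 2) G) x (spaceFor (B x)) 0 (t x (s.reg 2) = 0)
        (conf C (L + 2) G E s).1 := by
    intro s hs hv
    obtain ⟨s', he, hle, k₁, k₂, -⟩ := Calc.run ht hs (hB x _ hv).2.2
    have c₁ := chain_of_exec (C := C) (g₀ := L + 2) (g₁ := G) (he.seq (.clear 1 s')) hs le_rfl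
      _ _ _ lenE.symm eCE
    have hle' : ∀ r, (s'.set 1 0).reg r ≤ B x := by
      intro r; rw [St.set_reg]; split
      exacts [Nat.zero_le _, hle r]
    have c₂ := chain_eq (g₀ := L + 2) (g₁ := G) (x := x) (S := spaceFor (B x)) eE0 (s'.set 1 0)
      (hlen (hle' 1))
    refine good_of_chain (c₁.trans c₂) ?_
    have e₁ : (s'.set 1 0).reg 1 = 0 := by simp
    have e₂ : (s'.set 1 0).reg 2 = t x (s.reg 2) := by simp [k₁]
    rw [e₁, e₂]
    by_cases e : t x (s.reg 2) = 0
    · rw [if_pos e.symm]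
      exact (good_halt eE2 _ hS (m := 0)).iff (by simp [e])
    · rw [if_neg (Ne.symm e)]
      exact (good_halt eE1 _ hS (m := 0)).iff (by simp [e])
  -- the loop
  have loop : ∀ (k : ℕ) (s : St), (∀ r, s.reg r ≤ B x) → I x (s.reg 2) → s.reg 0 = m x 0 →
      s.reg 1 + k = m x 0 → Good (nmach C (L + 2) G) x (spaceFor (B x)) k
        (∃ l : List Bool, l.length = k ∧
          t x (l.foldl (fun v a => if a then s₁ x v else s₀ x v) (s.reg 2)) = 0)
        (conf C (L + 2) G L s).1 := by
    intro k
    induction k with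
    | zero =>
      intro s hs hv k₀ k₁
      have c := chain_eq (g₀ := L + 2) (g₁ := G) (x := x) (S := spaceFor (B x)) eL s (hlen (hs 1))
      rw [if_pos (by omega)] at c
      exact good_of_chain c ((fin s hs hv).iff (by simp [List.length_eq_zero_iff]))
    | succ k ih =>
      intro s hs hv k₀ k₁
      have c := chain_eq (g₀ := L + 2) (g₁ := G) (x := x) (S := spaceFor (B x)) eL s (hlen (hs 1))
      rw [if_neg (by omega)] at c
      have branch : ∀ {f bf : List Bool → ℕ → ℕ} {P : ℕ → Prog}, Realizes P f bf →
          bf x (s.reg 2) ≤ B x → I x (f x (s.reg 2)) →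
          ∃ s', Exec x (B x) (.seq (P 2) (.inc 1)) s s' ∧ s'.reg 2 = f x (s.reg 2) ∧
          Good (nmach C (L + 2) G) x (spaceFor (B x)) k (∃ l : List Bool, l.length = k ∧
            t x (l.foldl (fun v a => if a then s₁ x v else s₀ x v) (f x (s.reg 2))) = 0)
              (conf C (L + 2) G L s').1 := by
        intro f bf P hP hb hI'
        obtain ⟨s', he, hle, j₁, j₂, -⟩ := Calc.run hP hs hb
        have h1 := j₂ 1 (by omega)
        refine ⟨_, he.seq (.inc 1 s' (by omega)), ?_, ?_⟩
        · rw [St.set_reg, if_neg (by omega), j₁]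
        · have := ih (s'.set 1 (s'.reg 1 + 1)) (fun r => ?_) ?_ ?_ ?_
          · rwa [St.set_reg, if_neg (by omega), j₁] at this
          · rw [St.set_reg]; split
            · omega
            · exact hle r
          · rw [St.set_reg, if_neg (by omega), j₁]; exact hI'
          · rw [St.set_reg, if_neg (by omega), j₂ 0 (by omega), k₀]
          · rw [St.set_reg, if_pos rfl]; omega
      obtain ⟨u, hu, -, gu⟩ := branch h₀ (hB x _ hv).1 (hI₀ x _ hv)
      obtain ⟨w, hw, -, gw⟩ := branch h₁ (hB x _ hv).2.1 (hI₁ x _ hv)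
      have cu := chain_of_exec (C := C) (g₀ := L + 2) (g₁ := G) hu hs le_rfl _ _ (L + 2)
        (by simp [← hL]) eC₀
      have cw := chain_of_exec (C := C) (g₀ := L + 2) (g₁ := G) hw hs le_rfl _ _ G
        (by simp [← hL, ← hl₀]; omega) eC₁
      have ju := chain_jin (g₀ := L + 2) (g₁ := G) (x := x) eG0 u hS
      have jw := chain_jin (g₀ := L + 2) (g₁ := G) (x := x) eG1 w hS
      rw [if_pos rfl] at ju jw
      refine good_of_chain c ((good_guess eL1 s hS (good_of_chain (cu.trans ju) gu)
        (good_of_chain (cw.trans jw) gw)).iff ?_)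
      constructor
      · rintro (⟨l, hl, h⟩ | ⟨l, hl, h⟩)
        · exact ⟨false :: l, by simp [hl], by simpa using h⟩
        · exact ⟨true :: l, by simp [hl], by simpa using h⟩
      · rintro ⟨l, hl, h⟩
        obtain ⟨a, l, rfl⟩ := List.exists_cons_of_length_eq_add_one hl
        cases a
        · exact .inl ⟨l, by simpa using hl, by simpa using h⟩
        · exact .inr ⟨l, by simpa using hl, by simpa using h⟩
  obtain ⟨s₁', he₁, hle₁, a₁, -, -⟩ := Calc.run hm' (x := x) (B := B x) (n := 0) (s := St.zero)
    (fun _ => Nat.zero_le _) (hBm x)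
  replace a₁ : s₁'.reg 0 = m x 0 := a₁
  have hle₂ : ∀ r, ((s₁'.set 1 0).set 2 0).reg r ≤ B x := by
    intro r
    simp only [St.set_reg]
    split
    · exact Nat.zero_le _
    · split
      · exact Nat.zero_le _
      · exact hle₁ r
  obtain ⟨s₂', he₂, hle₃, a₂, a₃, -⟩ := Calc.run hi (n := 2) hle₂ (by simpa using hBi x)
  have hA : Exec x (B x) QA St.zero s₂' := he₁.seq (.seq (.clear 1 _) (.seq (.clear 2 _) he₂))
  have c₁ := chain_of_exec (C := C) (g₀ := L + 2) (g₁ := G) hA (fun _ => Nat.zero_le _) le_rfl []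
    _ 0 rfl hC
  rw [zero_add, ← hL] at c₁
  have a₂' : s₂'.reg 2 = i x 0 := by simpa using a₂
  have := loop (m x 0) s₂' hle₃ (by rw [a₂']; exact hI x)
    (by rw [a₃ 0 (by omega)]; simpa using a₁) (by rw [a₃ 1 (by omega)]; simp)
  rw [a₂'] at this
  exact good_of_chain ((chain_start hS).trans c₁) this

end ParamLog

namespace ParamLog
open NCode (enc)

/-! ## Parameterized logarithmic space -/

/-- Bounds polynomial in the length of the input and a computable function of the parameter. -/
def PLBdd (π : List Bool → ℕ) (B : List Bool → ℕ) : Prop :=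
  ∃ (G : ℕ → ℕ) (d : ℕ), Computable G ∧ ∀ x, B x ≤ (x.length + G (π x) + 2) ^ d

/-- Functions computed with such a bound on the registers. -/
def PLCalc (π φ : List Bool → ℕ) : Prop :=
  ∃ b, Calc (fun x _ => φ x) b ∧ PLBdd π fun x => b x 0

variable {π φ B B' : List Bool → ℕ}

namespace PLBdd

theorem mono (h : PLBdd π B) (hb : ∀ x, B' x ≤ B x) : PLBdd π B' :=
  let ⟨G, d, hG, hd⟩ := h
  ⟨G, d, hG, fun x => (hb x).trans (hd x)⟩

theorem comp {b : List Bool → ℕ → ℕ} (hb : PolyBdd b) (h : PLBdd π B) :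
    PLBdd π fun x => b x (B x) := by
  obtain ⟨G, d, hG, hd⟩ := h
  obtain ⟨d', hd'⟩ := hb
  refine ⟨G, (d + 2) * d', hG, fun x => (hd' x _).trans ?_⟩
  rw [pow_mul]
  refine Nat.pow_le_pow_left ?_ _
  have h₁ := hd x
  set N := x.length + G (π x) + 2
  have hN : 2 ≤ N := by omega
  have h₂ : x.length + 2 ≤ N := by omega
  have h₃ : 1 ≤ N ^ d := Nat.one_le_pow _ _ (by omega)
  calc x.length + B x + 2 ≤ N + N ^ d := by omega
    _ ≤ N ^ d * N + N ^ d * N := by gcongr <;> nlinarith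
    _ = N ^ d * N * 2 := by ring
    _ ≤ N ^ d * N * N := by gcongr
    _ = N ^ (d + 2) := by ring

theorem param {F : ℕ → ℕ} (hF : Computable F) : PLBdd π fun x => F (π x) :=
  ⟨F, 1, hF, fun x => by simp; omega⟩

theorem add (h : PLBdd π B) (h' : PLBdd π B') : PLBdd π fun x => B x + B' x := by
  obtain ⟨G, d, hG, hd⟩ := h
  obtain ⟨G', d', hG', hd'⟩ := h'
  refine ⟨fun n => G n + G' n, d + d' + 1, (Primrec.nat_add.to_comp).comp hG hG', fun x => ?_⟩
  have hN : 2 ≤ x.length + (G (π x) + G' (π x)) + 2 := by omega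
  have h₁ : B x ≤ (x.length + (G (π x) + G' (π x)) + 2) ^ (d + d') :=
    (hd x).trans ((Nat.pow_le_pow_left (by omega) _).trans (Nat.pow_le_pow_right (by omega) (by omega)))
  have h₂ : B' x ≤ (x.length + (G (π x) + G' (π x)) + 2) ^ (d + d') :=
    (hd' x).trans ((Nat.pow_le_pow_left (by omega) _).trans (Nat.pow_le_pow_right (by omega) (by omega)))
  rw [pow_succ]
  nlinarith

theorem max (h : PLBdd π B) (h' : PLBdd π B') : PLBdd π fun x => Max.max (B x) (B' x) :=
  (h.add h').mono fun x => by omega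

/-- The base of the bound is at most a power of 2 whose exponent is linear in `log |x|` and
`G(π(x))`. Estimating `G + 2` by `2 ^ (G + 2)` is crude but harmless, as any computable function of
the parameter is allowed. -/
theorem space (h : PLBdd π B) : ∃ f : ℕ → ℕ, Computable f ∧ ∃ d : ℕ, ∀ x,
    spaceFor (B x) ≤ d * (f (π x) + Nat.log 2 x.length) := by
  obtain ⟨G, d, hG, hd⟩ := h
  refine ⟨fun n => G n + 4, (Primrec.nat_add.to_comp).comp hG (Computable.const 4), d + 4,
    fun x => ?_⟩
  set L := Nat.log 2 x.length
  have h₁ : x.length < 2 ^ (L + 1) := Nat.lt_pow_succ_log_self (by norm_num) _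
  have h₂ : G (π x) + 2 < 2 ^ (G (π x) + 2) := Nat.lt_two_pow_self
  have h₃ : x.length + G (π x) + 2 ≤ 2 ^ (L + G (π x) + 3) := by
    have e : 2 ^ (L + G (π x) + 3) = 2 ^ (L + 1) * 2 ^ (G (π x) + 2) := by ring
    rw [e]
    nlinarith
  have h₄ : B x + 1 ≤ 2 ^ ((L + G (π x) + 3) * (d + 1)) := by
    rw [pow_mul, pow_succ]
    have := (hd x).trans (Nat.pow_le_pow_left h₃ d)
    have h₅ : 2 ≤ 2 ^ (L + G (π x) + 3) := by
      calc 2 = 2 ^ 1 := rfl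
        _ ≤ _ := Nat.pow_le_pow_right (by norm_num) (by omega)
    have h₆ : 1 ≤ (2 ^ (L + G (π x) + 3)) ^ d := Nat.one_le_pow _ _ (by positivity)
    nlinarith
  have h₅ : Nat.log 2 (B x + 1) ≤ (L + G (π x) + 3) * (d + 1) := by
    calc _ ≤ Nat.log 2 (2 ^ ((L + G (π x) + 3) * (d + 1))) := Nat.log_mono_right h₄
      _ = _ := Nat.log_pow (by norm_num) _
  unfold spaceFor
  nlinarith

end PLBdd

theorem PLCalc.bdd (h : PLCalc π φ) : PLBdd π φ := by
  obtain ⟨b, hc, hb⟩ := h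
  exact hb.mono fun x => by simpa using hc.le x 0

theorem PLCalc.comp_ls (h : PLCalc π φ) {g : List Bool → ℕ → ℕ} (hg : PolyCalc g) :
    PLCalc π fun x => g x (φ x) := by
  have hφ := h.bdd
  obtain ⟨b, hc, hb⟩ := h
  obtain ⟨b', hb', hc'⟩ := hg
  exact ⟨_, hc'.comp hc, hb.max (.comp hb' hφ)⟩

/-- A parameter that can be recognized in logarithmic space can be found by search. -/
theorem PLCalc.search {check : List Bool → ℕ → Prop} (h : LSP check)
    (hc : ∀ x v, check x v ↔ v = π x) : PLCalc π π := by
  classical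
  have hg := (LS.ite h (LS.const 0) (LS.const 1)).polyCalc
  obtain ⟨b, ⟨d, hd⟩, hb⟩ := hg
  have e : ∀ i v : ℕ, (fun v => v + 1)^[i] v = v + i := by
    intro i v
    induction i with
    | zero => rfl
    | succ i ih => rw [Function.iterate_succ_apply', ih]; rfl
  have := Calc.succ.iterateUntil hb Calc.zero (m := fun x _ => π x)
    (b := fun x _ => π x + (x.length + π x + 2) ^ d)
    (fun x v => by simp [e, hc]) (fun x v i hi => by simp [e, hc, hi.ne])
    (fun x v => by omega) (fun x v i hi => by rw [e]; omega)
    (fun x v i hi => by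
      rw [e, zero_add]
      exact (hd x i).trans ((Nat.pow_le_pow_left (by omega) d).trans (Nat.le_add_left _ _)))
  simp only [e, zero_add] at this
  refine ⟨_, this, (PLBdd.param Computable.id).add ?_⟩
  exact PLBdd.comp (b := fun x v => (x.length + v + 2) ^ d) ⟨d, fun x v => le_rfl⟩
    (.param Computable.id)

theorem PLCalc.of_ls (h : LS fun x (_ : ℕ) => φ x) : PLCalc π φ := by
  obtain ⟨b, hb, hc⟩ := h.polyCalc
  exact ⟨b, hc, .comp hb (.param (F := fun _ => 0) (Computable.const 0))⟩

theorem PLCalc.computable (h : PLCalc π π) {F : ℕ → ℕ} (hF : Computable F) :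
    PLCalc π fun x => F (π x) := by
  obtain ⟨b, hc, hb⟩ := h
  obtain ⟨G, hG, hc'⟩ := calc_of_computable hF
  exact ⟨_, hc'.comp hc, hb.max (.param hG)⟩

/-- Problems in para-L. -/
theorem inParaL {P : ParamProblem} (hφ : PLCalc P.param φ) {p : List Bool → ℕ → Prop}
    (hp : LSP p) (h : ∀ x, x ∈ P.lang ↔ p x (φ x)) : P.InParaL := by
  classical
  have hg := hφ.comp_ls (LS.ite hp (LS.const 0) (LS.const 1)).polyCalc
  obtain ⟨b, hc, hb⟩ := hg
  obtain ⟨M, hM, hS⟩ := exists_decider hc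
  refine ⟨M, ?_, ?_⟩
  · convert hM using 1
    ext x
    simp [h]
  · obtain ⟨f, hf, d, hd⟩ := hb.space
    exact ⟨f, hf, d, fun x c hcc j => (hS x c hcc j).trans_le (hd x)⟩

theorem logspaceComputable {κ : List Bool → ℕ} (h : LS fun x (_ : ℕ) => κ x) :
    LogspaceComputable κ := by
  obtain ⟨b, hb, hc⟩ := h.polyCalc
  obtain ⟨T, hT, b', hb', hS⟩ := exists_transducer hc
  -- A polynomial bound is a bound with respect to the constant parameter `0`, so that the
  -- contribution `f 0` of the parameter to the space is a constant.
  have h₀ : PLBdd (fun _ => 0) fun x => b x 0 :=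
    .comp hb (.param (F := fun _ => 0) (Computable.const 0))
  obtain ⟨f, -, d, hd⟩ := (h₀.max (.comp hb' h₀)).space
  refine ⟨T, hT, d * (f 0 + 1), fun x c hcc j => (hS x c hcc j).trans_le ((hd x).trans ?_)⟩
  nlinarith [Nat.zero_le (d * (f 0 * Nat.log 2 x.length))]

/-- Nondeterministic machines that guess a string bit by bit. -/
theorem exists_guessing_machine {σ : Type} [NCode σ] (hφ : PLCalc π φ) {m : List Bool → ℕ → ℕ}
    {init : List Bool → ℕ → σ} {stp : List Bool → σ → Bool → σ} {acc : List Bool → σ → Prop}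
    (hm : LS m) (hi : LS init) (hs : LS fun x (p : σ × Bool) => stp x p.1 p.2) (ha : LSP acc)
    {bd : List Bool → ℕ → ℕ} (hbd : PolyBdd bd) (I : List Bool → σ → Prop)
    (hI : ∀ x, I x (init x (φ x))) (hI' : ∀ x s a, I x s → I x (stp x s a))
    (hle : ∀ x s, I x s → enc s ≤ bd x (φ x)) :
    ∃ N : NTM, N.Accepts {x | ∃ l : List Bool, l.length = m x (φ x) ∧
        acc x (l.foldl (stp x) (init x (φ x)))} ∧
      PLSpaceBounded N.RunsInSpace π ∧ ∀ x, N.UsesBits x (m x (φ x)) := by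
  classical
  obtain ⟨bm, cm, km⟩ := hφ.comp_ls hm.polyCalc
  obtain ⟨gi, pi, ei⟩ := hi
  obtain ⟨bi, ci, ki⟩ := hφ.comp_ls pi
  obtain ⟨g₀, ⟨b₀, p₀, c₀⟩, e₀⟩ := hs.comp (LS.id.pair (LS.const false))
  obtain ⟨g₁, ⟨b₁, p₁, c₁⟩, e₁⟩ := hs.comp (LS.id.pair (LS.const true))
  obtain ⟨gt, ⟨bt, pt, ct⟩, et⟩ := LS.ite ha (LS.const 0) (LS.const 1)
  obtain ⟨d, hd⟩ := (p₀.max p₁).max pt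
  have hbB : PLBdd π fun x => bd x (φ x) := .comp hbd hφ.bdd
  set B : List Bool → ℕ := fun x => max (max (bm x 0) (bi x 0))
    ((x.length + bd x (φ x) + 2) ^ d) with hB
  have hBB : PLBdd π B := (km.max ki).max
    (.comp (b := fun x v => (x.length + v + 2) ^ d) ⟨d, fun _ _ => le_rfl⟩ hbB)
  -- The machine handles numbers, so its invariant is to be the code of some state satisfying `I`.
  obtain ⟨N, hN⟩ := exists_guesser cm ci c₀ c₁ ct B (fun x v => ∃ s, I x s ∧ v = enc s)
    (fun x => by simp [hB]) (fun x => by simp [hB])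
    (fun x => ⟨_, hI x, ei x _⟩) (fun x v ⟨s, h, hv⟩ => ⟨_, hI' x s false h, by rw [hv, e₀]⟩)
    (fun x v ⟨s, h, hv⟩ => ⟨_, hI' x s true h, by rw [hv, e₁]⟩) (fun x v ⟨s, h, hv⟩ => by
      have h₁ := hd x v
      have h₂ : (x.length + v + 2) ^ d ≤ B x := by
        refine le_trans (Nat.pow_le_pow_left ?_ d) (le_max_right _ _)
        have := hle x s h
        omega
      simp only at h₁
      omega)
  have hfold : ∀ x (l : List Bool) s, l.foldl (fun v a => if a then g₁ x v else g₀ x v) (enc s) =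
      enc (l.foldl (stp x) s) := by
    intro x l
    induction l with
    | nil => intro s; rfl
    | cons a l ih =>
      intro s
      rw [List.foldl_cons, List.foldl_cons, ← ih]
      congr 1
      cases a
      · simp [e₀]
      · simp [e₁]
  refine ⟨N, fun x => ?_, ?_, fun x => (hN x).bits⟩
  · refine Iff.trans ?_ (hN x).acc
    have ei' : ∀ x, gi x (φ x) = enc (init x (φ x)) := fun x => ei x (φ x)
    simp only [Set.mem_ofPred_eq, ei', hfold, et]
    refine exists_congr fun l => and_congr_right fun _ => ?_
    split <;> simp_all
  · obtain ⟨f, hf, d, hd⟩ := hBB.space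
    exact ⟨f, hf, d, fun x c hcc j => ((hN x).space c hcc j).trans_le (hd x)⟩

end ParamLog

namespace ParamLog

/-! ## Structures given by listings -/

namespace PairCode

variable (D : PairCode)

theorem mem_left_iff (i : Fin D.rels.length) (v : Fin (D.rels.get i).ar → Fin D.a) :
    (show Fin (D.vocabulary.ar i) → D.A.U from v) ∈ D.A.rel i ↔
      List.ofFn (fun j => (v j : ℕ)) ∈ (D.rels.get i).left := Iff.rfl

/-- Tuples of numbers below `n` are lists of numbers below `n`. -/
theorem exists_ofFn_eq {n k : ℕ} {l : List ℕ} (hl : l.length = k) (h : ∀ m ∈ l, m < n) :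
    ∃ v : Fin k → Fin n, List.ofFn (fun j => (v j : ℕ)) = l := by
  subst hl
  exact ⟨fun j => ⟨l[j], h _ (List.getElem_mem _)⟩, by simp⟩

/-- Maps between the finite universes are replaced by functions on numbers, whose values from `D.a`
on do not matter, and tuples by lists. From here on no dependent types are involved. -/
theorem exists_isHom_iff : (∃ h, D.A.IsHom D.B h) ↔ ∃ h : ℕ → ℕ, (∀ m < D.a, h m < D.b) ∧
    ∀ r ∈ D.rels, ∀ v ∈ r.left, v.map h ∈ r.right := by
  constructor
  · rintro ⟨h, hh⟩
    replace hh : ∀ (R : Fin D.rels.length) (v : Fin (D.rels.get R).ar → Fin D.a),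
      List.ofFn (fun j => (v j : ℕ)) ∈ (D.rels.get R).left →
      List.ofFn (fun j => ((show Fin D.a → Fin D.b from h) (v j) : ℕ)) ∈ (D.rels.get R).right := hh
    set h' : Fin D.a → Fin D.b := h
    refine ⟨fun m => if hm : m < D.a then h' ⟨m, hm⟩ else 0, fun m hm => by simp [hm], ?_⟩
    intro r hr v hv
    obtain ⟨i, rfl⟩ := List.get_of_mem hr
    obtain ⟨h₁, h₂⟩ := D.left_tuple _ hr v hv
    obtain ⟨w, rfl⟩ := exists_ofFn_eq h₁ h₂
    have := hh i w hv
    simpa [List.map_ofFn, Function.comp_def] using this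
  · rintro ⟨h, hb, hh⟩
    refine ⟨fun m : Fin D.a => (⟨h m, hb m m.2⟩ : Fin D.b), fun i v hv => ?_⟩
    change Fin D.rels.length at i
    change Fin (D.rels.get i).ar → Fin D.a at v
    have := hh _ (List.get_mem D.rels i) _ ((D.mem_left_iff i v).1 hv)
    rw [List.map_ofFn] at this
    exact this

/-- The listing has no repetitions, so cardinalities, and with them the parameter, can be read off
from the code. -/
theorem ncard_rel (i : Fin D.rels.length) :
    (D.A.rel i).ncard = (D.rels.get i).left.length := by
  classical
  have hmem := List.get_mem D.rels i
  rw [← List.toFinset_card_of_nodup (D.left_nodup _ hmem), ← Set.ncard_coe_finset]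
  refine Set.ncard_congr
    (fun (v : Fin (D.rels.get i).ar → Fin D.a) _ => List.ofFn (fun j => (v j : ℕ))) ?_ ?_ ?_
  · intro v hv
    exact List.mem_toFinset.2 ((D.mem_left_iff i v).1 hv)
  · intro v w _ _ h
    funext j
    exact Fin.val_injective (congrFun (List.ofFn_injective h) j)
  · intro l hl
    have hl' : l ∈ (D.rels.get i).left := by simpa using hl
    obtain ⟨h₁, h₂⟩ := D.left_tuple _ hmem l hl'
    obtain ⟨w, rfl⟩ := exists_ofFn_eq h₁ h₂
    exact ⟨w, hl', rfl⟩

theorem size_eq : D.A.size = D.rels.length + D.a +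
    ∑ j ∈ Finset.range D.rels.length,
      (D.rels[j]?.elim 0 fun r => r.left.length * r.ar) := by
  unfold RelStr.size
  congr 1
  · congr 1
    · exact Fintype.card_fin _
    · exact Nat.card_fin _
  · rw [Finset.sum_range]
    refine Finset.sum_congr rfl fun (i : Fin D.rels.length) _ => ?_
    rw [List.getElem?_eq_getElem i.2]
    exact congrArg (· * _) (D.ncard_rel i)

/-- The left structure is, up to names, the structure `P_a*`, with the vertices of the path in the
order `d 0, d 1, …` and with the symbol at index `j₀` in the role of the edge relation. -/
structure IsStar (d : ℕ → ℕ) (j₀ : ℕ) : Prop where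
  two_le : 2 ≤ D.a
  length_eq : D.rels.length = D.a + 1
  lt : ∀ i < D.a, d i < D.a
  inj : ∀ i < D.a, ∀ i' < D.a, d i = d i' → i = i'
  edge : ∃ r, D.rels[j₀]? = some r ∧ r.ar = 2 ∧ ∀ i < D.a, ∀ i' < D.a,
    ([d i, d i'] ∈ r.left ↔ i + 1 = i' ∨ i' + 1 = i)
  point : ∀ i < D.a, ∃ j, j ≠ j₀ ∧ ∃ r, D.rels[j]? = some r ∧ r.ar = 1 ∧
    ∀ m < D.a, ([m] ∈ r.left ↔ m = d i)

end PairCode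

theorem ofFn_eq_two {n : ℕ} (hn : 2 = n) (v : Fin n → ℕ) :
    List.ofFn v = [v (Fin.cast hn 0), v (Fin.cast hn 1)] := by
  subst hn; simp [List.ofFn_succ]

theorem ofFn_eq_one {n : ℕ} (hn : 1 = n) (v : Fin n → ℕ) :
    List.ofFn v = [v (Fin.cast hn 0)] := by
  subst hn; simp [List.ofFn_succ]

namespace PairCode

variable {D : PairCode}

/-- The order `d` of the vertices is the inverse of the composed isomorphism from the left structure
to the path. The number of symbols is one for the edges plus one for each element. -/
theorem exists_isStar (h : paths.star D.vocabulary D.A) : ∃ d j₀, D.IsStar d j₀ := by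
  obtain ⟨σ, S, ⟨k, hk, e₁, har₁, u₁, h₁⟩, e₂, har₂, u₂, h₂⟩ := h
  have ha : D.a = k := by
    simpa using Fintype.card_congr (show Fin D.a ≃ Fin k from u₂.trans u₁)
  have hlen : D.rels.length = D.a + 1 := by
    letI := Fintype.ofFinite S.U
    have hc := Fintype.card_congr (show Fin D.rels.length ≃ σ.Symb ⊕ S.U from e₂)
    have hc₁ := Fintype.card_congr (show σ.Symb ≃ Unit from e₁)
    have hc₂ := Fintype.card_congr (show S.U ≃ Fin k from u₁)
    rw [Fintype.card_sum, hc₁, hc₂] at hc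
    simp at hc
    omega
  subst ha
  set w : Fin D.a ≃ Fin D.a := u₂.trans u₁ with hw
  set s₀ : σ.Symb := e₁.symm ()
  obtain ⟨R₀, hR₀⟩ : ∃ R₀ : Fin D.rels.length, e₂ R₀ = Sum.inl s₀ := ⟨_, e₂.apply_symm_apply _⟩
  refine ⟨fun i => if h : i < D.a then (w.symm ⟨i, h⟩ : Fin D.a) else 0, R₀, hk, hlen,
    fun i hi => by simp [hi], fun i hi i' hi' h => by
      simp only [hi, hi', dif_pos] at h
      simpa using Fin.val_injective h, ?_, ?_⟩
  -- The symbol is generalized to `S'` before it is identified: its arity occurs in the type of the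
  -- tuples, which prevents rewriting in place.
  · have key : ∀ S' : σ.Symb ⊕ S.U, S' = .inl s₀ → ∀ (hS : S.starVocabulary.ar S' =
        D.vocabulary.ar R₀), (∀ v : Fin (D.vocabulary.ar R₀) → D.A.U, v ∈ D.A.rel R₀ ↔
          (fun j => u₂ (v (Fin.cast hS j))) ∈ S.star.rel S') →
        ∃ h : 2 = (D.rels.get R₀).ar, ∀ v : Fin (D.rels.get R₀).ar → Fin D.a,
          List.ofFn (fun j => (v j : ℕ)) ∈ (D.rels.get R₀).left ↔
            (w (v (Fin.cast h 0)) : ℕ) + 1 = w (v (Fin.cast h 1)) ∨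
            (w (v (Fin.cast h 1)) : ℕ) + 1 = w (v (Fin.cast h 0)) := by
      rintro _ rfl hS hv
      have e : 2 = σ.ar s₀ := har₁ s₀
      exact ⟨e.trans hS, fun v => (hv v).trans (h₁ s₀ _)⟩
    obtain ⟨h2, hv⟩ := key _ hR₀ (har₂ R₀) (h₂ R₀)
    refine ⟨D.rels.get R₀, by simp, h2.symm, fun i hi i' hi' => ?_⟩
    have := hv fun j => w.symm (if (Fin.cast h2.symm j) = 0 then ⟨i, hi⟩ else ⟨i', hi'⟩)
    rw [ofFn_eq_two h2] at this
    simpa [hi, hi'] using this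
  · intro i hi
    obtain ⟨R, hR⟩ : ∃ R : Fin D.rels.length, e₂ R = Sum.inr (u₁.symm ⟨i, hi⟩) :=
      ⟨_, e₂.apply_symm_apply _⟩
    have key : ∀ S' : σ.Symb ⊕ S.U, S' = .inr (u₁.symm ⟨i, hi⟩) →
        ∀ (hS : S.starVocabulary.ar S' =
        D.vocabulary.ar R), (∀ v : Fin (D.vocabulary.ar R) → D.A.U, v ∈ D.A.rel R ↔
          (fun j => u₂ (v (Fin.cast hS j))) ∈ S.star.rel S') →
        ∃ h : 1 = (D.rels.get R).ar, ∀ v : Fin (D.rels.get R).ar → Fin D.a,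
          List.ofFn (fun j => (v j : ℕ)) ∈ (D.rels.get R).left ↔
            v (Fin.cast h 0) = w.symm ⟨i, hi⟩ := by
      rintro _ rfl hS hv
      refine ⟨hS, fun v => (hv v).trans ?_⟩
      show (fun _ : Fin 1 => u₂ (v _)) = (fun _ : Fin 1 => u₁.symm ⟨i, hi⟩) ↔ _
      refine funext_iff.trans ?_
      constructor
      · intro h
        rw [hw]
        have := h 0
        exact u₂.injective (this.trans (u₂.apply_symm_apply _).symm)
      · intro h j
        obtain rfl : j = 0 := Subsingleton.elim _ _
        exact (congrArg u₂ h).trans (u₂.apply_symm_apply _)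
    obtain ⟨h1, hv⟩ := key _ hR (har₂ R) (h₂ R)
    refine ⟨R, fun e => ?_, D.rels.get R, by simp, h1.symm, fun m hm => ?_⟩
    · rw [Fin.val_injective e, hR₀] at hR
      exact Sum.inl_ne_inr hR
    · have := hv fun _ => ⟨m, hm⟩
      rw [ofFn_eq_one h1] at this
      simpa [hi, Fin.ext_iff] using this

/-- The edge symbol and the chosen symbols of the points are pairwise different, since distinct
points have distinct interpretations. There are only `a + 1` symbols, so none is left over and `F`
is a bijection. -/
theorem IsStar.star {d : ℕ → ℕ} {j₀ : ℕ} (h : D.IsStar d j₀) : paths.star D.vocabulary D.A := by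
  obtain ⟨r₀, hr₀, har₀, he⟩ := h.edge
  obtain ⟨hj₀, hr₀⟩ := List.getElem?_eq_some_iff.1 hr₀
  have hpoint : ∀ i : Fin D.a, ∃ j, j ≠ j₀ ∧ ∃ r, D.rels[j]? = some r ∧ r.ar = 1 ∧
    ∀ m < D.a, ([m] ∈ r.left ↔ m = d i) := fun i => h.point i i.2
  choose f hf r hr har hp using hpoint
  have hf' : ∀ i : Fin D.a, f i < D.rels.length := fun i =>
    (List.getElem?_eq_some_iff.1 (hr i)).1
  have hr' : ∀ i : Fin D.a, D.rels.get ⟨f i, hf' i⟩ = r i := fun i =>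
    (List.getElem?_eq_some_iff.1 (hr i)).2
  set F : Unit ⊕ Fin D.a → Fin D.rels.length := Sum.elim (fun _ => ⟨j₀, hj₀⟩)
    fun i => ⟨f i, hf' i⟩ with hF
  have Finj : Function.Injective F := by
    rintro (_ | i) (_ | i') e
    · rfl
    · exact (hf i' (Fin.val_eq_of_eq e).symm).elim
    · exact (hf i (Fin.val_eq_of_eq e)).elim
    · have e₁ : f i = f i' := Fin.val_eq_of_eq e
      have e₂ : r i = r i' := by
        have := hr i
        rw [e₁, hr i'] at this
        exact (Option.some.inj this).symm
      have := (hp i _ (h.lt i i.2)).2 rfl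
      rw [e₂, hp i' _ (h.lt i i.2)] at this
      exact congrArg _ (Fin.val_injective (h.inj _ i.2 _ i'.2 this))
  have Fbij : Function.Bijective F := (Fintype.bijective_iff_injective_and_card F).2
    ⟨Finj, by simp [h.length_eq]; omega⟩
  have dbij : Function.Bijective fun i : Fin D.a => (⟨d i, h.lt i i.2⟩ : Fin D.a) :=
    Finite.injective_iff_bijective.1 fun i i' e =>
      Fin.val_injective (h.inj i i.2 i' i'.2 (Fin.val_eq_of_eq e))
  set u := Equiv.ofBijective _ dbij with hu
  have hu' : ∀ i, ((u i : Fin D.a) : ℕ) = d i := fun i => rfl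
  set e := Equiv.ofBijective F Fbij with hee
  have key : ∀ S' : Unit ⊕ Fin D.a,
      ∃ hS : (pathStr D.a h.two_le).starVocabulary.ar S' = D.vocabulary.ar (F S'),
        ∀ v : Fin (D.vocabulary.ar (F S')) → D.A.U, v ∈ D.A.rel (F S') ↔
          (fun j => u.symm (v (Fin.cast hS j))) ∈ (pathStr D.a h.two_le).star.rel S' := by
    rintro (_ | i)
    · have h2 : 2 = (D.rels.get ⟨j₀, hj₀⟩).ar := by
        rw [← har₀, ← hr₀]; rfl
      refine ⟨h2, fun v => ?_⟩
      change Fin (D.rels.get ⟨j₀, hj₀⟩).ar → Fin D.a at v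
      refine (D.mem_left_iff _ v).trans ?_
      rw [ofFn_eq_two h2]
      have := he (u.symm (v (Fin.cast h2 0))) (Fin.is_lt _) (u.symm (v (Fin.cast h2 1))) (Fin.is_lt _)
      rw [← hu', ← hu', Equiv.apply_symm_apply, Equiv.apply_symm_apply, ← hr₀] at this
      exact this
    · have h1 : 1 = (D.rels.get ⟨f i, hf' i⟩).ar := by rw [hr', har i]
      refine ⟨h1, fun v => ?_⟩
      change Fin (D.rels.get ⟨f i, hf' i⟩).ar → Fin D.a at v
      refine (D.mem_left_iff _ v).trans ?_
      rw [ofFn_eq_one h1]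
      have := hp i (v (Fin.cast h1 0)) (Fin.is_lt _)
      rw [← hu', ← hr'] at this
      refine Iff.trans this ?_
      show _ ↔ (fun _ : Fin 1 => u.symm (v _)) = (fun _ : Fin 1 => i)
      rw [funext_iff]
      constructor
      · intro h j
        obtain rfl : j = 0 := Subsingleton.elim _ _
        exact (Equiv.symm_apply_eq u).2 (Fin.val_injective h)
      · intro h
        exact congrArg Fin.val ((Equiv.symm_apply_eq u).1 (h 0))
  choose har' hv using key
  refine ⟨graphVocabulary, pathStr D.a h.two_le, ⟨D.a, h.two_le, Equiv.refl _, fun _ => rfl,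
    Equiv.refl _, fun R v => Iff.rfl⟩, e.symm, fun R => ?_, u.symm, fun R v => ?_⟩
  · have := har' (e.symm R)
    rw [show F (e.symm R) = R from e.apply_symm_apply R] at this
    exact this
  · have hR : F (e.symm R) = R := e.apply_symm_apply R
    have gen : ∀ (R' : Fin D.rels.length) (hR' : F (e.symm R) = R')
        (hc : (pathStr D.a h.two_le).starVocabulary.ar (e.symm R) = D.vocabulary.ar R')
        (v : Fin (D.vocabulary.ar R') → D.A.U), v ∈ D.A.rel R' ↔
          (fun j => u.symm (v (Fin.cast hc j))) ∈ (pathStr D.a h.two_le).star.rel (e.symm R) := by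
      rintro _ rfl hc v
      exact hv _ v
    exact gen R hR _ v

end PairCode
end ParamLog

namespace ParamLog
open NCode (enc)

/-! ## Parsing encodings in logarithmic space -/

/-- That a code occurs at position `p` of `x` is always written as `· <+: x.drop p`. Parsing then
deals with positions only, which fit into logarithmic space, whereas the parsed objects need not. -/
theorem cons_prefix_drop {b : Bool} {s x : List Bool} {p : ℕ} :
    (b :: s) <+: x.drop p ↔ x[p]? = some b ∧ s <+: x.drop (p + 1) := by
  by_cases h : p < x.length
  · rw [List.drop_eq_getElem_cons h, List.cons_prefix_cons, List.getElem?_eq_getElem h,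
      Option.some_inj, eq_comm]
  · rw [List.drop_eq_nil_of_le (by omega), List.getElem?_eq_none (by omega)]
    simp

theorem append_prefix_drop {s t x : List Bool} {p : ℕ} :
    (s ++ t) <+: x.drop p ↔ s <+: x.drop p ∧ t <+: x.drop (p + s.length) := by
  induction s generalizing p with
  | nil => simp
  | cons b s ih =>
    rw [List.cons_append, cons_prefix_drop, ih, cons_prefix_drop, List.length_cons, and_assoc]
    congr! 4
    omega

theorem add_length_le {s x : List Bool} {p : ℕ} (h : s <+: x.drop p) (hp : p ≤ x.length) :
    p + s.length ≤ x.length := by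
  have := h.length_le
  rw [List.length_drop] at this
  omega

theorem getElem?_of_prefix_drop {s x : List Bool} {p i : ℕ} (h : s <+: x.drop p)
    (hi : i < s.length) : x[p + i]? = s[i]? := by
  obtain ⟨t, ht⟩ := h
  rw [← List.getElem?_drop, ← ht, List.getElem?_append_left hi]

theorem eq_of_prefix_drop {α : Type} {e : α → List Bool} (he : Readable e) {a a' : α}
    {s : List Bool} (h : e a <+: s) (h' : e a' <+: s) : a = a' := by
  obtain ⟨t, rfl⟩ := h
  obtain ⟨t', h'⟩ := h'
  exact (he _ _ _ _ h').1.symm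

theorem lt_of_getElem? {x : List Bool} {p : ℕ} {b : Bool} (h : x[p]? = some b) : p < x.length :=
  (List.getElem?_eq_some_iff.1 h).1

theorem readInput_succ_eq_iff {x : List Bool} {p : ℕ} {b : Bool} :
    readInput x (p + 1) = .bit b ↔ x[p]? = some b := by
  simp only [readInput]
  split <;> simp_all

theorem readInput_succ_eq_readInput_succ {x : List Bool} {p q : ℕ} :
    readInput x (p + 1) = readInput x (q + 1) ↔ x[p]? = x[q]? := by
  simp only [readInput]
  cases x[p]? <;> cases x[q]? <;> simp

theorem of_lt_leastLt {n i : ℕ} {p : ℕ → Prop} (h : i < leastLt n p) : ¬ p i := by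
  by_cases hex : ∃ i < n, p i
  · exact (leastLt_spec hex).2.2 i h
  · push Not at hex
    exact hex i (h.trans_le (leastLt_le _ _))

section

variable {α β γ : Type} [NCode β] [NCode γ]

theorem LS.getElem?_eq {f : List Bool → β → ℕ} (hf : LS f) (b : Bool) :
    LSP fun x a => x[f x a]? = some b :=
  ((hf.add (.const 1)).readInput.eq (.const (InSym.bit b))).congr
    fun x a => readInput_succ_eq_iff

theorem LS.getElem?_eq_bool {f : List Bool → β → ℕ} {g : List Bool → β → Bool} (hf : LS f)
    (hg : LS g) : LSP fun x a => x[f x a]? = some (g x a) :=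
  (((hg.eq (.const true)).and (hf.getElem?_eq true)).or
    ((hg.eq (.const false)).and (hf.getElem?_eq false))).congr fun x a => by
      cases g x a <;> simp

theorem LS.getElem?_eq_getElem? {f g : List Bool → β → ℕ} (hf : LS f) (hg : LS g) :
    LSP fun x a => x[f x a]? = x[g x a]? :=
  ((hf.add (.const 1)).readInput.eq (hg.add (.const 1)).readInput).congr
    fun x a => readInput_succ_eq_readInput_succ

theorem LS.size {f : List Bool → β → ℕ} (hf : LS f) : LS fun x a => (f x a).size := by
  classical
  refine (LS.ite (hf.eq (.const 0)) (.const 0) (hf.log2.add (.const 1))).congr fun x a => ?_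
  split
  · simp [*]
  · rename_i h
    refine le_antisymm (Nat.lt_size.2 (Nat.pow_log_le_self 2 h)) ?_
    exact Nat.size_le.2 (Nat.lt_pow_succ_log_self (by norm_num) _)

end

/-! ### Reading strings and binary numbers at a given position -/

theorem encStr_prefix_drop {s x : List Bool} {p : ℕ} : encStr s <+: x.drop p ↔
    (∀ i < s.length, x[p + 2 * i]? = some true ∧ x[p + 2 * i + 1]? = s[i]?) ∧
      x[p + 2 * s.length]? = some false := by
  induction s generalizing p with
  | nil => simp [encStr, encList, cons_prefix_drop]
  | cons b s ih =>
    have : encStr (b :: s) = true :: b :: encStr s := by simp [encStr, encList]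
    rw [this, cons_prefix_drop, cons_prefix_drop, ih]
    constructor
    · rintro ⟨h₁, h₂, h₃, h₄⟩
      refine ⟨fun i hi => ?_, ?_⟩
      · rcases i with _ | i
        · exact ⟨h₁, by simpa using h₂⟩
        · have := h₃ i (by simpa using hi)
          rw [show p + 2 * (i + 1) = p + 1 + 1 + 2 * i by ring]
          simpa using this
      · rw [List.length_cons, show p + 2 * (s.length + 1) = p + 1 + 1 + 2 * s.length by ring]
        exact h₄
    · rintro ⟨h₁, h₂⟩
      have h0 := h₁ 0 (by simp)
      refine ⟨h0.1, by simpa using h0.2, fun i hi => ?_, ?_⟩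
      · have := h₁ (i + 1) (by simpa using hi)
        rw [show p + 2 * (i + 1) = p + 1 + 1 + 2 * i by ring] at this
        simpa using this
      · rw [List.length_cons, show p + 2 * (s.length + 1) = p + 1 + 1 + 2 * s.length by ring] at h₂
        exact h₂

theorem length_encStr (s : List Bool) : (encStr s).length = 2 * s.length + 1 := by
  induction s with
  | nil => rfl
  | cons b s ih =>
    have : encStr (b :: s) = true :: b :: encStr s := by simp [encStr, encList]
    simp only [this, List.length_cons, ih]
    ring

theorem length_bits (n : ℕ) : n.bits.length = n.size := by rw [Nat.size_eq_bits_len]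

theorem length_encNat (n : ℕ) : (encNat n).length = 2 * n.size + 1 := by
  rw [encNat, length_encStr, length_bits]

theorem getElem?_bits {n i : ℕ} (h : i < n.size) : n.bits[i]? = some (n.testBit i) := by
  rw [← length_bits] at h
  rw [Nat.testBit_eq_inth, List.getElem?_eq_getElem h, List.getI_eq_getElem _ h]

section

variable {β : Type} [NCode β]

theorem LSP.encNat_prefix {f g : List Bool → β → ℕ} (hf : LS f) (hg : LS g) :
    LSP fun x a => encNat (f x a) <+: x.drop (g x a) := by
  have h₁ : LSP fun x a => ∀ i < (f x a).size,
      x[g x a + 2 * i]? = some true ∧ x[g x a + 2 * i + 1]? = some ((f x a).testBit i) := by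
    refine hf.size.allLt (p := fun x a i => x[g x a + 2 * i]? = some true ∧
      x[g x a + 2 * i + 1]? = some ((f x a).testBit i)) ?_
    have hp : LS fun x (q : β × ℕ) => g x q.1 + 2 * q.2 :=
      (hg.comp LS.id.fst).add ((LS.const 2).mul LS.id.snd)
    exact (hp.getElem?_eq true).and ((hp.add (.const 1)).getElem?_eq_bool
      ((hf.comp LS.id.fst).testBit LS.id.snd))
  refine (h₁.and ((hg.add ((LS.const 2).mul hf.size)).getElem?_eq false)).congr fun x a => ?_
  rw [encNat, encStr_prefix_drop, length_bits]
  refine and_congr_left fun _ => forall_congr' fun i => forall_congr' fun hi => ?_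
  rw [getElem?_bits hi]

theorem LS.length_encNat {f : List Bool → β → ℕ} (hf : LS f) :
    LS fun x a => (encNat (f x a)).length :=
  (((LS.const 2).mul hf.size).add (.const 1)).congr fun x a => (ParamLog.length_encNat _).symm

end

/-- A logspace parser for the encoding `e`, restricted to the objects that satisfy `V c`. From a
position `p` it finds the end of the encoding that begins there; it gives `|x| + 1` if there is
none. -/
structure Parser {α β : Type} [NCode β] (e : α → List Bool) (V : β → α → Prop) where
  next : List Bool → β × ℕ → ℕ
  ls : LS next
  le : ∀ x q, next x q ≤ x.length + 1
  complete : ∀ x c p a, p ≤ x.length → V c a → e a <+: x.drop p → next x (c, p) = p + (e a).length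
  sound : ∀ x c p, next x (c, p) ≤ x.length → ∃ a, V c a ∧ e a <+: x.drop p ∧
    next x (c, p) = p + (e a).length

namespace Parser

variable {α β γ : Type} [NCode β] [NCode γ] {e : α → List Bool} {V : β → α → Prop}

/-- Restriction of a parser to the objects with a further property. -/
noncomputable def refine (P : Parser e V) {W : β → α → Prop} (Q : List Bool → β × ℕ → Prop)
    (hQ : LSP Q) (h : ∀ x c p a, p ≤ x.length → V c a → e a <+: x.drop p → (Q x (c, p) ↔ W c a)) :
    Parser e fun c a => V c a ∧ W c a := by
  classical
  exact
  { next := fun x q => if Q x q then P.next x q else x.length + 1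
    ls := LS.ite hQ P.ls (LS.length.add (.const 1))
    le := fun x q => by
      show (if _ then _ else _) ≤ _
      split
      exacts [P.le x q, le_rfl]
    complete := fun x c p a hp hV he => by
      rw [if_pos ((h x c p a hp hV.1 he).2 hV.2), P.complete x c p a hp hV.1 he]
    sound := fun x c p hn => by
      split_ifs at hn ⊢ with hQ'
      · obtain ⟨a, h₁, h₂, h₃⟩ := P.sound x c p hn
        exact ⟨a, ⟨h₁, (h x c p a (by omega) h₁ h₂).1 hQ'⟩, h₂, h₃⟩
      · omega }

/-- Change of the parameter. -/
def comap (P : Parser e V) (f : γ → β) (hf : LS fun _ c => f c) :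
    Parser e fun c a => V (f c) a where
  next := fun x q => P.next x (f q.1, q.2)
  ls := P.ls.comp ((hf.comp LS.id.fst).pair LS.id.snd)
  le := fun x q => P.le x _
  complete := fun x c p a => P.complete x (f c) p a
  sound := fun x c p => P.sound x (f c) p

section List

variable (P : Parser e V)

/-- The position after one further entry of a list. -/
noncomputable def stepL (x : List Bool) (c : β) (p : ℕ) : ℕ :=
  open Classical in if x[p]? = some true then P.next x (c, p + 1) else x.length + 1

/-- The position in front of the `k`th entry of the list that begins at `p`. -/
noncomputable def pos (x : List Bool) (c : β) (p k : ℕ) : ℕ := (P.stepL x c)^[k] p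

/-- The number of entries of the list that begins at `p`. -/
noncomputable def cnt (x : List Bool) (q : β × ℕ) : ℕ :=
  leastLt (x.length + 1) fun k => ¬ x[P.pos x q.1 q.2 k]? = some true

variable {P}

theorem stepL_bad (x : List Bool) (c : β) {p : ℕ} (hp : x.length ≤ p) :
    P.stepL x c p = x.length + 1 := by
  simp [stepL, List.getElem?_eq_none hp]

/-- Failure is absorbing: behind the end of the input there is no bit, so the position `|x| + 1` is
never left. One final test therefore detects a failure at any entry. -/
theorem pos_bad (x : List Bool) (c : β) (k : ℕ) :
    P.pos x c (x.length + 1) k = x.length + 1 := by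
  induction k with
  | zero => rfl
  | succ k ih => rw [pos, Function.iterate_succ_apply', ← pos, ih, stepL_bad x c (by omega)]

theorem pos_succ' (x : List Bool) (c : β) (p k : ℕ) :
    P.pos x c p (k + 1) = P.stepL x c (P.pos x c p k) := Function.iterate_succ_apply' ..

theorem pos_succ (x : List Bool) (c : β) (p k : ℕ) :
    P.pos x c p (k + 1) = P.pos x c (P.stepL x c p) k := rfl

theorem ls_stepL : LS fun x (q : β × ℕ) => P.stepL x q.1 q.2 := by
  classical
  unfold stepL
  refine (LS.ite (LS.id.snd.getElem?_eq true)
    (P.ls.comp (LS.id.fst.pair (LS.id.snd.add (.const 1))))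
    (LS.length.add (.const 1))).congr fun x a => ?_
  congr

theorem stepL_le (x : List Bool) (c : β) (p : ℕ) : P.stepL x c p ≤ x.length + 1 := by
  unfold stepL
  split
  exacts [P.le _ _, le_rfl]

theorem ls_pos : LS fun x (q : (β × ℕ) × ℕ) => P.pos x q.1.1 q.1.2 q.2 := by
  have : LS fun x (q : (β × ℕ) × ℕ) => (P.stepL x q.1.1)^[q.2] q.1.2 := by
    refine LS.iterate (h := fun x (q : (β × ℕ) × ℕ) => P.stepL x q.1.1) LS.id.fst.snd
      (P.ls_stepL.comp (LS.id.fst.fst.fst.pair LS.id.snd)) LS.id.snd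
      (b := fun x (q : (β × ℕ) × ℕ) => q.1.2 + (x.length + 1))
      (LS.id.fst.snd.add (LS.length.add (.const 1))) fun x q i _ => ?_
    rcases i with _ | i
    · exact Nat.le_add_right _ _
    · rw [Function.iterate_succ_apply']
      exact (P.stepL_le x _ _).trans (Nat.le_add_left _ _)
  exact this

theorem ls_cnt : LS P.cnt := by
  unfold cnt
  exact LS.least (p := fun x (q : β × ℕ) k => ¬ x[P.pos x q.1 q.2 k]? = some true)
    (LS.length.add (.const 1)) (P.ls_pos.getElem?_eq true).not

/-- Every entry costs at least one bit, and so does the end of the list. Hence the search for the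
number of entries may be bounded by the length of the input. -/
theorem length_le_length_encList (l : List α) : l.length < (encList e l).length := by
  induction l with
  | nil => simp [encList]
  | cons a l ih => simp only [encList, List.length_cons, List.length_append]; omega

theorem pos_spec {x : List Bool} {c : β} {p : ℕ} {l : List α} (hp : p ≤ x.length)
    (hl : ∀ a ∈ l, V c a) (h : encList e l <+: x.drop p) {k : ℕ} (hk : k ≤ l.length) :
    P.pos x c p k ≤ x.length ∧ encList e (l.drop k) <+: x.drop (P.pos x c p k) ∧
      P.pos x c p k + (encList e (l.drop k)).length = p + (encList e l).length := by
  induction k with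
  | zero => exact ⟨hp, h, rfl⟩
  | succ k ih =>
    obtain ⟨h₁, h₂, h₃⟩ := ih (by omega)
    rw [List.drop_eq_getElem_cons hk, encList, cons_prefix_drop, append_prefix_drop] at h₂
    obtain ⟨h₄, h₅, h₆⟩ := h₂
    have h₇ := P.complete x c _ _ (lt_of_getElem? h₄) (hl _ (List.getElem_mem hk)) h₅
    rw [pos_succ', stepL, if_pos h₄, h₇]
    refine ⟨add_length_le h₅ (lt_of_getElem? h₄), h₆, ?_⟩
    rw [List.drop_eq_getElem_cons hk, encList] at h₃
    simp only [List.length_cons, List.length_append] at h₃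
    omega

theorem getElem_spec {x : List Bool} {c : β} {p : ℕ} {l : List α} (hp : p ≤ x.length)
    (hl : ∀ a ∈ l, V c a) (h : encList e l <+: x.drop p) {k : ℕ} (hk : k < l.length) :
    x[P.pos x c p k]? = some true ∧ e l[k] <+: x.drop (P.pos x c p k + 1) := by
  obtain ⟨-, h₂, -⟩ := P.pos_spec hp hl h hk.le
  rw [List.drop_eq_getElem_cons hk, encList, cons_prefix_drop, append_prefix_drop] at h₂
  exact ⟨h₂.1, h₂.2.1⟩

theorem cnt_spec {x : List Bool} {c : β} {p : ℕ} {l : List α} (hp : p ≤ x.length)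
    (hl : ∀ a ∈ l, V c a) (h : encList e l <+: x.drop p) : P.cnt x (c, p) = l.length := by
  refine leastLt_eq ?_ ?_ fun k hk => not_not.2 (P.getElem_spec hp hl h hk).1
  · have := add_length_le h hp
    have := length_le_length_encList (e := e) l
    omega
  · obtain ⟨-, h₂, -⟩ := P.pos_spec hp hl h le_rfl
    rw [List.drop_length, encList, cons_prefix_drop] at h₂
    simp [h₂.1]

/-- If the parser failed at some entry, all later positions would be `|x| + 1`, where the closing
bit cannot be read. So all entries before the closing bit have been parsed correctly. -/
theorem exists_list {x : List Bool} {c : β} {p k : ℕ}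
    (h : ∀ i < k, x[P.pos x c p i]? = some true) (h' : x[P.pos x c p k]? = some false) :
    ∃ l : List α, (∀ a ∈ l, V c a) ∧ encList e l <+: x.drop p ∧
      P.pos x c p k + 1 = p + (encList e l).length := by
  induction k generalizing p with
  | zero => exact ⟨[], by simp, by simpa [encList, cons_prefix_drop, pos] using h', rfl⟩
  | succ k ih =>
    have h0 : x[p]? = some true := h 0 (by omega)
    have hle : P.stepL x c p ≤ x.length := by
      by_contra hc
      have := P.stepL_le x c p
      rw [pos_succ, show P.stepL x c p = x.length + 1 by omega, pos_bad,
        List.getElem?_eq_none (by omega)] at h'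
      cases h'
    obtain ⟨l, h₁, h₂, h₃⟩ := ih (p := P.stepL x c p) (fun i hi => h (i + 1) (by omega)) h'
    have e₁ : P.stepL x c p = P.next x (c, p + 1) := by rw [stepL, if_pos h0]
    rw [e₁] at hle
    obtain ⟨a, h₄, h₅, h₆⟩ := P.sound x c (p + 1) hle
    rw [← e₁] at h₆
    refine ⟨a :: l, by simpa using ⟨h₄, h₁⟩, ?_, ?_⟩
    · rw [encList, cons_prefix_drop, append_prefix_drop, ← h₆]
      exact ⟨h0, h₅, h₂⟩
    · rw [pos_succ, h₃, h₆]
      simp only [encList, List.length_cons, List.length_append]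
      omega

variable (P) in
/-- The parser for lists. -/
noncomputable def list : Parser (encList e) fun c l => ∀ a ∈ l, V c a := by
  classical
  exact
  { next := fun x q => if x[P.pos x q.1 q.2 (P.cnt x q)]? = some false
      then P.pos x q.1 q.2 (P.cnt x q) + 1 else x.length + 1
    ls := by
      have := P.ls_pos.comp (LS.id.pair P.ls_cnt)
      exact LS.ite (this.getElem?_eq false) (this.add (.const 1)) (LS.length.add (.const 1))
    le := fun x q => by
      show (if _ then _ else _) ≤ _
      split
      · rename_i h
        exact Nat.succ_le_succ (lt_of_getElem? h).le
      · exact le_rfl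
    complete := fun x c p l hp hl h => by
      dsimp only
      rw [P.cnt_spec hp hl h]
      obtain ⟨-, h₂, h₃⟩ := P.pos_spec hp hl h le_rfl
      rw [List.drop_length, encList, cons_prefix_drop] at h₂
      rw [if_pos h₂.1, ← h₃, List.drop_length, encList]
      rfl
    sound := fun x c p hn => by
      dsimp only at hn ⊢
      split_ifs at hn ⊢ with hf
      · exact P.exists_list (fun i hi => not_not.1 (of_lt_leastLt hi)) hf
      · omega }

end List

end Parser

end ParamLog

namespace ParamLog
open NCode (enc)

/-! ## Parsing pairs of structures -/

/-- A number in unary is a list of entries with empty codes, so the parser for lists also serves for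
unary numbers. -/
theorem encUnary_eq (n : ℕ) : encUnary n = encList (fun _ : Unit => []) (List.replicate n ()) := by
  induction n with
  | zero => rfl
  | succ n ih =>
    rw [List.replicate_succ, encList, ← ih, List.nil_append, encUnary, encUnary,
      List.replicate_succ, List.cons_append]

/-- The parser for empty encodings. -/
def unitParser : Parser (fun _ : Unit => []) fun (_ : ℕ) _ => True where
  next := fun x q => min q.2 (x.length + 1)
  ls := by
    have h : LS fun x (q : ℕ × ℕ) => q.2 - (q.2 - (x.length + 1)) :=
      LS.id.snd.sub (LS.id.snd.sub (LS.length.add (.const 1)))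
    exact h.congr fun x q => by omega
  le := fun x q => min_le_right _ _
  complete := fun x c p a hp _ _ => by simp; omega
  sound := fun x c p h => ⟨(), trivial, List.nil_prefix, by
    simp only [min_le_iff] at h; simp; omega⟩

/-- The parser for numbers in unary. -/
noncomputable def unaryParser : Parser encUnary fun (_ : ℕ) _ => True where
  next := unitParser.list.next
  ls := unitParser.list.ls
  le := unitParser.list.le
  complete := fun x c p n hp _ h => by
    rw [encUnary_eq] at h ⊢
    exact unitParser.list.complete x c p _ hp (fun _ _ => trivial) h
  sound := fun x c p hn => by
    obtain ⟨l, -, h₂, h₃⟩ := unitParser.list.sound x c p hn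
    obtain ⟨n, rfl⟩ : ∃ n, l = List.replicate n () :=
      ⟨l.length, List.eq_replicate_iff.2 ⟨rfl, fun _ _ => rfl⟩⟩
    exact ⟨n, trivial, by rwa [encUnary_eq], by rwa [encUnary_eq]⟩

/-- The value of the number in unary at a given position. -/
noncomputable def unaryAt (x : List Bool) (p : ℕ) : ℕ := unitParser.cnt x (0, p)

theorem unaryAt_eq {x : List Bool} {p n : ℕ} (hp : p ≤ x.length) (h : encUnary n <+: x.drop p) :
    unaryAt x p = n := by
  rw [encUnary_eq] at h
  rw [unaryAt, unitParser.cnt_spec hp (fun _ _ => trivial) h, List.length_replicate]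

/-- The parser for numbers below a bound, in binary. -/
noncomputable def entryParser : Parser encNat fun (c : ℕ) m => m < c := by
  classical
  exact
  { next := fun x q =>
      -- The number is found by search below the given bound. Without a bound, a code of length up
      -- to `|x|` could stand for a number too large for the registers.
      let m := leastLt q.1 fun m => encNat m <+: x.drop q.2
      if m < q.1 ∧ q.2 + (encNat m).length ≤ x.length then q.2 + (encNat m).length else x.length + 1
    ls := by
      have h : LS fun x (q : ℕ × ℕ) => leastLt q.1 fun m => encNat m <+: x.drop q.2 :=
        LS.least (p := fun x (q : ℕ × ℕ) m => encNat m <+: x.drop q.2) LS.id.fst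
          (LSP.encNat_prefix LS.id.snd LS.id.fst.snd)
      have h' := LS.id.snd.add h.length_encNat
      exact LS.ite ((h.lt LS.id.fst).and (h'.le LS.length)) h' (LS.length.add (.const 1))
    le := fun x q => by
      dsimp only
      split_ifs <;> omega
    complete := fun x c p m hp hm h => by
      have he : leastLt c (fun m => encNat m <+: x.drop p) = m :=
        leastLt_eq hm h fun j hj h' => hj.ne (eq_of_prefix_drop readable_encNat h' h)
      dsimp only
      rw [he, if_pos ⟨hm, add_length_le h hp⟩]
    sound := fun x c p hn => by
      dsimp only at hn ⊢
      split_ifs at hn ⊢ with hm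
      · refine ⟨_, hm.1, ?_, rfl⟩
        by_contra hc
        have : ∀ i < c, ¬ encNat i <+: x.drop p := by
          intro i hi h
          exact hc (leastLt_spec (p := fun m => encNat m <+: x.drop p) ⟨i, hi, h⟩).2.1
        rw [leastLt_of_forall this] at hm
        exact absurd hm.1 (lt_irrefl _)
      · omega }

/-- The parser for tuples of a given length. -/
noncomputable def tupleParser : Parser (encList encNat)
    fun (c : ℕ × ℕ) v => (∀ m ∈ v, m < c.1) ∧ v.length = c.2 :=
  (entryParser.list.comap Prod.fst LS.id.fst).refine
    (fun x q => entryParser.cnt x (q.1.1, q.2) = q.1.2)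
    ((entryParser.ls_cnt.comp (LS.id.fst.fst.pair LS.id.snd)).eq LS.id.fst.snd)
    fun x c p v hp hv h => by rw [entryParser.cnt_spec hp hv h]

theorem readable_tuple : Readable (encList encNat) := readable_encList readable_encNat

/-- The position of an entry of a list of tuples of length `k` over `0, …, c - 1`, for
`q = ((c, k), p)` and a list at position `p`. -/
noncomputable def tuplePos (x : List Bool) (q : (ℕ × ℕ) × ℕ) (i : ℕ) : ℕ :=
  tupleParser.pos x q.1 q.2 i + 1

/-- Two tuples of the list are equal. -/
def SameTuple (x : List Bool) (q : (ℕ × ℕ) × ℕ) (i i' : ℕ) : Prop :=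
  tupleParser.next x (q.1, tuplePos x q i) - tuplePos x q i =
      tupleParser.next x (q.1, tuplePos x q i') - tuplePos x q i' ∧
    ∀ j < tupleParser.next x (q.1, tuplePos x q i) - tuplePos x q i,
      x[tuplePos x q i + j]? = x[tuplePos x q i' + j]?

section

variable {x : List Bool} {q : (ℕ × ℕ) × ℕ} {l : List (List ℕ)}

theorem tuple_spec (hp : q.2 ≤ x.length) (hl : ∀ v ∈ l, (∀ m ∈ v, m < q.1.1) ∧ v.length = q.1.2)
    (h : encTuples l <+: x.drop q.2) {i : ℕ} (hi : i < l.length) :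
    encList encNat l[i] <+: x.drop (tuplePos x q i) ∧
      tupleParser.next x (q.1, tuplePos x q i) = tuplePos x q i + (encList encNat l[i]).length := by
  obtain ⟨h₁, h₂⟩ := tupleParser.getElem_spec hp hl h hi
  exact ⟨h₂, tupleParser.complete x _ _ _ (lt_of_getElem? h₁) (hl _ (List.getElem_mem hi)) h₂⟩

/-- Tuples may be too long to be stored, so their codes are compared bit by bit; by unique
readability this amounts to comparing the tuples. -/
theorem sameTuple_iff (hp : q.2 ≤ x.length)
    (hl : ∀ v ∈ l, (∀ m ∈ v, m < q.1.1) ∧ v.length = q.1.2)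
    (h : encTuples l <+: x.drop q.2) {i i' : ℕ} (hi : i < l.length) (hi' : i' < l.length) :
    SameTuple x q i i' ↔ l[i] = l[i'] := by
  obtain ⟨h₁, h₂⟩ := tuple_spec hp hl h hi
  obtain ⟨h₃, h₄⟩ := tuple_spec hp hl h hi'
  have e : encList encNat l[i] = encList encNat l[i'] ↔ l[i] = l[i'] :=
    ⟨fun e => (readable_tuple _ _ [] [] (by simpa using e)).1, fun e => by rw [e]⟩
  rw [← e, SameTuple, h₂, h₄, Nat.add_sub_cancel_left, Nat.add_sub_cancel_left]
  constructor
  · rintro ⟨h₅, h₆⟩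
    refine List.ext_getElem? fun j => ?_
    by_cases hj : j < (encList encNat l[i]).length
    · rw [← getElem?_of_prefix_drop h₁ hj, h₆ j hj, getElem?_of_prefix_drop h₃ (h₅ ▸ hj)]
    · rw [List.getElem?_eq_none (by omega), List.getElem?_eq_none (by omega)]
  · intro e
    refine ⟨by rw [e], fun j hj => ?_⟩
    rw [getElem?_of_prefix_drop h₁ hj, getElem?_of_prefix_drop h₃ (e ▸ hj), e]

end

theorem LS.tuplePos {β : Type} [NCode β] {q : List Bool → β → (ℕ × ℕ) × ℕ}
    {i : List Bool → β → ℕ} (hq : LS q) (hi : LS i) :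
    LS fun x a => tuplePos x (q x a) (i x a) := by
  have := (tupleParser.ls_pos.comp ((hq.fst.pair hq.snd).pair hi)).add (.const 1)
  exact this

theorem lsp_sameTuple : LSP fun x (q : ((ℕ × ℕ) × ℕ) × ℕ × ℕ) => SameTuple x q.1 q.2.1 q.2.2 := by
  have h₁ : LS fun x (q : ((ℕ × ℕ) × ℕ) × ℕ × ℕ) => tuplePos x q.1 q.2.1 :=
    LS.id.fst.tuplePos LS.id.snd.fst
  have h₂ : LS fun x (q : ((ℕ × ℕ) × ℕ) × ℕ × ℕ) => tuplePos x q.1 q.2.2 :=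
    LS.id.fst.tuplePos LS.id.snd.snd
  have h₃ : LS fun x (q : ((ℕ × ℕ) × ℕ) × ℕ × ℕ) =>
      tupleParser.next x (q.1.1, tuplePos x q.1 q.2.1) - tuplePos x q.1 q.2.1 :=
    (tupleParser.ls.comp (LS.id.fst.fst.pair h₁)).sub h₁
  have h₄ : LS fun x (q : ((ℕ × ℕ) × ℕ) × ℕ × ℕ) =>
      tupleParser.next x (q.1.1, tuplePos x q.1 q.2.2) - tuplePos x q.1 q.2.2 :=
    (tupleParser.ls.comp (LS.id.fst.fst.pair h₂)).sub h₂
  have h₅ : LSP fun x (r : (((ℕ × ℕ) × ℕ) × ℕ × ℕ) × ℕ) =>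
      x[tuplePos x r.1.1 r.1.2.1 + r.2]? = x[tuplePos x r.1.1 r.1.2.2 + r.2]? :=
    ((h₁.comp LS.id.fst).add LS.id.snd).getElem?_eq_getElem? ((h₂.comp LS.id.fst).add LS.id.snd)
  exact (h₃.eq h₄).and (h₃.allLt (p := fun x (q : ((ℕ × ℕ) × ℕ) × ℕ × ℕ) j =>
    x[tuplePos x q.1 q.2.1 + j]? = x[tuplePos x q.1 q.2.2 + j]?) h₅)

/-- The parser for lists of distinct tuples. -/
noncomputable def tuplesParser : Parser encTuples
    fun (c : ℕ × ℕ) l => (∀ v ∈ l, (∀ m ∈ v, m < c.1) ∧ v.length = c.2) ∧ l.Nodup :=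
  tupleParser.list.refine
    (fun x q => ∀ i < tupleParser.cnt x q, ∀ i' < i, ¬ SameTuple x q i i')
    (by
      refine tupleParser.ls_cnt.allLt (p := fun x (q : (ℕ × ℕ) × ℕ) i =>
        ∀ i' < i, ¬ SameTuple x q i i') ?_
      refine LS.id.snd.allLt (p := fun x (q : ((ℕ × ℕ) × ℕ) × ℕ) i' =>
        ¬ SameTuple x q.1 q.2 i') ?_
      exact (lsp_sameTuple.comp (LS.id.fst.fst.pair (LS.id.fst.snd.pair LS.id.snd))).not)
    fun x c p l hp hl h => by
      rw [tupleParser.cnt_spec hp hl h, List.nodup_iff_pairwise_ne, List.pairwise_iff_getElem]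
      constructor
      · intro hn i j hi hj hij e
        exact hn j hj i hij ((sameTuple_iff (q := (c, p)) hp hl h hj hi).2 e.symm)
      · intro hn i hi i' hi' e
        exact hn i' i (hi'.trans hi) hi hi' ((sameTuple_iff (q := (c, p)) hp hl h hi _).1 e).symm

/-- The tuple `v` occurs in the list of tuples described by `q`. -/
def TupleMem (x : List Bool) (q : (ℕ × ℕ) × ℕ) (v : List ℕ) : Prop :=
  ∃ i < tupleParser.cnt x q, encList encNat v <+: x.drop (tuplePos x q i)

theorem tupleMem_iff {x : List Bool} {q : (ℕ × ℕ) × ℕ} {l : List (List ℕ)} (hp : q.2 ≤ x.length)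
    (hl : ∀ v ∈ l, (∀ m ∈ v, m < q.1.1) ∧ v.length = q.1.2)
    (h : encTuples l <+: x.drop q.2) {v : List ℕ} : TupleMem x q v ↔ v ∈ l := by
  rw [TupleMem, show q = (q.1, q.2) from rfl, tupleParser.cnt_spec hp hl h, List.mem_iff_getElem]
  constructor
  · rintro ⟨i, hi, hv⟩
    exact ⟨i, hi, eq_of_prefix_drop readable_tuple (tuple_spec hp hl h hi).1 hv⟩
  · rintro ⟨i, hi, rfl⟩
    exact ⟨i, hi, (tuple_spec hp hl h hi).1⟩

section

variable {β : Type} [NCode β] {q : List Bool → β → (ℕ × ℕ) × ℕ} {f g : List Bool → β → ℕ}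

/-- Membership has to be decided for tuples of length one and two only, since coloured paths have no
relations of other arities. -/
theorem LSP.tupleMem_one (hq : LS q) (hf : LS f) : LSP fun x a => TupleMem x (q x a) [f x a] := by
  refine (tupleParser.ls_cnt.comp hq).exLt (p := fun x a i =>
    encList encNat [f x a] <+: x.drop (tuplePos x (q x a) i)) ?_
  have hp := (hq.comp LS.id.fst).tuplePos (LS.id (α := β × ℕ)).snd
  have h := (hf.comp (LS.id (α := β × ℕ)).fst)
  refine ((hp.getElem?_eq true).and ((LSP.encNat_prefix h (hp.add (.const 1))).and
    (((hp.add (.const 1)).add h.length_encNat).getElem?_eq false))).congr fun x a => ?_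
  simp [encList, cons_prefix_drop, append_prefix_drop]

theorem LSP.tupleMem_two (hq : LS q) (hf : LS f) (hg : LS g) :
    LSP fun x a => TupleMem x (q x a) [f x a, g x a] := by
  refine (tupleParser.ls_cnt.comp hq).exLt (p := fun x a i =>
    encList encNat [f x a, g x a] <+: x.drop (tuplePos x (q x a) i)) ?_
  have hp := (hq.comp LS.id.fst).tuplePos (LS.id (α := β × ℕ)).snd
  have h := (hf.comp (LS.id (α := β × ℕ)).fst)
  have h' := (hg.comp (LS.id (α := β × ℕ)).fst)
  have hp₁ := (hp.add (.const 1)).add h.length_encNat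
  have hp₂ := (hp₁.add (.const 1)).add h'.length_encNat
  refine ((hp.getElem?_eq true).and ((LSP.encNat_prefix h (hp.add (.const 1))).and
    ((hp₁.getElem?_eq true).and ((LSP.encNat_prefix h' (hp₁.add (.const 1))).and
      (hp₂.getElem?_eq false))))).congr fun x a => ?_
  simp [encList, cons_prefix_drop, append_prefix_drop]

end

/-- The conditions on a relation symbol in a pair of structures on `a` and `b` elements. -/
def RelCode.Valid (c : ℕ × ℕ) (r : RelCode) : Prop :=
  ((∀ v ∈ r.left, (∀ m ∈ v, m < c.1) ∧ v.length = r.ar) ∧ r.left.Nodup) ∧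
    ((∀ v ∈ r.right, (∀ m ∈ v, m < c.2) ∧ v.length = r.ar) ∧ r.right.Nodup)

/-- The parameters and the position of the list of the tuples on the left side, for a relation
symbol encoded at position `q.2`. -/
noncomputable def leftList (x : List Bool) (q : (ℕ × ℕ) × ℕ) : (ℕ × ℕ) × ℕ :=
  ((q.1.1, unaryAt x q.2), unaryParser.next x (0, q.2))

/-- The same for the right side. -/
noncomputable def rightList (x : List Bool) (q : (ℕ × ℕ) × ℕ) : (ℕ × ℕ) × ℕ :=
  ((q.1.2, unaryAt x q.2), tuplesParser.next x (leftList x q))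

theorem ls_unaryAt : LS unaryAt := unitParser.ls_cnt.comp ((LS.const 0).pair LS.id)

theorem ls_leftList : LS leftList :=
  (LS.id.fst.fst.pair (ls_unaryAt.comp LS.id.snd)).pair
    (unaryParser.ls.comp ((LS.const 0).pair LS.id.snd))

theorem ls_rightList : LS rightList :=
  (LS.id.fst.snd.pair (ls_unaryAt.comp LS.id.snd)).pair (tuplesParser.ls.comp ls_leftList)

theorem RelCode.spec {x : List Bool} {c : ℕ × ℕ} {p : ℕ} {r : RelCode} (hp : p ≤ x.length)
    (hr : r.Valid c) (h : r.encode <+: x.drop p) :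
    unaryAt x p = r.ar ∧
    ((leftList x (c, p)).2 ≤ x.length ∧ (leftList x (c, p)).1 = (c.1, r.ar) ∧
      encTuples r.left <+: x.drop (leftList x (c, p)).2) ∧
    ((rightList x (c, p)).2 ≤ x.length ∧ (rightList x (c, p)).1 = (c.2, r.ar) ∧
      encTuples r.right <+: x.drop (rightList x (c, p)).2) ∧
    tuplesParser.next x (rightList x (c, p)) = p + r.encode.length := by
  rw [RelCode.encode, List.append_assoc, append_prefix_drop, append_prefix_drop] at h
  obtain ⟨h₁, h₂, h₃⟩ := h
  have e₁ := unaryAt_eq hp h₁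
  have e₂ := unaryParser.complete x 0 p r.ar hp trivial h₁
  have l₁ := add_length_le h₁ hp
  have eL : leftList x (c, p) = ((c.1, r.ar), p + (encUnary r.ar).length) := by
    rw [leftList, e₁, e₂]
  have e₃ := tuplesParser.complete x (c.1, r.ar) _ _ l₁ hr.1 h₂
  have l₂ := add_length_le h₂ l₁
  have eR : rightList x (c, p) =
      ((c.2, r.ar), p + (encUnary r.ar).length + (encTuples r.left).length) := by
    rw [rightList, e₁, eL, e₃]
  have e₄ := tuplesParser.complete x (c.2, r.ar) _ _ l₂ hr.2 h₃
  rw [eL, eR, e₄]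
  refine ⟨e₁, ⟨l₁, rfl, h₂⟩, ⟨l₂, rfl, h₃⟩, ?_⟩
  simp only [RelCode.encode, List.length_append]
  omega

/-- The parser for relation symbols. -/
noncomputable def relParser : Parser RelCode.encode RelCode.Valid where
  next := fun x q => tuplesParser.next x (rightList x q)
  ls := tuplesParser.ls.comp ls_rightList
  le := fun x q => tuplesParser.le x _
  complete := fun x c p r hp hr h => (RelCode.spec hp hr h).2.2.2
  sound := fun x c p hn => by
    -- The three parsers are unwound from the last to the first. The end position of a successful
    -- parser lies within the input, hence so does its starting position, which is the end position
    -- of the preceding parser.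
    obtain ⟨R, h₁, h₂, h₃⟩ := tuplesParser.sound x (rightList x (c, p)).1 (rightList x (c, p)).2 hn
    replace h₃ : tuplesParser.next x (rightList x (c, p)) = _ := h₃
    replace hn : tuplesParser.next x (rightList x (c, p)) ≤ x.length := hn
    have l₃ : (rightList x (c, p)).2 ≤ x.length := by omega
    obtain ⟨L, h₄, h₅, h₆⟩ := tuplesParser.sound x (leftList x (c, p)).1 (leftList x (c, p)).2 l₃
    replace h₆ : tuplesParser.next x (leftList x (c, p)) = _ := h₆
    replace l₃ : tuplesParser.next x (leftList x (c, p)) ≤ x.length := l₃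
    have l₄ : (leftList x (c, p)).2 ≤ x.length := by omega
    obtain ⟨k, -, h₇, h₈⟩ := unaryParser.sound x 0 p l₄
    have l₅ : p ≤ x.length := by
      have : unaryParser.next x (0, p) ≤ x.length := l₄
      omega
    have e := unaryAt_eq l₅ h₇
    have eL : (leftList x (c, p)).1 = (c.1, k) := by rw [leftList, e]
    have eR : (rightList x (c, p)).1 = (c.2, k) := by rw [rightList, e]
    rw [eL] at h₄
    rw [eR] at h₁
    have hr : RelCode.encode ⟨k, L, R⟩ <+: x.drop p := by
      rw [RelCode.encode, List.append_assoc, append_prefix_drop, append_prefix_drop]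
      refine ⟨h₇, ?_⟩
      rw [← h₈]
      refine ⟨h₅, ?_⟩
      have : (rightList x (c, p)).2 = unaryParser.next x (0, p) + (encTuples L).length := h₆
      rwa [← this]
    exact ⟨⟨k, L, R⟩, ⟨h₄, h₁⟩, hr, (RelCode.spec l₅ ⟨h₄, h₁⟩ hr).2.2.2⟩

namespace Code

/-! ### Reading an instance -/

/-- The number of elements of the left structure. -/
noncomputable def a (x : List Bool) : ℕ := unaryAt x 0

/-- The position after it. -/
noncomputable def p₁ (x : List Bool) : ℕ := unaryParser.next x (0, 0)

/-- The number of elements of the right structure. -/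
noncomputable def b (x : List Bool) : ℕ := unaryAt x (p₁ x)

/-- The position of the list of the relation symbols, with its parameters. -/
noncomputable def q (x : List Bool) : (ℕ × ℕ) × ℕ := ((a x, b x), unaryParser.next x (0, p₁ x))

/-- The number of relation symbols. -/
noncomputable def nr (x : List Bool) : ℕ := relParser.cnt x (q x)

/-- The position of a relation symbol, with its parameters. -/
noncomputable def rel (x : List Bool) (j : ℕ) : (ℕ × ℕ) × ℕ :=
  ((q x).1, relParser.pos x (q x).1 (q x).2 j + 1)

/-- The arity of a relation symbol. -/
noncomputable def ar (x : List Bool) (j : ℕ) : ℕ := unaryAt x (rel x j).2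

/-- The number of tuples on the left. -/
noncomputable def lcount (x : List Bool) (j : ℕ) : ℕ := tupleParser.cnt x (leftList x (rel x j))

/-- Membership in a relation on the left. -/
def LMem (x : List Bool) (j : ℕ) : List ℕ → Prop := TupleMem x (leftList x (rel x j))

/-- Membership in a relation on the right. -/
def RMem (x : List Bool) (j : ℕ) : List ℕ → Prop := TupleMem x (rightList x (rel x j))

/-- The string encodes a pair of structures. -/
def Valid (x : List Bool) : Prop :=
  0 < a x ∧ 0 < b x ∧ relParser.list.next x (q x) = x.length

section

variable {β : Type} [NCode β]

theorem ls_a : LS fun x (_ : β) => a x := ls_unaryAt.comp (.const 0)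

theorem ls_p₁ : LS fun x (_ : β) => p₁ x := unaryParser.ls.comp (.const (0, 0))

theorem ls_b : LS fun x (_ : β) => b x := ls_unaryAt.comp ls_p₁

theorem ls_q : LS fun x (_ : β) => q x :=
  (ls_a.pair ls_b).pair (unaryParser.ls.comp ((LS.const 0).pair ls_p₁))

theorem ls_nr : LS fun x (_ : β) => nr x := relParser.ls_cnt.comp ls_q

theorem ls_rel : LS rel :=
  ls_q.fst.pair ((relParser.ls_pos.comp ((ls_q.fst.pair ls_q.snd).pair LS.id)).add (.const 1))

theorem ls_ar : LS ar := ls_unaryAt.comp ls_rel.snd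

theorem ls_lcount : LS lcount := tupleParser.ls_cnt.comp (ls_leftList.comp ls_rel)

theorem lsp_valid : LSP fun x (_ : β) => Valid x :=
  ((LS.const 0).lt ls_a).and (((LS.const 0).lt ls_b).and
    ((relParser.list.ls.comp ls_q).eq LS.length))

end

theorem prefix_iff {x : List Bool} {s t u : List Bool} :
    s ++ t ++ u = x ↔ (s <+: x.drop 0 ∧ t <+: x.drop (0 + s.length) ∧
      u <+: x.drop (0 + s.length + t.length)) ∧ 0 + s.length + t.length + u.length = x.length := by
  rw [← append_prefix_drop, ← append_prefix_drop, ← List.append_assoc]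
  constructor
  · rintro rfl
    simp
    omega
  · rintro ⟨h, h'⟩
    refine h.eq_of_length ?_
    simp only [List.length_append, List.drop_zero]
    omega

/-- On the code of a pair all reading functions return what they are meant to return. Together with
`valid_iff` this allows every condition on strings to be replaced by one on the listing `D`. -/
theorem spec (D : PairCode) : Valid D.encode ∧ a D.encode = D.a ∧ b D.encode = D.b ∧
    nr D.encode = D.rels.length ∧ ∀ j r, D.rels[j]? = some r →
      ar D.encode j = r.ar ∧ lcount D.encode j = r.left.length ∧
      (∀ v, LMem D.encode j v ↔ v ∈ r.left) ∧ ∀ v, RMem D.encode j v ↔ v ∈ r.right := by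
  obtain ⟨⟨h₁, h₂, h₃⟩, h₄⟩ := prefix_iff.1 (rfl : _ = D.encode)
  set x := D.encode
  have ea : a x = D.a := unaryAt_eq (Nat.zero_le _) h₁
  have ep : p₁ x = 0 + (encUnary D.a).length :=
    unaryParser.complete x 0 0 D.a (Nat.zero_le _) trivial h₁
  have l₁ : p₁ x ≤ x.length := by omega
  rw [← ep] at h₂ h₃ h₄
  have eb : b x = D.b := unaryAt_eq l₁ h₂
  have hV : ∀ r ∈ D.rels, RelCode.Valid (D.a, D.b) r := fun r hr =>
    ⟨⟨fun v hv => (D.left_tuple r hr v hv).symm, D.left_nodup r hr⟩,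
      fun v hv => (D.right_tuple r hr v hv).symm, D.right_nodup r hr⟩
  have eq : q x = ((D.a, D.b), p₁ x + (encUnary D.b).length) := by
    rw [q, ea, eb, unaryParser.complete x 0 _ D.b l₁ trivial h₂]
  have l₂ : p₁ x + (encUnary D.b).length ≤ x.length := by omega
  refine ⟨⟨by rw [ea]; exact D.a_pos, by rw [eb]; exact D.b_pos, ?_⟩, ea, eb, ?_, ?_⟩
  · rw [eq, relParser.list.complete x _ _ D.rels l₂ hV h₃, h₄]
  · rw [nr, eq, relParser.cnt_spec l₂ hV h₃]
  · intro j r hr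
    obtain ⟨hj, rfl⟩ := List.getElem?_eq_some_iff.1 hr
    have hv := hV _ (List.getElem_mem hj)
    obtain ⟨k₁, k₂⟩ := relParser.getElem_spec l₂ hV h₃ hj
    obtain ⟨m₁, ⟨m₂, m₃, m₄⟩, ⟨m₅, m₆, m₇⟩, -⟩ := RelCode.spec (lt_of_getElem? k₁) hv k₂
    have er : rel x j = ((D.a, D.b), relParser.pos x (D.a, D.b)
        (p₁ x + (encUnary D.b).length) j + 1) := by rw [rel, eq]
    rw [← er] at m₂ m₃ m₄ m₅ m₆ m₇
    refine ⟨by rw [ar, er]; exact m₁, ?_, fun v => ?_, fun v => ?_⟩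
    · exact tupleParser.cnt_spec (c := (leftList x (rel x j)).1) m₂ (by rw [m₃]; exact hv.1.1) m₄
    · exact tupleMem_iff m₂ (by rw [m₃]; exact hv.1.1) m₄
    · exact tupleMem_iff m₅ (by rw [m₆]; exact hv.2.1) m₇

theorem valid_iff {x : List Bool} : Valid x ↔ ∃ D : PairCode, D.encode = x := by
  constructor
  · rintro ⟨ha, hb, hq⟩
    obtain ⟨R, h₁, h₂, h₃⟩ := relParser.list.sound x (q x).1 (q x).2 hq.le
    have hq' : relParser.list.next x ((q x).1, (q x).2) = x.length := hq
    have e₁ : (q x).2 = unaryParser.next x (0, p₁ x) := rfl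
    obtain ⟨m, -, h₄, h₅⟩ := unaryParser.sound x 0 (p₁ x) (by omega)
    have e₂ : p₁ x = unaryParser.next x (0, 0) := rfl
    obtain ⟨n, -, h₆, h₇⟩ := unaryParser.sound x 0 0 (by omega)
    have ea : a x = n := unaryAt_eq (Nat.zero_le _) h₆
    have eb : b x = m := unaryAt_eq (by omega) h₄
    have hR : ∀ r ∈ R, RelCode.Valid (n, m) r := by rw [← ea, ← eb]; exact h₁
    refine ⟨⟨n, m, R, ea ▸ ha, eb ▸ hb, fun r hr => (hR r hr).1.2, fun r hr => (hR r hr).2.2,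
      fun r hr v hv => ((hR r hr).1.1 v hv).symm, fun r hr v hv => ((hR r hr).2.1 v hv).symm⟩, ?_⟩
    refine prefix_iff.2 ⟨⟨h₆, ?_, ?_⟩, ?_⟩
    · rwa [← h₇, ← e₂]
    · rwa [← h₇, ← e₂, ← h₅, ← e₁]
    · rw [← h₇, ← e₂, ← h₅, ← e₁, ← h₃, hq']
  · rintro ⟨D, rfl⟩
    exact (spec D).1

end Code

end ParamLog

namespace ParamLog
open NCode (enc)

/-! ## Machines that guess a bounded number of short numbers -/

/-- The value of a list of bits, most significant bit first. -/
def bitsVal (c : ℕ) (l : List Bool) : ℕ := l.foldl (fun c b => 2 * c + b.toNat) c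

theorem bitsVal_lt {c k : ℕ} {l : List Bool} (h : c < 2 ^ k) : bitsVal c l < 2 ^ (k + l.length) := by
  induction l generalizing c k with
  | nil => simpa [bitsVal] using h
  | cons b l ih =>
    have hb := b.toNat_le
    have : 2 * c + b.toNat < 2 ^ (k + 1) := by rw [pow_succ]; omega
    rw [List.length_cons, show k + (l.length + 1) = k + 1 + l.length by omega]
    exact ih this

theorem exists_bitsVal (k : ℕ) : ∀ w < 2 ^ k, ∃ l : List Bool, l.length = k ∧ bitsVal 0 l = w := by
  induction k with
  | zero => intro w hw; exact ⟨[], rfl, by simp [bitsVal]; simp at hw; omega⟩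
  | succ k ih =>
    intro w hw
    obtain ⟨l, h₁, h₂⟩ := ih (w / 2) (by rw [pow_succ] at hw; omega)
    refine ⟨l ++ [w.bodd], by simp [h₁], ?_⟩
    rw [bitsVal, List.foldl_append]
    rw [bitsVal] at h₂
    rw [h₂]
    have := Nat.bodd_add_div2 w
    rw [Nat.div2_val] at this
    simp only [List.foldl_cons, List.foldl_nil]
    rw [add_comm]
    exact this

section

variable {σ : Type} (m L : List Bool → ℕ) (stp : List Bool → ℕ → σ → ℕ → σ)

/-- Reading one more bit of a number; the state holds the number of complete blocks, the length and
the value of the current block, and the inner state. -/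
def blockStep (x : List Bool) (s : ℕ × ℕ × ℕ × σ) (b : Bool) : ℕ × ℕ × ℕ × σ :=
  if s.2.1 + 1 = L x then
    -- After `m` complete blocks neither the count nor the inner state changes any more. So the
    -- states remain bounded on bit strings of arbitrary length.
    (if s.1 < m x then s.1 + 1 else s.1, 0, 0,
      if s.1 < m x then stp x s.1 s.2.2.2 (2 * s.2.2.1 + b.toNat) else s.2.2.2)
  else (s.1, s.2.1 + 1, 2 * s.2.2.1 + b.toNat, s.2.2.2)

variable {m L stp}

theorem foldl_blockStep {x : List Bool} {i : ℕ} {s : σ} (hi : i < m x) (l : List Bool) (hl : l ≠ [])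
    {t c : ℕ} (ht : t + l.length = L x) :
    l.foldl (blockStep m L stp x) (i, t, c, s) = (i + 1, 0, 0, stp x i s (bitsVal c l)) := by
  induction l generalizing t c with
  | nil => exact absurd rfl hl
  | cons b l ih =>
    rw [List.length_cons] at ht
    rcases l with _ | ⟨b', l⟩
    · simp only [List.length_nil] at ht
      simp [blockStep, show t + 1 = L x by omega, hi, bitsVal]
    · have : ¬ t + 1 = L x := by simp only [List.length_cons] at ht; omega
      rw [List.foldl_cons, show blockStep m L stp x (i, t, c, s) b = (i, t + 1, 2 * c + b.toNat, s) from
        if_neg this, ih (by simp) (by omega)]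
      simp [bitsVal]

/-- A string of `j * L` bits is the same as `j` numbers below `2 ^ L`: the last `L` bits are split
off and determine the last number. -/
theorem exists_foldl_blockStep {x : List Bool} (hL : 0 < L x) (s : σ) (j : ℕ) (hj : j ≤ m x)
    (st : ℕ × ℕ × ℕ × σ) :
    (∃ l : List Bool, l.length = j * L x ∧ l.foldl (blockStep m L stp x) (0, 0, 0, s) = st) ↔
      ∃ w : ℕ → ℕ, (∀ i < j, w i < 2 ^ L x) ∧
        st = (j, 0, 0, (Nat.rec s (fun i s => stp x i s (w i)) j : σ)) := by
  induction j generalizing st with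
  | zero => simp [List.length_eq_zero_iff, eq_comm]
  | succ j ih =>
    constructor
    · rintro ⟨l, hl, rfl⟩
      obtain ⟨w, hw, h⟩ := (ih (by omega) _).1 ⟨l.take (j * L x), by
        rw [List.length_take, hl, add_mul]; omega, rfl⟩
      have hd : (l.drop (j * L x)).length = L x := by
        rw [List.length_drop, hl, add_mul]; omega
      refine ⟨fun i => if i = j then bitsVal 0 (l.drop (j * L x)) else w i, fun i hi => ?_, ?_⟩
      · dsimp only
        split
        · have := bitsVal_lt (c := 0) (k := 0) (l := l.drop (j * L x)) (by norm_num)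
          rwa [hd, zero_add] at this
        · exact hw i (by omega)
      · rw [← List.take_append_drop (j * L x) l, List.foldl_append, h,
          foldl_blockStep (by omega) _ (by intro e; rw [e] at hd; simp at hd; omega)
            (by rw [hd, zero_add])]
        have : ∀ k ≤ j, (Nat.rec s (fun i s => stp x i s (if i = j then
            bitsVal 0 (l.drop (j * L x)) else w i)) k : σ) =
            Nat.rec s (fun i s => stp x i s (w i)) k := by
          intro k hk
          induction k with
          | zero => rfl
          | succ k ihk =>
            show stp x k _ _ = stp x k _ _
            rw [ihk (by omega), if_neg (by omega)]
        rw [List.take_append_drop]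
        show _ = (j + 1, 0, 0, stp x j _ (if j = j then _ else _))
        rw [if_pos rfl, this j le_rfl]
    · rintro ⟨w, hw, rfl⟩
      obtain ⟨l, hl, h⟩ := (ih (by omega) _).2 ⟨w, fun i hi => hw i (by omega), rfl⟩
      obtain ⟨l', hl', h'⟩ := exists_bitsVal (L x) (w j) (hw j (by omega))
      refine ⟨l ++ l', by rw [List.length_append, hl, hl']; ring, ?_⟩
      rw [List.foldl_append, h, foldl_blockStep (by omega) _
        (by intro e; rw [e] at hl'; simp at hl'; omega) (by rw [hl', zero_add]), h']

end

theorem pair_mono {a b c d : ℕ} (h₁ : a ≤ c) (h₂ : b ≤ d) : Nat.pair a b ≤ Nat.pair c d := by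
  rcases h₁.eq_or_lt with rfl | h₁ <;> rcases h₂.eq_or_lt with rfl | h₂
  · rfl
  · exact (Nat.pair_lt_pair_right _ h₂).le
  · exact (Nat.pair_lt_pair_left _ h₁).le
  · exact (Nat.pair_lt_pair_left _ h₁).le.trans (Nat.pair_lt_pair_right _ h₂).le

/-- Nondeterministic machines that guess `m` numbers with `L` bits each. -/
theorem exists_block_machine {π φ : List Bool → ℕ} {σ : Type} [NCode σ] (hφ : PLCalc π φ)
    {m : List Bool → ℕ → ℕ} {L : List Bool → ℕ} {init : List Bool → ℕ → σ}
    {stp : List Bool → ℕ → ℕ → σ → ℕ → σ} {acc : List Bool → ℕ → σ → Prop}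
    (hm : LS m) (hL : LS fun x (_ : ℕ) => L x) (hL0 : ∀ x, 0 < L x)
    {bL : List Bool → ℕ → ℕ} (hbL : PolyBdd bL) (hLb : ∀ x v, 2 ^ L x ≤ bL x v) (hi : LS init)
    (hs : LS fun x (p : ℕ × ℕ × σ × ℕ) => stp x p.1 p.2.1 p.2.2.1 p.2.2.2)
    (ha : LSP fun x (p : ℕ × σ) => acc x p.1 p.2)
    {bd : List Bool → ℕ → ℕ} (hbd : PolyBdd bd) (I : List Bool → σ → Prop)
    (hI : ∀ x, I x (init x (φ x)))
    (hI' : ∀ x s i w, i < m x (φ x) → w < 2 ^ L x → I x s → I x (stp x (φ x) i s w))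
    (hle : ∀ x s, I x s → enc s ≤ bd x (φ x)) :
    ∃ N : NTM, N.Accepts {x | ∃ w : ℕ → ℕ, (∀ i < m x (φ x), w i < 2 ^ L x) ∧ acc x (φ x)
        (Nat.rec (init x (φ x)) (fun i s => stp x (φ x) i s (w i)) (m x (φ x)))} ∧
      PLSpaceBounded N.RunsInSpace π ∧ ∀ x, N.UsesBits x (m x (φ x) * L x) := by
  classical
  -- The step function of the guessing machine sees only the input and the state. The value `φ x` is
  -- therefore carried along as first component of the state.
  have hst : LS fun x (p : (ℕ × ℕ × ℕ × ℕ × σ) × Bool) =>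
      (p.1.1, blockStep (fun x => m x p.1.1) L (fun x => stp x p.1.1) x p.1.2 p.2) := by
    have hn : LS fun x (p : (ℕ × ℕ × ℕ × ℕ × σ) × Bool) => p.1.1 := LS.id.fst.fst
    have hi : LS fun x (p : (ℕ × ℕ × ℕ × ℕ × σ) × Bool) => p.1.2.1 := LS.id.fst.snd.fst
    have ht : LS fun x (p : (ℕ × ℕ × ℕ × ℕ × σ) × Bool) => p.1.2.2.1 := LS.id.fst.snd.snd.fst
    have hs' : LS fun x (p : (ℕ × ℕ × ℕ × ℕ × σ) × Bool) => p.1.2.2.2.2 :=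
      LS.id.fst.snd.snd.snd.snd
    have hc : LS fun x (p : (ℕ × ℕ × ℕ × ℕ × σ) × Bool) => 2 * p.1.2.2.2.1 + p.2.toNat :=
      ((LS.const 2).mul LS.id.fst.snd.snd.snd.fst).add ((LS.ofFinite Bool.toNat).comp LS.id.snd)
    have hmn : LS fun x (p : (ℕ × ℕ × ℕ × ℕ × σ) × Bool) => m x p.1.1 := hm.comp hn
    have hLx : LS fun x (p : (ℕ × ℕ × ℕ × ℕ × σ) × Bool) => L x := hL.comp hn
    have hstp : LS fun x (p : (ℕ × ℕ × ℕ × ℕ × σ) × Bool) =>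
        stp x p.1.1 p.1.2.1 p.1.2.2.2.2 (2 * p.1.2.2.2.1 + p.2.toNat) :=
      hs.comp (hn.pair (hi.pair (hs'.pair hc)))
    have := hn.pair (LS.ite ((ht.add (.const 1)).eq hLx)
      ((LS.ite (hi.lt hmn) (hi.add (.const 1)) hi).pair ((LS.const 0).pair ((LS.const 0).pair
        (LS.ite (hi.lt hmn) hstp hs')))) (hi.pair ((ht.add (.const 1)).pair (hc.pair hs'))))
    exact this
  have hinit : LS fun x (n : ℕ) => (n, 0, 0, 0, init x n) :=
    LS.id.pair ((LS.const 0).pair ((LS.const 0).pair ((LS.const 0).pair hi)))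
  have hacc : LSP fun x (s : ℕ × ℕ × ℕ × ℕ × σ) => acc x s.1 s.2.2.2.2 :=
    ha.comp (LS.id.fst.pair LS.id.snd.snd.snd.snd)
  have hmb : PolyBdd m := hm.polyCalc.bdd
  have hb : PolyBdd fun x n => Nat.pair n (Nat.pair (m x n)
      (Nat.pair (L x) (Nat.pair (bL x n) (bd x n)))) :=
    .pair .arg (hmb.pair (.pair hL.polyCalc.bdd (hbL.pair hbd)))
  set J : List Bool → ℕ × ℕ × ℕ × ℕ × σ → Prop := fun x s => s.1 = φ x ∧ s.2.1 ≤ m x (φ x) ∧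
    s.2.2.1 < L x ∧ s.2.2.2.1 < 2 ^ s.2.2.1 ∧ I x s.2.2.2.2
  have hJ : ∀ x s b, J x s → J x (s.1, blockStep (fun x => m x s.1) L (fun x => stp x s.1) x s.2 b) := by
    rintro x ⟨n, i, t, c, s⟩ b ⟨rfl, h₂, h₃, h₄, h₅⟩
    dsimp only at h₂ h₃ h₄ h₅
    have hb' := b.toNat_le
    simp only [blockStep]
    have hc : 2 * c + b.toNat < 2 ^ (t + 1) := by rw [pow_succ]; omega
    by_cases e : t + 1 = L x
    · rw [if_pos e]
      refine ⟨rfl, ?_, hL0 x, by simp, ?_⟩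
      · dsimp only; split_ifs <;> omega
      · dsimp only
        split_ifs with hi
        · exact hI' x s i _ hi (e ▸ hc) h₅
        · exact h₅
    · rw [if_neg e]
      exact ⟨rfl, h₂, by dsimp only; omega, hc, h₅⟩
  have hJle : ∀ x s, J x s → enc s ≤ Nat.pair (φ x) (Nat.pair (m x (φ x))
      (Nat.pair (L x) (Nat.pair (bL x (φ x)) (bd x (φ x))))) := by
    rintro x ⟨n, i, t, c, s⟩ ⟨rfl, h₂, h₃, h₄, h₅⟩
    dsimp only at h₂ h₃ h₄ h₅
    refine pair_mono le_rfl (pair_mono h₂ (pair_mono h₃.le (pair_mono ?_ (hle x s h₅))))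
    exact h₄.le.trans ((Nat.pow_le_pow_right (by norm_num) h₃.le).trans (hLb x _))
  obtain ⟨N, h₁, h₂, h₃⟩ := exists_guessing_machine hφ (m := fun x n => m x n * L x)
    (stp := fun x s b => (s.1, blockStep (fun x => m x s.1) L (fun x => stp x s.1) x s.2 b))
    (acc := fun x s => acc x s.1 s.2.2.2.2)
    (hm.mul hL) hinit hst hacc hb
    J (fun x => ⟨rfl, Nat.zero_le _, hL0 x, by simp, hI x⟩) hJ hJle
  refine ⟨N, ?_, h₂, h₃⟩
  intro x
  refine Iff.trans ?_ (h₁ x)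
  have hf : ∀ (l : List Bool) (s : ℕ × ℕ × ℕ × σ), l.foldl (fun s b => (s.1,
      blockStep (fun x => m x s.1) L (fun x => stp x s.1) x s.2 b)) (φ x, s) =
      (φ x, l.foldl (blockStep (fun x => m x (φ x)) L (fun x => stp x (φ x)) x) s) := by
    intro l
    induction l with
    | nil => intro s; rfl
    | cons b l ih => intro s; exact ih _
  simp only [Set.mem_ofPred_eq, hf]
  have key := exists_foldl_blockStep (m := fun x => m x (φ x)) (stp := fun x => stp x (φ x))
    (hL0 x) (init x (φ x)) (m x (φ x)) le_rfl
  constructor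
  · rintro ⟨w, hw, h⟩
    obtain ⟨l, hl, h'⟩ := (key _).2 ⟨w, hw, rfl⟩
    exact ⟨l, hl, by rw [h']; exact h⟩
  · rintro ⟨l, hl, h⟩
    obtain ⟨w, hw, h'⟩ := (key _).1 ⟨l, hl, rfl⟩
    exact ⟨w, hw, by rw [h'] at h; exact h⟩

end ParamLog

namespace ParamLog
open NCode (enc)

/-! ## Homomorphisms from coloured paths -/

/-- The digit at index `i` of `u` to base `a`. -/
def dig (a u i : ℕ) : ℕ := u / a ^ i % a

/-- A sequence of `k` numbers below `a` is a number below `a ^ k`. In this way a whole ordering of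
the vertices is held in a single register. -/
theorem exists_dig {a : ℕ} (d : ℕ → ℕ) (k : ℕ) (hd : ∀ i < k, d i < a) :
    ∃ u < a ^ k, ∀ i < k, dig a u i = d i := by
  induction k generalizing d with
  | zero => exact ⟨0, by simp, by simp⟩
  | succ k ih =>
    obtain ⟨u, hu, h⟩ := ih (fun i => d (i + 1)) fun i hi => hd (i + 1) (by omega)
    have h0 := hd 0 (by omega)
    refine ⟨d 0 + a * u, ?_, fun i hi => ?_⟩
    · rw [pow_succ]
      nlinarith
    · rcases i with _ | i
      · simp [dig, Nat.mod_eq_of_lt h0]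
      · have := h i (by omega)
        rw [dig, pow_succ', ← Nat.div_div_eq_div_mul, Nat.add_mul_div_left _ _ (by omega),
          Nat.div_eq_of_lt h0, zero_add]
        exact this

namespace PairCode

variable {D : PairCode} {d : ℕ → ℕ} {j₀ : ℕ}

theorem IsStar.congr (h : D.IsStar d j₀) {d' : ℕ → ℕ} (hd : ∀ i < D.a, d' i = d i) :
    D.IsStar d' j₀ where
  two_le := h.two_le
  length_eq := h.length_eq
  lt := fun i hi => by rw [hd i hi]; exact h.lt i hi
  inj := fun i hi i' hi' e => h.inj i hi i' hi' (by rw [← hd i hi, ← hd i' hi', e])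
  edge := by
    obtain ⟨r, h₁, h₂, h₃⟩ := h.edge
    exact ⟨r, h₁, h₂, fun i hi i' hi' => by rw [hd i hi, hd i' hi']; exact h₃ i hi i' hi'⟩
  point := fun i hi => by
    obtain ⟨j, hj, r, h₁, h₂, h₃⟩ := h.point i hi
    exact ⟨j, hj, r, h₁, h₂, fun m hm => by rw [hd i hi]; exact h₃ m hm⟩

theorem IsStar.exists_eq (h : D.IsStar d j₀) {m : ℕ} (hm : m < D.a) : ∃ i < D.a, d i = m := by
  have hb : Function.Bijective fun i : Fin D.a => (⟨d i, h.lt i i.2⟩ : Fin D.a) :=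
    Finite.injective_iff_bijective.1 fun i i' e =>
      Fin.val_injective (h.inj i i.2 i' i'.2 (Fin.val_eq_of_eq e))
  obtain ⟨i, hi⟩ := hb.2 ⟨m, hm⟩
  exact ⟨i, i.2, Fin.val_eq_of_eq hi⟩

/-- The symbols of the `a` points are pairwise different and different from `j₀`. As there are `a +
1` symbols altogether, every symbol other than `j₀` is one of them. -/
theorem IsStar.exists_point (h : D.IsStar d j₀) {j : ℕ} {r : RelCode} (hr : D.rels[j]? = some r)
    (hj : j ≠ j₀) : ∃ i < D.a, r.ar = 1 ∧ ∀ m < D.a, ([m] ∈ r.left ↔ m = d i) := by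
  have hpoint : ∀ i : Fin D.a, ∃ j, j ≠ j₀ ∧ ∃ r, D.rels[j]? = some r ∧ r.ar = 1 ∧
    ∀ m < D.a, ([m] ∈ r.left ↔ m = d i) := fun i => h.point i i.2
  choose f hf r' hr' har hp using hpoint
  have hlt := fun i => (List.getElem?_eq_some_iff.1 (hr' i)).1
  obtain ⟨r₀, hr₀, -⟩ := h.edge
  have hj₀ := (List.getElem?_eq_some_iff.1 hr₀).1
  have hlj := (List.getElem?_eq_some_iff.1 hr).1
  have finj : Function.Injective f := by
    intro i i' e
    have e₂ : r' i = r' i' := by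
      have := hr' i
      rw [e, hr' i'] at this
      exact (Option.some.inj this).symm
    have := (hp i _ (h.lt i i.2)).2 rfl
    rw [e₂, hp i' _ (h.lt i i.2)] at this
    exact Fin.val_injective (h.inj _ i.2 _ i'.2 this)
  have himg : Finset.univ.image f = (Finset.range D.rels.length).erase j₀ := by
    refine Finset.eq_of_subset_of_card_le ?_ ?_
    · intro k hk
      obtain ⟨i, -, rfl⟩ := Finset.mem_image.1 hk
      exact Finset.mem_erase.2 ⟨hf i, Finset.mem_range.2 (hlt i)⟩
    · rw [Finset.card_image_of_injective _ finj, Finset.card_erase_of_mem (Finset.mem_range.2 hj₀)]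
      simp [h.length_eq]
  have : j ∈ Finset.univ.image f := by
    rw [himg]
    exact Finset.mem_erase.2 ⟨hj, Finset.mem_range.2 hlj⟩
  obtain ⟨i, -, rfl⟩ := Finset.mem_image.1 this
  rw [hr' i] at hr
  obtain rfl := Option.some.inj hr
  exact ⟨i, i.2, har i, hp i⟩

/-- The condition on the images `p` of the vertex `d (i - 1)` and `w` of the vertex `d i`. -/
def Compat (D : PairCode) (d : ℕ → ℕ) (j₀ i p w : ℕ) : Prop :=
  (i = 0 ∨ ∀ r, D.rels[j₀]? = some r → [p, w] ∈ r.right ∧ [w, p] ∈ r.right) ∧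
    ∀ j r, j ≠ j₀ → D.rels[j]? = some r → [d i] ∈ r.left → [w] ∈ r.right

/-- Every tuple of the edge relation joins two consecutive vertices in one of the two directions,
and all other relations are singletons. So being a homomorphism is a condition on consecutive images
and on single images, which can be checked while walking along the path. -/
theorem IsStar.exists_isHom_iff (h : D.IsStar d j₀) : (∃ g, D.A.IsHom D.B g) ↔
    ∃ w : ℕ → ℕ, (∀ i < D.a, w i < D.b) ∧ ∀ i < D.a, D.Compat d j₀ i (w (i - 1)) (w i) := by
  rw [PairCode.exists_isHom_iff]
  obtain ⟨r₀, hr₀, ar₀, he⟩ := h.edge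
  constructor
  · rintro ⟨g, hg, hh⟩
    refine ⟨fun i => g (d i), fun i hi => hg _ (h.lt i hi), fun i hi => ⟨?_, ?_⟩⟩
    · rcases i with _ | i
      · exact .inl rfl
      · right
        intro r hr
        rw [hr₀] at hr
        obtain rfl := Option.some.inj hr
        have hm := List.mem_of_getElem? hr₀
        refine ⟨?_, ?_⟩
        · exact hh _ hm _ ((he i (by omega) (i + 1) hi).2 (.inl rfl))
        · exact hh _ hm _ ((he (i + 1) hi i (by omega)).2 (.inr rfl))
    · intro j r _ hr hl
      exact hh r (List.mem_of_getElem? hr) _ hl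
  · rintro ⟨w, -, hw⟩
    choose! e he₁ he₂ using fun m (hm : m < D.a) => h.exists_eq hm
    have hed : ∀ i < D.a, e (d i) = i := fun i hi =>
      h.inj _ (he₁ _ (h.lt i hi)) _ hi (he₂ _ (h.lt i hi))
    have hpt : ∀ i < D.a, ∀ j r, j ≠ j₀ → D.rels[j]? = some r → [d i] ∈ r.left → [w i] ∈ r.right :=
      fun i hi => (hw i hi).2
    refine ⟨fun m => w (e m), fun m hm => ?_, fun r hr v hv => ?_⟩
    -- The image lies in `B` because the vertex carries a colour, and the tuples listed on the right
    -- consist of elements of `B`.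
    · obtain ⟨j, hj, r, h₁, h₂, h₃⟩ := h.point (e m) (he₁ m hm)
      have := hpt _ (he₁ m hm) j r hj h₁ ((h₃ _ (h.lt _ (he₁ m hm))).2 rfl)
      exact (D.right_tuple r (List.mem_of_getElem? h₁) _ this).2 _ (by simp)
    · obtain ⟨j, hj⟩ := List.mem_iff_getElem?.1 hr
      obtain ⟨hl, hlt⟩ := D.left_tuple r hr v hv
      by_cases hjj : j = j₀
      · subst hjj
        rw [hr₀] at hj
        obtain rfl := Option.some.inj hj
        rw [ar₀] at hl
        obtain ⟨m, m', rfl⟩ := List.length_eq_two.1 hl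
        have hm := hlt m (by simp)
        have hm' := hlt m' (by simp)
        rw [← he₂ m hm, ← he₂ m' hm', he _ (he₁ m hm) _ (he₁ m' hm')] at hv
        simp only [List.map_cons, List.map_nil]
        rcases hv with hv | hv
        · have := (hw _ (he₁ m' hm')).1.resolve_left (by omega) _ hr₀
          rw [← hv, Nat.add_sub_cancel] at this
          rw [← hv]
          exact this.1
        · have := (hw _ (he₁ m hm)).1.resolve_left (by omega) _ hr₀
          rw [← hv, Nat.add_sub_cancel] at this
          rw [← hv]
          exact this.2
      · obtain ⟨i, hi, har, -⟩ := h.exists_point hj hjj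
        rw [har] at hl
        obtain ⟨m, rfl⟩ := List.length_eq_one_iff.1 hl
        have hm := hlt m (by simp)
        rw [← he₂ m hm] at hv
        exact hpt _ (he₁ m hm) j r hjj hj hv

end PairCode

namespace Code

/-- The left structure is a coloured path with the vertices in the order given by the digits of `u`
and with edge relation at index `j₀`. -/
def StarAt (x : List Bool) (u j₀ : ℕ) : Prop :=
  (2 ≤ a x ∧ nr x = a x + 1 ∧ j₀ < nr x ∧ ar x j₀ = 2) ∧
    (∀ i < a x, ∀ i' < a x, dig (a x) u i = dig (a x) u i' → i = i') ∧
    (∀ i < a x, ∀ i' < a x,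
      (LMem x j₀ [dig (a x) u i, dig (a x) u i'] ↔ i + 1 = i' ∨ i' + 1 = i)) ∧
    ∀ i < a x, ∃ j < nr x, j ≠ j₀ ∧ ar x j = 1 ∧
      ∀ m < a x, (LMem x j [m] ↔ m = dig (a x) u i)

theorem starAt_iff (D : PairCode) (u j₀ : ℕ) :
    StarAt D.encode u j₀ ↔ D.IsStar (dig D.a u) j₀ := by
  obtain ⟨-, ea, -, en, hr⟩ := spec D
  rw [StarAt, ea, en]
  constructor
  · rintro ⟨⟨h₁, h₂, h₃, h₄⟩, h₅, h₆, h₇⟩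
    have hg := List.getElem?_eq_getElem h₃
    obtain ⟨k₁, -, k₂, -⟩ := hr _ _ hg
    refine ⟨h₁, h₂, fun i hi => Nat.mod_lt _ (by omega), h₅, ⟨_, hg, k₁.symm.trans h₄, ?_⟩, ?_⟩
    · intro i hi i' hi'
      rw [← k₂]
      exact h₆ i hi i' hi'
    · intro i hi
      obtain ⟨j, hj, hjj, ha, hm⟩ := h₇ i hi
      have hg := List.getElem?_eq_getElem hj
      obtain ⟨k₁, -, k₂, -⟩ := hr _ _ hg
      refine ⟨j, hjj, _, hg, k₁.symm.trans ha, fun m h => ?_⟩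
      rw [← k₂]
      exact hm m h
  · intro h
    obtain ⟨r, hg, har, he⟩ := h.edge
    obtain ⟨k₁, -, k₂, -⟩ := hr _ _ hg
    refine ⟨⟨h.two_le, h.length_eq, (List.getElem?_eq_some_iff.1 hg).1, k₁.trans har⟩, h.inj, ?_, ?_⟩
    · intro i hi i' hi'
      rw [k₂]
      exact he i hi i' hi'
    · intro i hi
      obtain ⟨j, hjj, r, hg, har, hm⟩ := h.point i hi
      obtain ⟨k₁, -, k₂, -⟩ := hr _ _ hg
      refine ⟨j, (List.getElem?_eq_some_iff.1 hg).1, hjj, k₁.trans har, fun m h => ?_⟩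
      rw [k₂]
      exact hm m h

/-- The number that gives the order of the vertices, searched for below `n`. -/
noncomputable def order (x : List Bool) (n : ℕ) : ℕ :=
  leastLt n fun u => ∃ j < nr x, StarAt x u j

/-- The index of the edge relation. -/
noncomputable def edgeIdx (x : List Bool) (n : ℕ) : ℕ := leastLt (nr x) (StarAt x (order x n))

/-- The string encodes an instance with a coloured path on the left. -/
def IsPath (x : List Bool) (n : ℕ) : Prop := Valid x ∧ ∃ u < n, ∃ j < nr x, StarAt x u j

/-- The condition checked when `w` is the image of vertex `i` and `p` that of its predecessor. -/
def Compat (x : List Bool) (n i p w : ℕ) : Prop :=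
  (i = 0 ∨ RMem x (edgeIdx x n) [p, w] ∧ RMem x (edgeIdx x n) [w, p]) ∧
    ∀ j < nr x, j ≠ edgeIdx x n → LMem x j [dig (a x) (order x n) i] → RMem x j [w]

theorem isPath_spec {D : PairCode} {n : ℕ} (h : IsPath D.encode n) :
    D.IsStar (dig D.a (order D.encode n)) (edgeIdx D.encode n) := by
  have h₁ := (leastLt_spec h.2).2.1
  exact (starAt_iff D _ _).1 (leastLt_spec h₁).2.1

/-- The digits of some number below `a ^ a` give the order of the vertices along the path. So a
search up to any `n ≥ a ^ a` recognizes all coloured paths. -/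
theorem isPath_of_star {D : PairCode} (h : paths.star D.vocabulary D.A) {n : ℕ}
    (hn : D.a ^ D.a ≤ n) : IsPath D.encode n := by
  obtain ⟨hv, -, -, en, -⟩ := spec D
  obtain ⟨d, j₀, hs⟩ := PairCode.exists_isStar h
  obtain ⟨u, hu, hd⟩ := exists_dig d D.a hs.lt
  obtain ⟨r, hr, -⟩ := hs.edge
  exact ⟨hv, u, hu.trans_le hn, j₀, by rw [en]; exact (List.getElem?_eq_some_iff.1 hr).1,
    (starAt_iff D _ _).2 (hs.congr hd)⟩

theorem compat_iff (D : PairCode) (n i p w : ℕ) (h : edgeIdx D.encode n < D.rels.length) :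
    Compat D.encode n i p w ↔
    D.Compat (dig D.a (order D.encode n)) (edgeIdx D.encode n) i p w := by
  obtain ⟨-, ea, -, en, hr⟩ := spec D
  rw [Compat, PairCode.Compat, ea, en]
  refine and_congr (or_congr_right ?_) ?_
  · have hg := List.getElem?_eq_getElem h
    obtain ⟨-, -, -, k⟩ := hr _ _ hg
    rw [k, k, hg]
    simp
  · constructor
    · intro H j r hj hg
      obtain ⟨-, -, k, k'⟩ := hr _ _ hg
      rw [← k, ← k']
      exact H j (List.getElem?_eq_some_iff.1 hg).1 hj
    · intro H j hj hjj
      have hg := List.getElem?_eq_getElem hj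
      obtain ⟨-, -, k, k'⟩ := hr _ _ hg
      rw [k, k']
      exact H j _ hjj hg

section

variable {β : Type} [NCode β] {u j i p w f g : List Bool → β → ℕ}

theorem ls_dig (hu : LS u) (hi : LS i) : LS fun x s => dig (a x) (u x s) (i x s) := by
  have := (hu.divPow ls_a hi).mod ls_a
  exact this

theorem lsp_lMem_one (hj : LS j) (hf : LS f) : LSP fun x s => LMem x (j x s) [f x s] := by
  have := LSP.tupleMem_one (ls_leftList.comp (ls_rel.comp hj)) hf
  exact this

theorem lsp_lMem_two (hj : LS j) (hf : LS f) (hg : LS g) :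
    LSP fun x s => LMem x (j x s) [f x s, g x s] := by
  have := LSP.tupleMem_two (ls_leftList.comp (ls_rel.comp hj)) hf hg
  exact this

theorem lsp_rMem_one (hj : LS j) (hf : LS f) : LSP fun x s => RMem x (j x s) [f x s] := by
  have := LSP.tupleMem_one (ls_rightList.comp (ls_rel.comp hj)) hf
  exact this

theorem lsp_rMem_two (hj : LS j) (hf : LS f) (hg : LS g) :
    LSP fun x s => RMem x (j x s) [f x s, g x s] := by
  have := LSP.tupleMem_two (ls_rightList.comp (ls_rel.comp hj)) hf hg
  exact this

end

theorem lsp_starAt : LSP fun x (q : ℕ × ℕ) => StarAt x q.1 q.2 := by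
  have h₁ : LSP fun x (q : ℕ × ℕ) => 2 ≤ a x ∧ nr x = a x + 1 ∧ q.2 < nr x ∧ ar x q.2 = 2 :=
    ((LS.const 2).le ls_a).and ((ls_nr.eq (ls_a.add (.const 1))).and
      ((LS.id.snd.lt ls_nr).and ((ls_ar.comp LS.id.snd).eq (.const 2))))
  have h₂ : LSP fun x (q : ((ℕ × ℕ) × ℕ) × ℕ) =>
      dig (a x) q.1.1.1 q.1.2 = dig (a x) q.1.1.1 q.2 → q.1.2 = q.2 :=
    ((ls_dig LS.id.fst.fst.fst LS.id.fst.snd).eq (ls_dig LS.id.fst.fst.fst LS.id.snd)).imp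
      (LS.id.fst.snd.eq LS.id.snd)
  have h₃ : LSP fun x (q : ((ℕ × ℕ) × ℕ) × ℕ) =>
      (LMem x q.1.1.2 [dig (a x) q.1.1.1 q.1.2, dig (a x) q.1.1.1 q.2] ↔
        q.1.2 + 1 = q.2 ∨ q.2 + 1 = q.1.2) :=
    (lsp_lMem_two LS.id.fst.fst.snd (ls_dig LS.id.fst.fst.fst LS.id.fst.snd)
      (ls_dig LS.id.fst.fst.fst LS.id.snd)).iff
      (((LS.id.fst.snd.add (.const 1)).eq LS.id.snd).or
        ((LS.id.snd.add (.const 1)).eq LS.id.fst.snd))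
  have h₄ : LSP fun x (q : (((ℕ × ℕ) × ℕ) × ℕ) × ℕ) =>
      (LMem x q.1.2 [q.2] ↔ q.2 = dig (a x) q.1.1.1.1 q.1.1.2) :=
    (lsp_lMem_one LS.id.fst.snd LS.id.snd).iff
      (LS.id.snd.eq (ls_dig LS.id.fst.fst.fst.fst LS.id.fst.fst.snd))
  have h₅ : LSP fun x (q : ((ℕ × ℕ) × ℕ) × ℕ) => q.2 ≠ q.1.1.2 ∧ ar x q.2 = 1 ∧
      ∀ m < a x, (LMem x q.2 [m] ↔ m = dig (a x) q.1.1.1 q.1.2) :=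
    (LS.id.snd.eq LS.id.fst.fst.snd).not.and (((ls_ar.comp LS.id.snd).eq (.const 1)).and
      (ls_a.allLt (p := fun x (q : ((ℕ × ℕ) × ℕ) × ℕ) m =>
        LMem x q.2 [m] ↔ m = dig (a x) q.1.1.1 q.1.2) h₄))
  have h₂' : LSP fun x (q : (ℕ × ℕ) × ℕ) => ∀ i' < a x,
      dig (a x) q.1.1 q.2 = dig (a x) q.1.1 i' → q.2 = i' :=
    ls_a.allLt (p := fun x (q : (ℕ × ℕ) × ℕ) i' =>
      dig (a x) q.1.1 q.2 = dig (a x) q.1.1 i' → q.2 = i') h₂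
  have h₃' : LSP fun x (q : (ℕ × ℕ) × ℕ) => ∀ i' < a x,
      (LMem x q.1.2 [dig (a x) q.1.1 q.2, dig (a x) q.1.1 i'] ↔ q.2 + 1 = i' ∨ i' + 1 = q.2) :=
    ls_a.allLt (p := fun x (q : (ℕ × ℕ) × ℕ) i' =>
      (LMem x q.1.2 [dig (a x) q.1.1 q.2, dig (a x) q.1.1 i'] ↔ q.2 + 1 = i' ∨ i' + 1 = q.2)) h₃
  have h₅' : LSP fun x (q : (ℕ × ℕ) × ℕ) => ∃ j < nr x, j ≠ q.1.2 ∧ ar x j = 1 ∧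
      ∀ m < a x, (LMem x j [m] ↔ m = dig (a x) q.1.1 q.2) :=
    ls_nr.exLt (p := fun x (q : (ℕ × ℕ) × ℕ) j => j ≠ q.1.2 ∧ ar x j = 1 ∧
      ∀ m < a x, (LMem x j [m] ↔ m = dig (a x) q.1.1 q.2)) h₅
  refine h₁.and (.and ?_ (.and ?_ ?_))
  · exact ls_a.allLt (p := fun x (q : ℕ × ℕ) i => ∀ i' < a x,
      dig (a x) q.1 i = dig (a x) q.1 i' → i = i') h₂'
  · exact ls_a.allLt (p := fun x (q : ℕ × ℕ) i => ∀ i' < a x,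
      (LMem x q.2 [dig (a x) q.1 i, dig (a x) q.1 i'] ↔ i + 1 = i' ∨ i' + 1 = i)) h₃'
  · exact ls_a.allLt (p := fun x (q : ℕ × ℕ) i => ∃ j < nr x, j ≠ q.2 ∧ ar x j = 1 ∧
      ∀ m < a x, (LMem x j [m] ↔ m = dig (a x) q.1 i)) h₅'

theorem lsp_exists_starAt : LSP fun x (q : ℕ × ℕ) => ∃ j < nr x, StarAt x q.2 j :=
  ls_nr.exLt (p := fun x (q : ℕ × ℕ) j => StarAt x q.2 j)
    (lsp_starAt.comp (LS.id.fst.snd.pair LS.id.snd))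

theorem ls_order : LS order :=
  LS.id.least (p := fun x (_ : ℕ) u => ∃ j < nr x, StarAt x u j) lsp_exists_starAt

theorem ls_edgeIdx : LS edgeIdx :=
  ls_nr.least (p := fun x n j => StarAt x (order x n) j)
    (lsp_starAt.comp ((ls_order.comp LS.id.fst).pair LS.id.snd))

theorem lsp_isPath : LSP IsPath :=
  lsp_valid.and (LS.id.exLt (p := fun x (_ : ℕ) u => ∃ j < nr x, StarAt x u j) lsp_exists_starAt)

theorem lsp_compat : LSP fun x (q : (ℕ × ℕ) × ℕ × ℕ) => Compat x q.1.1 q.1.2 q.2.1 q.2.2 := by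
  have he : LS fun x (q : (ℕ × ℕ) × ℕ × ℕ) => edgeIdx x q.1.1 := ls_edgeIdx.comp LS.id.fst.fst
  have h : LSP fun x (q : ((ℕ × ℕ) × ℕ × ℕ) × ℕ) => q.2 ≠ edgeIdx x q.1.1.1 →
      LMem x q.2 [dig (a x) (order x q.1.1.1) q.1.1.2] → RMem x q.2 [q.1.2.2] :=
    (LS.id.snd.eq (he.comp LS.id.fst)).not.imp ((lsp_lMem_one LS.id.snd
      (ls_dig (ls_order.comp LS.id.fst.fst.fst) LS.id.fst.fst.snd)).imp
        (lsp_rMem_one LS.id.snd LS.id.fst.snd.snd))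
  refine .and (.or (LS.id.fst.snd.eq (.const 0))
    ((lsp_rMem_two he LS.id.snd.fst LS.id.snd.snd).and
      (lsp_rMem_two he LS.id.snd.snd LS.id.snd.fst))) ?_
  exact ls_nr.allLt (p := fun x (q : (ℕ × ℕ) × ℕ × ℕ) j => j ≠ edgeIdx x q.1.1 →
      LMem x j [dig (a x) (order x q.1.1) q.1.2] → RMem x j [q.2.2]) h

end Code

/-! ### The homomorphism problem for coloured paths belongs to PATH -/

theorem pHOM_param_eq (D : PairCode) (C : StrClass) : (pHOM C).param D.encode = D.A.size := by
  have h : ∃ D' : PairCode, D'.encode = D.encode := ⟨D, rfl⟩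
  have e : h.choose = D := PairCode.encode_injective h.choose_spec
  exact (dif_pos h).trans (by rw [e])

open Classical in
theorem pHOM_param_eq_ite (C : StrClass) (x : List Bool) : (pHOM C).param x =
    if Code.Valid x then Code.nr x + Code.a x +
      ∑ j ∈ Finset.range (Code.nr x), Code.lcount x j * Code.ar x j else 0 := by
  split_ifs with h
  · obtain ⟨D, rfl⟩ := Code.valid_iff.1 h
    obtain ⟨-, ea, -, en, hr⟩ := Code.spec D
    rw [pHOM_param_eq, D.size_eq, ea, en]
    congr 1
    refine Finset.sum_congr rfl fun j hj => ?_
    have hg := List.getElem?_eq_getElem (Finset.mem_range.1 hj)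
    obtain ⟨k₁, k₂, -⟩ := hr _ _ hg
    rw [hg, k₁, k₂]
    rfl
  · exact dif_neg fun h' => h (Code.valid_iff.2 h')

theorem ls_pHOM_param (C : StrClass) : LS fun x (_ : ℕ) => (pHOM C).param x := by
  classical
  have h : LS fun x (_ : ℕ) => ∑ j ∈ Finset.range (Code.nr x), Code.lcount x j * Code.ar x j :=
    Code.ls_nr.sum (f := fun x (_ : ℕ) j => Code.lcount x j * Code.ar x j)
      ((Code.ls_lcount.comp LS.id.snd).mul (Code.ls_ar.comp LS.id.snd))
  refine (LS.ite Code.lsp_valid ((Code.ls_nr.add Code.ls_a).add h) (.const 0)).congr fun x _ => ?_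
  rw [pHOM_param_eq_ite]

theorem computable_pow_self : Computable fun k : ℕ => k ^ k := by
  have h : Primrec₂ fun a b : ℕ => a ^ b :=
    Primrec₂.unpaired'.1 Nat.Primrec.pow
  exact (h.comp Primrec.id Primrec.id).to_comp

/-- The machine guesses one number for each vertex of the path. Its state consists of a flag,
telling whether all checks so far were passed, and of the last image. The value `κ x ^ κ x` is
computed beforehand and bounds the search for the order of the vertices. -/
theorem pHOM_mem_PATH : pHOM paths.star ∈ PATH := by
  classical
  set κ := (pHOM paths.star).param with hκ
  have hls := ls_pHOM_param paths.star
  refine ⟨logspaceComputable hls, ?_⟩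
  have hφ : PLCalc κ fun x => κ x ^ κ x :=
    (PLCalc.of_ls hls).computable computable_pow_self
  -- Nothing is guessed if the left structure is not recognized as a coloured path. On strings that
  -- encode no pair this is necessary, as the parameter and hence the number of admissible guesses
  -- is `0`.
  have hm : LS fun x n => if Code.IsPath x n then Code.a x else 0 :=
    LS.ite Code.lsp_isPath Code.ls_a (.const 0)
  have hL : LS fun x (_ : ℕ) => Nat.log 2 x.length + 1 := LS.length.log2.add (.const 1)
  have hbL : ∀ (x : List Bool) (_ : ℕ), 2 ^ (Nat.log 2 x.length + 1) ≤ 2 * x.length + 2 := by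
    intro x _
    rw [pow_succ]
    rcases Nat.eq_zero_or_pos x.length with h | h
    · simp [h]
    · have := Nat.pow_log_le_self 2 h.ne'
      omega
  have hi : LS fun x n => (decide (Code.IsPath x n), 0) := (LS.dec Code.lsp_isPath).pair (.const 0)
  have hs : LS fun x (p : ℕ × ℕ × (Bool × ℕ) × ℕ) =>
      (p.2.2.1.1 && decide (Code.Compat x p.1 p.2.1 p.2.2.1.2 p.2.2.2), p.2.2.2) := by
    have h : LSP fun x (p : ℕ × ℕ × (Bool × ℕ) × ℕ) =>
        p.2.2.1.1 = true ∧ Code.Compat x p.1 p.2.1 p.2.2.1.2 p.2.2.2 :=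
      (LSP.ofBool LS.id.snd.snd.fst.fst).and (Code.lsp_compat.comp ((LS.id.fst.pair LS.id.snd.fst).pair
        (LS.id.snd.snd.fst.snd.pair LS.id.snd.snd.snd)))
    refine ((LS.dec h).pair LS.id.snd.snd.snd).congr fun x p => ?_
    rw [Bool.decide_and, Bool.decide_eq_true]
  have hbd : ∀ (x : List Bool) (s : Bool × ℕ), s.2 ≤ 2 * x.length + 2 →
      enc s ≤ Nat.pair 1 (2 * x.length + 2) := by
    intro x s hs
    have h1 : enc s.1 ≤ 1 := by
      rcases s with ⟨(_ | _), _⟩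
      · exact Nat.zero_le _
      · exact le_rfl
    exact pair_mono h1 hs
  obtain ⟨N, h₁, h₂, h₃⟩ := exists_block_machine hφ hm hL (fun x => Nat.succ_pos _)
    ((PolyBdd.const 2).mul .length |>.add (.const 2)) hbL hi
    (stp := fun x n i s w => (s.1 && decide (Code.Compat x n i s.2 w), w)) hs
    (acc := fun x n s => s.1 = true) (LSP.ofBool LS.id.snd.fst)
    (bd := fun x n => Nat.pair 1 (2 * x.length + 2))
    ((PolyBdd.const 1).pair ((PolyBdd.const 2).mul .length |>.add (.const 2)))
    (fun x s => s.2 ≤ 2 * x.length + 2) (fun x => Nat.zero_le _)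
    (fun x s i w _ hw _ => hw.le.trans (hbL x 0)) hbd
  -- Each of the at most `κ x` images takes `log |x| + 1` bits, one more than the logarithm so that
  -- all elements of `B` can be written. On encodings of pairs the logarithm is at least `1`, and
  -- the factor `2` pays for the additional bit.
  · refine ⟨N, ?_, h₂, fun k => 2 * k, (Primrec.nat_mul.comp (.const 2) .id).to_comp, ?_⟩
    · intro x
      refine Iff.trans ?_ (h₁ x)
      rw [Set.mem_ofPred_eq]
      set n := κ x ^ κ x with hn
      have hrec : ∀ (w : ℕ → ℕ) (c : Bool) (k : ℕ),
          ((Nat.rec (c, 0) (fun i s => (s.1 && decide (Code.Compat x n i s.2 (w i)), w i)) k :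
            Bool × ℕ).1 = true ↔ c = true ∧ ∀ i < k, Code.Compat x n i (w (i - 1)) (w i)) ∧
          (0 < k → (Nat.rec (c, 0) (fun i s =>
            (s.1 && decide (Code.Compat x n i s.2 (w i)), w i)) k : Bool × ℕ).2 = w (k - 1)) := by
        intro w c k
        -- At the first vertex the state holds the initial value `0`, whereas `w (i - 1)` is `w 0`.
        -- The condition does not look at the predecessor there.
        have h0 : ∀ p q, Code.Compat x n 0 p q ↔ Code.Compat x n 0 0 q := by
          intro p q
          simp [Code.Compat]
        induction k with
        | zero => simp
        | succ k ih =>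
          refine ⟨?_, fun _ => rfl⟩
          simp only [Bool.and_eq_true, decide_eq_true_eq]
          rw [ih.1, Nat.forall_lt_succ_right, and_assoc]
          refine and_congr_right fun _ => and_congr_right fun _ => ?_
          rcases k with _ | k
          · exact (h0 _ _).symm
          · rw [ih.2 (Nat.succ_pos _)]
      simp only [(hrec _ _ _).1, decide_eq_true_eq]
      constructor
      · rintro ⟨D, rfl, hs, hh⟩
        have hle : D.a ≤ κ D.encode := by
          rw [hκ, pHOM_param_eq, D.size_eq]
          omega
        have hp := Code.isPath_of_star hs (n := n) (by
          rw [hn]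
          exact (Nat.pow_le_pow_left hle _).trans (Nat.pow_le_pow_right (by have := D.a_pos; omega) hle))
        have hst := Code.isPath_spec hp
        obtain ⟨w, hw, hc⟩ := hst.exists_isHom_iff.1 hh
        obtain ⟨r, hr, -⟩ := hst.edge
        have ea := (Code.spec D).2.1
        refine ⟨w, ?_, hp, ?_⟩
        · rw [if_pos hp, ea]
          intro i hi
          refine (hw i hi).trans ?_
          refine lt_of_le_of_lt ?_ (Nat.lt_pow_succ_log_self (by norm_num) _)
          simp only [PairCode.encode, List.length_append, encUnary, List.length_replicate]
          omega
        · rw [if_pos hp, ea]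
          intro i hi
          exact (Code.compat_iff D _ _ _ _ (List.getElem?_eq_some_iff.1 hr).1).2 (hc i hi)
      · rintro ⟨w, -, hp, hc⟩
        obtain ⟨D, rfl⟩ := Code.valid_iff.1 hp.1
        have hst := Code.isPath_spec hp
        have ea := (Code.spec D).2.1
        obtain ⟨r, hr, -⟩ := hst.edge
        rw [if_pos hp, ea] at hc
        have hc' : ∀ i < D.a, D.Compat (dig D.a (Code.order D.encode n))
            (Code.edgeIdx D.encode n) i (w (i - 1)) (w i) := fun i hi =>
          (Code.compat_iff D _ _ _ _ (List.getElem?_eq_some_iff.1 hr).1).1 (hc i hi)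
        refine ⟨D, rfl, hst.star, hst.exists_isHom_iff.2 ⟨w, fun i hi => ?_, hc'⟩⟩
        obtain ⟨j, hj, r, g₁, g₂, g₃⟩ := hst.point i hi
        have := (hc' i hi).2 j r hj g₁ ((g₃ _ (hst.lt i hi)).2 rfl)
        exact (D.right_tuple r (List.mem_of_getElem? g₁) _ this).2 _ (by simp)
    · intro x n r h0 hr
      refine (h₃ x n r h0 hr).trans ?_
      dsimp only
      split_ifs with hp
      · obtain ⟨D, rfl⟩ := Code.valid_iff.1 hp.1
        rw [(Code.spec D).2.1]
        have hle : D.a ≤ κ D.encode := by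
          rw [hκ, pHOM_param_eq, D.size_eq]
          omega
        have hlog : 1 ≤ Nat.log 2 D.encode.length := by
          refine Nat.log_pos (by norm_num) ?_
          simp only [PairCode.encode, List.length_append, encUnary, List.length_replicate,
            List.length_singleton]
          omega
        change D.a * (Nat.log 2 D.encode.length + 1) ≤
          2 * κ D.encode * Nat.log 2 D.encode.length
        nlinarith
      · simp

end ParamLog

namespace ParamLog
open NCode (enc)

/-! ## Decoding -/

/-- Codes can be decoded in logarithmic space. -/
class NDec (α : Type) [NCode α] where
  dec : ℕ → α
  dec_enc : ∀ a, dec (enc a) = a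
  ls : LS fun _ n => dec n

open NDec (dec dec_enc)

instance : NDec ℕ := ⟨id, fun _ => rfl, LS.id⟩

theorem LS.unpair_fst {α : Type} [NCode α] {f : List Bool → α → ℕ} (hf : LS f) :
    LS fun x a => (Nat.unpair (f x a)).1 := by
  obtain ⟨g, hg, h⟩ := hf
  exact ⟨_, hg.left, fun x a => by rw [h]; rfl⟩

theorem LS.unpair_snd {α : Type} [NCode α] {f : List Bool → α → ℕ} (hf : LS f) :
    LS fun x a => (Nat.unpair (f x a)).2 := by
  obtain ⟨g, hg, h⟩ := hf
  exact ⟨_, hg.right, fun x a => by rw [h]; rfl⟩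

theorem LS.natPair {α : Type} [NCode α] {f g : List Bool → α → ℕ} (hf : LS f) (hg : LS g) :
    LS fun x a => Nat.pair (f x a) (g x a) := (hf.pair hg).toNat

instance {α β : Type} [NCode α] [NCode β] [NDec α] [NDec β] : NDec (α × β) where
  dec n := (dec (Nat.unpair n).1, dec (Nat.unpair n).2)
  dec_enc p := by simp [dec_enc]
  ls := ((NDec.ls (α := α)).comp LS.id.unpair_fst).pair ((NDec.ls (α := β)).comp LS.id.unpair_snd)

/-- Decoding of tuples. -/
def tupDec {α : Type} [NCode α] [NDec α] : (k : ℕ) → ℕ → Fin k → α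
  | 0, _ => Fin.elim0
  | k + 1, n => Fin.cons (dec (Nat.unpair n).1) (tupDec k (Nat.unpair n).2)

instance {α : Type} [NCode α] [NDec α] {k : ℕ} : NDec (Fin k → α) where
  dec := tupDec k
  dec_enc f := by
    show tupDec k (tupEnc k fun i => enc (f i)) = f
    induction k with
    | zero => exact Subsingleton.elim _ _
    | succ k ih =>
      have := ih (Fin.tail f)
      simp only [tupDec, tupEnc, Nat.unpair_pair, dec_enc]
      rw [← Fin.cons_self_tail f]
      congr 1
  ls := by
    refine LS.tuple fun j => ?_
    induction k with
    | zero => exact j.elim0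
    | succ k ih =>
      refine Fin.cases ?_ (fun j => ?_) j
      · exact (NDec.ls (α := α)).comp LS.id.unpair_fst
      · exact (ih j).comp LS.id.unpair_snd

/-- Codes for a finite type, with decoding, in which a given element has code `0`. -/
theorem exists_finite_code (α : Type) [Finite α] (a₀ : α) : ∃ e : α → ℕ, Function.Injective e ∧
    e a₀ = 0 ∧ (∀ a, e a < Nat.card α) ∧ ∀ n < Nat.card α, ∃ a, e a = n := by
  have : Nonempty α := ⟨a₀⟩
  have hc : 0 < Nat.card α := Nat.card_pos
  set f := (Finite.equivFin α).trans (Equiv.swap (Finite.equivFin α a₀) ⟨0, hc⟩) with hf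
  refine ⟨fun a => f a, fun a b h => f.injective (Fin.val_injective h), ?_, fun a => (f a).2,
    fun n hn => ⟨f.symm ⟨n, hn⟩, by simp⟩⟩
  simp [hf]

/-- The code of an element of a finite type. -/
noncomputable def finCode {α : Type} [Finite α] (a₀ : α) : α → ℕ :=
  (exists_finite_code α a₀).choose

section

variable {α : Type} [Finite α] (a₀ : α)

theorem finCode_injective : Function.Injective (finCode a₀) :=
  (exists_finite_code α a₀).choose_spec.1

theorem finCode_self : finCode a₀ a₀ = 0 := (exists_finite_code α a₀).choose_spec.2.1

theorem finCode_lt (a : α) : finCode a₀ a < Nat.card α :=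
  (exists_finite_code α a₀).choose_spec.2.2.1 a

theorem exists_finCode {n : ℕ} (hn : n < Nat.card α) : ∃ a, finCode a₀ a = n :=
  (exists_finite_code α a₀).choose_spec.2.2.2 n hn

/-- The instance given by `finCode`. -/
noncomputable abbrev NCode.fin : NCode α := ⟨finCode a₀, finCode_injective a₀⟩

open Classical in
/-- Decoding for `finCode`. -/
noncomputable abbrev NDec.fin : @NDec α (NCode.fin a₀) :=
  letI := NCode.fin a₀
  { dec := fun n => if h : ∃ a, finCode a₀ a = n then h.choose else a₀
    dec_enc := fun a => by
      have h : ∃ b, finCode a₀ b = finCode a₀ a := ⟨a, rfl⟩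
      show (if h : ∃ b, finCode a₀ b = finCode a₀ a then h.choose else a₀) = a
      rw [dif_pos h]
      exact finCode_injective a₀ h.choose_spec
    ls := by
      have h : LS fun _ (n : ℕ) => if n < Nat.card α then n else 0 :=
        LS.ite (LS.id.lt (.const _)) LS.id (.const 0)
      obtain ⟨g, hg, h⟩ := h
      refine ⟨g, hg, fun x n => (h x n).trans ?_⟩
      show (if n < Nat.card α then n else 0) =
        finCode a₀ (if h : ∃ a, finCode a₀ a = n then h.choose else a₀)
      split_ifs with h₁ h₂ h₂
      · exact h₂.choose_spec.symm
      · exact absurd (exists_finCode a₀ h₁) h₂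
      · obtain ⟨a, rfl⟩ := h₂
        exact absurd (finCode_lt a₀ a) h₁
      · exact (finCode_self a₀).symm }

end

/-! ## Short paths -/

theorem exists_path_of_reflTransGen {α : Type*} {R : α → α → Prop} {a b : α}
    (h : Relation.ReflTransGen R a b) :
    ∃ (n : ℕ) (r : ℕ → α), r 0 = a ∧ (∀ i < n, R (r i) (r (i + 1))) ∧ r n = b := by
  induction h with
  | refl => exact ⟨0, fun _ => a, rfl, by simp, rfl⟩
  | @tail b c _ hbc ih =>
    obtain ⟨n, r, h₀, hr, hn⟩ := ih
    refine ⟨n + 1, fun i => if i ≤ n then r i else c, by simp [h₀], fun i hi => ?_, by simp⟩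
    dsimp only
    rcases (Nat.lt_succ_iff.1 hi).lt_or_eq with h | rfl
    · rw [if_pos h.le, if_pos (Nat.succ_le_of_lt h)]
      exact hr i h
    · rw [if_pos le_rfl, if_neg (by omega), hn]
      exact hbc

theorem reflTransGen_of_path {α : Type*} {R : α → α → Prop} {n : ℕ} {r : ℕ → α}
    (hr : ∀ i < n, R (r i) (r (i + 1))) {i : ℕ} (hi : i ≤ n) : Relation.ReflTransGen R (r 0) (r i) := by
  induction i with
  | zero => exact .refl
  | succ i ih => exact (ih (by omega)).tail (hr i (by omega))

/-- A shortest path visits no point twice, since the part between two visits could be cut out. By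
injectivity of the codes on reachable points its length is at most `B`. -/
theorem exists_short_path {α : Type*} {R : α → α → Prop} {a : α} {P : α → Prop} {e : α → ℕ} {B : ℕ}
    (hinj : ∀ b c, Relation.ReflTransGen R a b → Relation.ReflTransGen R a c → e b = e c → b = c)
    (hB : ∀ b, Relation.ReflTransGen R a b → e b ≤ B)
    (h : ∃ b, Relation.ReflTransGen R a b ∧ P b) :
    ∃ n ≤ B, ∃ r : ℕ → α, r 0 = a ∧ (∀ i < n, R (r i) (r (i + 1))) ∧ P (r n) := by
  classical
  have hex : ∃ n, ∃ r : ℕ → α, r 0 = a ∧ (∀ i < n, R (r i) (r (i + 1))) ∧ P (r n) := by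
    obtain ⟨b, hb, hP⟩ := h
    obtain ⟨n, r, h₀, hr, rfl⟩ := exists_path_of_reflTransGen hb
    exact ⟨n, r, h₀, hr, hP⟩
  obtain ⟨r, h₀, hr, hP⟩ := Nat.find_spec hex
  set n := Nat.find hex with hn
  refine ⟨n, ?_, r, h₀, hr, hP⟩
  by_contra hlt
  push Not at hlt
  have hreach : ∀ i ≤ n, Relation.ReflTransGen R a (r i) := fun i hi =>
    h₀ ▸ reflTransGen_of_path hr hi
  obtain ⟨i, hi, j, hj, hij, heq⟩ := Finset.exists_ne_map_eq_of_card_lt_of_maps_to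
    (s := Finset.range (n + 1)) (t := Finset.range (B + 1)) (f := fun i => e (r i))
    (by simpa using hlt) fun i hi => by
      have := hB _ (hreach i (by have := Finset.mem_range.1 (Finset.mem_coe.1 hi); omega))
      simpa using Nat.lt_succ_of_le this
  have key : ∀ i j, i < j → j ≤ n → r i = r j → False := by
    intro i j hij hj heq
    refine Nat.find_min hex (m := n - (j - i)) (by omega)
      ⟨fun l => if l ≤ i then r l else r (l + (j - i)), by simp [h₀], fun l hl => ?_, ?_⟩
    · dsimp only
      rcases lt_trichotomy l i with h | rfl | h
      · rw [if_pos h.le, if_pos (by omega)]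
        exact hr l (by omega)
      · rw [if_pos le_rfl, if_neg (by omega), heq, show l + 1 + (j - l) = j + 1 by omega]
        exact hr j (by omega)
      · rw [if_neg (by omega), if_neg (by omega), show l + 1 + (j - i) = l + (j - i) + 1 by omega]
        exact hr _ (by omega)
    · dsimp only
      split_ifs with hc
      · have e₁ : n - (j - i) = i := by omega
        have e₂ : j = n := by omega
        rw [e₁, heq, e₂]
        exact hP
      · rw [show n - (j - i) + (j - i) = n by omega]
        exact hP
  have hi' : i ≤ n := by have := Finset.mem_range.1 hi; omega
  have hj' : j ≤ n := by have := Finset.mem_range.1 hj; omega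
  have := hinj _ _ (hreach i hi') (hreach j hj') heq
  rcases lt_or_gt_of_ne hij with h | h
  · exact key i j h hj' this
  · exact key j i h hi' this.symm

/-! ## Digits -/

/-- Replace the digit at the place with weight `P` to base `q` by `a`. -/
def setDig (q t P a : ℕ) : ℕ := t / (P * q) * (P * q) + (a * P + t % P)

theorem dig_eq_mod (q t p : ℕ) : dig q t p = t % q ^ (p + 1) / q ^ p := by
  rw [dig, pow_succ, Nat.mod_mul_right_div_self]

theorem setDig_tail_lt {q t h a : ℕ} (ha : a < q) : a * q ^ h + t % q ^ h < q ^ h * q := by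
  have : t % q ^ h < q ^ h := Nat.mod_lt _ (pow_pos (by omega) _)
  calc a * q ^ h + t % q ^ h < (a + 1) * q ^ h := by linarith
    _ ≤ q * q ^ h := Nat.mul_le_mul_right _ ha
    _ = q ^ h * q := mul_comm _ _

/-- The number is split into the part above the place `h`, the digit at this place and the remainder
modulo `q ^ h`. Only the middle part is exchanged, and the three cases of the place `p` read off one
part each. -/
theorem dig_setDig {q t h a p : ℕ} (ha : a < q) :
    dig q (setDig q t (q ^ h) a) p = if p = h then a else dig q t p := by
  have hq : 0 < q := by omega
  have hpos : ∀ n, 0 < q ^ n := fun n => pow_pos hq n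
  have hlt := setDig_tail_lt (t := t) (h := h) ha
  have hmod : t % q ^ h < q ^ h := Nat.mod_lt _ (hpos h)
  split_ifs with e
  · subst e
    have : setDig q t (q ^ p) a = t % q ^ p + q ^ p * (t / (q ^ p * q) * q + a) := by
      unfold setDig; ring
    rw [dig, this, Nat.add_mul_div_left _ _ (hpos p), Nat.div_eq_of_lt hmod, zero_add,
      Nat.mul_add_mod_self_right, Nat.mod_eq_of_lt ha]
  · rcases lt_or_gt_of_ne e with e | e
    · rw [dig_eq_mod, dig_eq_mod]
      have h₁ : setDig q t (q ^ h) a = t % q ^ h + q ^ h * (t / (q ^ h * q) * q + a) := by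
        unfold setDig; ring
      have h₂ : setDig q t (q ^ h) a % q ^ h = t % q ^ h := by
        rw [h₁, Nat.add_mul_mod_self_left, Nat.mod_mod]
      have h₃ : ∀ s, s % q ^ (p + 1) = s % q ^ h % q ^ (p + 1) := fun s =>
        (Nat.mod_mod_of_dvd s (pow_dvd_pow q (by omega))).symm
      rw [h₃, h₂, ← h₃]
    · have h₁ : ∀ s, s / q ^ p = s / (q ^ h * q) / q ^ (p - h - 1) := by
        intro s
        rw [Nat.div_div_eq_div_mul, ← pow_succ, ← pow_add]
        congr 2
        omega
      have h₂ : setDig q t (q ^ h) a / (q ^ h * q) = t / (q ^ h * q) := by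
        unfold setDig
        rw [add_comm, Nat.add_mul_div_right _ _ (by have := hpos h; positivity), Nat.div_eq_of_lt hlt,
          zero_add]
      rw [dig, dig, h₁, h₂, ← h₁]

theorem setDig_lt {q t h a S : ℕ} (ha : a < q) (hS : h < S) (ht : t < q ^ S) :
    setDig q t (q ^ h) a < q ^ S := by
  have hq : 0 < q := by omega
  have hlt := setDig_tail_lt (t := t) (h := h) ha
  have e : q ^ S = q ^ (S - h - 1) * (q ^ h * q) := by
    rw [← pow_succ, ← pow_add]; congr 1; omega
  have h₁ : t / (q ^ h * q) < q ^ (S - h - 1) :=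
    Nat.div_lt_of_lt_mul (by rw [mul_comm, ← e]; exact ht)
  unfold setDig
  rw [e]
  calc _ < t / (q ^ h * q) * (q ^ h * q) + q ^ h * q := by omega
    _ = (t / (q ^ h * q) + 1) * (q ^ h * q) := by ring
    _ ≤ _ := Nat.mul_le_mul_right _ h₁

end ParamLog

namespace ParamLog
open NCode (enc)
open NDec (dec dec_enc)

/-! ## Machines on an input that is given implicitly -/

/-- The strings `vx w` can be read in logarithmic space on input `w`. -/
structure Virtual (vx : List Bool → List Bool) : Prop where
  length : LS fun w (_ : ℕ) => (vx w).length
  read : LS fun w (p : ℕ) => readInput (vx w) p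

section

variable {vx : List Bool → List Bool} {α : Type} [NCode α]

theorem Virtual.length' (h : Virtual vx) : LS fun w (_ : α) => (vx w).length :=
  h.length.comp (f := fun _ (_ : α) => 0) (.const 0)

theorem Virtual.read' (h : Virtual vx) {f : List Bool → α → ℕ} (hf : LS f) :
    LS fun w a => readInput (vx w) (f w a) := h.read.comp hf

end

instance : Finite Dir := by
  have : Function.Injective fun d : Dir => match d with
      | .left => (0 : Fin 3)
      | .stay => 1
      | .right => 2 := by
    rintro (_ | _ | _) (_ | _ | _) h <;> first | rfl | exact absurd h (by decide)
  exact Finite.of_injective _ this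

instance : Finite InSym := by
  have : Function.Injective fun s : InSym => match s with
      | .left => (0 : Fin 4)
      | .bit false => 1
      | .bit true => 2
      | .right => 3 := by
    rintro (_ | (_ | _) | _) (_ | (_ | _) | _) h <;> first | rfl | exact absurd h (by decide)
  exact Finite.of_injective _ this

noncomputable instance : NCode Dir := NCode.fin Dir.stay

namespace TM

variable (M : TM)

noncomputable instance : NCode M.State := NCode.fin M.start
noncomputable instance : NDec M.State := NDec.fin M.start
noncomputable instance : NCode M.Sym := NCode.fin M.blank
noncomputable instance : NDec M.Sym := NDec.fin M.blank

/-- The base in which the contents of the worktapes are written. -/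
noncomputable def base : ℕ := Nat.card M.Sym + 1

theorem enc_sym_lt (a : M.Sym) : enc a < M.base := (finCode_lt M.blank a).trans (Nat.lt_succ_self _)

/-- The blank is the digit `0`, so a tape that is blank almost everywhere is a natural number, and
the empty tape is `0`. -/
theorem enc_blank : enc M.blank = 0 := finCode_self M.blank

theorem two_le_base : 2 ≤ M.base := by
  have : Nonempty M.Sym := ⟨M.blank⟩
  have : 0 < Nat.card M.Sym := Nat.card_pos
  unfold base
  omega

theorem base_pos : 0 < M.base := by have := M.two_le_base; omega

/-- Configurations with a worktape written as a number, together with the weight of the scanned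
cell. -/
abbrev Code : Type := M.State × ℕ × (Fin M.tapes → ℕ × ℕ)

/-- The weight of the cell after a move. -/
def moveWeight (q P : ℕ) : Dir → ℕ
  | .left => if P = 1 then 1 else P / q
  | .stay => P
  | .right => P * q

/-- Storing `q ^ p` in place of the head position `p` reduces scanning and writing to divisions, and
moving the head to a multiplication or division by `q`. No power with variable exponent has to be
computed. -/
theorem moveWeight_pow {q : ℕ} (hq : 2 ≤ q) (p : ℕ) (d : Dir) :
    moveWeight q (q ^ p) d = q ^ moveWork p d := by
  rcases d with _ | _ | _
  · rcases p with _ | p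
    · simp [moveWeight, moveWork]
    · have : q ^ (p + 1) ≠ 1 := (Nat.one_lt_pow (by omega) (by omega)).ne'
      rw [moveWeight, if_neg this, moveWork, pow_succ, Nat.mul_div_cancel _ (by omega)]
      simp
  · rfl
  · rw [moveWeight, moveWork, pow_succ]

/-- The symbols scanned on the worktapes. -/
noncomputable def scan (c : M.Code) : Fin M.tapes → M.Sym :=
  fun j => dec ((c.2.2 j).2 / (c.2.2 j).1 % M.base)

/-- What the transition function looks at. -/
noncomputable def view (x : List Bool) (c : M.Code) : M.State × InSym × (Fin M.tapes → M.Sym) :=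
  (c.1, readInput x c.2.1, M.scan c)

/-- The transition function on the scanned symbols. -/
def act (a : M.State × InSym × (Fin M.tapes → M.Sym)) : M.State × Dir × (Fin M.tapes → M.Sym × Dir) :=
  M.δ a.1 a.2.1 a.2.2

/-- The step on codes. -/
noncomputable def nextCode (x : List Bool) (c : M.Code) : M.Code :=
  let a := M.act (M.view x c)
  (a.1, moveInput x c.2.1 a.2.1, fun j =>
    (moveWeight M.base (c.2.2 j).1 (a.2.2 j).2,
      setDig M.base (c.2.2 j).2 (c.2.2 j).1 (enc (a.2.2 j).1)))

/-- The code of the starting configuration. -/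
def startCode : M.Code := (M.start, 0, fun _ => (1, 0))

/-- `c` is the code of `C`, and the worktapes of `C` are blank from cell `S` on. -/
structure Rep (x : List Bool) (S : ℕ) (c : M.Code) (C : M.Cfg) : Prop where
  state : c.1 = C.state
  inHead : c.2.1 = C.inHead
  weight : ∀ j, (c.2.2 j).1 = M.base ^ C.head j
  digit : ∀ j p, dig M.base (c.2.2 j).2 p = enc (C.tape j p)
  inHead_le : C.inHead ≤ x.length + 1
  tape_lt : ∀ j, (c.2.2 j).2 < M.base ^ S

variable {M} {x : List Bool} {S : ℕ} {c : M.Code} {C : M.Cfg}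

theorem rep_start : M.Rep x S M.startCode M.startCfg where
  state := rfl
  inHead := rfl
  weight _ := rfl
  digit j p := by
    show dig _ 0 p = enc M.blank
    rw [enc_blank, dig, Nat.zero_div, Nat.zero_mod]
  inHead_le := Nat.zero_le _
  tape_lt _ := pow_pos M.base_pos _

namespace Rep

theorem scan_eq (h : M.Rep x S c C) : M.scan c = M.scanned C := by
  funext j
  show dec ((c.2.2 j).2 / (c.2.2 j).1 % M.base) = _
  have := h.digit j (C.head j)
  rw [h.weight]
  unfold dig at this
  rw [this, dec_enc]
  rfl

theorem view_eq (h : M.Rep x S c C) : M.view x c = (C.state, readInput x C.inHead, M.scanned C) := by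
  rw [view, h.scan_eq, h.state, h.inHead]

theorem next (h : M.Rep x S c C) (hS : ∀ j, C.head j < S) :
    M.Rep x S (M.nextCode x c) (M.next x C) where
  state := by simp only [nextCode, TM.next, act, h.view_eq]
  inHead := by simp only [nextCode, TM.next, act, h.view_eq, h.inHead]
  weight j := by
    simp only [nextCode, TM.next, act, h.view_eq, h.weight]
    exact moveWeight_pow M.two_le_base _ _
  digit j p := by
    simp only [nextCode, TM.next, act, h.view_eq, h.weight]
    rw [dig_setDig (M.enc_sym_lt _), Function.update_apply]
    split_ifs
    · rfl
    · exact h.digit j p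
  inHead_le := by
    have := h.inHead_le
    simp only [TM.next]
    generalize (M.δ _ _ _).2.1 = d
    rcases d with _ | _ | _ <;> simp only [moveInput] <;> omega
  tape_lt j := by
    simp only [nextCode, h.weight]
    exact setDig_lt (M.enc_sym_lt _) (hS j) (h.tape_lt j)

/-- A code determines its configuration. This is the injectivity used to find short runs. -/
theorem unique {C' : M.Cfg} (h : M.Rep x S c C) (h' : M.Rep x S c C') : C = C' := by
  rcases C with ⟨s, i, hd, t⟩
  rcases C' with ⟨s', i', hd', t'⟩
  have e₁ : s = s' := h.state.symm.trans h'.state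
  have e₂ : i = i' := h.inHead.symm.trans h'.inHead
  have e₃ : hd = hd' := funext fun j =>
    Nat.pow_right_injective M.two_le_base ((h.weight j).symm.trans (h'.weight j))
  have e₄ : t = t' := funext fun j => funext fun p =>
    NCode.inj ((h.digit j p).symm.trans (h'.digit j p))
  rw [e₁, e₂, e₃, e₄]

theorem set_state (h : M.Rep x S c C) (s : M.State) : M.Rep x S (s, c.2) { C with state := s } :=
  ⟨rfl, h.inHead, h.weight, h.digit, h.inHead_le, h.tape_lt⟩

end Rep

theorem tupEnc_mono {k : ℕ} {f g : Fin k → ℕ} (h : ∀ j, f j ≤ g j) : tupEnc k f ≤ tupEnc k g := by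
  induction k with
  | zero => exact le_rfl
  | succ k ih => exact pair_mono (h 0) (ih fun j => h j.succ)

/-- A bound on the codes of configurations with worktapes below `Q` on inputs of length `n`. -/
noncomputable def codeBound (M : TM) (n Q : ℕ) : ℕ :=
  Nat.pair (Nat.card M.State) (Nat.pair (n + 1) (tupEnc M.tapes fun _ => Nat.pair Q Q))

theorem polyBdd_codeBound : PolyBdd fun x Q => M.codeBound x.length Q := by
  refine (PolyBdd.const _).pair ((PolyBdd.length.add (.const 1)).pair ?_)
  induction M.tapes with
  | zero => exact .const 0
  | succ k ih => exact (PolyBdd.arg.pair .arg).pair ih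

theorem Rep.enc_le (h : M.Rep x S c C) (hS : ∀ j, C.head j < S) :
    enc c ≤ M.codeBound x.length (M.base ^ S) := by
  refine pair_mono (finCode_lt M.start c.1).le (pair_mono ?_ (tupEnc_mono fun j => ?_))
  · rw [enc_nat, h.inHead]
    exact h.inHead_le
  · refine pair_mono ?_ (h.tape_lt j).le
    rw [enc_nat, h.weight]
    exact Nat.pow_le_pow_right M.base_pos (hS j).le

/-- The space splits into a part given by the parameter, which is absorbed by `Φ`, and a multiple of
`log n`. As the base is at most `2 ^ base`, the latter contributes only a power of `n` with constant
exponent. -/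
theorem exists_codeBound_le (M : TM) (d : ℕ) : ∃ e, ∀ n s Φ, M.base ^ (d * s) ≤ Φ →
    M.codeBound n (M.base ^ (d * (s + Nat.log 2 n))) ≤ (n + Φ + 2) ^ e := by
  obtain ⟨D, hD⟩ := M.polyBdd_codeBound
  refine ⟨(M.base * d + 2) * D, fun n s Φ hΦ => ?_⟩
  have := hD (List.replicate n true) (M.base ^ (d * (s + Nat.log 2 n)))
  beta_reduce at this
  rw [List.length_replicate] at this
  refine this.trans ?_
  rw [pow_mul _ (M.base * d + 2) D]
  refine Nat.pow_le_pow_left ?_ D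
  have h₁ : M.base ^ (d * Nat.log 2 n) ≤ (n + Φ + 2) ^ (M.base * d) := by
    calc M.base ^ (d * Nat.log 2 n) ≤ (2 ^ M.base) ^ (d * Nat.log 2 n) :=
          Nat.pow_le_pow_left Nat.lt_two_pow_self.le _
      _ = (2 ^ Nat.log 2 n) ^ (M.base * d) := by rw [← pow_mul, ← pow_mul]; ring_nf
      _ ≤ _ := by
          refine Nat.pow_le_pow_left ?_ _
          rcases Nat.eq_zero_or_pos n with h | h
          · simp [h]
          · have := Nat.pow_log_le_self 2 h.ne'
            omega
  have h₂ : M.base ^ (d * (s + Nat.log 2 n)) ≤ Φ * (n + Φ + 2) ^ (M.base * d) := by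
    rw [mul_add, pow_add]
    exact Nat.mul_le_mul hΦ h₁
  have h₃ : 1 ≤ (n + Φ + 2) ^ (M.base * d) := Nat.one_le_pow _ _ (by omega)
  rw [pow_add]
  set A := (n + Φ + 2) ^ (M.base * d)
  calc n + M.base ^ (d * (s + Nat.log 2 n)) + 2 ≤ n * A + Φ * A + 2 * A := by nlinarith
    _ = A * (n + Φ + 2) := by ring
    _ ≤ A * (n + Φ + 2) ^ 2 := Nat.mul_le_mul_left _ (by nlinarith)

section

variable {vx : List Bool → List Bool}

theorem ls_scan : LS fun _ (c : M.Code) => M.scan c := by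
  refine LS.tuple fun j => ?_
  have := (LS.id (α := M.Code)).snd.snd.apply j
  exact (NDec.ls (α := M.Sym)).comp ((this.snd.div this.fst).mod (.const M.base))

theorem ls_view (hv : Virtual vx) : LS fun w (c : M.Code) => M.view (vx w) c :=
  LS.id.fst.pair ((hv.read' LS.id.snd.fst).pair ls_scan)

theorem ls_moveInput (hv : Virtual vx) : LS fun w (p : ℕ × Dir) => moveInput (vx w) p.1 p.2 := by
  classical
  have h : LS fun w (p : ℕ × Dir) => if p.2 = .left then p.1 - 1 else if p.2 = .stay then p.1 else
      if p.1 + 1 ≤ (vx w).length + 1 then p.1 + 1 else (vx w).length + 1 := by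
    have h₁ : LS fun (_ : List Bool) (p : ℕ × Dir) => p.1 + 1 := LS.id.fst.add (.const 1)
    have h₂ : LS fun w (_ : ℕ × Dir) => (vx w).length + 1 := hv.length'.add (.const 1)
    exact LS.ite (LS.id.snd.eq (.const _)) (LS.id.fst.sub (.const 1))
      (LS.ite (LS.id.snd.eq (.const _)) LS.id.fst (LS.ite (h₁.le h₂) h₁ h₂))
  refine h.congr fun w p => ?_
  rcases p with ⟨p, _ | _ | _⟩
  · exact if_pos rfl
  · exact (if_neg (by simp)).trans (if_pos rfl)
  · rw [if_neg (by simp), if_neg (by simp)]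
    simp only [moveInput]
    split_ifs <;> omega

theorem ls_moveWeight (q : ℕ) : LS fun _ (p : ℕ × Dir) => moveWeight q p.1 p.2 := by
  classical
  have h : LS fun _ (p : ℕ × Dir) => if p.2 = .left then (if p.1 = 1 then 1 else p.1 / q) else
      if p.2 = .stay then p.1 else p.1 * q :=
    LS.ite (LS.id.snd.eq (.const _)) (LS.ite (LS.id.fst.eq (.const _)) (.const 1)
      (LS.id.fst.div (.const q))) (LS.ite (LS.id.snd.eq (.const _)) LS.id.fst
      (LS.id.fst.mul (.const q)))
  refine h.congr fun w p => ?_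
  rcases p with ⟨p, _ | _ | _⟩ <;> simp [moveWeight]

theorem ls_setDig (q : ℕ) : LS fun _ (p : ℕ × ℕ × ℕ) => setDig q p.1 p.2.1 p.2.2 := by
  have h : LS fun (_ : List Bool) (p : ℕ × ℕ × ℕ) => p.2.1 * q := LS.id.snd.fst.mul (.const q)
  exact ((LS.id.fst.div h).mul h).add ((LS.id.snd.snd.mul LS.id.snd.fst).add
    (LS.id.fst.mod LS.id.snd.fst))

theorem ls_nextCode (hv : Virtual vx) : LS fun w (c : M.Code) => M.nextCode (vx w) c := by
  have ha : LS fun w (c : M.Code) => M.act (M.view (vx w) c) :=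
    (LS.ofFinite M.act).comp (ls_view hv)
  refine ha.fst.pair (((ls_moveInput hv).comp (LS.id.snd.fst.pair ha.snd.fst)).pair
    (LS.tuple fun j => ?_))
  have h₁ := ha.snd.snd.apply j
  have h₂ := (LS.id (α := M.Code)).snd.snd.apply j
  exact ((ls_moveWeight M.base).comp (h₂.fst.pair h₁.snd)).pair
    ((ls_setDig M.base).comp (h₂.snd.pair (h₂.fst.pair h₁.fst.toNat)))

end

end TM
end ParamLog

namespace ParamLog
open NCode (enc)
open NDec (dec dec_enc)

/-! ## Comparing the output of a transducer with a number -/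

/-- Remove the lowest bit of `u - 1` if it is `b`; the value `0` stands for failure. -/
def readBit (u : ℕ) (b : Bool) : ℕ := if 2 ≤ u ∧ (u - 1) % 2 = b.toNat then (u - 1) / 2 + 1 else 0

theorem readBit_le (u : ℕ) (b : Bool) : readBit u b ≤ u := by
  unfold readBit
  split_ifs <;> omega

theorem foldl_readBit_le (u : ℕ) (o : List Bool) : o.foldl readBit u ≤ u := by
  induction o generalizing u with
  | nil => exact le_rfl
  | cons b o ih => exact (ih _).trans (readBit_le u b)

/-- The output can be compared with `v` while it is produced, without being stored: each bit must
match the lowest remaining bit of `v`. The offset by one reserves `0` for failure, and `1` means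
that `v` is used up. An output longer than `v.bits` also ends in failure. -/
theorem foldl_readBit_eq_one (v : ℕ) (o : List Bool) : o.foldl readBit (v + 1) = 1 ↔ o = v.bits := by
  induction o generalizing v with
  | nil =>
    rw [List.foldl_nil]
    constructor
    · intro h
      obtain rfl : v = 0 := by omega
      simp
    · intro h
      have := congrArg List.length h
      rw [length_bits, List.length_nil] at this
      have := Nat.size_eq_zero.1 this.symm
      omega
  | cons b o ih =>
    rw [List.foldl_cons]
    rcases Nat.eq_zero_or_pos v with rfl | hv
    · have h := foldl_readBit_le 0 o
      simp [readBit, show o.foldl readBit 0 = 0 by omega]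
    · have hb : v.bits = v.bodd :: v.div2.bits := by
        conv_lhs => rw [← Nat.bit_bodd_div2 v]
        refine Nat.bits_append_bit _ _ fun h => ?_
        have h₁ := Nat.bodd_add_div2 v
        rw [h] at h₁
        rcases hh : v.bodd with _ | _
        · rw [hh] at h₁; simp at h₁; omega
        · rfl
      have hm : v % 2 = v.bodd.toNat := Nat.mod_two_of_bodd v
      rw [hb, readBit]
      split_ifs with h
      · have e : v.bodd = b := by
          have h₂ := h.2
          rw [Nat.add_sub_cancel, hm] at h₂
          rcases hh : v.bodd with _ | _ <;> rcases b with _ | _ <;> simp_all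
        rw [Nat.add_sub_cancel, ih, e, ← Nat.div2_val]
        simp
      · have h₀ := foldl_readBit_le 0 o
        constructor
        · intro h'; omega
        · intro h'
          have : b = v.bodd := (List.cons.inj h').1
          exact absurd ⟨by omega, by rw [Nat.add_sub_cancel, hm, this]⟩ h

theorem ls_readBit : LS fun _ (p : ℕ × Bool) => readBit p.1 p.2 := by
  classical
  have h : LS fun (_ : List Bool) (p : ℕ × Bool) => p.1 - 1 := LS.id.fst.sub (.const 1)
  have hb : LS fun (_ : List Bool) (p : ℕ × Bool) => p.2.toNat :=
    (LS.ofFinite Bool.toNat).comp LS.id.snd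
  exact LS.ite (((LS.const 2).le LS.id.fst).and ((h.mod (.const 2)).eq hb))
    ((h.div (.const 2)).add (.const 1)) (.const 0)

/-- Iterating a partial function up to a point where it is undefined. -/
theorem iterate_getD_eq {α : Type*} {f : α → Option α} {a b : α}
    (h : Relation.ReflTransGen (fun s t => f s = some t) a b) (hb : f b = none) {n B : ℕ}
    (hn : f ((fun s => (f s).getD s)^[n] a) = none) (hB : n ≤ B) :
    (fun s => (f s).getD s)^[B] a = b := by
  set F := fun s => (f s).getD s with hF
  have hhalt : ∀ s k, f s = none → F^[k] s = s := by
    intro s k hs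
    exact Function.iterate_fixed (by rw [hF]; simp [hs]) k
  obtain ⟨m, hm⟩ : ∃ m, F^[m] a = b := by
    clear hb
    induction h with
    | refl => exact ⟨0, rfl⟩
    | @tail s t _ hst ih =>
      obtain ⟨m, rfl⟩ := ih
      refine ⟨m + 1, ?_⟩
      rw [Function.iterate_succ_apply']
      show (f (F^[m] a)).getD _ = t
      rw [hst, Option.getD_some]
  have h₁ : F^[n + m] a = b := by rw [Function.iterate_add_apply, hm, hhalt _ _ hb]
  have h₂ : F^[m + n] a = F^[n] a := by rw [Function.iterate_add_apply, hhalt _ _ hn]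
  have h₃ : F^[B - n + n] a = F^[n] a := by rw [Function.iterate_add_apply, hhalt _ _ hn]
  rw [show B - n + n = B by omega] at h₃
  rw [h₃, ← h₂, Nat.add_comm, h₁]

namespace TM

variable {M : TM}

/-- Reachable configurations are mapped injectively to codes up to `B`, so the pigeonhole argument
for short paths applies. -/
theorem exists_short_run {x : List Bool} {S B : ℕ} {R : M.Cfg → M.Cfg → Prop} {P : M.Cfg → Prop}
    (hrep : ∀ C, Relation.ReflTransGen R M.startCfg C → ∃ c, M.Rep x S c C)
    (hS : ∀ C, Relation.ReflTransGen R M.startCfg C → ∀ j, C.head j < S)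
    (hB : M.codeBound x.length (M.base ^ S) ≤ B)
    (h : ∃ C, Relation.ReflTransGen R M.startCfg C ∧ P C) :
    ∃ n ≤ B, ∃ r : ℕ → M.Cfg, r 0 = M.startCfg ∧ (∀ i < n, R (r i) (r (i + 1))) ∧ P (r n) := by
  classical
  refine exists_short_path (e := fun C => if h : ∃ c, M.Rep x S c C then enc h.choose else 0)
    (fun C C' hC hC' he => ?_) (fun C hC => ?_) h
  · have h₁ := hrep C hC
    have h₂ := hrep C' hC'
    beta_reduce at he
    rw [dif_pos h₁, dif_pos h₂] at he
    have h₃ := h₁.choose_spec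
    rw [NCode.inj he] at h₃
    exact h₃.unique h₂.choose_spec
  · have h₁ := hrep C hC
    rw [dif_pos h₁]
    exact (h₁.choose_spec.enc_le (hS C hC)).trans hB

end TM

namespace Transducer

variable (T : Transducer)

open Classical in
/-- The simulation of a step, on codes of configurations. -/
noncomputable def simStep (x : List Bool) (p : T.toTM.Code × ℕ) : T.toTM.Code × ℕ :=
  if p.1.1 = T.accept ∨ p.1.1 = T.reject then p else (T.toTM.nextCode x p.1,
    (T.out p.1.1 (readInput x p.1.2.1) (T.toTM.scan p.1)).toList.foldl readBit p.2)

theorem ls_simStep {vx : List Bool → List Bool} (hv : Virtual vx) :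
    LS fun w p => T.simStep (vx w) p := by
  classical
  have hout : ∀ b, LSP fun w (p : T.toTM.Code × ℕ) =>
      T.out p.1.1 (readInput (vx w) p.1.2.1) (T.toTM.scan p.1) = some b := by
    intro b
    have h : LS fun (_ : List Bool) (a : T.State × InSym × (Fin T.tapes → T.Sym)) =>
      decide (T.out a.1 a.2.1 a.2.2 = some b) := LS.ofFinite _
    exact (LSP.ofBool (h.comp ((TM.ls_view hv).comp LS.id.fst))).congr fun w p => by
      rw [decide_eq_true_iff]; rfl
  have hu : LS fun w (p : T.toTM.Code × ℕ) =>
      (T.out p.1.1 (readInput (vx w) p.1.2.1) (T.toTM.scan p.1)).toList.foldl readBit p.2 := by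
    refine (LS.ite (hout true) (ls_readBit.comp (LS.id.snd.pair (.const true))) (LS.ite (hout false)
      (ls_readBit.comp (LS.id.snd.pair (.const false))) LS.id.snd)).congr fun w p => ?_
    rcases T.out p.1.1 (readInput (vx w) p.1.2.1) (T.toTM.scan p.1) with _ | (_ | _) <;> simp
  exact LS.ite ((LS.id.fst.fst.eq (.const _)).or (LS.id.fst.fst.eq (.const _))) LS.id
    (((TM.ls_nextCode hv).comp LS.id.fst).pair hu)

variable {T}

theorem iterate_simStep {x : List Bool} {S : ℕ} (hS : T.toTM.RunsInSpace x S) (u i : ℕ) :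
    ∃ c, T.toTM.Rep x S c ((fun s => (T.stepOut x s).getD s)^[i] (T.toTM.startCfg, [])).1 ∧
      T.toTM.ReachesCfg x ((fun s => (T.stepOut x s).getD s)^[i] (T.toTM.startCfg, [])).1 ∧
      (T.simStep x)^[i] (T.toTM.startCode, u) =
        (c, ((fun s => (T.stepOut x s).getD s)^[i] (T.toTM.startCfg, [])).2.foldl readBit u) := by
  induction i with
  | zero => exact ⟨_, TM.rep_start, .refl, rfl⟩
  | succ i ih =>
    obtain ⟨c, h₁, h₂, h₃⟩ := ih
    simp only [Function.iterate_succ_apply'] at h₁ h₂ h₃ ⊢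
    rw [h₃]
    generalize ((fun s => (T.stepOut x s).getD s)^[i] (T.toTM.startCfg, [])) = s at *
    by_cases hh : T.toTM.Halting s.1
    · have e : T.stepOut x s = none := by simp [stepOut, TM.step, hh]
      rw [e]
      refine ⟨c, h₁, h₂, if_pos ?_⟩
      rw [h₁.state]
      exact hh
    · have e : T.toTM.step x s.1 = some (T.toTM.next x s.1) := by simp [TM.step, hh]
      have e' : T.stepOut x s = some (T.toTM.next x s.1, s.2 ++
          (T.out s.1.state (readInput x s.1.inHead) (T.toTM.scanned s.1)).toList) := by
        simp [stepOut, e]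
      rw [e']
      refine ⟨_, h₁.next (hS _ h₂), h₂.tail e, ?_⟩
      have hn : ¬ (c.1 = T.accept ∨ c.1 = T.reject) := by rw [h₁.state]; exact hh
      simp only [Option.getD_some, List.foldl_append]
      rw [simStep, if_neg hn, h₁.scan_eq]
      simp only [h₁.state, h₁.inHead]

theorem reaches_fst {x : List Bool} {s t : T.toTM.Cfg × List Bool}
    (h : Relation.ReflTransGen (fun c₁ c₂ => T.stepOut x c₁ = some c₂) s t) :
    Relation.ReflTransGen (fun c₁ c₂ => T.toTM.step x c₁ = some c₂) s.1 t.1 := by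
  refine h.lift Prod.fst fun a b hab => ?_
  obtain ⟨c, hc, rfl⟩ := Option.map_eq_some_iff.1 hab
  exact hc

end Transducer

/-- The graph of a function computed by a logspace transducer, on an implicit input. -/
theorem exists_lsp_eq {κ : List Bool → ℕ} (hκ : LogspaceComputable κ) {vx : List Bool → List Bool}
    (hv : Virtual vx) : LSP fun w v => v = κ (vx w) := by
  obtain ⟨T, hT, d, hS⟩ := hκ
  obtain ⟨e, he⟩ := T.toTM.exists_codeBound_le d
  set V : List Bool → ℕ := fun x => (x.length + T.toTM.base ^ d + 2) ^ e with hV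
  have hS' : ∀ x, T.toTM.RunsInSpace x (d * (1 + Nat.log 2 x.length)) := fun x => by
    have := hS x
    rwa [mul_add, mul_one, add_comm]
  have hVb : ∀ x : List Bool, T.toTM.codeBound x.length
      (T.toTM.base ^ (d * (1 + Nat.log 2 x.length))) ≤ V x := fun x => he _ _ _ (by rw [mul_one])
  have hVl : LS fun w (_ : ℕ) => V (vx w) := ((hv.length.add (.const _)).add (.const 2)).pow e
  -- A run without repetitions halts after at most `V` steps, so `V` iterations are enough. Besides
  -- the code of a configuration only the unread part of the candidate `v` has to be kept.
  have hls : LS fun w (v : ℕ) => (T.simStep (vx w))^[V (vx w)] (T.toTM.startCode, v + 1) := by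
    refine LS.iterate (h := fun w _ p => T.simStep (vx w) p) (b := fun w v =>
      Nat.pair (V (vx w)) (v + 1)) ((LS.const _).pair (LS.id.add (.const 1)))
      ((T.ls_simStep hv).comp LS.id.snd) hVl (hVl.pair (LS.id.add (.const 1))).toNat ?_
    intro w v i _
    obtain ⟨c, h₁, h₂, h₃⟩ := Transducer.iterate_simStep (hS' (vx w)) (v + 1) i
    rw [h₃]
    exact pair_mono ((h₁.enc_le (hS' _ _ h₂)).trans (hVb _)) (foldl_readBit_le _ _)
  refine (hls.snd.eq (.const 1)).congr fun w v => ?_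
  generalize vx w = x
  obtain ⟨C, hC, hh⟩ := hT x
  have hrep : ∀ D, T.toTM.ReachesCfg x D →
      ∃ c, T.toTM.Rep x (d * (1 + Nat.log 2 x.length)) c D := by
    intro D hD
    induction hD with
    | refl => exact ⟨_, TM.rep_start⟩
    | @tail D D' hD hDD ih =>
      obtain ⟨c, hc⟩ := ih
      have hn : ¬ T.toTM.Halting D := fun h => by simp [TM.step, h] at hDD
      rw [TM.step, if_neg hn, Option.some_inj] at hDD
      exact hDD ▸ ⟨_, hc.next (hS' x _ hD)⟩
  obtain ⟨n, hn, r, h₀, hr, hP⟩ := TM.exists_short_run hrep (hS' x) (hVb x)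
    (P := T.toTM.Halting) ⟨C, Transducer.reaches_fst hC, hh⟩
  have hri : ∀ i ≤ n, ((fun s => (T.stepOut x s).getD s)^[i] (T.toTM.startCfg, [])).1 = r i := by
    intro i hi
    induction i with
    | zero => exact h₀.symm
    | succ i ih =>
      have h₁ := hr i (by omega)
      rw [Function.iterate_succ_apply']
      rw [← ih (by omega)] at h₁
      rw [Transducer.stepOut, h₁]
      rfl
  have hfin := iterate_getD_eq hC (by simp [Transducer.stepOut, TM.step, hh]) (n := n)
    (by rw [Transducer.stepOut, hri n le_rfl]; simp [TM.step, hP]) hn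
  obtain ⟨c, h₁, h₂, h₃⟩ := Transducer.iterate_simStep (hS' x) (v + 1) (V x)
  rw [h₃, hfin]
  show (κ x).bits.foldl readBit (v + 1) = 1 ↔ _
  rw [foldl_readBit_eq_one]
  constructor
  · exact fun h => Nat.eq_of_testBit_eq fun i => by rw [Nat.testBit_eq_inth, ← h, Nat.testBit_eq_inth]
  · rintro rfl; rfl

end ParamLog

namespace ParamLog
open NCode (enc)
open NDec (dec dec_enc)

/-! ## Runs of nondeterministic machines, in blocks between guesses -/

namespace NTM

variable (N : NTM)

open Classical in
/-- A step on codes, together with the number of bits of `w` that are left. -/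
noncomputable def rawStep (x : List Bool) (w : ℕ) (p : N.toTM.Code × ℕ) : N.toTM.Code × ℕ :=
  if p.1.1 = N.accept ∨ p.1.1 = N.reject then p
  else if p.1.1 = N.guess then
    if p.2 = 0 then p else ((if w.testBit (p.2 - 1) = true then N.s₁ else N.s₀, p.1.2), p.2 - 1)
  else (N.toTM.nextCode x p.1, p.2)

/-- The step, restricted to codes that are at most `V`. -/
noncomputable def boundedStep (x : List Bool) (V w : ℕ) (p : N.toTM.Code × ℕ) : N.toTM.Code × ℕ :=
  -- The restriction keeps the simulation bounded even when it starts from a code that represents no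
  -- reachable configuration.
  if enc (N.rawStep x w p).1 ≤ V then N.rawStep x w p else p

/-- The run from `c` until more than `log |x|` bits are needed. -/
noncomputable def block (x : List Bool) (V w : ℕ) (c : N.toTM.Code) : N.toTM.Code :=
  -- A shortest accepting run has at most `V` steps. So `V + 1` steps along it either reach its end
  -- or stop at a guess for which no bit is left.
  ((N.boundedStep x V w)^[V + 1] (c, Nat.log 2 x.length)).1

variable {N} {x : List Bool} {V w : ℕ}

theorem rawStep_snd_le (p : N.toTM.Code × ℕ) : (N.rawStep x w p).2 ≤ p.2 := by
  unfold rawStep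
  split_ifs <;> simp

theorem boundedStep_snd_le (p : N.toTM.Code × ℕ) : (N.boundedStep x V w p).2 ≤ p.2 := by
  unfold boundedStep
  split_ifs
  · exact rawStep_snd_le p
  · exact le_rfl

theorem iterate_boundedStep_le (p : N.toTM.Code × ℕ) (i : ℕ) :
    enc ((N.boundedStep x V w)^[i] p) ≤ Nat.pair (enc p.1 + V) p.2 := by
  suffices enc ((N.boundedStep x V w)^[i] p).1 ≤ enc p.1 + V ∧
      ((N.boundedStep x V w)^[i] p).2 ≤ p.2 from pair_mono this.1 this.2
  induction i with
  | zero => exact ⟨Nat.le_add_right _ _, le_rfl⟩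
  | succ i ih =>
    rw [Function.iterate_succ_apply']
    refine ⟨?_, (boundedStep_snd_le _).trans ih.2⟩
    rw [boundedStep]
    split_ifs with h
    · exact h.trans (Nat.le_add_left _ _)
    · exact ih.1

theorem ls_block {vx : List Bool → List Bool} (hv : Virtual vx) :
    LS fun w (q : N.toTM.Code × ℕ × ℕ) => N.block (vx w) q.2.1 q.2.2 q.1 := by
  classical
  have hraw : LS fun w (q : ℕ × N.toTM.Code × ℕ) => N.rawStep (vx w) q.1 q.2 := by
    have hst : LS fun (_ : List Bool) (q : ℕ × N.toTM.Code × ℕ) => q.2.1.1 := LS.id.snd.fst.fst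
    have hbit : LS fun (_ : List Bool) (q : ℕ × N.toTM.Code × ℕ) => q.1.testBit (q.2.2 - 1) :=
      LS.id.fst.testBit (LS.id.snd.snd.sub (.const 1))
    have hg : LS fun (_ : List Bool) (q : ℕ × N.toTM.Code × ℕ) =>
        if q.1.testBit (q.2.2 - 1) = true then N.s₁ else N.s₀ :=
      LS.ite (LSP.ofBool hbit) (.const _) (.const _)
    have hn : LS fun w (q : ℕ × N.toTM.Code × ℕ) => N.toTM.nextCode (vx w) q.2.1 :=
      (TM.ls_nextCode hv).comp LS.id.snd.fst
    exact LS.ite ((hst.eq (.const _)).or (hst.eq (.const _))) LS.id.snd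
      (LS.ite (hst.eq (.const _)) (LS.ite (LS.id.snd.snd.eq (.const 0)) LS.id.snd
        ((hg.pair LS.id.snd.fst.snd).pair (LS.id.snd.snd.sub (.const 1))))
        (hn.pair LS.id.snd.snd))
  have hstep : LS fun w (q : (N.toTM.Code × ℕ × ℕ) × N.toTM.Code × ℕ) =>
      N.boundedStep (vx w) q.1.2.1 q.1.2.2 q.2 := by
    have h : LS fun w (q : (N.toTM.Code × ℕ × ℕ) × N.toTM.Code × ℕ) =>
        N.rawStep (vx w) q.1.2.2 q.2 := hraw.comp (LS.id.fst.snd.snd.pair LS.id.snd)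
    exact LS.ite (h.fst.toNat.le LS.id.fst.snd.fst) h LS.id.snd
  have hlog : LS fun w (_ : N.toTM.Code × ℕ × ℕ) => Nat.log 2 (vx w).length := hv.length'.log2
  have hb : LS fun w (q : N.toTM.Code × ℕ × ℕ) =>
      Nat.pair (enc q.1 + q.2.1) (Nat.log 2 (vx w).length) :=
    (LS.id.fst.toNat.add LS.id.snd.fst).natPair hlog
  have hn : LS fun (_ : List Bool) (q : N.toTM.Code × ℕ × ℕ) => q.2.1 + 1 :=
    LS.id.snd.fst.add (.const 1)
  have hg : LS fun w (q : N.toTM.Code × ℕ × ℕ) => (q.1, Nat.log 2 (vx w).length) :=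
    LS.id.fst.pair hlog
  have h := LS.iterate (h := fun w (q : N.toTM.Code × ℕ × ℕ) p => N.boundedStep (vx w) q.2.1 q.2.2 p)
    hg hstep hn hb fun w q i _ => iterate_boundedStep_le _ i
  exact h.fst

/-- With `ρ` bits left only the bits of `w` below `ρ` are ever read. So a choice for later guesses
is unaffected by a further bit put on top of it. -/
theorem iterate_boundedStep_congr {w' : ℕ} {t : ℕ} {p : N.toTM.Code × ℕ}
    (h : ∀ i < p.2, w.testBit i = w'.testBit i) :
    (N.boundedStep x V w)^[t] p = (N.boundedStep x V w')^[t] p := by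
  induction t generalizing p with
  | zero => rfl
  | succ t ih =>
    have e : N.boundedStep x V w p = N.boundedStep x V w' p := by
      have : N.rawStep x w p = N.rawStep x w' p := by
        unfold rawStep
        split_ifs with h₁ h₂ h₃ <;> first | rfl | simp_all
        all_goals
          have := h (p.2 - 1) (by omega)
          simp_all
      rw [boundedStep, boundedStep, this]
    rw [Function.iterate_succ_apply, Function.iterate_succ_apply, e]
    exact ih fun i hi => h i (hi.trans_le (boundedStep_snd_le p))

theorem distinct' (N : NTM) : N.guess ≠ N.accept ∧ N.guess ≠ N.reject := by
  have := N.distinct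
  simp only [List.nodup_cons, List.mem_cons, not_or] at this
  exact ⟨fun h => this.1.2.1 h.symm, fun h => this.2.1.1 h.symm⟩

variable {S : ℕ} {c : N.toTM.Code} {C : N.toTM.Cfg}

theorem boundedStep_sound (hS : N.RunsInSpace x S) (hC : N.ReachesCfg x C) (h : N.toTM.Rep x S c C)
    (w ρ : ℕ) : ∃ C', N.ReachesCfg x C' ∧ N.toTM.Rep x S (N.boundedStep x V w (c, ρ)).1 C' := by
  rw [boundedStep]
  split_ifs
  swap
  · exact ⟨C, hC, h⟩
  unfold rawStep
  split_ifs with h₁ h₂ h₃ h₄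
  · exact ⟨C, hC, h⟩
  · exact ⟨C, hC, h⟩
  · refine ⟨_, hC.tail ?_, h.set_state N.s₁⟩
    rw [Step, if_pos (h.state.symm.trans h₂)]
    exact .inr rfl
  · refine ⟨_, hC.tail ?_, h.set_state N.s₀⟩
    rw [Step, if_pos (h.state.symm.trans h₂)]
    exact .inl rfl
  · refine ⟨_, hC.tail ?_, h.next (hS C hC)⟩
    have h₁' : ¬ N.toTM.Halting C := by rw [TM.Halting, ← h.state]; exact h₁
    rw [Step, if_neg fun h' => h₂ (h.state.trans h'), TM.step, if_neg h₁']

/-- Whatever number `w` is supplied, a block follows actual steps of the machine or stands still.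
Hence walks never lead to unreachable configurations. -/
theorem block_sound (hS : N.RunsInSpace x S) (hC : N.ReachesCfg x C) (h : N.toTM.Rep x S c C)
    (w : ℕ) : ∃ C', N.ReachesCfg x C' ∧ N.toTM.Rep x S (N.block x V w c) C' := by
  unfold block
  generalize V + 1 = t
  induction t with
  | zero => exact ⟨C, hC, h⟩
  | succ t ih =>
    obtain ⟨C', hC', h'⟩ := ih
    rw [Function.iterate_succ_apply']
    exact boundedStep_sound hS hC' h' _ _

/-- The number of configurations with the guess state before the configuration at index `m`. -/
def guesses (N : NTM) (r : ℕ → N.toTM.Cfg) (m : ℕ) : ℕ :=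
  ((Finset.range m).filter fun i => (r i).state = N.guess).card

theorem guesses_succ (r : ℕ → N.toTM.Cfg) (m : ℕ) :
    N.guesses r (m + 1) = N.guesses r m + if (r m).state = N.guess then 1 else 0 := by
  unfold guesses
  rw [Finset.range_add_one, Finset.filter_insert]
  split_ifs
  · rw [Finset.card_insert_of_notMem (by simp)]
  · rfl

section

variable {r : ℕ → N.toTM.Cfg} {n : ℕ}

theorem reaches_of_run (h₀ : r 0 = N.toTM.startCfg) (hr : ∀ i < n, N.Step x (r i) (r (i + 1)))
    {i : ℕ} (hi : i ≤ n) : N.ReachesCfg x (r i) := by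
  rw [ReachesCfg, ← h₀]
  exact reflTransGen_of_path hr hi

/-- The number `w` is assembled from the guesses made along the run, the next guess being the
highest bit that is left. The simulation then follows the run until it ends, `t` steps are done, or
a guess is met with no bit left; in the last case the guess falls to the following block. -/
theorem exists_iterate_boundedStep (hS : N.RunsInSpace x S)
    (hV : N.toTM.codeBound x.length (N.toTM.base ^ S) ≤ V) (h₀ : r 0 = N.toTM.startCfg)
    (hr : ∀ i < n, N.Step x (r i) (r (i + 1))) (hn : (r n).state = N.accept)
    (t : ℕ) {m ρ : ℕ} {c : N.toTM.Code} (hm : m ≤ n) (hc : N.toTM.Rep x S c (r m)) :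
    ∃ w < 2 ^ ρ, ∃ m' ≤ n, m ≤ m' ∧
      N.toTM.Rep x S ((N.boundedStep x V w)^[t] (c, ρ)).1 (r m') ∧
      N.guesses r m' + ((N.boundedStep x V w)^[t] (c, ρ)).2 = N.guesses r m + ρ ∧
      (m' = n ∨ m' = m + t ∨
        ((N.boundedStep x V w)^[t] (c, ρ)).2 = 0 ∧ (r m').state = N.guess) := by
  classical
  induction t generalizing m ρ c with
  | zero => exact ⟨0, by positivity, m, hm, le_rfl, hc, rfl, .inr (.inl rfl)⟩
  | succ t ih =>
    have hS' : ∀ j ≤ n, ∀ i, (r j).head i < S := fun j hj => hS _ (reaches_of_run h₀ hr hj)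
    have hstay : N.boundedStep x V 0 (c, ρ) = (c, ρ) → (m = n ∨ ρ = 0 ∧ (r m).state = N.guess) →
        ∃ w < 2 ^ ρ, ∃ m' ≤ n, m ≤ m' ∧
          N.toTM.Rep x S ((N.boundedStep x V w)^[t + 1] (c, ρ)).1 (r m') ∧
          N.guesses r m' + ((N.boundedStep x V w)^[t + 1] (c, ρ)).2 = N.guesses r m + ρ ∧
          (m' = n ∨ m' = m + (t + 1) ∨
            ((N.boundedStep x V w)^[t + 1] (c, ρ)).2 = 0 ∧ (r m').state = N.guess) := fun e h => ⟨0, by positivity, m, hm, le_rfl, by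
          rw [Function.iterate_fixed e]; exact ⟨hc, rfl, h.imp id .inr⟩⟩
    rcases hm.lt_or_eq with hlt | rfl
    swap
    · refine hstay ?_ (.inl rfl)
      have : N.rawStep x 0 (c, ρ) = (c, ρ) := if_pos (.inl (hc.state.trans hn))
      rw [boundedStep, this, ite_self]
    have hst := hr m hlt
    have hle : ∀ {c' : N.toTM.Code}, N.toTM.Rep x S c' (r (m + 1)) → enc c' ≤ V :=
      fun h => (h.enc_le (hS' _ hlt)).trans hV
    by_cases hg : (r m).state = N.guess
    · have hcg : c.1 = N.guess := hc.state.trans hg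
      have hna : ¬ (c.1 = N.accept ∨ c.1 = N.reject) := by
        rw [hcg]
        exact not_or.2 N.distinct'
      rcases ρ with _ | ρ
      · refine hstay ?_ (.inr ⟨rfl, hg⟩)
        have : N.rawStep x 0 (c, 0) = (c, 0) := by
          rw [rawStep, if_neg hna, if_pos hcg, if_pos rfl]
        rw [boundedStep, this, ite_self]
      · obtain ⟨b, hb⟩ : ∃ b : Bool, r (m + 1) = { r m with state := if b = true then N.s₁ else N.s₀ } := by
          rw [Step, if_pos hg] at hst
          rcases hst with h | h
          · exact ⟨false, h⟩
          · exact ⟨true, h⟩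
        have hc' : N.toTM.Rep x S (if b = true then N.s₁ else N.s₀, c.2) (r (m + 1)) := by
          rw [hb]
          exact hc.set_state _
        obtain ⟨w, hw, m', h₁, h₂, h₃, h₄, h₅⟩ := ih (ρ := ρ) hlt hc'
        have hbit : ∀ i, (2 ^ ρ * b.toNat + w).testBit i =
            if i < ρ then w.testBit i else b.toNat.testBit (i - ρ) := fun i =>
          Nat.testBit_two_pow_mul_add _ hw i
        have hbρ : (2 ^ ρ * b.toNat + w).testBit ρ = b := by
          rw [hbit, if_neg (lt_irrefl _), Nat.sub_self]
          cases b <;> rfl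
        have e : N.boundedStep x V (2 ^ ρ * b.toNat + w) (c, ρ + 1) =
            ((if b = true then N.s₁ else N.s₀, c.2), ρ) := by
          have e' : N.rawStep x (2 ^ ρ * b.toNat + w) (c, ρ + 1) =
              ((if b = true then N.s₁ else N.s₀, c.2), ρ) := by
            rw [rawStep, if_neg hna, if_pos hcg, if_neg (Nat.succ_ne_zero ρ)]
            simp only [Nat.add_sub_cancel, hbρ]
          rw [boundedStep, e', if_pos (hle hc')]
        refine ⟨2 ^ ρ * b.toNat + w, ?_, m', h₁, by omega, ?_⟩
        · have := Bool.toNat_le b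
          rw [pow_succ]
          nlinarith [Nat.mul_le_mul_left (2 ^ ρ) this]
        · rw [Function.iterate_succ_apply, e, iterate_boundedStep_congr (w' := w) fun i hi => by
            rw [hbit, if_pos hi]]
          refine ⟨h₃, ?_, ?_⟩
          · rw [h₄, guesses_succ, if_pos hg]
            ring
          · rcases h₅ with h | h | h
            · exact .inl h
            · exact .inr (.inl (by omega))
            · exact .inr (.inr h)
    · rw [Step, if_neg hg] at hst
      have hnh : ¬ N.toTM.Halting (r m) := fun h => by simp [TM.step, h] at hst
      rw [TM.step, if_neg hnh, Option.some_inj] at hst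
      have hc' : N.toTM.Rep x S (N.toTM.nextCode x c) (r (m + 1)) := hst ▸ hc.next (hS' m hm)
      obtain ⟨w, hw, m', h₁, h₂, h₃, h₄, h₅⟩ := ih (ρ := ρ) hlt hc'
      have e : N.boundedStep x V w (c, ρ) = (N.toTM.nextCode x c, ρ) := by
        have e' : N.rawStep x w (c, ρ) = (N.toTM.nextCode x c, ρ) := by
          rw [rawStep, if_neg (by rw [hc.state]; exact hnh), if_neg (by rw [hc.state]; exact hg)]
        rw [boundedStep, e', if_pos (hle hc')]
      refine ⟨w, hw, m', h₁, by omega, ?_⟩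
      rw [Function.iterate_succ_apply, e]
      refine ⟨h₃, ?_, ?_⟩
      · rw [h₄, guesses_succ, if_neg hg, add_zero]
      · rcases h₅ with h | h | h
        · exact .inl h
        · exact .inr (.inl (by omega))
        · exact .inr (.inr h)

end

/-- An accepting run gives a walk of fixed length in the graph of blocks. -/
theorem exists_walk (hS : N.RunsInSpace x S)
    (hV : N.toTM.codeBound x.length (N.toTM.base ^ S) ≤ V) {g k : ℕ}
    (hg : N.UsesBits x (g * Nat.log 2 x.length)) (hk : g < k)
    (h : ∃ C, N.ReachesCfg x C ∧ C.state = N.accept) : ∃ u : ℕ → N.toTM.Code,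
      u 0 = N.toTM.startCode ∧ (∀ i < k, ∃ w < x.length + 1, u (i + 1) = N.block x V w (u i)) ∧
      (∀ i ≤ k, enc (u i) ≤ V) ∧ (u k).1 = N.accept := by
  have hrep : ∀ C, N.ReachesCfg x C → ∃ c, N.toTM.Rep x S c C := by
    intro C hC
    induction hC with
    | refl => exact ⟨_, TM.rep_start⟩
    | @tail C C' hC hst ih =>
      obtain ⟨c, hc⟩ := ih
      rw [Step] at hst
      split_ifs at hst with hgs
      · rcases hst with rfl | rfl
        · exact ⟨_, hc.set_state _⟩
        · exact ⟨_, hc.set_state _⟩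
      · have hn : ¬ N.toTM.Halting C := fun h => by simp [TM.step, h] at hst
        rw [TM.step, if_neg hn, Option.some_inj] at hst
        exact hst ▸ ⟨_, hc.next (hS _ hC)⟩
  obtain ⟨n, hnV, r, h₀, hr, hn⟩ := TM.exists_short_run hrep hS hV h
  -- Hence all numbers of `log |x|` bits are at most `|x|`, also on the empty input, where the only
  -- such number is `0`.
  have hlog : 2 ^ Nat.log 2 x.length < x.length + 2 := by
    rcases Nat.eq_zero_or_pos x.length with h | h
    · simp [h]
    · have := Nat.pow_log_le_self 2 h.ne'
      omega
  have key : ∀ j, ∃ u : ℕ → N.toTM.Code, u 0 = N.toTM.startCode ∧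
      (∀ i < j, ∃ w < x.length + 1, u (i + 1) = N.block x V w (u i)) ∧
      (∀ i ≤ j, enc (u i) ≤ V) ∧ ∃ m ≤ n, N.toTM.Rep x S (u j) (r m) ∧
      (m = n ∨ N.guesses r m = j * Nat.log 2 x.length ∧ (0 < j → (r m).state = N.guess)) := by
    intro j
    induction j with
    | zero =>
      have h : N.toTM.Rep x S N.toTM.startCode (r 0) := h₀ ▸ TM.rep_start
      refine ⟨fun _ => N.toTM.startCode, rfl, by simp, fun _ _ => ?_, 0, Nat.zero_le _, h,
        .inr ⟨by simp [guesses], by simp⟩⟩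
      exact (h.enc_le (hS _ (reaches_of_run h₀ hr (Nat.zero_le _)))).trans hV
    | succ j ih =>
      obtain ⟨u, hu₀, hu, huV, m, hm, hrepm, hcase⟩ := ih
      obtain ⟨w, hw, m', hm', hmm', h₃, h₄, h₅⟩ := exists_iterate_boundedStep hS hV h₀ hr hn
        (V + 1) (ρ := Nat.log 2 x.length) hm hrepm
      change N.toTM.Rep x S (N.block x V w (u j)) (r m') at h₃
      refine ⟨fun i => if i ≤ j then u i else N.block x V w (u j), by simp [hu₀], fun i hi => ?_,
        fun i hi => ?_, m', hm', by simpa using h₃, ?_⟩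
      · rcases (Nat.lt_succ_iff.1 hi).lt_or_eq with h | rfl
        · beta_reduce
          rw [if_pos h.le, if_pos (Nat.succ_le_of_lt h)]
          exact hu i h
        · exact ⟨w, by omega, by simp⟩
      · beta_reduce
        split_ifs with h
        · exact huV i h
        · exact (h₃.enc_le (hS _ (reaches_of_run h₀ hr hm'))).trans hV
      · rcases h₅ with h | h | h
        · exact .inl h
        · omega
        · rcases hcase with rfl | hcase
          · exact .inl (le_antisymm hm' hmm')
          · refine .inr ⟨?_, fun _ => h.2⟩
            rw [h.1, hcase.1] at h₄
            rw [add_mul, one_mul]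
            exact h₄
  obtain ⟨u, hu₀, hu, huV, m, hm, hrepm, hcase⟩ := key k
  refine ⟨u, hu₀, hu, huV, ?_⟩
  rcases hcase with rfl | ⟨h₁, h₂⟩
  · exact hrepm.state.trans hn
  -- If the run had not ended, the `k` blocks would have used `k * log |x|` guesses, and the guess
  -- state in which the last block stopped is one more. This contradicts the bound even when the
  -- logarithm is `0`.
  · exfalso
    have h₃ : N.guesses r (m + 1) ≤ g * Nat.log 2 x.length :=
      hg m r h₀ fun i hi => hr i (by omega)
    rw [guesses_succ, if_pos (h₂ (by omega)), h₁] at h₃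
    have := Nat.mul_le_mul_right (Nat.log 2 x.length) hk.le
    omega

theorem accepting_of_walk (hS : N.RunsInSpace x S) {k : ℕ} {u : ℕ → N.toTM.Code}
    (hu₀ : u 0 = N.toTM.startCode) (hu : ∀ i < k, ∃ w, u (i + 1) = N.block x V w (u i))
    (hacc : (u k).1 = N.accept) : ∃ C, N.ReachesCfg x C ∧ C.state = N.accept := by
  have key : ∀ i ≤ k, ∃ C, N.ReachesCfg x C ∧ N.toTM.Rep x S (u i) C := by
    intro i hi
    induction i with
    | zero => exact ⟨_, .refl, hu₀ ▸ TM.rep_start⟩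
    | succ i ih =>
      obtain ⟨C, hC, h⟩ := ih (by omega)
      obtain ⟨w, e⟩ := hu i (by omega)
      rw [e]
      exact block_sound hS hC h w
  obtain ⟨C, hC, h⟩ := key k le_rfl
  exact ⟨C, hC, h.state.symm.trans hacc⟩

end NTM
end ParamLog

namespace ParamLog
open NCode (enc)

/-! ## String functions computed bit by bit -/

variable {α : Type} [NCode α]

/-- The length and the bits of the values are logspace computable. -/
structure LStr (F : List Bool → α → List Bool) : Prop where
  length : LS fun x a => (F x a).length
  bit : LSP fun x (p : α × ℕ) => (F x p.1)[p.2]? = some true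

theorem length_flatMap_range (f : ℕ → List Bool) (n : ℕ) :
    ((List.range n).flatMap f).length = ∑ m ∈ Finset.range n, (f m).length := by
  induction n with
  | zero => rfl
  | succ n ih =>
    rw [List.range_succ, List.flatMap_append, List.length_append, ih, Finset.sum_range_succ]
    simp

/-- A bit of a concatenation is located by the sum of the lengths of the preceding pieces. Lengths
and bits of the pieces thus suffice to compute any bit without storing a string. -/
theorem getElem?_flatMap_range {f : ℕ → List Bool} {n i : ℕ} {b : Bool} :
    ((List.range n).flatMap f)[i]? = some b ↔
      ∃ j < n, ∑ m ∈ Finset.range j, (f m).length ≤ i ∧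
        (f j)[i - ∑ m ∈ Finset.range j, (f m).length]? = some b := by
  induction n with
  | zero => simp
  | succ n ih =>
    rw [List.range_succ, List.flatMap_append, Nat.exists_lt_succ_right]
    rw [← ih, List.flatMap_singleton, List.getElem?_append, length_flatMap_range]
    split_ifs with h
    · simp [h.not_ge]
    · have hnone : ((List.range n).flatMap f)[i]? = none :=
        List.getElem?_eq_none (by rw [length_flatMap_range]; omega)
      simp [hnone, not_lt.1 h]

namespace LStr

variable {F G : List Bool → α → List Bool}

theorem congr (hF : LStr F) (h : ∀ x a, F x a = G x a) : LStr G := by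
  have : F = G := by funext x a; exact h x a
  rwa [this] at hF

theorem nil : LStr fun _ (_ : α) => [] := ⟨.const 0, (LSP.const False).congr fun _ _ => by simp⟩

theorem single {p : List Bool → α → Prop} [∀ x a, Decidable (p x a)] (hp : LSP p) :
    LStr fun x a => [decide (p x a)] := by
  refine ⟨.const 1, ((LS.id.snd.eq (.const 0)).and (hp.comp LS.id.fst)).congr fun x q => ?_⟩
  rcases q with ⟨a, _ | i⟩ <;> simp

theorem bitTrue : LStr fun _ (_ : α) => [true] :=
  (single (LSP.const True)).congr fun _ _ => by simp

theorem bitFalse : LStr fun _ (_ : α) => [false] :=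
  (single (LSP.const False)).congr fun _ _ => by simp

theorem append (hF : LStr F) (hG : LStr G) : LStr fun x a => F x a ++ G x a := by
  refine ⟨(hF.length.add hG.length).congr fun x a => List.length_append.symm, ?_⟩
  have hl : LS fun x (q : α × ℕ) => (F x q.1).length := hF.length.comp LS.id.fst
  have hG' : LSP fun x (q : α × ℕ) => (G x q.1)[q.2 - (F x q.1).length]? = some true :=
    hG.bit.comp (f := fun x (q : α × ℕ) => (q.1, q.2 - (F x q.1).length))
      (LS.id.fst.pair (LS.id.snd.sub hl))
  refine (hF.bit.or ((hl.le LS.id.snd).and hG')).congr fun x q => ?_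
  rw [List.getElem?_append]
  split_ifs with h
  · simp [h.not_ge]
  · rw [List.getElem?_eq_none (by omega)]
    simp [not_lt.1 h]

theorem ite {p : List Bool → α → Prop} [∀ x a, Decidable (p x a)] (hp : LSP p) (hF : LStr F)
    (hG : LStr G) : LStr fun x a => if p x a then F x a else G x a := by
  refine ⟨(LS.ite hp hF.length hG.length).congr fun x a => by split_ifs <;> rfl, ?_⟩
  have hp' : LSP fun x (q : α × ℕ) => p x q.1 := hp.comp LS.id.fst
  refine ((hp'.and hF.bit).or (hp'.not.and hG.bit)).congr fun x q => ?_
  split_ifs with h <;> simp [h]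

theorem flatMap {n : List Bool → α → ℕ} {F : List Bool → α → ℕ → List Bool} (hn : LS n)
    (hF : LStr fun x (q : α × ℕ) => F x q.1 q.2) :
    LStr fun x a => (List.range (n x a)).flatMap (F x a) := by
  refine ⟨(hn.sum (f := fun x a i => (F x a i).length) hF.length).congr fun x a =>
    (length_flatMap_range _ _).symm, ?_⟩
  have hs : LS fun x (q : (α × ℕ) × ℕ) => ∑ m ∈ Finset.range q.2, (F x q.1.1 m).length :=
    LS.sum (f := fun x (q : (α × ℕ) × ℕ) m => (F x q.1.1 m).length) LS.id.snd
      (hF.length.comp (f := fun _ (q : ((α × ℕ) × ℕ) × ℕ) => (q.1.1.1, q.2))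
        (LS.id.fst.fst.fst.pair LS.id.snd))
  have hb : LSP fun x (q : (α × ℕ) × ℕ) => (F x q.1.1 q.2)[q.1.2 -
      ∑ m ∈ Finset.range q.2, (F x q.1.1 m).length]? = some true :=
    hF.bit.comp (f := fun x (q : (α × ℕ) × ℕ) => ((q.1.1, q.2), q.1.2 -
      ∑ m ∈ Finset.range q.2, (F x q.1.1 m).length))
      ((LS.id.fst.fst.pair LS.id.snd).pair (LS.id.fst.snd.sub hs))
  have hn' : LS fun x (q : α × ℕ) => n x q.1 := hn.comp LS.id.fst
  refine (hn'.exLt (p := fun x (q : α × ℕ) j => ∑ m ∈ Finset.range j, (F x q.1 m).length ≤ q.2 ∧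
    (F x q.1 j)[q.2 - ∑ m ∈ Finset.range j, (F x q.1 m).length]? = some true)
    ((hs.le LS.id.fst.snd).and hb)).congr fun x q => ?_
  exact getElem?_flatMap_range.symm

theorem encNat {f : List Bool → α → ℕ} (hf : LS f) : LStr fun x a => ParamLog.encNat (f x a) := by
  have h : LStr fun x (q : α × ℕ) => [true] ++ [decide ((f x q.1).testBit q.2 = true)] :=
    bitTrue.append (single (LSP.ofBool ((hf.comp LS.id.fst).testBit LS.id.snd)))
  refine ((flatMap (F := fun x a i => [true] ++ [decide ((f x a).testBit i = true)]) hf.size h).append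
    bitFalse).congr fun x a => ?_
  have e : ∀ s : List Bool, encStr s = s.flatMap (fun b => [true, b]) ++ [false] := by
    intro s
    induction s with
    | nil => rfl
    | cons b s ih =>
      have : encStr (b :: s) = true :: b :: encStr s := by simp [encStr, encList]
      rw [this, ih]
      rfl
  have e' : (f x a).bits = (List.range (f x a).size).map (f x a).testBit := by
    refine List.ext_getElem? fun i => ?_
    rcases lt_or_ge i (f x a).size with h | h
    · rw [getElem?_bits h, List.getElem?_map, List.getElem?_range h]
      rfl
    · rw [List.getElem?_eq_none (by rwa [length_bits]), List.getElem?_eq_none (by simpa using h)]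
  rw [ParamLog.encNat, e, e', List.flatMap_map]
  simp

theorem encUnary {f : List Bool → α → ℕ} (hf : LS f) : LStr fun x a => ParamLog.encUnary (f x a) := by
  refine ((flatMap (F := fun _ _ _ => [true]) hf bitTrue).append bitFalse).congr fun x a => ?_
  rw [ParamLog.encUnary]
  congr 1
  induction f x a with
  | zero => rfl
  | succ n ih =>
    rw [List.range_succ, List.flatMap_append, ih, List.replicate_succ']
    rfl

theorem encList {γ : Type} {e : γ → List Bool} {n : List Bool → α → ℕ} (hn : LS n)
    {p : List Bool → α → ℕ → Prop} [∀ x a i, Decidable (p x a i)]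
    (hp : LSP fun x (q : α × ℕ) => p x q.1 q.2) {t : List Bool → α → ℕ → γ} (ht : LStr fun x (q : α × ℕ) => e (t x q.1 q.2)) :
    LStr fun x a => ParamLog.encList e (((List.range (n x a)).filter (p x a)).map (t x a)) := by
  have h : LStr fun x (q : α × ℕ) => if p x q.1 q.2 then [true] ++ e (t x q.1 q.2) else [] :=
    ite hp (bitTrue.append ht) nil
  refine ((flatMap (F := fun x a i => if p x a i then [true] ++ e (t x a i) else []) hn h).append
    bitFalse).congr fun x a => ?_
  induction List.range (n x a) with
  | nil => rfl
  | cons i l ih =>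
    rw [List.flatMap_cons, List.append_assoc, ih]
    by_cases hpi : p x a i
    · rw [List.filter_cons_of_pos (by simpa using hpi), if_pos hpi]
      simp [ParamLog.encList]
    · rw [List.filter_cons_of_neg (by simpa using hpi), if_neg hpi]
      simp

theorem encPair {f g : List Bool → α → ℕ} (hf : LS f) (hg : LS g) :
    LStr fun x a => ParamLog.encList ParamLog.encNat [f x a, g x a] :=
  (bitTrue.append ((encNat hf).append (bitTrue.append ((encNat hg).append bitFalse)))).congr
    fun x a => by simp [ParamLog.encList]

theorem encOne {f : List Bool → α → ℕ} (hf : LS f) :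
    LStr fun x a => ParamLog.encList ParamLog.encNat [f x a] :=
  (bitTrue.append ((encNat hf).append bitFalse)).congr fun x a => by simp [ParamLog.encList]

end LStr

/-! ## Coloured graphs -/

namespace ColGraph

open Classical in
/-- The edge symbol: the path on `k` vertices, and the graph `E` on `U` vertices. -/
noncomputable def edgeRel (k U : ℕ) (E : ℕ → ℕ → Prop) : RelCode where
  ar := 2
  left := ((List.range (k * k)).filter fun n => n / k + 1 = n % k ∨ n % k + 1 = n / k).map
    fun n => [n / k, n % k]
  right := ((List.range (U * U)).filter fun n => E (n / U) (n % U)).map fun n => [n / U, n % U]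

open Classical in
/-- The symbol of the vertex `i` of the path: it allows the vertices in `C i`. -/
noncomputable def pointRel (U : ℕ) (C : ℕ → ℕ → Prop) (i : ℕ) : RelCode where
  ar := 1
  left := [[i]]
  right := ((List.range U).filter (C i)).map fun v => [v]

variable {k U : ℕ} {E C : ℕ → ℕ → Prop}

theorem pair_div_mod_nodup (k : ℕ) (l : List ℕ) (hl : l.Nodup) :
    (l.map fun n => [n / k, n % k]).Nodup := by
  refine hl.map fun n n' h => ?_
  have h' : n / k = n' / k ∧ n % k = n' % k := by simpa using h
  rw [← Nat.div_add_mod n k, h'.1, h'.2, Nat.div_add_mod]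

theorem mem_pairs {p : ℕ → ℕ → Prop} [DecidablePred fun n => p (n / k) (n % k)] {i j : ℕ}
    (hi : i < k) (hj : j < k) :
    [i, j] ∈ ((List.range (k * k)).filter fun n => p (n / k) (n % k)).map
      (fun n => [n / k, n % k]) ↔ p i j := by
  simp only [List.mem_map, List.mem_filter, List.mem_range, decide_eq_true_eq, List.cons.injEq,
    and_true]
  constructor
  · rintro ⟨n, ⟨-, h⟩, rfl, rfl⟩
    exact h
  · intro h
    have h₁ : (i * k + j) / k = i := by
      rw [mul_comm, Nat.mul_add_div (by omega), Nat.div_eq_of_lt hj, add_zero]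
    have h₂ : (i * k + j) % k = j := by rw [mul_comm, Nat.mul_add_mod, Nat.mod_eq_of_lt hj]
    refine ⟨i * k + j, ⟨by nlinarith, by rwa [h₁, h₂]⟩, h₁, h₂⟩

theorem pairs_lt {n : ℕ} (h : n < k * k) : n / k < k ∧ n % k < k := by
  have : 0 < k := Nat.pos_of_ne_zero fun h0 => by simp [h0] at h
  exact ⟨Nat.div_lt_of_lt_mul h, Nat.mod_lt _ this⟩

/-- The coloured path and the coloured graph. -/
noncomputable def code (k U : ℕ) (hk : 0 < k) (hU : 0 < U) (E C : ℕ → ℕ → Prop) : PairCode where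
  a := k
  b := U
  rels := edgeRel k U E :: (List.range k).map (pointRel U C)
  a_pos := hk
  b_pos := hU
  left_nodup r hr := by
    simp only [List.mem_cons, List.mem_map, List.mem_range] at hr
    rcases hr with rfl | ⟨i, -, rfl⟩
    · exact pair_div_mod_nodup _ _ (List.nodup_range.filter _)
    · exact List.nodup_singleton _
  right_nodup r hr := by
    simp only [List.mem_cons, List.mem_map, List.mem_range] at hr
    rcases hr with rfl | ⟨i, -, rfl⟩
    · exact pair_div_mod_nodup _ _ (List.nodup_range.filter _)
    · exact (List.nodup_range.filter _).map fun v v' h => by simpa using h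
  left_tuple r hr v hv := by
    simp only [List.mem_cons, List.mem_map, List.mem_range] at hr
    rcases hr with rfl | ⟨i, hi, rfl⟩
    · simp only [edgeRel, List.mem_map, List.mem_filter, List.mem_range] at hv
      obtain ⟨n, ⟨hn, -⟩, rfl⟩ := hv
      exact ⟨rfl, by simpa using pairs_lt hn⟩
    · simp only [pointRel, List.mem_singleton] at hv
      subst hv
      exact ⟨rfl, by simpa using hi⟩
  right_tuple r hr v hv := by
    simp only [List.mem_cons, List.mem_map, List.mem_range] at hr
    rcases hr with rfl | ⟨i, hi, rfl⟩
    · simp only [edgeRel, List.mem_map, List.mem_filter, List.mem_range] at hv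
      obtain ⟨n, ⟨hn, -⟩, rfl⟩ := hv
      exact ⟨rfl, by simpa using pairs_lt hn⟩
    · simp only [pointRel, List.mem_map, List.mem_filter, List.mem_range] at hv
      obtain ⟨n, ⟨hn, -⟩, rfl⟩ := hv
      exact ⟨rfl, by simpa using hn⟩

theorem code_isStar (hk : 2 ≤ k) (hU : 0 < U) :
    (code k U (by omega) hU E C).IsStar (fun i => i) 0 where
  two_le := hk
  length_eq := by simp [code]
  lt i hi := hi
  inj i _ i' _ h := h
  edge := ⟨_, rfl, rfl, fun i hi i' hi' =>
    mem_pairs (p := fun a b => a + 1 = b ∨ b + 1 = a) hi hi'⟩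
  point i hi := by
    refine ⟨i + 1, Nat.succ_ne_zero i, pointRel U C i, ?_, rfl, fun m _ => by simp [pointRel]⟩
    show ((List.range k).map (pointRel U C))[i]? = _
    rw [List.getElem?_map, List.getElem?_range (show i < k from hi)]
    rfl

/-- The path contains each edge in both directions. As `E` is symmetric, it is enough to look at the
edges in the direction of the path. -/
theorem code_exists_isHom_iff (hk : 0 < k) (hU : 0 < U) (hE : ∀ v v', E v v' → E v' v) :
    (∃ h, (code k U hk hU E C).A.IsHom (code k U hk hU E C).B h) ↔ ∃ h : ℕ → ℕ,
      (∀ i < k, h i < U ∧ C i (h i)) ∧ ∀ i, i + 1 < k → E (h i) (h (i + 1)) := by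
  classical
  rw [PairCode.exists_isHom_iff]
  refine exists_congr fun h => ?_
  constructor
  · rintro ⟨h₁, h₂⟩
    refine ⟨fun i hi => ⟨h₁ i hi, ?_⟩, fun i hi => ?_⟩
    · have := h₂ (pointRel U C i) (List.mem_cons_of_mem _ (List.mem_map.2 ⟨i, List.mem_range.2 hi, rfl⟩))
        [i] (List.mem_singleton_self _)
      simp only [pointRel, List.mem_map, List.mem_filter, List.mem_range, decide_eq_true_eq] at this
      obtain ⟨v, ⟨-, hv⟩, e⟩ := this
      have e' : v = h i := by simpa using e
      exact e' ▸ hv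
    · have := h₂ (edgeRel k U E) List.mem_cons_self [i, i + 1]
        ((mem_pairs (p := fun a b => a + 1 = b ∨ b + 1 = a) (by omega) hi).2 (.inl rfl))
      exact (mem_pairs (p := E) (h₁ i (show i < k by omega)) (h₁ (i + 1) hi)).1 this
  · rintro ⟨h₁, h₂⟩
    refine ⟨fun i hi => (h₁ i hi).1, fun r hr v hv => ?_⟩
    simp only [code, List.mem_cons, List.mem_map, List.mem_range] at hr
    rcases hr with rfl | ⟨i, hi, rfl⟩
    · simp only [edgeRel, List.mem_map, List.mem_filter, List.mem_range, decide_eq_true_eq] at hv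
      obtain ⟨n, ⟨hn, hc⟩, rfl⟩ := hv
      obtain ⟨l₁, l₂⟩ := pairs_lt hn
      refine (mem_pairs (p := E) (h₁ _ l₁).1 (h₁ _ l₂).1).2 ?_
      rcases hc with hc | hc
      · have := h₂ (n / k) (by omega)
        rwa [hc] at this
      · have := h₂ (n % k) (by omega)
        rw [hc] at this
        exact hE _ _ this
    · simp only [pointRel, List.mem_singleton] at hv
      subst hv
      simp only [pointRel, List.mem_map, List.mem_filter, List.mem_range, decide_eq_true_eq]
      exact ⟨h i, ⟨(h₁ i hi).1, (h₁ i hi).2⟩, rfl⟩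

/-- The bound depends on `k` alone and not on the graph: `k + 1` symbols, `k` elements, at most `k *
k` pairs in the edge relation and `k` singletons. This bounds the new parameter. -/
theorem code_size_le (hk : 0 < k) (hU : 0 < U) :
    (code k U hk hU E C).A.size ≤ 3 * k + 1 + 2 * (k * k) := by
  rw [PairCode.size_eq]
  have hl : (code k U hk hU E C).rels.length = k + 1 := by simp [code]
  rw [hl, Finset.sum_range_succ']
  have h₁ : ∀ i ∈ Finset.range k, ((code k U hk hU E C).rels[i + 1]?.elim 0
      fun r => r.left.length * r.ar) = 1 := by
    intro i hi
    show ((List.range k).map (pointRel U C))[i]?.elim 0 _ = 1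
    rw [List.getElem?_map, List.getElem?_range (Finset.mem_range.1 hi)]
    rfl
  have h₂ : ((code k U hk hU E C).rels[0]?.elim 0 fun r => r.left.length * r.ar) ≤ k * k * 2 := by
    show (List.length _) * 2 ≤ _
    refine Nat.mul_le_mul_right _ ?_
    rw [edgeRel, List.length_map]
    exact (List.length_filter_le _ _).trans (List.length_range).le
  rw [Finset.sum_congr rfl h₁, Finset.sum_const, Finset.card_range, smul_eq_mul]
  have : (code k U hk hU E C).a = k := rfl
  omega

theorem lstr_code {k U : List Bool → α → ℕ} (hk : LS k) (hU : LS U) (hk₀ : ∀ x a, 0 < k x a)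
    (hU₀ : ∀ x a, 0 < U x a) {E C : List Bool → α → ℕ → ℕ → Prop}
    (hE : LSP fun x (q : α × ℕ × ℕ) => E x q.1 q.2.1 q.2.2)
    (hC : LSP fun x (q : α × ℕ × ℕ) => C x q.1 q.2.1 q.2.2) :
    LStr fun x a => (code (k x a) (U x a) (hk₀ x a) (hU₀ x a) (E x a) (C x a)).encode := by
  classical
  have hpairs : ∀ {m : List Bool → α → ℕ}, LS m → ∀ {p : List Bool → α → ℕ → ℕ → Prop}
      [∀ x a i j, Decidable (p x a i j)], LSP (fun x (q : α × ℕ × ℕ) => p x q.1 q.2.1 q.2.2) → LStr fun x a =>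
        encTuples (((List.range (m x a * m x a)).filter fun n => p x a (n / m x a) (n % m x a)).map
          fun n => [n / m x a, n % m x a]) := by
    intro m hm p _ hp
    have hm' : LS fun x (q : α × ℕ) => m x q.1 := hm.comp LS.id.fst
    have hd : LS fun x (q : α × ℕ) => q.2 / m x q.1 := LS.id.snd.div hm'
    have hr : LS fun x (q : α × ℕ) => q.2 % m x q.1 := LS.id.snd.mod hm'
    exact LStr.encList (p := fun x a n => p x a (n / m x a) (n % m x a))
      (t := fun x a n => [n / m x a, n % m x a]) (hm.mul hm)
      (hp.comp (LS.id.fst.pair (hd.pair hr))) (LStr.encPair hd hr)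
  have hadj : LSP fun (_ : List Bool) (q : α × ℕ × ℕ) => q.2.1 + 1 = q.2.2 ∨ q.2.2 + 1 = q.2.1 :=
    ((LS.id.snd.fst.add (.const 1)).eq LS.id.snd.snd).or
      ((LS.id.snd.snd.add (.const 1)).eq LS.id.snd.fst)
  have hedge : LStr fun x a => RelCode.encode (edgeRel (k x a) (U x a) (E x a)) := by
    refine (((LStr.encUnary (.const 2)).append (hpairs hk
      (p := fun _ _ i j => i + 1 = j ∨ j + 1 = i) hadj)).append (hpairs hU hE)).congr fun x a => ?_
    simp only [RelCode.encode, edgeRel]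
  have hpoint : LStr fun x (q : α × ℕ) => RelCode.encode (pointRel (U x q.1) (C x q.1) q.2) := by
    have h₁ : LStr fun (_ : List Bool) (q : α × ℕ) => encTuples [[q.2]] :=
      (LStr.bitTrue.append ((LStr.encOne LS.id.snd).append LStr.bitFalse)).congr fun x a => by
        simp [encTuples, encList]
    have h₂ : LStr fun x (q : α × ℕ) =>
        encTuples (((List.range (U x q.1)).filter (C x q.1 q.2)).map fun v => [v]) :=
      LStr.encList (p := fun x (q : α × ℕ) v => C x q.1 q.2 v) (t := fun _ _ v => [v])
        (hU.comp LS.id.fst) (hC.comp (f := fun _ (q : (α × ℕ) × ℕ) => (q.1.1, q.1.2, q.2))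
          (LS.id.fst.fst.pair (LS.id.fst.snd.pair LS.id.snd))) (LStr.encOne LS.id.snd)
    refine (((LStr.encUnary (.const 1)).append h₁).append h₂).congr fun x q => ?_
    simp only [RelCode.encode, pointRel]
  have hrest : LStr fun x a => encList RelCode.encode
      (((List.range (k x a)).filter fun _ => True).map (pointRel (U x a) (C x a))) :=
    LStr.encList (p := fun _ _ _ => True) (t := fun x a i => pointRel (U x a) (C x a) i) hk
      (.const True) hpoint
  refine (((LStr.encUnary hk).append (LStr.encUnary hU)).append
    (LStr.bitTrue.append (hedge.append hrest))).congr fun x a => ?_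
  simp [PairCode.encode, code, encList]

end ColGraph
end ParamLog

namespace ParamLog
open NCode (enc)
open NDec (dec dec_enc)

/-! ## Triples -/

/-- The length of the string that is encoded at the front of `w`. -/
noncomputable def frontLen (w : List Bool) : ℕ :=
  leastLt w.length fun j => ¬ w[2 * j]? = some true

/-- The string that is encoded at the front of `w`. -/
noncomputable def front (w : List Bool) : List Bool :=
  (List.range (frontLen w)).map fun j => decide (w[2 * j + 1]? = some true)

theorem ls_frontLen : LS fun w (_ : ℕ) => frontLen w :=
  LS.least (p := fun w _ j => ¬ w[2 * j]? = some true) LS.length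
    ((((LS.const 2).mul LS.id.snd).getElem?_eq true).not)

theorem length_front (w : List Bool) : (front w).length = frontLen w := by simp [front]

theorem virtual_front : Virtual front where
  length := ls_frontLen.congr fun w _ => (length_front w).symm
  read := by
    classical
    have hp : LS fun (_ : List Bool) (p : ℕ) => 2 * (p - 1) + 1 :=
      ((LS.const 2).mul (LS.id.sub (.const 1))).add (.const 1)
    refine (LS.ite (LS.id.eq (.const 0)) (.const InSym.left) (LS.ite (LS.id.le ls_frontLen)
      (LS.ite (hp.getElem?_eq true) (.const (.bit true)) (.const (.bit false)))
      (.const InSym.right))).congr fun w p => ?_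
    rcases p with _ | p
    · rfl
    · rw [if_neg (Nat.succ_ne_zero p), readInput, front, List.getElem?_map]
      split_ifs with h h'
      · rw [List.getElem?_range (by omega)]
        simpa using h'
      · rw [List.getElem?_range (by omega)]
        simpa using h'
      · rw [List.getElem?_eq_none (by simpa using h)]
        rfl

theorem front_eq {x w : List Bool} (h : encStr x <+: w) : front w = x := by
  have h' : encStr x <+: w.drop 0 := h
  have hl := h.length_le
  rw [length_encStr] at hl
  rw [encStr_prefix_drop] at h'
  simp only [zero_add] at h'
  have e : frontLen w = x.length := leastLt_eq (by omega) (by simp [h'.2]) fun j hj => by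
    simp [(h'.1 j hj).1]
  refine List.ext_getElem? fun i => ?_
  rw [front, e, List.getElem?_map]
  rcases lt_or_ge i x.length with hi | hi
  · rw [List.getElem?_range hi, Option.map_some, (h'.1 i hi).2, List.getElem?_eq_getElem hi]
    simp
  · rw [List.getElem?_eq_none (by simpa using hi), List.getElem?_eq_none hi]
    rfl

theorem front_encTriple (t : List Bool × ℕ+ × Bool) : front (encTriple t) = t.1 :=
  front_eq (by rw [encTriple, List.append_assoc]; exact List.prefix_append _ _)

/-- The strings whose last, most significant bit is `1` are exactly the binary expansions of
positive numbers; this direction is needed to recognize encodings of triples. -/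
theorem exists_bits_eq (s : List Bool) (h : s.getLast? = some true) : ∃ n, 0 < n ∧ n.bits = s := by
  induction s with
  | nil => simp at h
  | cons b s ih =>
    rcases s with _ | ⟨c, s⟩
    · obtain rfl : b = true := by simpa using h
      exact ⟨1, one_pos, Nat.one_bits⟩
    · obtain ⟨n, hn, e⟩ := ih (by simpa using h)
      refine ⟨Nat.bit b n, ?_, by rw [Nat.bits_append_bit _ _ fun h0 => by omega, e]⟩
      cases b <;> simp [Nat.bit] <;> omega

/-- `w` encodes a triple in which the string has length `l` and the number has length `m`. -/
def TripleAt (w : List Bool) (l m : ℕ) : Prop :=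
  (0 < m ∧ w.length = 2 * l + 2 * m + 3) ∧
    ((∀ j < l, w[2 * j]? = some true) ∧ w[2 * l]? = some false) ∧
    ((∀ j < m, w[2 * l + 1 + 2 * j]? = some true) ∧ w[2 * l + 1 + 2 * m]? = some false) ∧
    -- This is the position of the most significant bit of the number, which has to be `1`. The two
    -- encodings have lengths `2 * l + 1` and `2 * m + 1`, and the final bit brings the total to `2
    -- * l + 2 * m + 3`.
    w[2 * l + 2 * m]? = some true

theorem exists_encStr {w : List Bool} {p l : ℕ} (h : ∀ j < l, w[p + 2 * j]? = some true)
    (h' : w[p + 2 * l]? = some false) : ∃ s : List Bool, s.length = l ∧ encStr s <+: w.drop p := by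
  have hl := lt_of_getElem? h'
  refine ⟨(List.range l).map fun j => decide (w[p + 2 * j + 1]? = some true), by simp, ?_⟩
  rw [encStr_prefix_drop]
  simp only [List.length_map, List.length_range]
  refine ⟨fun i hi => ⟨h i hi, ?_⟩, h'⟩
  rw [List.getElem?_map, List.getElem?_range hi, List.getElem?_eq_getElem (by omega)]
  simp [List.getElem?_eq_getElem (show p + 2 * i + 1 < w.length by omega)]

theorem exists_tripleAt_iff {w : List Bool} :
    (∃ t, encTriple t = w) ↔ ∃ l < w.length, ∃ m < w.length, TripleAt w l m := by
  constructor
  · rintro ⟨⟨x, i, b⟩, rfl⟩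
    set w := encTriple (x, i, b) with hw
    have hpre : encStr x ++ encStr (i : ℕ).bits <+: w.drop 0 := List.prefix_append _ _
    rw [append_prefix_drop, length_encStr, zero_add] at hpre
    obtain ⟨h₁, h₂⟩ := hpre
    rw [encStr_prefix_drop] at h₁ h₂
    simp only [zero_add] at h₁
    have hm : 0 < (i : ℕ).size := Nat.size_pos.2 i.pos
    have hlen : w.length = 2 * x.length + 2 * (i : ℕ).size + 3 := by
      rw [hw, encTriple, List.length_append, List.length_append, length_encStr, length_encNat,
        List.length_singleton]
      ring
    rw [length_bits] at h₂
    refine ⟨x.length, by omega, (i : ℕ).size, by omega, ⟨hm, hlen⟩, ⟨fun j hj => (h₁.1 j hj).1, h₁.2⟩,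
      ⟨fun j hj => (h₂.1 j hj).1, h₂.2⟩, ?_⟩
    have h₃ := (h₂.1 ((i : ℕ).size - 1) (by omega)).2
    rw [getElem?_bits (by omega)] at h₃
    rw [show 2 * x.length + 2 * (i : ℕ).size =
      2 * x.length + 1 + 2 * ((i : ℕ).size - 1) + 1 by omega, h₃, Option.some_inj]
    by_contra hb
    have hle : (i : ℕ) < 2 ^ (i : ℕ).size := Nat.lt_size_self _
    have hge : 2 ^ ((i : ℕ).size - 1) ≤ (i : ℕ) := Nat.lt_size.1 (by omega)
    rw [Nat.testBit_eq_decide_div_mod_eq, decide_eq_true_iff] at hb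
    have h₄ : (i : ℕ) / 2 ^ ((i : ℕ).size - 1) = 1 := by
      refine Nat.div_eq_of_lt_le (by simpa using hge) ?_
      rw [show (i : ℕ).size = (i : ℕ).size - 1 + 1 by omega, pow_succ] at hle
      simpa [mul_comm] using hle
    rw [h₄] at hb
    exact hb rfl
  · rintro ⟨l, -, m, -, ⟨hm, hlen⟩, ⟨h₁, h₂⟩, ⟨h₃, h₄⟩, h₅⟩
    obtain ⟨x, rfl, hx⟩ := exists_encStr (w := w) (p := 0) (by simpa using h₁) (by simpa using h₂)
    obtain ⟨s, rfl, hs⟩ := exists_encStr h₃ h₄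
    obtain ⟨n, hn, rfl⟩ := exists_bits_eq s (by
      have h₆ := (encStr_prefix_drop.1 hs).1 (s.length - 1) (by omega)
      rw [List.getLast?_eq_getElem?, ← h₆.2, ← h₅]
      congr 1
      omega)
    have hpre : encStr x ++ encStr n.bits <+: w.drop 0 := by
      rw [append_prefix_drop, length_encStr, zero_add]
      exact ⟨hx, hs⟩
    obtain ⟨t, ht⟩ := hpre
    rw [List.drop_zero] at ht
    have htl : t.length = 1 := by
      have := congrArg List.length ht
      rw [List.length_append, List.length_append, length_encStr, length_encStr] at this
      omega
    obtain ⟨b, rfl⟩ := List.length_eq_one_iff.1 htl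
    exact ⟨(x, ⟨n, hn⟩, b), ht⟩

theorem lsp_isTriple {α : Type} [NCode α] : LSP fun w (_ : α) => ∃ t, encTriple t = w := by
  suffices LSP fun w (_ : ℕ) => ∃ t, encTriple t = w from
    this.comp (f := fun _ (_ : α) => 0) (.const 0)
  have hl : LS fun (_ : List Bool) (q : (ℕ × ℕ) × ℕ) => q.1.2 := LS.id.fst.snd
  have hm : LS fun (_ : List Bool) (q : (ℕ × ℕ) × ℕ) => q.2 := LS.id.snd
  have hj : LS fun (_ : List Bool) (q : ((ℕ × ℕ) × ℕ) × ℕ) => q.2 := LS.id.snd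
  have hl' : LS fun (_ : List Bool) (q : (ℕ × ℕ) × ℕ) => 2 * q.1.2 := (LS.const 2).mul hl
  have hm' : LS fun (_ : List Bool) (q : (ℕ × ℕ) × ℕ) => 2 * q.2 := (LS.const 2).mul hm
  have hj' : LS fun (_ : List Bool) (q : ((ℕ × ℕ) × ℕ) × ℕ) => 2 * q.2 := (LS.const 2).mul hj
  have hl₁ : LS fun (_ : List Bool) (q : ((ℕ × ℕ) × ℕ) × ℕ) => 2 * q.1.1.2 + 1 + 2 * q.2 :=
    ((hl'.comp LS.id.fst).add (.const 1)).add hj'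
  have h₁ : LSP fun w (q : (ℕ × ℕ) × ℕ) => ∀ j < q.1.2, w[2 * j]? = some true :=
    hl.allLt (p := fun w _ j => w[2 * j]? = some true) (hj'.getElem?_eq true)
  have h₂ : LSP fun w (q : (ℕ × ℕ) × ℕ) => ∀ j < q.2, w[2 * q.1.2 + 1 + 2 * j]? = some true :=
    hm.allLt (p := fun w (q : (ℕ × ℕ) × ℕ) j => w[2 * q.1.2 + 1 + 2 * j]? = some true)
      (hl₁.getElem?_eq true)
  have h : LSP fun w (q : (ℕ × ℕ) × ℕ) => TripleAt w q.1.2 q.2 :=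
    (((LS.const 0).lt hm).and (LS.length.eq ((hl'.add hm').add (.const 3)))).and
      ((h₁.and (hl'.getElem?_eq false)).and
        ((h₂.and (((hl'.add (.const 1)).add hm').getElem?_eq false)).and
          ((hl'.add hm').getElem?_eq true)))
  have h' : LSP fun w (q : ℕ × ℕ) => ∃ m < w.length, TripleAt w q.2 m :=
    LS.length.exLt (p := fun w (q : ℕ × ℕ) m => TripleAt w q.2 m) h
  exact (LS.length.exLt (p := fun w (_ : ℕ) l => ∃ m < w.length, TripleAt w l m) h').congr
    fun w _ => exists_tripleAt_iff.symm

/-! ## Implicitly computable functions -/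

theorem bitgraph_param_encTriple (κ : List Bool → ℕ) (F : List Bool → List Bool)
    (t : List Bool × ℕ+ × Bool) : (bitgraph κ F).param (encTriple t) = κ t.1 := by
  classical
  have h : ∃ t', encTriple t' = encTriple t := ⟨t, rfl⟩
  show (if h : ∃ t', encTriple t' = encTriple t then κ h.choose.1 else 0) = _
  rw [dif_pos h, encTriple_injective h.choose_spec]

/-- The parameter is defined through the string inside the triple. Candidates `v` are tried in turn;
whether `v` is the right one is decided by running the transducer for `κ` on the virtual input
`front w`. -/
theorem plCalc_bitgraph_param {κ : List Bool → ℕ} (hκ : LogspaceComputable κ)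
    (F : List Bool → List Bool) : PLCalc (bitgraph κ F).param (bitgraph κ F).param := by
  refine PLCalc.search (check := fun w v => (∃ t, encTriple t = w) ∧ v = κ (front w) ∨
    ¬ (∃ t, encTriple t = w) ∧ v = 0) ((lsp_isTriple.and (exists_lsp_eq hκ virtual_front)).or
      (lsp_isTriple.not.and (LS.id.eq (.const 0)))) fun w v => ?_
  by_cases h : ∃ t, encTriple t = w
  · obtain ⟨t, rfl⟩ := h
    rw [bitgraph_param_encTriple, front_encTriple]
    simp
  · have e : (bitgraph κ F).param w = 0 := dif_neg h
    rw [e]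
    simp [h]

/-- Functions whose bits are logspace computable with the help of a computable function of the
parameter are implicitly pl-computable. -/
theorem implicitlyPLComputable {κ : List Bool → ℕ} (hκ : LogspaceComputable κ)
    {R : List Bool → ℕ → List Bool} {Φ : ℕ → ℕ} (hΦ : Computable Φ)
    (hR : ∀ vx : List Bool → List Bool, Virtual vx → LStr fun w (n : ℕ) => R (vx w) n) :
    ImplicitlyPLComputable κ fun x => R x (Φ (κ x)) := by
  classical
  constructor
  · have hf := hR _ virtual_front
    set pos : List Bool → ℕ → ℕ → ℕ := fun w _ i => 2 * frontLen w + 1 + (encNat (i + 1)).length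
      with hpos
    have hfl : LS fun w (_ : ℕ × ℕ) => 2 * frontLen w + 1 :=
      ((LS.const 2).mul (ls_frontLen.comp (f := fun _ (_ : ℕ × ℕ) => 0) (.const 0))).add (.const 1)
    have hi : LS fun (_ : List Bool) (q : ℕ × ℕ) => q.2 + 1 := LS.id.snd.add (.const 1)
    have hp : LSP fun w (q : ℕ × ℕ) => encNat (q.2 + 1) <+: w.drop (2 * frontLen w + 1) ∧
        ((R (front w) q.1)[q.2]? = some true ↔ w[pos w q.1 q.2]? = some true) :=
      (LSP.encNat_prefix hi hfl).and (hf.bit.iff ((hfl.add hi.length_encNat).getElem?_eq true))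
    -- The index in the triple may be far too large for a register. It is not decoded; an index `j`
    -- below the length of the value is searched whose code occurs at the right place of `w`.
    refine inParaL ((plCalc_bitgraph_param hκ _).computable hΦ) (p := fun w n =>
      (∃ t, encTriple t = w) ∧ ∃ i < (R (front w) n).length,
        encNat (i + 1) <+: w.drop (2 * frontLen w + 1) ∧
        ((R (front w) n)[i]? = some true ↔ w[pos w n i]? = some true))
      (lsp_isTriple.and (hf.length.exLt (p := fun w n i =>
        encNat (i + 1) <+: w.drop (2 * frontLen w + 1) ∧
        ((R (front w) n)[i]? = some true ↔ w[pos w n i]? = some true)) hp)) fun w => ?_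
    have key : ∀ (x : List Bool) (i : ℕ+) (b : Bool) (s : List Bool), w = encTriple (x, i, b) →
        (s[(i : ℕ) - 1]? = some b ↔ ∃ j < s.length,
          encNat (j + 1) <+: w.drop (2 * frontLen w + 1) ∧
          (s[j]? = some true ↔ w[pos w 0 j]? = some true)) := by
      rintro x i b s rfl
      have hpre : encStr x ++ encNat i ++ [b] <+: (encTriple (x, i, b)).drop 0 := List.prefix_rfl
      have hfr : frontLen (encTriple (x, i, b)) = x.length := by
        rw [← length_front, front_encTriple]
      rw [append_prefix_drop, append_prefix_drop, length_encStr, zero_add, cons_prefix_drop, zero_add,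
        List.length_append, length_encStr] at hpre
      obtain ⟨⟨-, h₁⟩, h₂, -⟩ := hpre
      have hipos := i.pos
      rw [hpos]
      simp only [hfr]
      constructor
      · intro h
        refine ⟨(i : ℕ) - 1, lt_of_getElem? h, ?_, ?_⟩
        · rw [Nat.sub_add_cancel hipos]
          exact h₁
        · rw [Nat.sub_add_cancel hipos, h, h₂]
      · rintro ⟨j, hj, h₃, h₄⟩
        have e : j + 1 = i := eq_of_prefix_drop readable_encNat h₃ h₁
        rw [e, h₂, List.getElem?_eq_getElem hj] at h₄
        rw [← e, Nat.add_sub_cancel, List.getElem?_eq_getElem hj]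
        revert h₄
        cases b <;> cases s[j] <;> simp
    constructor
    · rintro ⟨x, i, b, rfl, h⟩
      refine ⟨⟨_, rfl⟩, ?_⟩
      rw [bitgraph_param_encTriple, front_encTriple]
      exact (key x i b _ rfl).1 h
    · rintro ⟨⟨⟨x, i, b⟩, rfl⟩, h⟩
      rw [bitgraph_param_encTriple, front_encTriple] at h
      exact ⟨x, i, b, rfl, (key x i b _ rfl).2 h⟩
  · have hid : Virtual id := ⟨LS.length, LS.readInput LS.id⟩
    -- With the input itself as virtual input, the length of the value is logspace computable and
    -- therefore polynomially bounded.
    obtain ⟨d, hd⟩ := (hR _ hid).length.polyCalc.bdd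
    refine ⟨fun k => (Φ k + 2) ^ d, ?_, d, fun x => ?_⟩
    · have h : Primrec fun n : ℕ => (n + 2) ^ d :=
        (Primrec₂.unpaired'.1 Nat.Primrec.pow).comp (Primrec.nat_add.comp .id (.const 2)) (.const d)
      exact h.to_comp.comp hΦ
    · refine (hd x _).trans ?_
      rw [← mul_pow]
      refine Nat.pow_le_pow_left ?_ d
      nlinarith [Nat.zero_le (Φ (κ x) * x.length)]

end ParamLog

namespace ParamLog
open NCode (enc)
open NDec (dec dec_enc)

/-! ## Hardness -/

namespace NTM

variable (N : NTM) (x : List Bool) (V Φ : ℕ)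

/-- A block leads from the vertex `a` to the vertex `b` of the next layer. -/
noncomputable def Arc (a b : ℕ) : Prop := ∃ w < x.length + 1,
  b = Nat.pair ((Nat.unpair a).1 + 1) (enc (N.block x V w (dec (Nat.unpair a).2)))

/-- The vertex `v` lies in layer `i`, is the start in the first layer and accepting in the last. -/
noncomputable def Colour (i v : ℕ) : Prop := (Nat.unpair v).1 = i ∧
  (i = 0 → (Nat.unpair v).2 = enc N.toTM.startCode) ∧
  (i = Φ + 1 → (dec (Nat.unpair v).2 : N.toTM.Code).1 = N.accept)

/-- The instance of the homomorphism problem. -/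
noncomputable def instanceCode : PairCode :=
  -- A path with `Φ + 2` vertices has room for `Φ + 1` blocks, more than the guesses can fill. The
  -- square exceeds all pairs of a layer up to `Φ + 1` and a code up to `V`.
  ColGraph.code (Φ + 2) ((Φ + V + 2) ^ 2) (by omega) (by positivity)
    (fun a b => N.Arc x V a b ∨ N.Arc x V b a) (N.Colour Φ)

variable {N x V Φ}

/-- The colours put the image of the `i`th vertex of the path into layer `i`. So the images form a
walk of blocks from the start to an accepting configuration, and such walks exist precisely if `N`
accepts. -/
theorem instanceCode_exists_isHom_iff {S g : ℕ} (hS : N.RunsInSpace x S)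
    (hV : N.toTM.codeBound x.length (N.toTM.base ^ S) ≤ V)
    (hg : N.UsesBits x (g * Nat.log 2 x.length)) (hΦ : g ≤ Φ) :
    (∃ h, (N.instanceCode x V Φ).A.IsHom (N.instanceCode x V Φ).B h) ↔
      ∃ C, N.ReachesCfg x C ∧ C.state = N.accept := by
  rw [instanceCode, ColGraph.code_exists_isHom_iff _ _ fun v v' h => h.symm]
  constructor
  · rintro ⟨h, h₁, h₂⟩
    refine accepting_of_walk (V := V) (k := Φ + 1)
      (u := fun i => dec (Nat.unpair (h i)).2) hS ?_ (fun i hi => ?_) ?_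
    · rw [(h₁ 0 (by omega)).2.2.1 rfl, dec_enc]
    · have l₁ := (h₁ i (by omega)).2.1
      have l₂ := (h₁ (i + 1) (by omega)).2.1
      rcases h₂ i (by omega) with ⟨w, -, e⟩ | ⟨w, -, e⟩
      · refine ⟨w, ?_⟩
        rw [e, Nat.unpair_pair, dec_enc]
      -- The edges of the graph are undirected, but an arc traversed backwards would lead to a lower
      -- layer.
      · rw [e, Nat.unpair_pair, l₂] at l₁
        change i + 1 + 1 = i at l₁
        omega
    · exact (h₁ (Φ + 1) (by omega)).2.2.2 rfl
  · intro hC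
    obtain ⟨u, hu₀, hu, huV, hacc⟩ := exists_walk hS hV hg (Nat.lt_succ_of_le hΦ) hC
    refine ⟨fun i => Nat.pair i (enc (u i)), fun i hi => ⟨?_, ?_⟩, fun i hi => .inl ?_⟩
    · refine (Nat.pair_lt_max_add_one_sq _ _).trans_le (Nat.pow_le_pow_left ?_ 2)
      have := huV i (by omega)
      have := max_le (show i ≤ Φ + V + 1 by omega) (show enc (u i) ≤ Φ + V + 1 by omega)
      omega
    · refine ⟨by rw [Nat.unpair_pair], ?_, ?_⟩
      · rintro rfl
        rw [Nat.unpair_pair, hu₀]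
      · rintro rfl
        rw [Nat.unpair_pair, dec_enc, hacc]
    · obtain ⟨w, hw, e⟩ := hu i (by omega)
      refine ⟨w, hw, ?_⟩
      beta_reduce
      rw [Nat.unpair_pair, dec_enc, e]

theorem lstr_instanceCode {vx : List Bool → List Bool} (hv : Virtual vx) (e : ℕ) :
    LStr fun w (n : ℕ) => (N.instanceCode (vx w) (((vx w).length + n + 2) ^ e) n).encode := by
  have hV : LS fun w (n : ℕ) => ((vx w).length + n + 2) ^ e :=
    ((hv.length.add LS.id).add (.const 2)).pow e
  have hdec : LS fun (_ : List Bool) (v : ℕ) => (dec (Nat.unpair v).2 : N.toTM.Code) :=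
    (NDec.ls (α := N.toTM.Code)).comp LS.id.unpair_snd
  have harc : LSP fun w (q : ℕ × ℕ × ℕ) =>
      N.Arc (vx w) (((vx w).length + q.1 + 2) ^ e) q.2.1 q.2.2 := by
    have h₁ : LS fun (_ : List Bool) (q : (ℕ × ℕ × ℕ) × ℕ) =>
        (Nat.unpair q.1.2.1).1 + 1 := LS.id.fst.snd.fst.unpair_fst.add (.const 1)
    have hV' : LS fun w (q : (ℕ × ℕ × ℕ) × ℕ) => ((vx w).length + q.1.1 + 2) ^ e :=
      hV.comp LS.id.fst.fst
    have hd : LS fun (_ : List Bool) (q : (ℕ × ℕ × ℕ) × ℕ) =>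
        (dec (Nat.unpair q.1.2.1).2 : N.toTM.Code) := hdec.comp LS.id.fst.snd.fst
    have h₂ : LS fun w (q : (ℕ × ℕ × ℕ) × ℕ) => N.block (vx w)
        (((vx w).length + q.1.1 + 2) ^ e) q.2 (dec (Nat.unpair q.1.2.1).2) :=
      (ls_block (N := N) hv).comp (f := fun w (q : (ℕ × ℕ × ℕ) × ℕ) =>
        ((dec (Nat.unpair q.1.2.1).2 : N.toTM.Code), ((vx w).length + q.1.1 + 2) ^ e, q.2))
        (hd.pair (hV'.pair LS.id.snd))
    have hn : LS fun w (_ : ℕ × ℕ × ℕ) => (vx w).length + 1 := hv.length'.add (.const 1)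
    exact hn.exLt (p := fun w (q : ℕ × ℕ × ℕ) i => q.2.2 = Nat.pair ((Nat.unpair q.2.1).1 + 1)
      (enc (N.block (vx w) (((vx w).length + q.1 + 2) ^ e) i (dec (Nat.unpair q.2.1).2))))
      (LS.id.fst.snd.snd.eq (h₁.natPair h₂.toNat))
  have harc' : LSP fun w (q : ℕ × ℕ × ℕ) =>
      N.Arc (vx w) (((vx w).length + q.1 + 2) ^ e) q.2.2 q.2.1 :=
    harc.comp (f := fun _ (q : ℕ × ℕ × ℕ) => (q.1, q.2.2, q.2.1))
      (LS.id.fst.pair (LS.id.snd.snd.pair LS.id.snd.fst))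
  have hcol : LSP fun (_ : List Bool) (q : ℕ × ℕ × ℕ) => N.Colour q.1 q.2.1 q.2.2 := by
    have hi : LS fun (_ : List Bool) (q : ℕ × ℕ × ℕ) => q.2.1 := LS.id.snd.fst
    have hv : LS fun (_ : List Bool) (q : ℕ × ℕ × ℕ) => q.2.2 := LS.id.snd.snd
    have hd : LS fun (_ : List Bool) (q : ℕ × ℕ × ℕ) =>
        (dec (Nat.unpair q.2.2).2 : N.toTM.Code) := hdec.comp hv
    exact (hv.unpair_fst.eq hi).and (((hi.eq (.const 0)).imp (hv.unpair_snd.eq (.const _))).and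
      ((hi.eq (LS.id.fst.add (.const 1))).imp (hd.fst.eq (.const _))))
  exact ColGraph.lstr_code (k := fun _ n => n + 2)
    (U := fun w n => (n + ((vx w).length + n + 2) ^ e + 2) ^ 2)
    (E := fun w n a b => N.Arc (vx w) (((vx w).length + n + 2) ^ e) a b ∨
      N.Arc (vx w) (((vx w).length + n + 2) ^ e) b a) (C := fun _ n => N.Colour n)
    (LS.id.add (.const 2)) (((LS.id.add hV).add (.const 2)).pow 2) (fun _ _ => by omega)
    (fun _ _ => by positivity) (harc.or harc') hcol

end NTM

/-- The left structure of the instance is always a coloured path, so only the existence of a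
homomorphism is at stake, and unique readability identifies the encoded pair with the instance. The
new parameter depends on the length of the path only, which is a computable function of the old one.
-/
theorem plReducible_pHOM {P : ParamProblem} (hP : P ∈ PATH) : PLReducible P (pHOM paths.star) := by
  obtain ⟨hκ, N, hacc, ⟨f, hf, d, hd⟩, g, hg, hgb⟩ := hP
  obtain ⟨e, he⟩ := N.toTM.exists_codeBound_le d
  have hpow : Primrec₂ fun a b : ℕ => a ^ b := Primrec₂.unpaired'.1 Nat.Primrec.pow
  -- The first summand dominates the contribution of the parameter to the codes of the worktapes,
  -- the second the number of blocks.
  set Φ : ℕ → ℕ := fun n => N.toTM.base ^ (d * f n) + g n with hΦdef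
  have hΦ : Computable Φ :=
    Primrec.nat_add.to_comp.comp (hpow.to_comp.comp (.const _)
      (Primrec.nat_mul.to_comp.comp (.const d) hf)) hg
  refine ⟨fun x => (N.instanceCode x ((x.length + Φ (P.param x) + 2) ^ e) (Φ (P.param x))).encode,
    fun x => ?_, ?_, fun n => 3 * (Φ n + 2) + 1 + 2 * ((Φ n + 2) * (Φ n + 2)), ?_, fun x => ?_⟩
  · have hV := he x.length (f (P.param x)) (Φ (P.param x)) (Nat.le_add_right _ _)
    have hgΦ : g (P.param x) ≤ Φ (P.param x) := Nat.le_add_left _ _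
    refine (hacc x).trans (Iff.trans (NTM.instanceCode_exists_isHom_iff (hd x) hV (hgb x) hgΦ).symm ?_)
    constructor
    · exact fun h => ⟨_, rfl, (ColGraph.code_isStar (Nat.le_add_left _ _) (by positivity)).star, h⟩
    · rintro ⟨D, hD, -, h⟩
      exact PairCode.encode_injective hD ▸ h
  · exact implicitlyPLComputable (R := fun x n =>
      (N.instanceCode x ((x.length + n + 2) ^ e) n).encode) hκ hΦ fun vx hv => NTM.lstr_instanceCode hv e
  · have h : Primrec fun n : ℕ => 3 * (n + 2) + 1 + 2 * ((n + 2) * (n + 2)) := by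
      have h₀ : Primrec fun n : ℕ => n + 2 := Primrec.nat_add.comp .id (.const 2)
      exact Primrec.nat_add.comp (Primrec.nat_add.comp (Primrec.nat_mul.comp (.const 3) h₀) (.const 1))
        (Primrec.nat_mul.comp (.const 2) (Primrec.nat_mul.comp h₀ h₀))
    exact h.to_comp.comp hΦ
  · rw [pHOM_param_eq]
    exact ColGraph.code_size_le _ _

end ParamLog

theorem theorem4p3 :
    ParamLog.PLComplete (ParamLog.pHOM ParamLog.paths.star) ParamLog.PATH := by
  exact ⟨ParamLog.pHOM_mem_PATH, fun _ => ParamLog.plReducible_pHOM⟩
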